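/- Let $d\ge 2$ and $k\ge 0$ be integers, let $\mathbb Z(d)$ be the integers modulo $d$, $\omega=e^{2\pi i/d}$, and let a qudit be a system with computational basis $|n\rangle$, $n\in\mathbb Z(d)$. Put $X|n\rangle=|n+1\rangle$, $Z|n\rangle=\omega^n|n\rangle$, $F|n\rangle=d^{-1/2}\sum_m\omega^{mn}|m\rangle$, $|+_0\rangle=F|0\rangle$, $CZ|m\rangle|n\rangle=\omega^{mn}|m\rangle|n\rangle$ and, for $\theta\in\mathbb R^d$, $R(\theta)|n\rangle=e^{i\theta_n}|n\rangle$ and $v(\theta)=FR(\theta)$. A computation consists of a finite set $\mathcal V$ of qudits, ordered $n$-tuples of distinct input and output qudits in $\mathcal V$, and a finite sequence of operations on $\mathcal V$. Two models are considered. (i) *Unbounded fan-out circuits*: the operations are $CZ$, $v(\theta)$ ($\theta\in\mathbb R^d$) and the fan-out gates $|x\rangle|y_1,\dots,y_m\rangle\mapsto|x\rangle|y_1+x,\dots,y_m+x\rangle$ on any number of qudits; non-input qudits are prepared in $|0\rangle$. (ii) *Measurement patterns*: the operations are $CZ$, the corrections $X^s$ and $Z^s$ on one qudit, and the destructive measurements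 of a qudit in the basis $v(\Lambda(\theta,s,t))^\dagger|j\rangle$, $j\in\mathbb Z(d)$, with outcome $j$, where $\Lambda_j(\theta,s,t)=\theta_{j+s}+2\pi tj/d$; here $s,t\in\mathbb Z(d)$ are sums modulo $d$ of outcomes of earlier measurements and their additive inverses. Nothing acts on a qudit after it is measured, and output qudits are not measured. Non-input qudits are prepared in $|+_0\rangle$. The size of a computation is the sum over its operations of the number of qudits acted on. Its depth is the length of its longest subsequence of operations in which each operation acts on a qudit in common with, or depends on the measurement outcome of, the previous one in the subsequence. It implements $U\in U(d^n)$ if for every input state $|\psi\rangle$ the final state of the output qudits, all other qudits being traced out and the outcomes being random, is $U|\psi\rangle$ (up to a global phase). A family $(\mathfrak Q_n)_{n\in\mathbb N}$ of computations, $\mathfrak Q_n$ having $n$ input qudits, is uniform if a Turing machine computes from $1^n$, in time polynomial in $n$, a description of $\mathfrak Q_n$ in which angle vectors are given by indices, written in unary, into a table of vectors in $\mathbb R^d$ that includes the zero vector; the table may depend on the family but not on $n$, and its entries are real numbers computable to precision $2^{-m}$ in time polynomial in $m$ and the index. Let $\mathrm{QNC}^k_{f,d}$ (respectively $\mathrm{QMNC}^k_d$)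 be the class of families $(U_n)_{n\in\mathbb N}$, $U_n\in U(d^n)$, for which there is a uniform family of unbounded fan-out circuits (respectively measurement patterns) of depth $O(\log^k n)$ and of size polynomial in $n$ whose $n$-th member implements $U_n$ exactly for every $n$. Then $$\mathrm{QNC}^k_{f,d}=\mathrm{QMNC}^k_d .$$ -/

import Mathlib

open scoped Matrix

noncomputable section

namespace QuditComp

/-! ## Single-qudit operators -/

section Gates

variable {d : ℕ} [NeZero d]

/-- The Fourier gate, `F|n⟩ = d^{-1/2} ∑ m, ω^{mn} |m⟩` with `ω = exp (2πi/d)`. -/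
def fourier : Matrix (ZMod d) (ZMod d) ℂ :=
  Matrix.of fun m n => ZMod.stdAddChar (m * n) / (Real.sqrt d : ℂ)

/-- The rotation gate, `R(θ)|n⟩ = exp (i θ_n) |n⟩`. -/
def rotation (θ : ZMod d → ℝ) : Matrix (ZMod d) (ZMod d) ℂ :=
  Matrix.diagonal fun n => Complex.exp (Complex.I * (θ n : ℂ))

/-- The gate `v(θ) = F R(θ)`. -/
def vGate (θ : ZMod d → ℝ) : Matrix (ZMod d) (ZMod d) ℂ :=
  fourier * rotation θ

/-- `X^s|n⟩ = |n + s⟩`. -/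
def pauliX (s : ZMod d) : Matrix (ZMod d) (ZMod d) ℂ :=
  Matrix.of fun m n => if m = n + s then 1 else 0

/-- `Z^s|n⟩ = ω^{sn} |n⟩`. -/
def pauliZ (s : ZMod d) : Matrix (ZMod d) (ZMod d) ℂ :=
  Matrix.diagonal fun n => ZMod.stdAddChar (s * n)

/-- The vector `Λ(θ,s,t)` with entries `Λ_j = θ_{j+s} + t j (2π/d)`. -/
def measAngle (θ : ZMod d → ℝ) (s t : ZMod d) : ZMod d → ℝ :=
  fun j => θ (j + s) + (t.val : ℝ) * (j.val : ℝ) * (2 * Real.pi / (d : ℝ))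

/-- The projector onto the state `v(Λ(θ,s,t))† |j⟩`, i.e. onto the eigenspace with eigenvalue `j`
of the observable which the dependent measurement with parameters `θ, s, t` measures. -/
def measProj (θ : ZMod d → ℝ) (s t j : ZMod d) : Matrix (ZMod d) (ZMod d) ℂ :=
  (vGate (measAngle θ s t))ᴴ * Matrix.single j j 1 * vGate (measAngle θ s t)

/-- The state `|0⟩`. -/
def ketZero : ZMod d → ℂ := Pi.single 0 1

/-- The state `|+_0⟩ = F|0⟩`. -/
def ketPlus : ZMod d → ℂ := (fourier : Matrix (ZMod d) (ZMod d) ℂ) *ᵥ ketZero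

end Gates

/-! ## Operations on a register of `N` qudits -/

/-- Labels of the computational basis of `N` qudits. -/
abbrev Basis (d N : ℕ) : Type := Fin N → ZMod d

/-- A dit which is a sum modulo `d` of measurement outcomes and of their additive inverses,
`∑ k, σ k * s_k`, given by its coefficients. -/
abbrev Signal (d N : ℕ) : Type := Fin N → ZMod d

/-- The value of a signal on recorded outcomes. -/
def Signal.value {d N : ℕ} (σ : Signal d N) (s : Fin N → ZMod d) : ZMod d := ∑ k, σ k * s k

/-- The operations of the circuit model and of the one-way model on `N` qudits. An angle vector is
referred to by a natural number, to be looked up in a table of angle vectors (see `angles`). -/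
inductive Op (d N : ℕ) : Type
  /-- the controlled-`Z` gate (in patterns: the entangling command) on two distinct qudits -/
  | cz (i j : Fin N) (h : i ≠ j)
  /-- the gate `v(θ)` on qudit `i`, where `θ` is the angle vector number `a` -/
  | rot (a : ℕ) (i : Fin N)
  /-- the fan-out gate with control `c` and set of targets `T` -/
  | fanout (c : Fin N) (T : Finset (Fin N)) (h : c ∉ T)
  /-- the Pauli correction `X^σ` on qudit `i` -/
  | corrX (i : Fin N) (σ : Signal d N)
  /-- the Pauli correction `Z^σ` on qudit `i` -/
  | corrZ (i : Fin N) (σ : Signal d N)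
  /-- the destructive measurement of qudit `i` with parameters `θ, σ, τ`, where `θ` is the angle
  vector number `a`; it is an independent measurement if `σ = τ = 0` -/
  | measure (i : Fin N) (a : ℕ) (σ τ : Signal d N)

/-- The angle vectors which operations refer to: number `0` is the zero vector, so that
`v(0) = F`, and number `k + 1` is entry `k` of the table `θ`. -/
def angles {d : ℕ} (θ : ℕ → ZMod d → ℝ) : ℕ → ZMod d → ℝ
  | 0 => 0
  | k + 1 => θ k

namespace Op

variable {d N : ℕ}

/-- The qudits an operation acts on. -/
def acts : Op d N → Finset (Fin N)
  | cz i j _ => {i, j}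
  | rot _ i => {i}
  | fanout c T _ => insert c T
  | corrX i _ => {i}
  | corrZ i _ => {i}
  | measure i _ _ _ => {i}

/-- The qudits whose measurement outcomes an operation depends on. -/
def deps : Op d N → Finset (Fin N)
  | cz _ _ _ => ∅
  | rot _ _ => ∅
  | fanout _ _ _ => ∅
  | corrX _ σ => Finset.univ.filter fun k => σ k ≠ 0
  | corrZ _ σ => Finset.univ.filter fun k => σ k ≠ 0
  | measure _ _ σ τ => Finset.univ.filter fun k => σ k ≠ 0 ∨ τ k ≠ 0

/-- The qudits (none or one) which an operation measures and thereby destroys. -/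
def measured : Op d N → Finset (Fin N)
  | measure i _ _ _ => {i}
  | _ => ∅

/-- The gates of the unbounded fan-out model: `CZ`, `v(θ)` and fan-out gates. -/
def IsFanoutGate : Op d N → Prop
  | cz _ _ _ => True
  | rot _ _ => True
  | fanout _ _ _ => True
  | _ => False

/-- The commands of the one-way model: entangling commands, Pauli corrections, measurements. -/
def IsPatternCommand : Op d N → Prop
  | cz _ _ _ => True
  | corrX _ _ => True
  | corrZ _ _ => True
  | measure _ _ _ _ => True
  | _ => False

/-- The operation `b` acts on a qudit in common with, or depends on the outcome of, `a`. -/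
def Follows (a b : Op d N) : Prop :=
  (∃ i, i ∈ a.acts ∧ i ∈ b.acts) ∨ ∃ i, i ∈ a.measured ∧ i ∈ b.deps

/-- The single-qudit operator `g` on qudit `i`, tensored with the identity on the others. -/
def onQudit (i : Fin N) (g : Matrix (ZMod d) (ZMod d) ℂ) : Matrix (Basis d N) (Basis d N) ℂ :=
  Matrix.of fun x y => if ∀ k, k ≠ i → x k = y k then g (x i) (y i) else 0

variable [NeZero d]

/-- The operator applied to the register when the recorded outcomes are `s`: for a measurement,
the projector belonging to outcome `j`; for every other operation, a unitary (and `j` is idle). -/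
def operator (θ : ℕ → ZMod d → ℝ) (s : Fin N → ZMod d) (j : ZMod d) :
    Op d N → Matrix (Basis d N) (Basis d N) ℂ
  | cz i k _ => Matrix.diagonal fun x => ZMod.stdAddChar (x i * x k)
  | rot a i => onQudit i (vGate (angles θ a))
  | fanout c T _ =>
      Matrix.of fun x y => if x = (fun k => if k ∈ T then y k + y c else y k) then 1 else 0
  | corrX i σ => onQudit i (pauliX (σ.value s))
  | corrZ i σ => onQudit i (pauliZ (σ.value s))
  | measure i a σ τ => onQudit i (measProj (angles θ a) (σ.value s) (τ.value s) j)

/-- A description of an operation by natural numbers. -/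
def code : Op d N → List ℕ
  | cz i j _ => [0, i, j]
  | rot a i => [1, a, i]
  | fanout c T _ => [2, (c : ℕ)] ++ List.ofFn fun k => if k ∈ T then 1 else 0
  | corrX i σ => [3, (i : ℕ)] ++ List.ofFn fun k => (σ k).val
  | corrZ i σ => [4, (i : ℕ)] ++ List.ofFn fun k => (σ k).val
  | measure i a σ τ =>
      [5, (i : ℕ), a] ++ (List.ofFn fun k => (σ k).val) ++ List.ofFn fun k => (τ k).val

end Op

/-! ## Computations -/

/-- A quantum computation with `n` input and `n` output qudits: the qudits `Fin N`, the (ordered)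
input and output qudits, and the sequence of operations, the first one performed first. -/
structure Computation (d n : ℕ) where
  /-- the number of qudits -/
  N : ℕ
  /-- the input qudits -/
  inp : Fin n ↪ Fin N
  /-- the output qudits -/
  out : Fin n ↪ Fin N
  /-- the operations -/
  ops : List (Op d N)

/-- The sequence of operations can be performed on a register whose qudits in `M` have been
measured: nothing acts on a measured qudit, operations depend only on outcomes of earlier
measurements, and the output qudits are not measured. -/
def Executable {d n N : ℕ} (out : Fin n ↪ Fin N) : Finset (Fin N) → List (Op d N) → Prop
  | M, [] => ∀ i, out i ∉ M
  | M, q :: qs => Disjoint q.acts M ∧ q.deps ⊆ M ∧ Executable out (M ∪ q.measured) qs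

section Semantics

variable {d n N : ℕ} [NeZero d]

/-- The initial state: `ψ` on the input qudits and `φ` on each of the other qudits. -/
def initialState (inp : Fin n ↪ Fin N) (φ : ZMod d → ℂ) (ψ : Basis d n → ℂ) :
    Basis d N → ℂ :=
  fun x => ψ (fun a => x (inp a)) *
    ∏ i ∈ Finset.univ.filter (fun i => ∀ a, inp a ≠ i), φ (x i)

/-- The reduced density matrix, on the output qudits, of the pure state `Φ`. -/
def reducedState (out : Fin n ↪ Fin N) (Φ : Basis d N → ℂ) :
    Matrix (Basis d n) (Basis d n) ℂ :=
  Matrix.of fun x y => ∑ w : Basis d N, ∑ w' : Basis d N,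
    if (∀ a, w (out a) = x a) ∧ (∀ a, w' (out a) = y a) ∧ (∀ i, (∀ a, out a ≠ i) → w i = w' i)
    then Φ w * star (Φ w') else 0

/-- The final density matrix of the output qudits, all other qudits being traced out, when the
operations are performed on the (unnormalised) state `Φ`, the outcomes recorded so far being `s`:
a sum over the outcomes of all measurements, each branch weighted by its probability. -/
def finalState (θ : ℕ → ZMod d → ℝ) (out : Fin n ↪ Fin N) :
    List (Op d N) → (Fin N → ZMod d) → (Basis d N → ℂ) → Matrix (Basis d n) (Basis d n) ℂ
  | [], _, Φ => reducedState out Φ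
  | .measure i a σ τ :: qs, s, Φ =>
      ∑ j, finalState θ out qs (Function.update s i j)
        ((Op.measure i a σ τ).operator θ s j *ᵥ Φ)
  | q :: qs, s, Φ => finalState θ out qs s (q.operator θ s 0 *ᵥ Φ)

end Semantics

namespace Computation

variable {d n : ℕ}

/-- The quantum size: the sum, over the operations, of the number of qudits acted on. -/
def size (Q : Computation d n) : ℕ := (Q.ops.map fun q => q.acts.card).sum

/-- The quantum depth: the length of the longest path of dependent operations, i.e. of the longest
subsequence in which every operation acts on a qudit in common with, or depends on the outcome of,
the previous operation in the subsequence. -/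
def depth (Q : Computation d n) : ℕ :=
  sSup {k | ∃ l : List (Op d Q.N), l.Sublist Q.ops ∧ l.IsChain Op.Follows ∧ l.length = k}

/-- With non-input qudits prepared in `φ`, the computation implements `U`: it can be executed and,
for every input state `ψ`, the final state of the output qudits is `Uψ` (as a state, that is, up
to a global phase). -/
def Implements [NeZero d] (Q : Computation d n) (θ : ℕ → ZMod d → ℝ) (φ : ZMod d → ℂ)
    (U : Matrix (Basis d n) (Basis d n) ℂ) : Prop :=
  Executable Q.out ∅ Q.ops ∧
    ∀ ψ : Basis d n → ℂ,
      finalState θ Q.out Q.ops 0 (initialState Q.inp φ ψ) =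
        Matrix.vecMulVec (U *ᵥ ψ) (star (U *ᵥ ψ))

/-- A description of a computation by natural numbers. -/
def code [NeZero d] (Q : Computation d n) : List ℕ :=
  [Q.N, n] ++ (List.ofFn fun a => (Q.inp a : ℕ)) ++ (List.ofFn fun a => (Q.out a : ℕ)) ++
    Q.ops.flatMap Op.code

end Computation

/-! ## Uniform families and complexity classes -/

/-- The bit string `1^{k_1} 0 1^{k_2} 0 …` of a list of natural numbers. -/
def encodeList (l : List ℕ) : List Bool :=
  l.flatMap fun k => List.replicate k true ++ [false]

/-- The integer with a list of binary digits, least significant first, after a sign. -/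
def signedBinary : List ℕ → ℤ
  | [] => 0
  | s :: b => if s = 0 then (Nat.ofDigits 2 b : ℤ) else -(Nat.ofDigits 2 b : ℤ)

/-- The entries of the table of angle vectors are real numbers computable in polynomial time: from
`k`, `j`, `m` in unary, a Turing machine finds in polynomial time a dyadic rational within
`2^{-m}` of the entry `j` of the vector `θ k`. -/
def PolyTimeAngles {d : ℕ} (θ : ℕ → ZMod d → ℝ) : Prop :=
  ∃ f : ℕ × ℕ × ℕ → List ℕ,
    Nonempty (Turing.TM2ComputableInPolyTime
      (fun x : ℕ × ℕ × ℕ => encodeList [x.1, x.2.1, x.2.2]) encodeList f) ∧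
    ∀ (k : ℕ) (j : ZMod d) (m : ℕ),
      |θ k j - (signedBinary (f (k, j.val, m)) : ℝ) / 2 ^ m| ≤ 1 / 2 ^ m

/-- A Turing machine finds the description of the computation for `n` qudits in polynomial time
from `n` in unary. -/
def Uniform {d : ℕ} [NeZero d] (Q : (n : ℕ) → Computation d n) : Prop :=
  Nonempty (Turing.TM2ComputableInPolyTime Computability.unaryEncodeNat encodeList
    fun n => (Q n).code)

/-- A family of operators: for every `n`, a unitary operator on `n` qudits. -/
abbrev OperatorFamily (d : ℕ) [NeZero d] : Type :=
  (n : ℕ) → Matrix.unitaryGroup (Basis d n) ℂ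

/-- The families of operators computed exactly by uniform families of computations, with allowed
operations `A` and non-input qudits prepared in `φ`, which have input size `n`, depth
`O(log^k n)` and polynomial size. -/
def complexityClass (d : ℕ) [NeZero d] (A : ∀ {N : ℕ}, Op d N → Prop) (φ : ZMod d → ℂ) (k : ℕ) :
    Set (OperatorFamily d) :=
  {U | ∃ (θ : ℕ → ZMod d → ℝ) (Q : (n : ℕ) → Computation d n),
    PolyTimeAngles θ ∧ Uniform Q ∧
    (∀ n, ∀ q ∈ (Q n).ops, A q) ∧
    (∀ n, (Q n).Implements θ φ (U n : Matrix (Basis d n) (Basis d n) ℂ)) ∧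
    (∃ p : Polynomial ℕ, ∀ n, (Q n).size ≤ p.eval n) ∧
    (fun n : ℕ => ((Q n).depth : ℝ)) =O[Filter.atTop] fun n : ℕ => Real.log n ^ k}

/-- The class of operators computed by unbounded fan-out circuits of depth `O(log^k n)`. -/
def QNCf (d : ℕ) [NeZero d] (k : ℕ) : Set (OperatorFamily d) :=
  complexityClass d Op.IsFanoutGate ketZero k

/-- The class of operators computed by measurement patterns of depth `O(log^k n)`. -/
def QMNC (d : ℕ) [NeZero d] (k : ℕ) : Set (OperatorFamily d) :=
  complexityClass d Op.IsPatternCommand ketPlus k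

end QuditComp

end

/-! Each inclusion is a translation of computations which keeps the implemented operator and the
table of angles, multiplies the depth by a constant depending only on `d` (up to an additive
constant), and acts on descriptions as a polynomial-time function. `complexityClass_subset` turns
such a translation into an inclusion. Polynomial size comes for free: a description produced in
polynomial time has polynomial length, and it bounds the size (`size_le`). The different
preparations of the two models are reconciled at the start by one layer of Fourier gates, because
`F` exchanges `|0⟩` and `|+_0⟩` (`complexityClass_prepare`).

Patterns become circuits by deferred measurement. The identity `vGate_measAngle`, namely
`v(Λ(θ,s,t)) = Z^{-s} v(θ) X^s Z^t`, shows that a dependent measurement is a Pauli correction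
followed by an independent measurement; the factor `Z^{-s}` is a phase on the outcome and is
invisible. In the circuit the qudit is not measured: after `v(θ)` its label is fanned out to many
copies, one for each operation of the pattern. A correction `Z^σ` on qudit `i` is made by fanning
`i` out to a row of auxiliary qudits, applying `CZ` between this row and the row of copies `σ k`
times in column `k`, and undoing the fan-out by `d - 1` further ones (`Coherent.run_corrZ`). `X^σ`
is `F³ Z^σ F`. A measurement of a qudit which is traced out and which later gates leave alone may be
inserted at the end, and this gives equality of the final states (`Coherent.finalState_eq`).

Circuits become patterns by teleportation. A `CZ` with a fresh `|+_0⟩`, a measurement and an `X`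
correction apply `v(θ)` while the qudit moves to a new place (`OneWay.Spec.mv`). A fan-out gate is
`F³` on the targets, after `CZ` gates between the control and the targets, after `F` on the targets
(`OneWay.actAll_fourier_eq_fanout`). The `CZ` gates with a common control are made in bounded depth
(`OneWay.Spec.star`): along a chain `c, q₀, p₀, q₁, p₁, …` with alternating `CZ` and `CZ⁻¹`, Fourier
measurements of all `q` at once leave in every `p_k` the value of `c` shifted by the sum of the
outcomes up to `k`. Each copy then acts on its own target, and Fourier measurements erase the
copies. All by-products are `Z` corrections by sums of outcomes, which are admissible signals and do
not add to the depth, and a phase which depends only on the outcomes.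

The depth bound rests on `exists_chain_of_blocks`. Every operation has rows of auxiliary qudits of
its own, so two blocks depend on one another only if the translated operations do, and a path of
dependent operations in the translation projects to a path in the original which is shorter by at
most a constant factor.

Uniformity requires actual Turing machines. A small structured language over stacks of bits is
compiled to `TM2` machines and run after the given machine (`nonempty_comp`). Functions of an array
of numbers computable in this language form the classes `PolyFun` and `PolyList`, with closure under
arithmetic, array lookup, case distinction, bounded iteration and concatenation over ranges. The
descriptions of the translated computations are expressed by these operations alone
(`Coherent.code_translate`, `OneWay.code_translate`). -/

namespace StackProg

open Function Turing

/-! ## A structured language over stacks of bits -/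

/-- Programs over stacks of bits which are numbered by natural numbers. -/
inductive Prog : Type
  | skip
  | push (k : ℕ) (b : Bool)
  | pop (k : ℕ)
  | seq (p q : Prog)
  | ite (k : ℕ) (c : Option Bool → Bool) (p q : Prog)
  | while (k : ℕ) (c : Option Bool → Bool) (p : Prog)

/-- The contents of the stacks. -/
abbrev Store : Type := ℕ → List Bool

/-- `Exec p S t S'`: the program `p`, started with stacks `S`, stops after `t` steps
with stacks `S'`. -/
inductive Exec : Prog → Store → ℕ → Store → Prop
  | skip (S) : Exec .skip S 1 S
  | push (k b S) : Exec (.push k b) S 1 (update S k (b :: S k))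
  | pop (k S) : Exec (.pop k) S 1 (update S k (S k).tail)
  | seq {p q S t₁ S₁ t₂ S₂} : Exec p S t₁ S₁ → Exec q S₁ t₂ S₂ → Exec (.seq p q) S (t₁ + t₂) S₂
  | ite_true {k c p q S t S'} : c (S k).head? = true → Exec p S t S' →
      Exec (.ite k c p q) S (t + 1) S'
  | ite_false {k c p q S t S'} : c (S k).head? = false → Exec q S t S' →
      Exec (.ite k c p q) S (t + 1) S'
  | while_false {k c p S} : c (S k).head? = false → Exec (.while k c p) S 1 S
  | while_true {k c p S t₁ S₁ t₂ S₂} : c (S k).head? = true → Exec p S t₁ S₁ →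
      Exec (.while k c p) S₁ t₂ S₂ → Exec (.while k c p) S (t₁ + t₂ + 1) S₂

namespace Prog

/-- All stacks which the program uses have numbers at most `R`. -/
def Within (R : ℕ) : Prog → Prop
  | skip => True
  | push k _ => k ≤ R
  | pop k => k ≤ R
  | seq p q => p.Within R ∧ q.Within R
  | ite k _ p q => k ≤ R ∧ p.Within R ∧ q.Within R
  | .while k _ p => k ≤ R ∧ p.Within R

theorem Within.mono {R R' : ℕ} (h : R ≤ R') : ∀ {p : Prog}, p.Within R → p.Within R'
  | skip, _ => trivial
  | push _ _, hp => le_trans hp h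
  | pop _, hp => le_trans hp h
  | seq _ _, hp => ⟨hp.1.mono h, hp.2.mono h⟩
  | ite _ _ _ _, hp => ⟨hp.1.trans h, hp.2.1.mono h, hp.2.2.mono h⟩
  | .while _ _ _, hp => ⟨hp.1.trans h, hp.2.mono h⟩

/-- A number of a stack which bounds those that the program uses. -/
def top : Prog → ℕ
  | skip => 0
  | push k _ => k
  | pop k => k
  | seq p q => max p.top q.top
  | ite k _ p q => max k (max p.top q.top)
  | .while k _ p => max k p.top

theorem within_top : ∀ p : Prog, p.Within p.top
  | skip => trivial
  | push _ _ => le_rfl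
  | pop _ => le_rfl
  | seq p q => ⟨p.within_top.mono (le_max_left _ _), q.within_top.mono (le_max_right _ _)⟩
  | ite _ _ p q => ⟨le_max_left _ _, p.within_top.mono (by simp [top]),
      q.within_top.mono (by simp [top])⟩
  | .while _ _ p => ⟨le_max_left _ _, p.within_top.mono (le_max_right _ _)⟩

/-- The program points. -/
def Point : Prog → Type
  | skip => Unit
  | push _ _ => Unit
  | pop _ => Unit
  | seq p q => p.Point ⊕ q.Point
  | ite _ _ p q => Unit ⊕ p.Point ⊕ q.Point
  | .while _ _ p => Unit ⊕ p.Point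

instance instFintypePoint : ∀ p : Prog, Fintype p.Point
  | skip => inferInstanceAs (Fintype Unit)
  | push _ _ => inferInstanceAs (Fintype Unit)
  | pop _ => inferInstanceAs (Fintype Unit)
  | seq p q =>
    haveI := instFintypePoint p
    haveI := instFintypePoint q
    inferInstanceAs (Fintype (p.Point ⊕ q.Point))
  | ite _ _ p q =>
    haveI := instFintypePoint p
    haveI := instFintypePoint q
    inferInstanceAs (Fintype (Unit ⊕ p.Point ⊕ q.Point))
  | .while _ _ p =>
    haveI := instFintypePoint p
    inferInstanceAs (Fintype (Unit ⊕ p.Point))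

/-- The program point at which the execution starts. -/
def entry : ∀ p : Prog, p.Point
  | skip => ()
  | push _ _ => ()
  | pop _ => ()
  | seq p _ => Sum.inl p.entry
  | ite _ _ _ _ => Sum.inl ()
  | .while _ _ _ => Sum.inl ()

end Prog

/-! ### Compiling stack programs to `TM2` machines; embedding a machine in a larger one -/

section Machine

variable {K : Type} [DecidableEq K] {Γ : K → Type} {Λ σ : Type} {R : ℕ}

/-- The alphabets of a machine with `R + 1` additional stacks of bits. -/
abbrev ExtΓ (Γ : K → Type) (R : ℕ) : K ⊕ Fin (R + 1) → Type := Sum.elim Γ fun _ => Bool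

/-- The stacks of the extended machine. -/
def extStk (R : ℕ) (T : ∀ k, List (Γ k)) (S : Store) : ∀ k, List (ExtΓ Γ R k)
  | .inl k => T k
  | .inr i => S i.val

theorem extStk_reg {K : Type} {Γ : K → Type} {R : ℕ} (T : ∀ k, List (Γ k)) (S : Store) {k : ℕ}
    (hk : k ≤ R) : extStk R T S (.inr (Fin.ofNat (R + 1) k)) = S k := by
  simp [extStk, Nat.mod_eq_of_lt (Nat.lt_succ_of_le hk)]

theorem update_extStk_reg (T : ∀ k, List (Γ k)) (S : Store) {k : ℕ} (hk : k ≤ R) (x : List Bool) :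
    update (extStk R T S) (.inr (Fin.ofNat (R + 1) k)) x = extStk R T (update S k x) := by
  have hval : (Fin.ofNat (R + 1) k).val = k := by simp [Nat.mod_eq_of_lt (Nat.lt_succ_of_le hk)]
  refine Function.update_eq_iff.2 ⟨?_, ?_⟩
  · change x = update S k x (Fin.ofNat (R + 1) k).val
    rw [hval, update_self]
  · rintro (i | i) h
    · rfl
    · have : i.val ≠ k := fun e => h (congrArg _ (Fin.ext (by rw [hval, e])))
      exact (update_of_ne this x S).symm

theorem update_extStk_inl (T : ∀ k, List (Γ k)) (S : Store) (k : K) (x : List (Γ k)) :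
    update (extStk R T S) (.inl k) x = extStk R (update T k x) S := by
  refine Function.update_eq_iff.2 ⟨?_, ?_⟩
  · exact (update_self k x T).symm
  · rintro (i | i) h
    · have : i ≠ k := fun e => h (congrArg _ e)
      exact (update_of_ne this x T).symm
    · rfl

theorem stepAux_push (T : ∀ k, List (Γ k)) (S : Store) {k : ℕ} (hk : k ≤ R) (b : Bool) (ex : Λ)
    (v : σ × Option Bool) :
    TM2.stepAux (Γ := ExtΓ Γ R) (.push (.inr (Fin.ofNat (R + 1) k)) (fun _ => b) (.goto fun _ => ex))
      v (extStk R T S) = ⟨some ex, v, extStk R T (update S k (b :: S k))⟩ := by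
  have h := update_extStk_reg T S hk (b :: extStk R T S (.inr (Fin.ofNat (R + 1) k)))
  have h' : update S k (b :: extStk R T S (.inr (Fin.ofNat (R + 1) k))) =
      update S k (b :: S k) := congrArg (fun l : List Bool => update S k (b :: l))
        (extStk_reg T S hk)
  exact congrArg (TM2.Cfg.mk (some ex) v) (h.trans (congrArg _ h'))

theorem stepAux_pop (T : ∀ k, List (Γ k)) (S : Store) {k : ℕ} (hk : k ≤ R) (ex : Λ)
    (v : σ × Option Bool) :
    TM2.stepAux (Γ := ExtΓ Γ R) (.pop (.inr (Fin.ofNat (R + 1) k)) (fun v _ => v)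
      (.goto fun _ => ex)) v (extStk R T S) = ⟨some ex, v, extStk R T (update S k (S k).tail)⟩ := by
  have h := update_extStk_reg T S hk (extStk R T S (.inr (Fin.ofNat (R + 1) k))).tail
  have h' : update S k (extStk R T S (.inr (Fin.ofNat (R + 1) k))).tail =
      update S k (S k).tail := congrArg (fun l : List Bool => update S k l.tail)
        (extStk_reg T S hk)
  exact congrArg (TM2.Cfg.mk (some ex) v) (h.trans (congrArg _ h'))

theorem stepAux_test (T : ∀ k, List (Γ k)) (S : Store) {k : ℕ} (hk : k ≤ R)
    (c : Option Bool → Bool) (l₁ l₂ : Λ) (v : σ × Option Bool) :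
    TM2.stepAux (Γ := ExtΓ Γ R) (.peek (.inr (Fin.ofNat (R + 1) k)) (fun v o => (v.1, o))
        (.branch (fun v => c v.2) (.goto fun _ => l₁) (.goto fun _ => l₂))) v (extStk R T S) =
      ⟨some (bif c (S k).head? then l₁ else l₂), (v.1, (S k).head?), extStk R T S⟩ := by
  have h : (extStk R T S (.inr (Fin.ofNat (R + 1) k))).head? = (S k).head? :=
    congrArg (fun l : List Bool => l.head?) (extStk_reg T S hk)
  have : ∀ o : Option Bool, TM2.stepAux (Γ := ExtΓ Γ R) (.branch (fun v => c v.2)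
      (.goto fun _ => l₁) (.goto fun _ => l₂)) (v.1, o) (extStk R T S) =
        ⟨some (bif c o then l₁ else l₂), (v.1, o), extStk R T S⟩ := by
    intro o
    simp only [TM2.stepAux]
    cases c o <;> rfl
  exact (this _).trans (congrArg (fun o : Option Bool =>
    TM2.Cfg.mk (some (bif c o then l₁ else l₂)) (v.1, o) (extStk R T S)) h)

/-- The statement at a program point; `emb` embeds the program points into the labels, and control
passes to the label `ex` in the end. -/
def Prog.stmt (R : ℕ) : ∀ p : Prog, (p.Point → Λ) → Λ → p.Point →
    TM2.Stmt (ExtΓ Γ R) Λ (σ × Option Bool)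
  | .skip, _, ex, _ => .goto fun _ => ex
  | .push k b, _, ex, _ => .push (.inr (Fin.ofNat (R + 1) k)) (fun _ => b) (.goto fun _ => ex)
  | .pop k, _, ex, _ => .pop (.inr (Fin.ofNat (R + 1) k)) (fun v _ => v) (.goto fun _ => ex)
  | .seq p q, emb, _, .inl l => p.stmt R (fun l => emb (.inl l)) (emb (.inr q.entry)) l
  | .seq _ q, emb, ex, .inr l => q.stmt R (fun l => emb (.inr l)) ex l
  | .ite k c p q, emb, _, .inl _ =>
      .peek (.inr (Fin.ofNat (R + 1) k)) (fun v o => (v.1, o))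
        (.branch (fun v => c v.2) (.goto fun _ => emb (.inr (.inl p.entry)))
          (.goto fun _ => emb (.inr (.inr q.entry))))
  | .ite _ _ p _, emb, ex, .inr (.inl l) => p.stmt R (fun l => emb (.inr (.inl l))) ex l
  | .ite _ _ _ q, emb, ex, .inr (.inr l) => q.stmt R (fun l => emb (.inr (.inr l))) ex l
  | .while k c p, emb, ex, .inl _ =>
      .peek (.inr (Fin.ofNat (R + 1) k)) (fun v o => (v.1, o))
        (.branch (fun v => c v.2) (.goto fun _ => emb (.inr p.entry)) (.goto fun _ => ex))
  | .while _ _ p, emb, _, .inr l => p.stmt R (fun l => emb (.inr l)) (emb (.inl ())) l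

/-- The machine `m` gets from the configuration `a` to the configuration `b` in `t` steps. -/
def Steps {K : Type} [DecidableEq K] {Γ : K → Type} {Λ σ : Type} (m : Λ → TM2.Stmt Γ Λ σ) (t : ℕ)
    (a b : TM2.Cfg Γ Λ σ) : Prop :=
  (flip bind (TM2.step m))^[t] (some a) = some b

theorem Steps.trans {m : Λ → TM2.Stmt Γ Λ σ} {t₁ t₂ : ℕ} {a b c : TM2.Cfg Γ Λ σ}
    (h₁ : Steps m t₁ a b) (h₂ : Steps m t₂ b c) : Steps m (t₁ + t₂) a c := by
  unfold Steps at *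
  rw [add_comm, iterate_add_apply, h₁, h₂]

theorem Steps.one {m : Λ → TM2.Stmt Γ Λ σ} {a b : TM2.Cfg Γ Λ σ} (h : TM2.step m a = some b) :
    Steps m 1 a b := by
  simpa [Steps, flip] using h

/-- Every unit of time in `Exec` is one step of the compiled machine, so the times agree exactly. A
test stores the symbol it has seen in the second component of the internal state; nothing reads it
later, and its final value `o` is left unspecified. -/
theorem Exec.steps {m : Λ → TM2.Stmt (ExtΓ Γ R) Λ (σ × Option Bool)} (T : ∀ k, List (Γ k))
    {p : Prog} {S S' : Store} {t : ℕ} (h : Exec p S t S') :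
    ∀ (emb : p.Point → Λ) (ex : Λ), p.Within R → (∀ l, m (emb l) = p.stmt R emb ex l) →
    ∀ v : σ × Option Bool, ∃ o : Option Bool,
      Steps m t ⟨some (emb p.entry), v, extStk R T S⟩ ⟨some ex, (v.1, o), extStk R T S'⟩ := by
  have one : ∀ {l : Λ} {q : TM2.Stmt (ExtΓ Γ R) Λ (σ × Option Bool)} {v : σ × Option Bool}
      {S : Store} {b : TM2.Cfg (ExtΓ Γ R) Λ (σ × Option Bool)}, m l = q →
      TM2.stepAux q v (extStk R T S) = b → Steps m 1 ⟨some l, v, extStk R T S⟩ b := by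
    rintro l _ v S _ rfl rfl
    exact Steps.one rfl
  induction h with
  | skip S =>
    intro emb ex _ hm v
    exact ⟨v.2, one (hm _) rfl⟩
  | push k b S =>
    intro emb ex hR hm v
    exact ⟨v.2, one (hm _) (stepAux_push T S hR b ex v)⟩
  | pop k S =>
    intro emb ex hR hm v
    exact ⟨v.2, one (hm _) (stepAux_pop T S hR ex v)⟩
  | @seq p q S t₁ S₁ t₂ S₂ _ _ ih₁ ih₂ =>
    intro emb ex hR hm v
    obtain ⟨o, h⟩ := ih₁ (fun l => emb (.inl l)) (emb (.inr q.entry)) hR.1 (fun l => hm _) v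
    obtain ⟨o', h'⟩ := ih₂ (fun l => emb (.inr l)) ex hR.2 (fun l => hm _) (v.1, o)
    exact ⟨o', h.trans h'⟩
  | @ite_true k c p q S t S' hc _ ih =>
    intro emb ex hR hm v
    obtain ⟨o', h'⟩ := ih (fun l => emb (.inr (.inl l))) ex hR.2.1 (fun l => hm _)
      (v.1, (S k).head?)
    refine ⟨o', ?_⟩
    rw [add_comm t 1]
    refine Steps.trans (one (hm _) ((stepAux_test T S hR.1 c _ _ v).trans ?_)) h'
    rw [hc, cond_true]
    rfl
  | @ite_false k c p q S t S' hc _ ih =>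
    intro emb ex hR hm v
    obtain ⟨o', h'⟩ := ih (fun l => emb (.inr (.inr l))) ex hR.2.2 (fun l => hm _)
      (v.1, (S k).head?)
    refine ⟨o', ?_⟩
    rw [add_comm t 1]
    refine Steps.trans (one (hm _) ((stepAux_test T S hR.1 c _ _ v).trans ?_)) h'
    rw [hc, cond_false]
    rfl
  | @while_false k c p S hc =>
    intro emb ex hR hm v
    refine ⟨(S k).head?, one (hm _) ((stepAux_test T S hR.1 c _ _ v).trans ?_)⟩
    rw [hc, cond_false]
    rfl
  | @while_true k c p S t₁ S₁ t₂ S₂ hc _ _ ih₁ ih₂ =>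
    intro emb ex hR hm v
    obtain ⟨o, h⟩ := ih₁ (fun l => emb (.inr l)) (emb (.inl ())) hR.2 (fun l => hm _)
      (v.1, (S k).head?)
    obtain ⟨o', h'⟩ := ih₂ emb ex hR hm (v.1, o)
    refine ⟨o', ?_⟩
    rw [add_comm (t₁ + t₂) 1]
    refine Steps.trans (one (hm _) ((stepAux_test T S hR.1 c _ _ v).trans ?_)) (h.trans h')
    rw [hc, cond_true]
    rfl

/-- A statement of the original machine as a statement of the extended machine, which passes
control to the label `ex` instead of halting. -/
def liftStmt {Λ' : Type} (R : ℕ) (emb : Λ → Λ') (ex : Λ') :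
    TM2.Stmt Γ Λ σ → TM2.Stmt (ExtΓ Γ R) Λ' (σ × Option Bool)
  | .push k f q => .push (.inl k) (fun v => f v.1) (liftStmt R emb ex q)
  | .peek k f q => .peek (.inl k) (fun v o => (f v.1 o, v.2)) (liftStmt R emb ex q)
  | .pop k f q => .pop (.inl k) (fun v o => (f v.1 o, v.2)) (liftStmt R emb ex q)
  | .load f q => .load (fun v => (f v.1, v.2)) (liftStmt R emb ex q)
  | .branch f q₁ q₂ => .branch (fun v => f v.1) (liftStmt R emb ex q₁) (liftStmt R emb ex q₂)
  | .goto f => .goto fun v => emb (f v.1)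
  | .halt => .goto fun _ => ex

/-- The configuration of the extended machine for one of the original machine. -/
def liftCfg {Λ' : Type} (R : ℕ) (emb : Λ → Λ') (ex : Λ') (o : Option Bool) (S : Store)
    (c : TM2.Cfg Γ Λ σ) : TM2.Cfg (ExtΓ Γ R) Λ' (σ × Option Bool) :=
  ⟨some (c.l.elim ex emb), (c.var, o), extStk R c.stk S⟩

theorem stepAux_liftStmt {Λ' : Type} (emb : Λ → Λ') (ex : Λ') (o : Option Bool) (S : Store)
    (q : TM2.Stmt Γ Λ σ) : ∀ (v : σ) (T : ∀ k, List (Γ k)),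
    TM2.stepAux (liftStmt R emb ex q) (v, o) (extStk R T S) =
      liftCfg R emb ex o S (TM2.stepAux q v T) := by
  induction q with
  | push k f q ih => intro v T; simp only [liftStmt, TM2.stepAux, ← ih, ← update_extStk_inl]; rfl
  | peek k f q ih => intro v T; simp only [liftStmt, TM2.stepAux, ← ih]; rfl
  | pop k f q ih => intro v T; simp only [liftStmt, TM2.stepAux, ← ih, ← update_extStk_inl]; rfl
  | load f q ih => intro v T; simp only [liftStmt, TM2.stepAux, ← ih]
  | branch f q₁ q₂ ih₁ ih₂ =>
    intro v T
    simp only [liftStmt, TM2.stepAux]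
    cases f v <;> simp [ih₁, ih₂]
  | goto f => intro v T; simp [liftStmt, TM2.stepAux, liftCfg]
  | halt => intro v T; simp [liftStmt, TM2.stepAux, liftCfg]

/-- A halted machine makes no further step, so each counted step starts at a genuine label. There
the lifted statement does the same in one step, and halting has become a jump to `ex`. -/
theorem steps_lift {Λ' : Type} {M : Λ → TM2.Stmt Γ Λ σ}
    {m : Λ' → TM2.Stmt (ExtΓ Γ R) Λ' (σ × Option Bool)} (emb : Λ → Λ') (ex : Λ')
    (hm : ∀ l, m (emb l) = liftStmt R emb ex (M l)) (o : Option Bool) (S : Store) {t : ℕ} :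
    ∀ {a b : TM2.Cfg Γ Λ σ}, Steps M t a b →
      Steps m t (liftCfg R emb ex o S a) (liftCfg R emb ex o S b) := by
  induction t with
  | zero =>
    intro a b h
    have : a = b := by simpa [Steps] using h
    rw [this]; rfl
  | succ t ih =>
    rintro ⟨l, v, T⟩ b h
    have hnone : ∀ t, (flip bind (TM2.step M))^[t] none = none := fun t => by
      induction t with
      | zero => rfl
      | succ t ih => rw [iterate_succ_apply]; exact ih
    cases l with
    | none =>
      have : (flip bind (TM2.step M))^[t] none = some b := h
      rw [hnone] at this
      cases this
    | some l =>
      have h' : Steps M t (TM2.stepAux (M l) v T) b := h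
      rw [add_comm t 1]
      refine Steps.trans (Steps.one ?_) (ih h')
      simp only [liftCfg, Option.elim_some, TM2.step, hm, stepAux_liftStmt]

/-- The number of symbols which a statement pushes, at most. -/
def pushes : TM2.Stmt Γ Λ σ → ℕ
  | .push _ _ q => pushes q + 1
  | .peek _ _ q => pushes q
  | .pop _ _ q => pushes q
  | .load _ q => pushes q
  | .branch _ q₁ q₂ => max (pushes q₁) (pushes q₂)
  | .goto _ => 0
  | .halt => 0

theorem length_stepAux_le (q : TM2.Stmt Γ Λ σ) : ∀ (v : σ) (T : ∀ k, List (Γ k)) (k : K),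
    ((TM2.stepAux q v T).stk k).length ≤ (T k).length + pushes q := by
  induction q with
  | push k f q ih =>
    intro v T k'
    refine (ih _ _ _).trans ?_
    by_cases h : k' = k
    · subst h; simp [pushes]; omega
    · simp [update_of_ne h, pushes]
  | peek k f q ih => intro v T k'; exact ih _ _ _
  | pop k f q ih =>
    intro v T k'
    refine (ih _ _ _).trans ?_
    by_cases h : k' = k
    · subst h; simp [pushes]
    · simp [update_of_ne h, pushes]
  | load f q ih => intro v T k'; exact ih _ _ _
  | branch f q₁ q₂ ih₁ ih₂ =>
    intro v T k'
    simp only [TM2.stepAux, pushes]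
    cases f v
    · exact (ih₂ v T k').trans (by simp)
    · exact (ih₁ v T k').trans (by simp)
  | goto f => intro v T k'; simp [TM2.stepAux]
  | halt => intro v T k'; simp [TM2.stepAux]

/-- A statement pushes a bounded number of symbols, and there are finitely many statements. This is
why the output of a polynomial-time machine has polynomial length. -/
theorem Steps.length_le {M : Λ → TM2.Stmt Γ Λ σ} {C : ℕ} (hC : ∀ l, pushes (M l) ≤ C) {t : ℕ} :
    ∀ {a b : TM2.Cfg Γ Λ σ}, Steps M t a b → ∀ k, (b.stk k).length ≤ (a.stk k).length + t * C := by
  induction t with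
  | zero =>
    intro a b h k
    have : a = b := by simpa [Steps] using h
    simp [this]
  | succ t ih =>
    rintro ⟨l, v, T⟩ b h k
    have hnone : ∀ t, (flip bind (TM2.step M))^[t] none = none := fun t => by
      induction t with
      | zero => rfl
      | succ t ih => rw [iterate_succ_apply]; exact ih
    cases l with
    | none =>
      have : (flip bind (TM2.step M))^[t] none = some b := h
      rw [hnone] at this
      cases this
    | some l =>
      have h' : Steps M t (TM2.stepAux (M l) v T) b := h
      have := (ih h' k).trans (Nat.add_le_add_right (length_stepAux_le _ _ _ _) _)
      have h₂ := hC l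
      simp only [add_mul, one_mul]
      omega

end Machine

end StackProg


/-! ### Running a stack program on the output of a machine -/

namespace StackProg

open Function Turing

/-- The stacks at the start of a program which is run after a machine: the output of the machine,
in reverse, on stack `1`. -/
def Store.start (l : List Bool) : Store := update (fun _ => []) 1 l.reverse

/-- The stacks when the output `l` has been computed. -/
def Store.final (l : List Bool) : Store := update (fun _ => []) 3 l

section Attach

variable (M : FinTM2) (out : M.Γ M.k₁ ≃ Bool) (p : Prog)

/-- The labels of the machine which runs `M` and then `p`. -/
abbrev AttachΛ : Type := M.Λ ⊕ Unit ⊕ p.Point ⊕ Unit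

/-- The code of the machine which runs `M` and then `p`. -/
def attachStmt (R : ℕ) : AttachΛ M p → TM2.Stmt (ExtΓ M.Γ R) (AttachΛ M p) (M.σ × Option Bool)
  | .inl l => liftStmt R .inl (.inr (.inl ())) (M.m l)
  | .inr (.inl _) =>
      .pop (.inl M.k₁) (fun v o => (v.1, o.map out))
        (.branch (fun v => v.2.isSome)
          (.push (.inr (Fin.ofNat (R + 1) 1)) (fun v => v.2.getD false)
            (.goto fun _ => .inr (.inl ())))
          (.goto fun _ => .inr (.inr (.inl p.entry))))
  | .inr (.inr (.inl l)) => p.stmt R (fun l => .inr (.inr (.inl l))) (.inr (.inr (.inr ()))) l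
  | .inr (.inr (.inr _)) => .load (fun _ => (M.initialState, none)) .halt

/-- The machine which runs `M` and then `p`. -/
def attach (R : ℕ) : FinTM2 :=
  haveI := M.kDecidableEq
  haveI := M.kFin
  haveI := M.ΛFin
  haveI := M.σFin
  { K := M.K ⊕ Fin (R + 1)
    k₀ := .inl M.k₀
    k₁ := .inr (Fin.ofNat (R + 1) 3)
    Γ := ExtΓ M.Γ R
    Λ := AttachΛ M p
    main := .inl M.main
    σ := M.σ × Option Bool
    initialState := (M.initialState, none)
    Γk₀Fin := M.Γk₀Fin
    m := attachStmt M out p R }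

theorem haltList_stk (tm : FinTM2) (s : List (tm.Γ tm.k₁)) :
    (haltList tm s).stk = update (fun _ => []) tm.k₁ s := by
  funext k
  by_cases h : k = tm.k₁
  · subst h; simp [haltList]
  · simp [haltList, h]

theorem initList_stk (tm : FinTM2) (s : List (tm.Γ tm.k₀)) :
    (initList tm s).stk = update (fun _ => []) tm.k₀ s := by
  funext k
  by_cases h : k = tm.k₀
  · subst h; simp [initList]
  · simp [initList, h]

theorem extStk_nil {K : Type} {Γ : K → Type} {R : ℕ} :
    extStk R (fun k : K => ([] : List (Γ k))) (fun _ => []) =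
      fun i => ([] : List (ExtΓ Γ R i)) := by
  funext i; rcases i with i | i <;> rfl

/-- One symbol is moved per step, which reverses the word; this is the reason for `reverse` in
`Store.start`. The additional step is the one that finds the stack empty and enters `p`. -/
theorem steps_transfer (R : ℕ) (hR : 1 ≤ R) (T : ∀ k, List (M.Γ k)) :
    ∀ (l : List (M.Γ M.k₁)) (S : Store) (v : M.σ × Option Bool),
      Steps (attachStmt M out p R) (l.length + 1)
        ⟨some (.inr (.inl ())), v, extStk R (update T M.k₁ l) S⟩
        ⟨some (.inr (.inr (.inl p.entry))), (v.1, none),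
          extStk R (update T M.k₁ []) (update S 1 ((l.map out).reverse ++ S 1))⟩ := by
  intro l
  induction l with
  | nil =>
    intro S v
    refine Steps.one ?_
    have h₁ : extStk R (update T M.k₁ []) S (.inl M.k₁) = [] := update_self _ _ _
    have h₂ := update_extStk_inl (R := R) (update T M.k₁ []) S M.k₁ []
    rw [update_idem] at h₂
    have : update S 1 (([] : List Bool) ++ S 1) = S := update_eq_self _ _
    simp only [List.map_nil, List.reverse_nil, this]
    simp only [TM2.step, attachStmt, TM2.stepAux]
    have e : (update (extStk R (update T M.k₁ []) S) (.inl M.k₁)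
      (extStk R (update T M.k₁ []) S (.inl M.k₁)).tail) = extStk R (update T M.k₁ []) S := by
      rw [h₁]; exact h₂
    rw [e]
    have e' : (extStk R (update T M.k₁ []) S (.inl M.k₁)).head? = none := by rw [h₁]; rfl
    rw [e']; rfl
  | cons x l ih =>
    intro S v
    have := ih (update S 1 (out x :: S 1)) (v.1, some (out x))
    rw [List.length_cons, add_comm (l.length + 1) 1]
    refine Steps.trans (Steps.one (b := ⟨some (.inr (.inl ())), (v.1, some (out x)),
      extStk R (update T M.k₁ l) (update S 1 (out x :: S 1))⟩) ?_) ?_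
    · have h₁ : extStk R (update T M.k₁ (x :: l)) S (.inl M.k₁) = x :: l := update_self _ _ _
      have h₂ := update_extStk_inl (R := R) (update T M.k₁ (x :: l)) S M.k₁ l
      rw [update_idem] at h₂
      simp only [TM2.step, attachStmt, TM2.stepAux]
      have e : (update (extStk R (update T M.k₁ (x :: l)) S) (.inl M.k₁)
        (extStk R (update T M.k₁ (x :: l)) S (.inl M.k₁)).tail) =
          extStk R (update T M.k₁ l) S := by
        rw [h₁]; exact h₂
      have e' : (extStk R (update T M.k₁ (x :: l)) S (.inl M.k₁)).head? = some x := by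
        rw [h₁]; rfl
      rw [e, e']
      exact congrArg some (stepAux_push (σ := M.σ) (update T M.k₁ l) S hR (out x) _
        (v.1, some (out x)))
    · have e : update (update S 1 (out x :: S 1)) 1 ((l.map out).reverse ++
        update S 1 (out x :: S 1) 1) = update S 1 (((x :: l).map out).reverse ++ S 1) := by
        simp
      rw [e] at this
      exact this

theorem eval_mono (Q : Polynomial ℕ) {a b : ℕ} (hab : a ≤ b) : Q.eval a ≤ Q.eval b := by
  simp only [Polynomial.eval_eq_sum, Polynomial.sum]
  exact Finset.sum_le_sum fun i _ => Nat.mul_le_mul_left _ (Nat.pow_le_pow_left hab i)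

/-- The output of a machine which runs in polynomial time has polynomial length. -/
theorem exists_length_le {α αΓ β βΓ : Type} {ea : α → List αΓ} {eb : β → List βΓ} {f : α → β}
    (h : Nonempty (TM2ComputableInPolyTime ea eb f)) :
    ∃ B : Polynomial ℕ, ∀ a, (eb (f a)).length ≤ B.eval (ea a).length := by
  obtain ⟨⟨M, inA, outA⟩, time, outputs⟩ := h
  have := M.ΛFin
  set C := Finset.univ.sup fun l : M.Λ => pushes (M.m l)
  have hC : ∀ l, pushes (M.m l) ≤ C := fun l =>
    Finset.le_sup (f := fun l : M.Λ => pushes (M.m l)) (Finset.mem_univ l)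
  refine ⟨Polynomial.X + time * Polynomial.C C, fun a => ?_⟩
  obtain ⟨⟨s₁, hs₁⟩, hle₁⟩ := outputs a
  dsimp only at hs₁ hle₁
  have hs : Steps M.m s₁ (initList M ((ea a).map inA.invFun))
      (haltList M ((eb (f a)).map outA.invFun)) := hs₁
  have := hs.length_le hC M.k₁
  rw [haltList_stk, update_self, List.length_map, initList_stk] at this
  have h₂ : ((update (fun _ => []) M.k₀ ((ea a).map inA.invFun) : ∀ k, List (M.Γ k))
      M.k₁).length ≤ (ea a).length := by
    by_cases hk : M.k₁ = M.k₀
    · have : ∀ k, k = M.k₀ → ((update (fun _ => []) M.k₀ ((ea a).map inA.invFun) :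
          ∀ k, List (M.Γ k)) k).length ≤ (ea a).length := by
        rintro _ rfl; simp
      exact this _ hk
    · rw [update_of_ne hk]; simp
  have h₃ : s₁ * C ≤ time.eval (ea a).length * C := Nat.mul_le_mul_right _ hle₁
  simp only [Polynomial.eval_add, Polynomial.eval_X, Polynomial.eval_mul, Polynomial.eval_C]
  omega

/-- If `M` computes `f` in polynomial time and the program `p` gets from `f a` to `g (f a)`
in polynomial time, then `g ∘ f` is computable in polynomial time. -/
theorem nonempty_comp {α αΓ : Type} {β : Type} {ea : α → List αΓ} {eb : β → List Bool}
    {f : α → β} (h : Nonempty (TM2ComputableInPolyTime ea eb f)) {γ : Type} {ec : γ → List Bool}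
    {g : β → γ} (p : Prog) (P : Polynomial ℕ)
    (hp : ∀ b, ∃ t, t ≤ P.eval (eb b).length ∧
      Exec p (Store.start (eb b)) t (Store.final (ec (g b)))) :
    Nonempty (TM2ComputableInPolyTime ea ec (fun a => g (f a))) := by
  obtain ⟨h⟩ := h
  set R := max p.top 3 with hRdef
  have hpR : p.Within R := p.within_top.mono (le_max_left _ _)
  have h3 : 3 ≤ R := le_max_right _ _
  obtain ⟨B, hlen⟩ := exists_length_le ⟨h⟩
  obtain ⟨⟨M, inA, outA⟩, time, outputs⟩ := h
  -- The summands are the run of `M`, the transfer of its output (whose length `B` bounds), the run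
  -- of `p` on it, and one last step.
  let time' : Polynomial ℕ := time + (B + 1) + P.comp B + 1
  refine ⟨⟨⟨attach M outA p R, inA, Equiv.refl Bool⟩, time', fun a => Classical.choice ?_⟩⟩
  obtain ⟨⟨s₁, hs₁⟩, hle₁⟩ := outputs a
  dsimp only at hs₁ hle₁ ⊢
  have hs : Steps M.m s₁ (initList M ((ea a).map inA.invFun))
      (haltList M ((eb (f a)).map outA.invFun)) := hs₁
  have hs' := steps_lift (m := attachStmt M outA p R) (R := R) Sum.inl (.inr (.inl ()))
    (fun l => rfl) none (fun _ => []) hs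
  obtain ⟨t, ht, hex⟩ := hp (f a)
  have htr := steps_transfer M outA p R (by omega) (fun _ => [])
    ((eb (f a)).map outA.invFun) (fun _ => []) (M.initialState, none)
  have e₁ : (((eb (f a)).map outA.invFun).map outA).reverse ++ [] = (eb (f a)).reverse := by
    simp
  obtain ⟨o, hprog⟩ := hex.steps (m := attachStmt M outA p R) (R := R) (fun _ => [])
    (fun l => .inr (.inr (.inl l))) (.inr (.inr (.inr ()))) hpR (fun l => rfl)
    (M.initialState, none)
  -- A halting configuration in the sense of `haltList` has the initial internal state and empty
  -- stacks except for the output; the last step resets the state.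
  have hend : Steps (attachStmt M outA p R) 1
      ⟨some (.inr (.inr (.inr ()))), (M.initialState, o), extStk R (fun _ => [])
        (Store.final (ec (g (f a))))⟩
      ⟨none, (M.initialState, none), extStk R (fun _ => []) (Store.final (ec (g (f a))))⟩ :=
    Steps.one rfl
  have hmid : liftCfg R Sum.inl (.inr (.inl ())) none (fun _ => [])
      (haltList M ((eb (f a)).map outA.invFun)) =
      (⟨some (.inr (.inl ())), (M.initialState, none), extStk R (update (fun _ => []) M.k₁
        ((eb (f a)).map outA.invFun)) (fun _ => [])⟩ :
        TM2.Cfg (ExtΓ M.Γ R) (AttachΛ M p) (M.σ × Option Bool)) :=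
    congrArg (fun T => TM2.Cfg.mk (some (Sum.inr (Sum.inl ()))) (M.initialState, none)
      (extStk R T (fun _ => []))) (haltList_stk M _)
  have hstart : extStk R (update (fun _ => []) M.k₁ []) (update (fun _ => []) 1
      ((((eb (f a)).map outA.invFun).map outA).reverse ++ [])) =
      extStk R (fun k => ([] : List (M.Γ k))) (Store.start (eb (f a))) := by
    rw [e₁, update_eq_self_iff.2 rfl]; rfl
  rw [hmid] at hs'
  rw [hstart] at htr
  have hinit : initList (attach M outA p R) ((ea a).map inA.invFun) =
      liftCfg R Sum.inl (.inr (.inl ())) none (fun _ => [])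
        (initList M ((ea a).map inA.invFun)) := by
    have e := update_extStk_inl (R := R) (fun k => ([] : List (M.Γ k))) (fun _ => []) M.k₀
      ((ea a).map inA.invFun)
    rw [extStk_nil] at e
    exact congrArg (TM2.Cfg.mk (some (Sum.inl M.main)) (M.initialState, none))
      (((initList_stk (attach M outA p R) _).trans e).trans
        (congrArg (fun T => extStk R T (fun _ => [])) (initList_stk M _).symm))
  have hfin : haltList (attach M outA p R) (ec (g (f a))) =
      (⟨none, (M.initialState, none), extStk R (fun _ => []) (Store.final (ec (g (f a))))⟩ :
        TM2.Cfg (ExtΓ M.Γ R) (AttachΛ M p) (M.σ × Option Bool)) := by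
    have e := update_extStk_reg (R := R) (fun k => ([] : List (M.Γ k))) (fun _ => []) h3
      (ec (g (f a)))
    rw [extStk_nil] at e
    exact congrArg (TM2.Cfg.mk none (M.initialState, none))
      ((haltList_stk (attach M outA p R) _).trans e)
  have hall := hs'.trans (htr.trans (hprog.trans hend))
  rw [← hinit, ← hfin] at hall
  have hmap : ((ec (g (f a))).map (Equiv.refl Bool).invFun) = ec (g (f a)) := List.map_id _
  refine ⟨⟨⟨_, Eq.trans hall (congrArg (fun l => some (haltList (attach M outA p R) l))
    hmap.symm)⟩, ?_⟩⟩
  have hlen := hlen a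
  have hP := eval_mono P hlen
  have hmap' : ((eb (f a)).map outA.invFun).length = (eb (f a)).length := List.length_map _
  simp only [time', Polynomial.eval_add, Polynomial.eval_one, Polynomial.eval_comp]
  omega

end Attach

end StackProg


namespace StackProg

open Function Turing

/-! ## Running programs within a time bound -/

/-- The program `p` gets from the stacks `S` to the stacks `S'` within `T` steps. -/
def Runs (p : Prog) (S S' : Store) (T : ℕ) : Prop := ∃ t, t ≤ T ∧ Exec p S t S'

theorem Runs.mono {p : Prog} {S S' : Store} {T T' : ℕ} (h : Runs p S S' T) (hT : T ≤ T') :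
    Runs p S S' T' :=
  let ⟨t, ht, e⟩ := h; ⟨t, ht.trans hT, e⟩

theorem Runs.congr {p : Prog} {S S' S'' : Store} {T : ℕ} (h : Runs p S S' T) (e : S' = S'') :
    Runs p S S'' T := e ▸ h

theorem Runs.skip (S : Store) : Runs .skip S S 1 := ⟨_, le_rfl, .skip S⟩

theorem Runs.push (k b) (S : Store) : Runs (.push k b) S (update S k (b :: S k)) 1 :=
  ⟨_, le_rfl, .push k b S⟩

theorem Runs.pop (k) (S : Store) : Runs (.pop k) S (update S k (S k).tail) 1 :=
  ⟨_, le_rfl, .pop k S⟩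

theorem Runs.seq {p q : Prog} {S S₁ S₂ : Store} {T₁ T₂ : ℕ} (h₁ : Runs p S S₁ T₁)
    (h₂ : Runs q S₁ S₂ T₂) : Runs (.seq p q) S S₂ (T₁ + T₂) :=
  let ⟨_, l₁, e₁⟩ := h₁
  let ⟨_, l₂, e₂⟩ := h₂
  ⟨_, add_le_add l₁ l₂, e₁.seq e₂⟩

theorem Runs.ite_true {k c} {p : Prog} (q : Prog) {S S' : Store} {T : ℕ}
    (hc : c (S k).head? = true) (h : Runs p S S' T) : Runs (.ite k c p q) S S' (T + 1) :=
  let ⟨_, l, e⟩ := h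
  ⟨_, Nat.add_le_add_right l 1, .ite_true hc e⟩

theorem Runs.ite_false {k c} (p : Prog) {q : Prog} {S S' : Store} {T : ℕ}
    (hc : c (S k).head? = false) (h : Runs q S S' T) : Runs (.ite k c p q) S S' (T + 1) :=
  let ⟨_, l, e⟩ := h
  ⟨_, Nat.add_le_add_right l 1, .ite_false hc e⟩

/-- The rule for loops, in terms of the sequence of the states before each round. -/
theorem Runs.while {k c} {p : Prog} (B : ℕ) : ∀ (v : ℕ) (I : ℕ → Store),
    (∀ i < v, c (I i k).head? = true) → c (I v k).head? = false →
    (∀ i < v, Runs p (I i) (I (i + 1)) B) → Runs (.while k c p) (I 0) (I v) (v * (B + 1) + 1)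
  | 0, I, _, h₀, _ => ⟨1, by simp, .while_false h₀⟩
  | v + 1, I, h₁, h₀, hp => by
    obtain ⟨t, ht, e⟩ := hp 0 (Nat.succ_pos v)
    obtain ⟨t', ht', e'⟩ := Runs.while B v (fun i => I (i + 1))
      (fun i hi => h₁ _ (Nat.succ_lt_succ hi)) h₀ (fun i hi => hp _ (Nat.succ_lt_succ hi))
    refine ⟨t + t' + 1, ?_, .while_true (h₁ 0 (Nat.succ_pos v)) e e'⟩
    have : (v + 1) * (B + 1) = v * (B + 1) + (B + 1) := by ring
    omega

/-- The contents of a counter with value `v`. -/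
def unary (v : ℕ) : List Bool := List.replicate v true

@[simp] theorem unary_zero : unary 0 = [] := rfl

theorem unary_succ (v : ℕ) : unary (v + 1) = true :: unary v := rfl

theorem unary_add (v w : ℕ) : unary (v + w) = unary v ++ unary w := List.replicate_add ..

@[simp] theorem tail_unary (v : ℕ) : (unary v).tail = unary (v - 1) := by cases v <;> rfl

/-- Repeat the program `p`, with the counter `k` counting down. -/
def Prog.loop (k : ℕ) (p : Prog) : Prog := .while k Option.isSome (.seq (.pop k) p)

/-- The counter is decremented before the body runs, so the body of round `i` sees `v - (i + 1)`. A
round costs the test, the pop and the body: `B + 2` steps. -/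
theorem Runs.loop {k : ℕ} {p : Prog} (B v : ℕ) (I : ℕ → Store) {S S' : Store} (h0 : I 0 = S)
    (hv : I v = S') (hk : ∀ i ≤ v, I i k = unary (v - i))
    (hp : ∀ i < v, Runs p (update (I i) k (unary (v - (i + 1)))) (I (i + 1)) B) :
    Runs (Prog.loop k p) S S' (v * (B + 2) + 1) := by
  subst h0 hv
  refine (Runs.while (B + 1) v I (fun i hi => ?_) ?_ fun i hi => ?_).mono (by ring_nf; rfl)
  · rw [hk i hi.le]
    obtain ⟨w, hw⟩ : ∃ w, v - i = w + 1 := ⟨v - i - 1, by omega⟩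
    rw [hw]; rfl
  · rw [hk v le_rfl]; simp
  · have h₁ := Runs.pop k (I i)
    rw [hk i hi.le, tail_unary] at h₁
    have := h₁.seq (hp i hi)
    exact this.mono (by omega)

/-- Empty the stack `k`. -/
def Prog.clear (k : ℕ) : Prog := Prog.loop k .skip

theorem Runs.clear {k v : ℕ} {S : Store} (h : S k = unary v) :
    Runs (Prog.clear k) S (update S k []) (3 * v + 1) := by
  refine (Runs.loop 1 v (fun i => update S k (unary (v - i))) ?_ (by simp) (by simp) ?_).mono
    (by omega)
  · simp [← h]
  · intro i hi
    simpa using Runs.skip (update S k (unary (v - (i + 1))))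

/-- Move the contents of the counter `a` to the stack `b`. -/
def Prog.move (a b : ℕ) : Prog := Prog.loop a (.push b true)

theorem Runs.move {a b v : ℕ} {S : Store} (hab : a ≠ b) (h : S a = unary v) :
    Runs (Prog.move a b) S (update (update S a []) b (unary v ++ S b)) (3 * v + 1) := by
  refine (Runs.loop 1 v (fun i => update (update S a (unary (v - i))) b (unary i ++ S b)) ?_
    (by simp) (fun i _ => by simp [update_of_ne hab]) ?_).mono (by omega)
  · simp [← h]
  · intro i hi
    refine (Runs.push _ _ _).congr ?_
    funext k
    simp only [update_apply, unary_succ]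
    grind

/-- Copy the counter `a` to the stack `b`, by means of the auxiliary counter `c`. -/
def Prog.copy (a b c : ℕ) : Prog :=
  .seq (Prog.loop a (.seq (.push b true) (.push c true))) (Prog.move c a)

/-- The counter is unloaded onto `b` and `c` simultaneously, in `4 * v + 1` steps, and then restored
from `c`, in `3 * v + 1` steps. -/
theorem Runs.copy {a b c v : ℕ} {S : Store} (hab : a ≠ b) (hac : a ≠ c) (hbc : b ≠ c)
    (h : S a = unary v) (hc : S c = []) :
    Runs (Prog.copy a b c) S (update S b (unary v ++ S b)) (7 * v + 2) := by
  have h₁ : Runs (Prog.loop a (.seq (.push b true) (.push c true))) S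
      (update (update (update S a []) b (unary v ++ S b)) c (unary v)) (v * 4 + 1) := by
    refine (Runs.loop 2 v (fun i => update (update (update S a (unary (v - i))) b
      (unary i ++ S b)) c (unary i)) ?_ (by simp) (fun i _ => by simp [update_of_ne, hab, hac])
        ?_)
    · funext k
      simp only [update_apply]
      grind [unary]
    · intro i hi
      refine ((Runs.push _ _ _).seq (Runs.push _ _ _)).congr ?_
      funext k
      simp only [update_apply, unary_succ]
      grind
  refine ((h₁.seq (Runs.move (v := v) (Ne.symm hac) (by simp))).congr ?_).mono (by omega)
  funext k
  simp only [update_apply]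
  grind [unary]

end StackProg


namespace StackProg

open Function Turing QuditComp

/-! ## Contexts -/

/-- A context: an array of natural numbers and finitely many natural numbers. -/
class Ctx (Γ : Type) where
  /-- the array -/
  arr : Γ → List ℕ
  /-- the number of variables -/
  dim : ℕ
  /-- the values of the variables -/
  var : Γ → ℕ → ℕ
  /-- the size of a context -/
  size : Γ → ℕ

instance : Ctx (List ℕ) := ⟨id, 0, fun _ _ => 0, fun A => (encodeList A).length⟩

instance {Γ : Type} [Ctx Γ] : Ctx (Γ × ℕ) :=
  ⟨fun c => Ctx.arr c.1, Ctx.dim Γ + 1, fun c i => if i = Ctx.dim Γ then c.2 else Ctx.var c.1 i,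
    fun c => Ctx.size c.1 + c.2⟩

/-- The contexts which the closure properties are about: variables and array are bounded by the
size. -/
class LawfulCtx (Γ : Type) extends Ctx Γ where
  length_le : ∀ c : Γ, (encodeList (arr c)).length ≤ size c
  var_le : ∀ (c : Γ), ∀ i < dim, var c i ≤ size c

instance : LawfulCtx (List ℕ) where
  length_le _ := le_rfl
  var_le _ i hi := absurd hi (Nat.not_lt_zero i)

instance {Γ : Type} [LawfulCtx Γ] : LawfulCtx (Γ × ℕ) where
  length_le c := (LawfulCtx.length_le c.1).trans (Nat.le_add_right _ _)
  var_le c i hi := by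
    change (if i = Ctx.dim Γ then c.2 else Ctx.var c.1 i) ≤ Ctx.size c.1 + c.2
    split_ifs with h
    · omega
    · have := LawfulCtx.var_le c.1 i (lt_of_le_of_ne (Nat.le_of_lt_succ hi) h)
      omega

/-- The stacks hold the context `c`: its array on stack `0`, its variables on the stacks `src i`;
the stacks from number `m` on are free. -/
structure Holds {Γ : Type} [Ctx Γ] (src : ℕ → ℕ) (m : ℕ) (c : Γ) (S : Store) : Prop where
  arr : S 0 = encodeList (Ctx.arr c)
  one : S 1 = []
  free : ∀ k, m ≤ k → S k = []
  four_le : 4 ≤ m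
  four_le_src : ∀ i < Ctx.dim Γ, 4 ≤ src i
  src_lt : ∀ i < Ctx.dim Γ, src i < m
  var : ∀ i < Ctx.dim Γ, S (src i) = unary (Ctx.var c i)

section

variable {Γ : Type} [LawfulCtx Γ]

/-- Array and variables lie below `m`; intermediate values may occupy the stacks from `m` to `m' -
1` once the free stacks are declared to begin at `m'`. -/
theorem Holds.of_agree {src : ℕ → ℕ} {m m' : ℕ} {c : Γ} {S S' : Store} (h : Holds src m c S)
    (hm : m ≤ m') (hlt : ∀ k < m, S' k = S k) (hge : ∀ k, m' ≤ k → S' k = S k) :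
    Holds src m' c S' := by
  have h4 := h.four_le
  refine ⟨?_, ?_, fun j hj => ?_, by omega, h.four_le_src, fun i hi => (h.src_lt i hi).trans_le hm,
    fun i hi => ?_⟩
  · rw [hlt 0 (by omega), h.arr]
  · rw [hlt 1 (by omega), h.one]
  · rw [hge j hj, h.free j (by omega)]
  · rw [hlt _ (h.src_lt i hi), h.var i hi]

theorem Holds.update {src : ℕ → ℕ} {m m' k : ℕ} {c : Γ} {S : Store} (h : Holds src m c S)
    (l : List Bool) (hk : m ≤ k) (hm : m ≤ m') (hk' : k < m') :
    Holds src m' c (update S k l) :=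
  h.of_agree hm (fun j hj => update_of_ne (by omega) _ _) fun j hj => update_of_ne (by omega) _ _

theorem Holds.weaken {src : ℕ → ℕ} {m m' : ℕ} {c : Γ} {S : Store} (h : Holds src m c S)
    (hm : m ≤ m') : Holds src m' c S :=
  ⟨h.arr, h.one, fun k hk => h.free k (hm.trans hk), h.four_le.trans hm, h.four_le_src,
    fun i hi => (h.src_lt i hi).trans_le hm, h.var⟩

theorem Holds.output {src : ℕ → ℕ} {m : ℕ} {c : Γ} {S : Store} (h : Holds src m c S)
    (l : List Bool) : Holds src m c (Function.update S 2 l) := by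
  have h4 := h.four_le
  refine ⟨?_, ?_, fun j hj => ?_, h4, h.four_le_src, h.src_lt, fun i hi => ?_⟩
  · rw [update_of_ne (by omega), h.arr]
  · rw [update_of_ne (by omega), h.one]
  · rw [update_of_ne (by omega), h.free j (by omega)]
  · have := h.four_le_src i hi
    rw [update_of_ne (by omega), h.var i hi]

/-- The value of a stack becomes a new last variable. Loops use this to make their index and
accumulator visible to the body. -/
theorem Holds.bind {src : ℕ → ℕ} {m k v : ℕ} {c : Γ} {S : Store} (h : Holds src m c S)
    (h4 : 4 ≤ k) (hk : k < m) (hv : S k = unary v) :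
    Holds (Function.update src (Ctx.dim Γ) k) m (c, v) S := by
  refine ⟨h.arr, h.one, h.free, h.four_le, fun i hi => ?_, fun i hi => ?_, fun i hi => ?_⟩
  all_goals
    have hi' : i < Ctx.dim Γ + 1 := hi
    by_cases hd : i = Ctx.dim Γ
  · subst hd; simpa
  · rw [update_of_ne hd]; exact h.four_le_src i (by omega)
  · subst hd; simpa
  · rw [update_of_ne hd]; exact h.src_lt i (by omega)
  · subst hd; simpa [Ctx.var] using hv
  · rw [update_of_ne hd, h.var i (by omega)]
    change _ = unary (if i = Ctx.dim Γ then v else Ctx.var c i)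
    rw [if_neg hd]

/-! ## Functions computable in polynomial time -/

/-- The function `f` of the context is polynomially bounded. -/
def Bounded (f : Γ → ℕ) : Prop := ∃ B : Polynomial ℕ, ∀ c, f c ≤ B.eval (Ctx.size c)

theorem Bounded.const (a : ℕ) : Bounded fun _ : Γ => a := ⟨Polynomial.C a, by simp⟩

theorem Bounded.size : Bounded fun c : Γ => Ctx.size c := ⟨Polynomial.X, by simp⟩

theorem Bounded.add {f g : Γ → ℕ} (hf : Bounded f) (hg : Bounded g) :
    Bounded fun c => f c + g c :=
  let ⟨B, hB⟩ := hf
  let ⟨B', hB'⟩ := hg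
  ⟨B + B', fun c => by simpa using add_le_add (hB c) (hB' c)⟩

theorem Bounded.mul {f g : Γ → ℕ} (hf : Bounded f) (hg : Bounded g) :
    Bounded fun c => f c * g c :=
  let ⟨B, hB⟩ := hf
  let ⟨B', hB'⟩ := hg
  ⟨B * B', fun c => by simpa using Nat.mul_le_mul (hB c) (hB' c)⟩

theorem Bounded.mono {f g : Γ → ℕ} (hg : Bounded g) (h : ∀ c, f c ≤ g c) : Bounded f :=
  let ⟨B, hB⟩ := hg
  ⟨B, fun c => (h c).trans (hB c)⟩

theorem Bounded.fst {f : Γ → ℕ} (hf : Bounded f) : Bounded fun c : Γ × ℕ => f c.1 :=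
  let ⟨B, hB⟩ := hf
  ⟨B, fun c => (hB c.1).trans (eval_mono B (Nat.le_add_right _ _))⟩

theorem Bounded.snd : Bounded fun c : Γ × ℕ => c.2 :=
  Bounded.size.mono fun _ => Nat.le_add_left _ _

/-- Substitution of a polynomially bounded value for a variable, in a bound. -/
theorem Bounded.subst {f : Γ × ℕ → ℕ} {g : Γ → ℕ} (hf : Bounded f) (hg : Bounded g) :
    ∃ B : Polynomial ℕ, ∀ c, ∀ v ≤ g c, f (c, v) ≤ B.eval (Ctx.size c) := by
  obtain ⟨B, hB⟩ := hf
  obtain ⟨B', hB'⟩ := hg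
  refine ⟨B.comp (Polynomial.X + B'), fun c v hv => (hB _).trans ?_⟩
  rw [Polynomial.eval_comp]
  refine eval_mono B ?_
  have := hB' c
  simp only [Polynomial.eval_add, Polynomial.eval_X]
  change Ctx.size c + v ≤ _
  omega

/-- The function `f` is computed in polynomial time by a program which leaves the value on the
first free stack. -/
structure PolyFun (f : Γ → ℕ) : Prop where
  /-- The values are bounded by a polynomial. -/
  bounded : Bounded f
  /-- There is a program. -/
  exists_prog : ∃ (P : (ℕ → ℕ) → ℕ → Prog) (T : Γ → ℕ), Bounded T ∧
    ∀ src m c S, Holds src m c S → Runs (P src m) S (update S m (unary (f c))) (T c)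

/-- The list-valued function `g` is computed in polynomial time by a program which appends the
bit string of the list, in reverse, to stack `2`. -/
structure PolyList (g : Γ → List ℕ) : Prop where
  /-- There is a program. -/
  exists_prog : ∃ (P : (ℕ → ℕ) → ℕ → Prog) (T : Γ → ℕ), Bounded T ∧
    ∀ src m c S, Holds src m c S →
      Runs (P src m) S (update S 2 ((encodeList (g c)).reverse ++ S 2)) (T c)

/-- Push the number `a` in unary. -/
def Prog.pushNat (k : ℕ) : ℕ → Prog
  | 0 => .skip
  | a + 1 => .seq (pushNat k a) (.push k true)

theorem Runs.pushNat (k : ℕ) (S : Store) : ∀ a : ℕ,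
    Runs (Prog.pushNat k a) S (Function.update S k (unary a ++ S k)) (a + 1)
  | 0 => (Runs.skip S).congr (by simp)
  | a + 1 => ((Runs.pushNat k S a).seq (Runs.push _ _ _)).congr (by simp [unary_succ])

namespace PolyFun

theorem const (a : ℕ) : PolyFun fun _ : Γ => a := by
  refine ⟨.const a, fun _ m => .pushNat m a, fun _ => a + 1, .const _, fun src m c S h => ?_⟩
  refine (Runs.pushNat m S a).congr ?_
  rw [h.free m le_rfl, List.append_nil]

theorem snd : PolyFun fun c : Γ × ℕ => c.2 := by
  refine ⟨.snd, fun src m => .copy (src (Ctx.dim Γ)) m (m + 1), fun c => 7 * c.2 + 2,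
    ((Bounded.const 7).mul .snd).add (.const 2), fun src m c S h => ?_⟩
  have hd : Ctx.dim Γ < Ctx.dim (Γ × ℕ) := Nat.lt_succ_self _
  have h₁ := h.src_lt _ hd
  have hv : S (src (Ctx.dim Γ)) = unary c.2 := by
    rw [h.var _ hd]
    change unary (if Ctx.dim Γ = Ctx.dim Γ then c.2 else _) = _
    rw [if_pos rfl]
  refine (Runs.copy (by omega) (by omega) (by omega) hv (h.free _ (by omega))).congr ?_
  rw [h.free m le_rfl, List.append_nil]

/-- The program is kept: it relies only on the earlier variables. -/
theorem fst {f : Γ → ℕ} (hf : PolyFun f) : PolyFun fun c : Γ × ℕ => f c.1 := by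
  obtain ⟨hb, P, T, hT, hP⟩ := hf
  refine ⟨hb.fst, P, fun c => T c.1, hT.fst, fun src m c S h => hP src m c.1 S ?_⟩
  have hlt : ∀ i, i < Ctx.dim Γ → i < Ctx.dim (Γ × ℕ) := fun i hi => Nat.lt_succ_of_lt hi
  refine ⟨h.arr, h.one, h.free, h.four_le, fun i hi => h.four_le_src i (hlt i hi),
    fun i hi => h.src_lt i (hlt i hi), fun i hi => ?_⟩
  rw [h.var i (hlt i hi)]
  change unary (if i = Ctx.dim Γ then _ else _) = _
  rw [if_neg hi.ne]

theorem add {f g : Γ → ℕ} (hf : PolyFun f) (hg : PolyFun g) : PolyFun fun c => f c + g c := by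
  obtain ⟨hb, P, T, hT, hP⟩ := hf
  obtain ⟨hb', P', T', hT', hP'⟩ := hg
  refine ⟨hb.add hb', fun src m => .seq (P src m) (.seq (P' src (m + 1)) (.move (m + 1) m)),
    fun c => T c + (T' c + (3 * g c + 1)),
    hT.add (hT'.add (((Bounded.const 3).mul hb').add (.const 1))), fun src m c S h => ?_⟩
  have h₁ := hP src m c S h
  have h₂ := hP' src (m + 1) c _ (h.update (unary (f c)) le_rfl (Nat.le_succ m) (Nat.lt_succ_self m))
  refine (h₁.seq (h₂.seq (Runs.move (v := g c) (by omega) (by simp)))).congr ?_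
  have := h.free (m + 1) (by omega)
  have e : unary (f c + g c) = unary (g c) ++ unary (f c) := by rw [add_comm, unary_add]
  funext k
  simp only [update_apply, e]
  grind

/-- Popping an empty stack leaves it empty, which is exactly truncation of the subtraction at `0`.
-/
theorem sub {f g : Γ → ℕ} (hf : PolyFun f) (hg : PolyFun g) : PolyFun fun c => f c - g c := by
  obtain ⟨hb, P, T, hT, hP⟩ := hf
  obtain ⟨hb', P', T', hT', hP'⟩ := hg
  refine ⟨hb.mono fun c => Nat.sub_le _ _,
    fun src m => .seq (P src m) (.seq (P' src (m + 1)) (.loop (m + 1) (.pop m))),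
    fun c => T c + (T' c + (g c * 3 + 1)),
    hT.add (hT'.add ((hb'.mul (.const 3)).add (.const 1))), fun src m c S h => ?_⟩
  have h₁ := hP src m c S h
  have h₂ := hP' src (m + 1) c _ (h.update (unary (f c)) le_rfl (Nat.le_succ m) (Nat.lt_succ_self m))
  have hfree := h.free (m + 1) (by omega)
  refine h₁.seq (h₂.seq (Runs.loop 1 (g c) (fun i => update (update S m (unary (f c - i))) (m + 1)
    (unary (g c - i))) (by simp) ?_ (by simp) ?_))
  · funext k
    simp only [update_apply]
    grind [unary_zero]
  · intro i hi
    refine (Runs.pop _ _).congr ?_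
    funext k
    simp only [update_apply]
    grind [tail_unary]

theorem mul {f g : Γ → ℕ} (hf : PolyFun f) (hg : PolyFun g) : PolyFun fun c => f c * g c := by
  obtain ⟨hb, P, T, hT, hP⟩ := hf
  obtain ⟨hb', P', T', hT', hP'⟩ := hg
  refine ⟨hb.mul hb', fun src m => .seq (P src (m + 1)) (.seq (P' src (m + 2))
      (.seq (.loop (m + 1) (.copy (m + 2) m (m + 3))) (.clear (m + 2)))),
    fun c => T c + (T' c + ((f c * (7 * g c + 2 + 2) + 1) + (3 * g c + 1))),
    hT.add (hT'.add (((hb.mul ((((Bounded.const 7).mul hb').add (.const 2)).add (.const 2))).add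
      (.const 1)).add (((Bounded.const 3).mul hb').add (.const 1)))), fun src m c S h => ?_⟩
  have h₁ := hP src (m + 1) c S (h.weaken (Nat.le_succ m))
  have h₂ := hP' src (m + 2) c _ (h.update (k := m + 1) (m' := m + 2) (unary (f c)) (by omega)
    (by omega) (by omega))
  have hfree := h.free
  have h₃ : Runs (.loop (m + 1) (.copy (m + 2) m (m + 3)))
      (update (update S (m + 1) (unary (f c))) (m + 2) (unary (g c)))
      (update (update S m (unary (f c * g c))) (m + 2) (unary (g c)))
      (f c * (7 * g c + 2 + 2) + 1) := by
    refine Runs.loop (7 * g c + 2) (f c) (fun i => update (update (update S m (unary (i * g c)))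
      (m + 1) (unary (f c - i))) (m + 2) (unary (g c))) ?_ ?_ ?_ ?_
    · funext k
      simp only [update_apply]
      grind [unary_zero]
    · funext k
      simp only [update_apply]
      grind [unary_zero]
    · simp [update_of_ne]
    · intro i hi
      refine (Runs.copy (v := g c) (by omega) (by omega) (by omega) (by simp) ?_).congr ?_
      · simp [hfree (m + 3)]
      · have : unary ((i + 1) * g c) = unary (g c) ++ unary (i * g c) := by
          rw [← unary_add]; congr 1; ring
        funext k
        simp only [update_apply]
        grind
  refine (h₁.seq (h₂.seq (h₃.seq (Runs.clear (v := g c) (by simp))))).congr ?_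
  funext k
  simp only [update_apply]
  grind

theorem ite {f g h : Γ → ℕ} (hf : PolyFun f) (hg : PolyFun g) (hh : PolyFun h) :
    PolyFun fun c => if f c = 0 then g c else h c := by
  obtain ⟨hb, P, T, hT, hP⟩ := hf
  obtain ⟨hb', P', T', hT', hP'⟩ := hg
  obtain ⟨hb'', P'', T'', hT'', hP''⟩ := hh
  refine ⟨(hb'.add hb'').mono fun c => by split_ifs <;> omega,
    fun src m => .seq (P src m) (.ite m Option.isSome (.seq (.clear m) (P'' src m)) (P' src m)),
    fun c => T c + (3 * f c + 1 + T'' c + T' c + 1),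
    hT.add ((((((Bounded.const 3).mul hb).add (.const 1)).add hT'').add hT').add (.const 1)),
    fun src m c S hS => ?_⟩
  have h₁ := hP src m c S hS
  have hfree := hS.free m le_rfl
  by_cases h0 : f c = 0
  · have h₂ := hP' src m c S hS
    have e : update S m (unary (f c)) = S := by rw [h0, unary_zero, ← hfree, update_eq_self]
    rw [e] at h₁
    simp only [h0, if_true]
    refine (h₁.seq (Runs.ite_false _ (by simp [hfree]) h₂)).mono (by omega)
  · simp only [h0, if_false]
    obtain ⟨v, hv⟩ := Nat.exists_eq_succ_of_ne_zero h0
    have h₂ := hP'' src m c S hS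
    have h₃ := Runs.clear (k := m) (S := update S m (unary (f c))) (v := f c) (by simp)
    have e : update (update S m (unary (f c))) m [] = S := by
      rw [update_idem, ← hfree, update_eq_self]
    rw [e] at h₃
    exact (h₁.seq (Runs.ite_true _ (by simp [hv, unary_succ]) (h₃.seq h₂))).mono (by omega)

end PolyFun

end

end StackProg


/-! ### Array lookup and array length -/

namespace StackProg

open Function Turing QuditComp

theorem encodeList_append (l l' : List ℕ) :
    encodeList (l ++ l') = encodeList l ++ encodeList l' := List.flatMap_append ..

theorem encodeList_cons (a : ℕ) (l : List ℕ) :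
    encodeList (a :: l) = unary a ++ (false :: encodeList l) := by
  simp [encodeList, unary]

theorem length_le_encodeList (l : List ℕ) : l.length ≤ (encodeList l).length := by
  induction l with
  | nil => simp
  | cons a l ih => rw [encodeList_cons]; simp; omega

theorem getD_le_encodeList (l : List ℕ) (i : ℕ) : l.getD i 0 ≤ (encodeList l).length := by
  induction l generalizing i with
  | nil => simp
  | cons a l ih =>
    rw [encodeList_cons]
    cases i with
    | zero => simp [unary]
    | succ i => have := ih i; simp [unary] at this ⊢; omega

/-- Pour the stack `a` onto the stack `b`. -/
def Prog.pour (a b : ℕ) : Prog :=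
  .while a Option.isSome (.seq (.ite a (· == some true) (.push b true) (.push b false)) (.pop a))

theorem Runs.pour {a b : ℕ} (hab : a ≠ b) : ∀ (l : List Bool) (S : Store), S a = l →
    Runs (.pour a b) S (update (update S a []) b (l.reverse ++ S b)) (4 * l.length + 1)
  | [], S, h => ⟨1, by simp, by
      have e : update (update S a []) b ([].reverse ++ S b) = S := by
        rw [← h, update_eq_self]; simp [h]
      rw [e]
      exact .while_false (by simp [h])⟩
  | x :: l, S, h => by
    have h₁ : Runs (.ite a (· == some true) (.push b true) (.push b false)) S
        (update S b (x :: S b)) 2 := by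
      cases x
      · exact Runs.ite_false _ (by simp [h]) (Runs.push _ _ _)
      · exact Runs.ite_true _ (by simp [h]) (Runs.push _ _ _)
    obtain ⟨t, ht, e⟩ := h₁.seq (Runs.pop a _)
    obtain ⟨t', ht', e'⟩ := Runs.pour hab l
      (update (update S b (x :: S b)) a (update S b (x :: S b) a).tail) (by
        rw [update_self, update_of_ne hab, h, List.tail_cons])
    refine ⟨t + t' + 1, by rw [List.length_cons]; omega, .while_true (by simp [h]) e ?_⟩
    refine (congrArg (Exec (.pour a b) _ t') ?_).mp e'
    funext k
    simp only [update_apply, List.reverse_cons]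
    grind

/-- Move the first number on stack `0` to stack `1`, and a copy of it to the counter `k`. -/
def Prog.scan (k : ℕ) : Prog :=
  .seq (.while 0 (· == some true) (.seq (.pop 0) (.seq (.push 1 true) (.push k true))))
    (.ite 0 Option.isSome (.seq (.pop 0) (.push 1 false)) .skip)

/-- On an empty stack nothing is moved and the copy is `0`, in accordance with `headD 0`; thus
reading beyond the end of the array needs no separate treatment. -/
theorem Runs.scan {k : ℕ} (hk : 2 ≤ k) (L : List ℕ) (S : Store) (h : S 0 = encodeList L) :
    Runs (.scan k) S (update (update (update S 0 (encodeList L.tail)) 1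
      ((encodeList (L.take 1)).reverse ++ S 1)) k (unary (L.headD 0) ++ S k))
      (4 * L.headD 0 + 4) := by
  cases L with
  | nil =>
    have h0 : S 0 = [] := h
    refine ((Runs.seq (S₁ := S) (T₁ := 1) ⟨1, le_rfl, .while_false (by simp [h0])⟩
      (Runs.ite_false _ (by simp [h0]) (Runs.skip S))).congr ?_).mono (by simp)
    funext j
    simp only [update_apply]
    have : encodeList [] = [] := rfl
    simp only [List.tail_nil, List.headD_nil, List.take_nil, this, unary_zero]
    grind
  | cons a L =>
    rw [encodeList_cons] at h
    have h₁ : Runs (.while 0 (· == some true) (.seq (.pop 0) (.seq (.push 1 true) (.push k true))))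
        S (update (update (update S 0 (false :: encodeList L)) 1 (unary a ++ S 1)) k
          (unary a ++ S k)) (a * 4 + 1) := by
      have := Runs.while (k := 0) (c := (· == some true))
        (p := .seq (.pop 0) (.seq (.push 1 true) (.push k true))) 3 a
        (fun i => update (update (update S 0 (unary (a - i) ++ false :: encodeList L)) 1
          (unary i ++ S 1)) k (unary i ++ S k)) ?_ ?_ ?_
      · refine Eq.mp (congrArg₂ (fun x y => Runs _ x y _) ?_ ?_) this
        · funext j
          simp only [update_apply, Nat.sub_zero, unary_zero, List.nil_append, ← h]
          grind
        · simp
      · intro i hi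
        obtain ⟨w, hw⟩ : ∃ w, a - i = w + 1 := ⟨a - i - 1, by omega⟩
        rw [update_of_ne (by omega), update_of_ne (by omega), update_self, hw]
        rfl
      · rw [update_of_ne (by omega), update_of_ne (by omega), update_self, Nat.sub_self]
        rfl
      · intro i hi
        obtain ⟨w, hw⟩ : ∃ w, a - i = w + 1 := ⟨a - i - 1, by omega⟩
        have hw' : a - (i + 1) = w := by omega
        refine ((Runs.pop _ _).seq ((Runs.push _ _ _).seq (Runs.push _ _ _))).congr ?_
        rw [hw, hw']
        funext j
        simp only [update_apply, unary_succ]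
        grind
    refine ((h₁.seq (Runs.ite_true _ ?_ ((Runs.pop 0 _).seq (Runs.push 1 _ _)))).congr ?_).mono ?_
    · rw [update_of_ne (by omega), update_of_ne (by omega), update_self]
      rfl
    · have e : (encodeList ((a :: L).take 1)).reverse = false :: unary a := by
        simp [encodeList, unary]
      funext j
      simp only [update_apply, List.headD_cons, e, List.tail_cons]
      grind
    · simp; omega

section

variable {Γ : Type} [LawfulCtx Γ]

namespace PolyFun

/-- The entries before the wanted one are moved to stack `1` and their copies are discarded; the
copy of the next entry is kept. Since stack `1` holds the scanned prefix reversed, pouring it back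
restores the array. -/
theorem get {f : Γ → ℕ} (hf : PolyFun f) : PolyFun fun c => (Ctx.arr c).getD (f c) 0 := by
  obtain ⟨hb, P, T, hT, hP⟩ := hf
  refine ⟨Bounded.size.mono fun c => (getD_le_encodeList _ _).trans (LawfulCtx.length_le c),
    fun src m => .seq (P src (m + 1)) (.seq (.loop (m + 1) (.seq (.scan m) (.clear m)))
      (.seq (.scan m) (.pour 1 0))),
    fun c => T c + ((f c * (4 * Ctx.size c + 4 + (3 * Ctx.size c + 1) + 2) + 1) +
      ((4 * Ctx.size c + 4) + (4 * Ctx.size c + 1))),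
    hT.add (((hb.mul ((((((Bounded.const 4).mul .size).add (.const 4)).add
      (((Bounded.const 3).mul .size).add (.const 1))).add (.const 2)))).add (.const 1)).add
      ((((Bounded.const 4).mul .size).add (.const 4)).add
        (((Bounded.const 4).mul .size).add (.const 1)))), fun src m c S h => ?_⟩
  have h4 := h.four_le
  have h₁ := hP src (m + 1) c S (h.weaken (Nat.le_succ m))
  have hfree := h.free
  have hone := h.one
  have harr := h.arr
  set A := Ctx.arr c with hA
  have hlen : (encodeList A).length ≤ Ctx.size c := LawfulCtx.length_le c
  have hget : ∀ i, (A.drop i).headD 0 = A.getD i 0 := fun i => by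
    rw [List.headD_eq_head?_getD, List.head?_drop, List.getD_eq_getElem?_getD]
  have hle : ∀ i, (A.drop i).headD 0 ≤ Ctx.size c := fun i => by
    rw [hget]; exact (getD_le_encodeList _ _).trans hlen
  have htake : ∀ i, (encodeList (A.take (i + 1))).reverse =
      (encodeList ((A.drop i).take 1)).reverse ++ (encodeList (A.take i)).reverse := fun i => by
    rw [← List.reverse_append, ← encodeList_append, List.take_add]
  have h₂ : Runs (.loop (m + 1) (.seq (.scan m) (.clear m)))
      (update S (m + 1) (unary (f c)))
      (update (update S 0 (encodeList (A.drop (f c)))) 1 (encodeList (A.take (f c))).reverse)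
      (f c * (4 * Ctx.size c + 4 + (3 * Ctx.size c + 1) + 2) + 1) := by
    refine Runs.loop _ (f c) (fun i => update (update (update S 0 (encodeList (A.drop i))) 1
      (encodeList (A.take i)).reverse) (m + 1) (unary (f c - i))) ?_ ?_ (by simp) ?_
    · have e : encodeList (A.take 0) = [] := rfl
      funext j
      simp only [update_apply, List.drop_zero, e]
      grind
    · funext j
      simp only [update_apply, Nat.sub_self, unary_zero]
      grind
    · intro i hi
      refine (((Runs.scan (k := m) (by omega) (A.drop i) _ ?_).seq (Runs.clear (k := m)
        (v := (A.drop i).headD 0) ?_)).mono ?_).congr ?_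
      · simp
      · have : m ≠ 0 := by omega
        have : m ≠ 1 := by omega
        simp [hfree m le_rfl, *]
      · have := hle i
        omega
      · have := hfree m le_rfl
        rw [htake]
        simp only [List.tail_drop]
        funext j
        simp only [update_apply]
        grind
  have h₃ := Runs.scan (k := m) (by omega) (A.drop (f c)) (update (update S 0
    (encodeList (A.drop (f c)))) 1 (encodeList (A.take (f c))).reverse) (by simp)
  have h₄ := Runs.pour (a := 1) (b := 0) (by omega) (encodeList (A.take (f c + 1))).reverse
    (update (update (update (update (update S 0
    (encodeList (A.drop (f c)))) 1 (encodeList (A.take (f c))).reverse) 0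
      (encodeList (A.drop (f c)).tail)) 1 ((encodeList ((A.drop (f c)).take 1)).reverse ++
        (update (update S 0 (encodeList (A.drop (f c)))) 1 (encodeList (A.take (f c))).reverse) 1))
        m (unary ((A.drop (f c)).headD 0) ++ (update (update S 0
    (encodeList (A.drop (f c)))) 1 (encodeList (A.take (f c))).reverse) m)) (by
      rw [htake]
      simp [update_apply]
      omega)
  refine ((h₁.seq (h₂.seq (h₃.seq h₄))).mono ?_).congr ?_
  · have := hle (f c)
    have : (encodeList (A.take (f c + 1))).length ≤ (encodeList A).length := by
      conv_rhs => rw [← List.take_append_drop (f c + 1) A, encodeList_append]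
      simp
    rw [List.length_reverse]
    dsimp only
    omega
  · have e : encodeList (A.take (f c + 1)) ++ encodeList (A.drop (f c)).tail = encodeList A := by
      rw [List.tail_drop, ← encodeList_append, List.take_append_drop]
    rw [List.reverse_reverse, hget]
    have := hfree m le_rfl
    funext j
    simp only [update_apply]
    grind

theorem len : PolyFun fun c : Γ => (Ctx.arr c).length := by
  refine ⟨Bounded.size.mono fun c => (length_le_encodeList _).trans (LawfulCtx.length_le c),
    fun src m => .seq (.while 0 Option.isSome (.seq (.scan (m + 1)) (.seq (.clear (m + 1))
      (.push m true)))) (.pour 1 0),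
    fun c => (Ctx.size c * (4 * Ctx.size c + 4 + (3 * Ctx.size c + 1 + 1) + 1) + 1) +
      (4 * Ctx.size c + 1),
    (((Bounded.size.mul ((((((Bounded.const 4).mul .size).add (.const 4)).add
      ((((Bounded.const 3).mul .size).add (.const 1)).add (.const 1))).add (.const 1)))).add
        (.const 1)).add (((Bounded.const 4).mul .size).add (.const 1))), fun src m c S h => ?_⟩
  have h4 := h.four_le
  have hfree := h.free
  have hone := h.one
  have harr := h.arr
  set A := Ctx.arr c with hA
  have hlen : (encodeList A).length ≤ Ctx.size c := LawfulCtx.length_le c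
  have hle : ∀ i, (A.drop i).headD 0 ≤ Ctx.size c := fun i => by
    rw [List.headD_eq_head?_getD, List.head?_drop, ← List.getD_eq_getElem?_getD]
    exact (getD_le_encodeList _ _).trans hlen
  have htake : ∀ i, (encodeList (A.take (i + 1))).reverse =
      (encodeList ((A.drop i).take 1)).reverse ++ (encodeList (A.take i)).reverse := fun i => by
    rw [← List.reverse_append, ← encodeList_append, List.take_add]
  have h₁ := Runs.while (k := 0) (c := Option.isSome)
    (p := .seq (.scan (m + 1)) (.seq (.clear (m + 1)) (.push m true)))
    (4 * Ctx.size c + 4 + (3 * Ctx.size c + 1 + 1)) A.length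
    (fun i => update (update (update S 0 (encodeList (A.drop i))) 1
      (encodeList (A.take i)).reverse) m (unary i)) (fun i hi => by
        rw [update_of_ne (by omega), update_of_ne (by omega), update_self,
          List.drop_eq_getElem_cons hi, encodeList_cons]
        cases A[i] <;> simp [unary_succ]) (by
        rw [update_of_ne (by omega), update_of_ne (by omega), update_self, List.drop_length]
        rfl) (fun i hi => by
      refine (((Runs.scan (k := m + 1) (by omega) (A.drop i) _ ?_).seq ((Runs.clear (k := m + 1)
        (v := (A.drop i).headD 0) ?_).seq (Runs.push _ _ _))).mono ?_).congr ?_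
      · simp [update_apply]
        omega
      · have : m ≠ 0 := by omega
        simp [update_apply, hfree (m + 1), *]
      · have := hle i
        omega
      · have := hfree (m + 1) (by omega)
        rw [htake]
        simp only [List.tail_drop]
        funext j
        simp only [update_apply, unary_succ]
        grind)
  have h₂ := Runs.pour (a := 1) (b := 0) (by omega) (encodeList A).reverse
    (update (update (update S 0 (encodeList (A.drop A.length))) 1
      (encodeList (A.take A.length)).reverse) m (unary A.length)) (by
      simp [update_apply]
      omega)
  have e₀ : (update (update (update S 0 (encodeList (A.drop 0))) 1
      (encodeList (A.take 0)).reverse) m (unary 0)) = S := by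
    have e : encodeList (A.take 0) = [] := rfl
    have := hfree m le_rfl
    funext j
    simp only [update_apply, List.drop_zero, e, unary_zero]
    grind
  rw [e₀] at h₁
  refine ((h₁.seq h₂).mono ?_).congr ?_
  · have := (length_le_encodeList A).trans hlen
    have : A.length * (4 * Ctx.size c + 4 + (3 * Ctx.size c + 1 + 1) + 1) ≤
      Ctx.size c * (4 * Ctx.size c + 4 + (3 * Ctx.size c + 1 + 1) + 1) := Nat.mul_le_mul_right _ this
    rw [List.length_reverse]
    dsimp only
    omega
  · have e : encodeList (A.drop A.length) = [] := by simp [encodeList]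
    rw [List.reverse_reverse, e]
    have := hfree m le_rfl
    funext j
    simp only [update_apply]
    grind

end PolyFun

end

end StackProg


/-! ### Bounded iteration, and functions whose values are lists -/

namespace StackProg

open Function Turing QuditComp

section

variable {Γ : Type} [LawfulCtx Γ]

namespace PolyFun

/-- Iteration, with a step function of the context, the number of the round and the value
so far. -/
theorem iter {cnt init : Γ → ℕ} {step : (Γ × ℕ) × ℕ → ℕ} (hc : PolyFun cnt) (hi : PolyFun init)
    (hs : PolyFun step) {F : Γ → ℕ → ℕ} (hF₀ : ∀ c, F c 0 = init c)
    (hF : ∀ c i, F c (i + 1) = step ((c, i), F c i)) {bd : Γ → ℕ} (hbd : Bounded bd)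
    (hle : ∀ c, ∀ i ≤ cnt c, F c i ≤ bd c) : PolyFun fun c => F c (cnt c) := by
  obtain ⟨hcb, Pc, Tc, hTc, hPc⟩ := hc
  obtain ⟨_, Pi, Ti, hTi, hPi⟩ := hi
  obtain ⟨_, Ps, Ts, hTs, hPs⟩ := hs
  -- The step function runs in a context of size `size c + i + F c i`. This is polynomial only
  -- because the values along the iteration are bounded by `bd`; repeated application of a
  -- polynomial-time function would not be polynomial in general.
  obtain ⟨B, hB⟩ : ∃ B : Polynomial ℕ, ∀ c, ∀ i ≤ cnt c,
      Ts ((c, i), F c i) ≤ B.eval (Ctx.size c) := by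
    obtain ⟨B₁, hB₁⟩ := hTs
    obtain ⟨B₂, hB₂⟩ := hcb
    obtain ⟨B₃, hB₃⟩ := hbd
    refine ⟨B₁.comp (Polynomial.X + B₂ + B₃), fun c i hi => (hB₁ _).trans ?_⟩
    rw [Polynomial.eval_comp]
    refine eval_mono B₁ ?_
    have h₁ := hB₂ c
    have h₂ := hB₃ c
    have h₃ := hle c i hi
    change Ctx.size c + i + F c i ≤ _
    simp only [Polynomial.eval_add, Polynomial.eval_X]
    omega
  have hRB : Bounded fun c : Γ => B.eval (Ctx.size c) := ⟨B, fun _ => le_rfl⟩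
  -- Stack `m` holds the value so far, `m + 1` the number of the round, `m + 2` the countdown, and
  -- `m + 3` receives the next value.
  refine ⟨hbd.mono fun c => hle c _ le_rfl, fun src m => .seq (Pi src m)
    (.seq (Pc src (m + 2)) (.seq (.loop (m + 2)
      (.seq (Ps (update (update src (Ctx.dim Γ) (m + 1)) (Ctx.dim Γ + 1) m) (m + 3))
        (.seq (.clear m) (.seq (.move (m + 3) m) (.push (m + 1) true))))) (.clear (m + 1)))),
    fun c => Ti c + (Tc c + ((cnt c * (B.eval (Ctx.size c) + ((3 * bd c + 1) +
      ((3 * bd c + 1) + 1)) + 2) + 1) + (3 * cnt c + 1))),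
    hTi.add (hTc.add (((hcb.mul ((hRB.add ((((Bounded.const 3).mul hbd).add (.const 1)).add
      ((((Bounded.const 3).mul hbd).add (.const 1)).add (.const 1)))).add (.const 2))).add
        (.const 1)).add (((Bounded.const 3).mul hcb).add (.const 1)))), fun src m c S h => ?_⟩
  have h4 := h.four_le
  have hfree := h.free
  have h₁ := hPi src m c S h
  have h₂ := hPc src (m + 2) c _ (h.update (m' := m + 2) (unary (init c)) le_rfl (by omega)
    (by omega))
  have h₃ : Runs (.loop (m + 2)
      (.seq (Ps (update (update src (Ctx.dim Γ) (m + 1)) (Ctx.dim Γ + 1) m) (m + 3))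
        (.seq (.clear m) (.seq (.move (m + 3) m) (.push (m + 1) true)))))
      (update (update S m (unary (init c))) (m + 2) (unary (cnt c)))
      (update (update S (m + 1) (unary (cnt c))) m (unary (F c (cnt c))))
      (cnt c * (B.eval (Ctx.size c) + ((3 * bd c + 1) + ((3 * bd c + 1) + 1)) + 2) + 1) := by
    refine Runs.loop _ (cnt c) (fun i => update (update (update S (m + 2) (unary (cnt c - i)))
      (m + 1) (unary i)) m (unary (F c i))) ?_ ?_ ?_ ?_
    · have := hfree (m + 1) (by omega)
      funext k
      simp only [update_apply, Nat.sub_zero, unary_zero, hF₀]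
      grind
    · have := hfree (m + 2) (by omega)
      funext k
      simp only [update_apply, Nat.sub_self, unary_zero]
      grind
    · intro i _
      simp
    · intro i hi
      have hS : Holds src (m + 3) c (update (update (update (update S (m + 2)
          (unary (cnt c - i))) (m + 1) (unary i)) m (unary (F c i))) (m + 2)
            (unary (cnt c - (i + 1)))) := h.of_agree (by omega)
          (fun k hk => by simp only [update_apply]; grind)
          (fun k hk => by simp only [update_apply]; grind)
      have hS' := (hS.bind (k := m + 1) (v := i) (by omega) (by omega)
        (by simp)).bind (k := m) (v := F c i) (by omega) (by omega)
          (by simp)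
      have r₁ := (hPs _ (m + 3) ((c, i), F c i) _ hS').mono (hB c i hi.le)
      have r₂ := Runs.clear (k := m) (v := F c i) (S := update (update (update (update (update S
        (m + 2) (unary (cnt c - i))) (m + 1) (unary i)) m (unary (F c i))) (m + 2)
            (unary (cnt c - (i + 1)))) (m + 3) (unary (step ((c, i), F c i))))
          (by simp)
      have r₃ := Runs.move (a := m + 3) (b := m) (v := F c (i + 1)) (S := update (update (update
        (update (update (update S
        (m + 2) (unary (cnt c - i))) (m + 1) (unary i)) m (unary (F c i))) (m + 2)
            (unary (cnt c - (i + 1)))) (m + 3) (unary (step ((c, i), F c i)))) m [])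
          (by omega) (by simp [hF])
      refine ((r₁.seq (r₂.seq (r₃.seq (Runs.push _ _ _)))).mono ?_).congr ?_
      · have := hle c i hi.le
        have := hle c (i + 1) hi
        omega
      · have := hfree (m + 3) (by omega)
        rw [← hF]
        funext k
        simp only [update_apply, unary_succ]
        grind
  refine (h₁.seq (h₂.seq (h₃.seq (Runs.clear (v := cnt c) (by simp))))).congr ?_
  have := hfree (m + 1) (by omega)
  funext k
  simp only [update_apply]
  grind

end PolyFun

namespace PolyList

theorem nil : PolyList fun _ : Γ => [] :=
  ⟨fun _ _ => .skip, fun _ => 1, .const 1, fun src m c S h => (Runs.skip S).congr (by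
    have : encodeList [] = [] := rfl
    simp [this])⟩

theorem append {f g : Γ → List ℕ} (hf : PolyList f) (hg : PolyList g) :
    PolyList fun c => f c ++ g c := by
  obtain ⟨P, T, hT, hP⟩ := hf
  obtain ⟨P', T', hT', hP'⟩ := hg
  refine ⟨fun src m => .seq (P src m) (P' src m), fun c => T c + T' c, hT.add hT',
    fun src m c S h => ?_⟩
  refine ((hP src m c S h).seq (hP' src m c _ (h.output _))).congr ?_
  rw [encodeList_append]
  simp

theorem single {f : Γ → ℕ} (hf : PolyFun f) : PolyList fun c => [f c] := by
  obtain ⟨hb, P, T, hT, hP⟩ := hf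
  refine ⟨fun src m => .seq (P src m) (.seq (.move m 2) (.push 2 false)),
    fun c => T c + ((3 * f c + 1) + 1),
    hT.add ((((Bounded.const 3).mul hb).add (.const 1)).add (.const 1)), fun src m c S h => ?_⟩
  have h4 := h.four_le
  refine ((hP src m c S h).seq ((Runs.move (b := 2) (v := f c) (by omega) (by simp)).seq
    (Runs.push _ _ _))).congr ?_
  have e : (encodeList [f c]).reverse = false :: unary (f c) := by simp [encodeList, unary]
  have := h.free m le_rfl
  funext k
  simp only [update_apply, e]
  grind

theorem cons {f : Γ → ℕ} {g : Γ → List ℕ} (hf : PolyFun f) (hg : PolyList g) :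
    PolyList fun c => f c :: g c :=
  (single hf).append hg

theorem ite {f : Γ → ℕ} {g h : Γ → List ℕ} (hf : PolyFun f) (hg : PolyList g) (hh : PolyList h) :
    PolyList fun c => if f c = 0 then g c else h c := by
  obtain ⟨hb, P, T, hT, hP⟩ := hf
  obtain ⟨P', T', hT', hP'⟩ := hg
  obtain ⟨P'', T'', hT'', hP''⟩ := hh
  refine ⟨fun src m => .seq (P src m) (.ite m Option.isSome (.seq (.clear m) (P'' src m))
    (P' src m)), fun c => T c + (3 * f c + 1 + T'' c + T' c + 1),
    hT.add ((((((Bounded.const 3).mul hb).add (.const 1)).add hT'').add hT').add (.const 1)),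
    fun src m c S hS => ?_⟩
  have h₁ := hP src m c S hS
  have hfree := hS.free m le_rfl
  by_cases h0 : f c = 0
  · have h₂ := hP' src m c S hS
    have e : update S m (unary (f c)) = S := by rw [h0, unary_zero, ← hfree, update_eq_self]
    rw [e] at h₁
    simp only [h0, if_true]
    refine (h₁.seq (Runs.ite_false _ (by simp [hfree]) h₂)).mono (by omega)
  · simp only [h0, if_false]
    obtain ⟨v, hv⟩ := Nat.exists_eq_succ_of_ne_zero h0
    have h₂ := hP'' src m c S hS
    have h₃ := Runs.clear (k := m) (S := update S m (unary (f c))) (v := f c) (by simp)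
    have e : update (update S m (unary (f c))) m [] = S := by
      rw [update_idem, ← hfree, update_eq_self]
    rw [e] at h₃
    exact (h₁.seq (Runs.ite_true _ (by simp [hv, unary_succ]) (h₃.seq h₂))).mono (by omega)

/-- While the counter on `m` goes down, the index goes up on `m + 1` and is bound as the last
variable for the body. Output accumulates reversed on stack `2`, so concatenation requires no work.
-/
theorem flatMap {cnt : Γ → ℕ} {g : Γ × ℕ → List ℕ} (hc : PolyFun cnt) (hg : PolyList g) :
    PolyList fun c => (List.range (cnt c)).flatMap fun i => g (c, i) := by
  obtain ⟨hcb, Pc, Tc, hTc, hPc⟩ := hc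
  obtain ⟨P, T, hT, hP⟩ := hg
  obtain ⟨B, hB⟩ := hT.subst hcb
  refine ⟨fun src m => .seq (Pc src m) (.seq (.loop m (.seq (P (update src (Ctx.dim Γ) (m + 1))
    (m + 2)) (.push (m + 1) true))) (.clear (m + 1))),
    fun c => Tc c + ((cnt c * (B.eval (Ctx.size c) + 1 + 2) + 1) + (3 * cnt c + 1)),
    hTc.add (((hcb.mul ((Bounded.add ⟨B, fun _ => le_rfl⟩ (.const 1)).add (.const 2))).add
      (.const 1)).add (((Bounded.const 3).mul hcb).add (.const 1))), fun src m c S h => ?_⟩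
  have h4 := h.four_le
  have hfree := h.free
  have h₁ := hPc src m c S h
  have h₂ : Runs (.loop m (.seq (P (update src (Ctx.dim Γ) (m + 1)) (m + 2)) (.push (m + 1) true)))
      (update S m (unary (cnt c))) (update (update S (m + 1) (unary (cnt c))) 2 ((encodeList
        ((List.range (cnt c)).flatMap fun i => g (c, i))).reverse ++ S 2))
      (cnt c * (B.eval (Ctx.size c) + 1 + 2) + 1) := by
    refine Runs.loop _ (cnt c) (fun i => update (update (update S m (unary (cnt c - i))) (m + 1)
      (unary i)) 2 ((encodeList ((List.range i).flatMap fun i => g (c, i))).reverse ++ S 2))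
      ?_ ?_ ?_ ?_
    · have := hfree (m + 1) (by omega)
      have e : encodeList [] = [] := rfl
      funext k
      simp only [update_apply, Nat.sub_zero, unary_zero, List.range_zero, List.flatMap_nil, e]
      grind
    · have := hfree m le_rfl
      funext k
      simp only [update_apply, Nat.sub_self, unary_zero]
      grind
    · intro i _
      have : m ≠ 2 := by omega
      simp [this]
    · intro i hi
      have hS : Holds src (m + 2) c (update (update (update S m (unary (cnt c - (i + 1)))) (m + 1)
          (unary i)) 2 ((encodeList ((List.range i).flatMap fun i => g (c, i))).reverse ++ S 2)) :=
        Holds.output (h.of_agree (by omega) (fun k hk => by simp only [update_apply]; grind)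
          (fun k hk => by simp only [update_apply]; grind)) _
      have hS' := hS.bind (k := m + 1) (v := i) (by omega) (by omega) (by
        have : m + 1 ≠ 2 := by omega
        simp [this])
      have e : update (update (update (update S m (unary (cnt c - i))) (m + 1)
          (unary i)) 2 ((encodeList ((List.range i).flatMap fun i => g (c, i))).reverse ++ S 2)) m
            (unary (cnt c - (i + 1))) = update (update (update S m (unary (cnt c - (i + 1)))) (m + 1)
          (unary i)) 2 ((encodeList ((List.range i).flatMap fun i => g (c, i))).reverse ++ S 2) := by
        funext k
        simp only [update_apply]
        grind
      rw [e]
      refine (((hP _ (m + 2) (c, i) _ hS').mono (hB c i hi.le)).seq (Runs.push _ _ _)).congr ?_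
      rw [List.range_succ, List.flatMap_append, encodeList_append]
      funext k
      simp only [update_apply, unary_succ, List.flatMap_singleton, List.reverse_append,
        List.append_assoc]
      grind
  refine (h₁.seq (h₂.seq (Runs.clear (v := cnt c) ?_))).congr ?_
  · have : m + 1 ≠ 2 := by omega
    simp [this]
  · have := hfree (m + 1) (by omega)
    funext k
    simp only [update_apply]
    grind

end PolyList

end

theorem Runs.drain (k : ℕ) : ∀ (l : List Bool) (S : Store), S k = l →
    Runs (.while k Option.isSome (.pop k)) S (update S k []) (2 * l.length + 1)
  | [], S, h => ⟨1, by simp, by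
      rw [← h, update_eq_self]
      exact .while_false (by simp [h])⟩
  | x :: l, S, h => by
    obtain ⟨t, ht, e⟩ := Runs.drain k l (update S k (S k).tail) (by simp [h])
    rw [update_idem] at e
    exact ⟨1 + t + 1, by simp; omega, .while_true (by simp [h]) (.pop k S) e⟩

/-- Each step pushes at most one bit. Hence the running time bounds the length of the output, and
list-valued functions need no separate bound on their values. -/
theorem Exec.length_le {p : Prog} {S S' : Store} {t : ℕ} (h : Exec p S t S') (k : ℕ) :
    (S' k).length ≤ (S k).length + t := by
  induction h with
  | skip => omega
  | push k' b S =>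
    by_cases hk : k = k'
    · subst hk; simp
    · simp [update_of_ne hk]
  | pop k' S =>
    by_cases hk : k = k'
    · subst hk; simp; omega
    · simp [update_of_ne hk]
  | seq _ _ ih₁ ih₂ => omega
  | ite_true _ _ ih => omega
  | ite_false _ _ ih => omega
  | while_false _ => omega
  | while_true _ _ _ ih₁ ih₂ => omega

/-- The image under a polynomial-time function on lists of numbers of a function which a machine
computes in polynomial time. -/
theorem PolyList.nonempty_comp {g : List ℕ → List ℕ} (hg : PolyList g) {α αΓ : Type}
    {ea : α → List αΓ} {f : α → List ℕ}
    (h : Nonempty (TM2ComputableInPolyTime ea encodeList f)) :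
    Nonempty (TM2ComputableInPolyTime ea encodeList fun a => g (f a)) := by
  obtain ⟨P, T, ⟨B, hB⟩, hP⟩ := hg
  -- Pouring from `1` to `0` undoes the reversal made by the transfer; the output collected in
  -- reverse on `2` is poured to `3`; the array is then emptied, because in the end all stacks but
  -- the output must be empty.
  refine StackProg.nonempty_comp h (.seq (.pour 1 0) (.seq (P (fun _ => 0) 4) (.seq (.pour 2 3)
    (.while 0 Option.isSome (.pop 0)))))
    (4 * Polynomial.X + 1 + (B + (4 * (Polynomial.X + B) + 1 + (2 * Polynomial.X + 1)))) fun A => ?_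
  have h₁ := Runs.pour (a := 1) (b := 0) (by omega) (encodeList A).reverse
    (Store.start (encodeList A)) (by simp [Store.start])
  rw [List.reverse_reverse] at h₁
  have e₁ : update (update (Store.start (encodeList A)) 1 []) 0
      (encodeList A ++ Store.start (encodeList A) 0) = update (fun _ => []) 0 (encodeList A) := by
    simp [Store.start]
  rw [e₁] at h₁
  have hS : Holds (fun _ => 0) 4 A (update (fun _ => []) 0 (encodeList A)) :=
    ⟨by simp [Ctx.arr], by simp, fun k hk => by rw [update_of_ne (by omega)], le_rfl,
      fun i hi => absurd hi (Nat.not_lt_zero i), fun i hi => absurd hi (Nat.not_lt_zero i),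
      fun i hi => absurd hi (Nat.not_lt_zero i)⟩
  have h₂ := hP _ _ A _ hS
  have hTA : T A ≤ B.eval (encodeList A).length := hB A
  have hlen : (encodeList (g A)).length ≤ T A := by
    obtain ⟨t, ht, e⟩ := h₂
    have := e.length_le 2
    simp at this
    omega
  have h₃ := Runs.pour (a := 2) (b := 3) (by omega) (encodeList (g A)).reverse
    (update (update (fun _ => []) 0 (encodeList A)) 2 (encodeList (g A)).reverse) (by simp)
  have h₄ := Runs.drain 0 (encodeList A) (update (update (update (update (fun _ => []) 0
    (encodeList A)) 2 (encodeList (g A)).reverse) 2 []) 3 (encodeList (g A))) (by simp)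
  have e₂ : update (update (fun _ => []) 0 (encodeList A)) 2
      ((encodeList (g A)).reverse ++ update (fun _ => []) 0 (encodeList A) 2) =
        update (update (fun _ => []) 0 (encodeList A)) 2 (encodeList (g A)).reverse := by simp
  rw [e₂] at h₂
  have e₃ : update (update (update (update (fun _ => []) 0
    (encodeList A)) 2 (encodeList (g A)).reverse) 2 []) 3 ((encodeList (g A)).reverse.reverse ++
      update (update (fun _ => []) 0 (encodeList A)) 2 (encodeList (g A)).reverse 3) =
      update (update (update (update (fun _ => []) 0
    (encodeList A)) 2 (encodeList (g A)).reverse) 2 []) 3 (encodeList (g A)) := by simp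
  rw [e₃] at h₃
  refine ((h₁.seq (h₂.seq (h₃.seq h₄))).mono ?_).congr ?_
  · simp only [Polynomial.eval_add, Polynomial.eval_mul, Polynomial.eval_X, Polynomial.eval_one,
      Polynomial.eval_ofNat, List.length_reverse]
    omega
  · funext k
    simp only [update_apply, Store.final]
    grind

end StackProg


set_option linter.unusedSectionVars false

noncomputable section

namespace QuditComp

open Function ZMod

section Semantics

variable {d : ℕ} [NeZero d] {n N : ℕ}

/-! ## Single-qudit operators acting on states -/

/-- The state `Φ` after the single-qudit operator `g` has been applied to qudit `i`. -/
def act (i : Fin N) (g : Matrix (ZMod d) (ZMod d) ℂ) (Φ : Basis d N → ℂ) : Basis d N → ℂ :=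
  fun x => ∑ a, g (x i) a * Φ (update x i a)

theorem onQudit_mulVec (i : Fin N) (g : Matrix (ZMod d) (ZMod d) ℂ) (Φ : Basis d N → ℂ) :
    Op.onQudit i g *ᵥ Φ = act i g Φ := by
  funext x
  simp only [Matrix.mulVec, dotProduct, Op.onQudit, Matrix.of_apply, act]
  rw [← Finset.sum_subset (Finset.subset_univ (Finset.univ.image fun a => update x i a))]
  · rw [Finset.sum_image]
    · refine Finset.sum_congr rfl fun a _ => ?_
      rw [if_pos (fun k hk => by rw [update_of_ne hk])]
      simp
    · intro a _ b _ h
      simpa using congrFun h i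
  · intro y _ hy
    rw [if_neg, zero_mul]
    intro h
    refine hy (Finset.mem_image.2 ⟨y i, Finset.mem_univ _, ?_⟩)
    funext k
    by_cases hk : k = i
    · subst hk; simp
    · rw [update_of_ne hk, h k hk]

theorem act_act (i : Fin N) (A B : Matrix (ZMod d) (ZMod d) ℂ) (Φ : Basis d N → ℂ) :
    act i A (act i B Φ) = act i (A * B) Φ := by
  funext x
  simp only [act, update_self, update_idem, Matrix.mul_apply, Finset.sum_mul, Finset.mul_sum]
  rw [Finset.sum_comm]
  simp only [mul_assoc]

theorem act_one (i : Fin N) (Φ : Basis d N → ℂ) : act i 1 Φ = Φ := by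
  funext x
  simp only [act, Matrix.one_apply, ite_mul, one_mul, zero_mul, Finset.sum_ite_eq,
    Finset.mem_univ, if_true, update_eq_self]

theorem act_comm {i k : Fin N} (h : i ≠ k) (A B : Matrix (ZMod d) (ZMod d) ℂ)
    (Φ : Basis d N → ℂ) : act i A (act k B Φ) = act k B (act i A Φ) := by
  funext x
  simp only [act, Finset.mul_sum, update_of_ne h, update_of_ne h.symm]
  rw [Finset.sum_comm]
  refine Finset.sum_congr rfl fun a _ => Finset.sum_congr rfl fun b _ => ?_
  rw [update_comm h]
  ring

theorem act_smul (i : Fin N) (A : Matrix (ZMod d) (ZMod d) ℂ) (c : ℂ) (Φ : Basis d N → ℂ) :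
    act i A (c • Φ) = c • act i A Φ := by
  funext x
  simp only [act, Pi.smul_apply, smul_eq_mul, Finset.mul_sum]
  exact Finset.sum_congr rfl fun a _ => by ring

theorem act_diagonal (i : Fin N) (D : ZMod d → ℂ) (Φ : Basis d N → ℂ) :
    act i (Matrix.diagonal D) Φ = fun x => D (x i) * Φ x := by
  funext x
  simp only [act, Matrix.diagonal_apply, ite_mul, zero_mul, Finset.sum_ite_eq,
    Finset.mem_univ, if_true, update_eq_self]

theorem act_pauliZ (i : Fin N) (s : ZMod d) (Φ : Basis d N → ℂ) :
    act i (pauliZ s) Φ = fun x => stdAddChar (s * x i) * Φ x := act_diagonal i _ Φ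

theorem act_pauliX (i : Fin N) (s : ZMod d) (Φ : Basis d N → ℂ) :
    act i (pauliX s) Φ = fun x => Φ (update x i (x i - s)) := by
  funext x
  have : ∀ a, (x i = a + s) ↔ (a = x i - s) := fun a => by
    constructor
    · rintro h; rw [h]; ring
    · rintro rfl; ring
  simp only [act, pauliX, Matrix.of_apply, this, ite_mul, one_mul, zero_mul, Finset.sum_ite_eq',
    Finset.mem_univ, if_true]

/-! ## The operations as operators on states -/

/-- The state after an operation. -/
def Op.apply (θ : ℕ → ZMod d → ℝ) (s : Fin N → ZMod d) (j : ZMod d) (q : Op d N)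
    (Φ : Basis d N → ℂ) : Basis d N → ℂ := q.operator θ s j *ᵥ Φ

theorem apply_cz (θ : ℕ → ZMod d → ℝ) (s : Fin N → ZMod d) (j : ZMod d) {i k : Fin N} (h : i ≠ k)
    (Φ : Basis d N → ℂ) :
    (Op.cz i k h).apply θ s j Φ = fun x => stdAddChar (x i * x k) * Φ x := by
  funext x
  simp [Op.apply, Op.operator, Matrix.mulVec_diagonal]

theorem apply_rot (θ : ℕ → ZMod d → ℝ) (s : Fin N → ZMod d) (j : ZMod d) (a : ℕ) (i : Fin N)
    (Φ : Basis d N → ℂ) : (Op.rot a i).apply θ s j Φ = act i (vGate (angles θ a)) Φ :=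
  onQudit_mulVec _ _ _

theorem apply_corrX (θ : ℕ → ZMod d → ℝ) (s : Fin N → ZMod d) (j : ZMod d) (i : Fin N)
    (σ : Signal d N) (Φ : Basis d N → ℂ) :
    (Op.corrX i σ).apply θ s j Φ = act i (pauliX (σ.value s)) Φ := onQudit_mulVec _ _ _

theorem apply_corrZ (θ : ℕ → ZMod d → ℝ) (s : Fin N → ZMod d) (j : ZMod d) (i : Fin N)
    (σ : Signal d N) (Φ : Basis d N → ℂ) :
    (Op.corrZ i σ).apply θ s j Φ = act i (pauliZ (σ.value s)) Φ := onQudit_mulVec _ _ _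

theorem apply_measure (θ : ℕ → ZMod d → ℝ) (s : Fin N → ZMod d) (j : ZMod d) (i : Fin N) (a : ℕ)
    (σ τ : Signal d N) (Φ : Basis d N → ℂ) :
    (Op.measure i a σ τ).apply θ s j Φ =
      act i (measProj (angles θ a) (σ.value s) (τ.value s) j) Φ := onQudit_mulVec _ _ _

theorem apply_fanout (θ : ℕ → ZMod d → ℝ) (s : Fin N → ZMod d) (j : ZMod d) {c : Fin N}
    {T : Finset (Fin N)} (h : c ∉ T) (Φ : Basis d N → ℂ) :
    (Op.fanout c T h).apply θ s j Φ = fun x => Φ fun k => if k ∈ T then x k - x c else x k := by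
  funext x
  simp only [Op.apply, Op.operator, Matrix.mulVec, dotProduct, Matrix.of_apply, ite_mul, one_mul,
    zero_mul]
  have : ∀ y : Basis d N, (x = fun k => if k ∈ T then y k + y c else y k) ↔
      (y = fun k => if k ∈ T then x k - x c else x k) := by
    intro y
    constructor
    · rintro rfl
      funext k
      simp only [h, if_false]
      split_ifs <;> ring
    · rintro rfl
      funext k
      simp only [h, if_false]
      split_ifs <;> ring
  simp only [this, Finset.sum_ite_eq', Finset.mem_univ, if_true]

theorem Op.apply_smul (θ : ℕ → ZMod d → ℝ) (s : Fin N → ZMod d) (j : ZMod d) (q : Op d N) (c : ℂ)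
    (Φ : Basis d N → ℂ) : q.apply θ s j (c • Φ) = c • q.apply θ s j Φ := Matrix.mulVec_smul _ _ _

/-- An operation commutes with single-qudit operators on qudits on which it does not act. -/
theorem Op.apply_act (θ : ℕ → ZMod d → ℝ) (s : Fin N → ZMod d) (j : ZMod d) (q : Op d N)
    {i : Fin N} (hi : i ∉ q.acts) (V : Matrix (ZMod d) (ZMod d) ℂ) (Φ : Basis d N → ℂ) :
    q.apply θ s j (act i V Φ) = act i V (q.apply θ s j Φ) := by
  cases q with
  | cz k l h =>
    simp only [acts, Finset.mem_insert, Finset.mem_singleton, not_or] at hi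
    rw [apply_cz, apply_cz]
    funext x
    simp only [act, Finset.mul_sum, update_of_ne (Ne.symm hi.1), update_of_ne (Ne.symm hi.2)]
    exact Finset.sum_congr rfl fun a _ => by ring
  | rot a k =>
    rw [apply_rot, apply_rot, act_comm]
    exact fun h => hi (by simp [acts, h])
  | fanout c T h =>
    simp only [acts, Finset.mem_insert, not_or] at hi
    rw [apply_fanout, apply_fanout]
    funext x
    simp only [act, if_neg hi.2]
    refine Finset.sum_congr rfl fun a _ => ?_
    congr 2
    funext k
    by_cases hk : k = i
    · subst hk; simp [hi.2]
    · simp [update_of_ne hk, update_of_ne (Ne.symm hi.1)]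
  | corrX k σ =>
    rw [apply_corrX, apply_corrX, act_comm]
    exact fun h => hi (by simp [acts, h])
  | corrZ k σ =>
    rw [apply_corrZ, apply_corrZ, act_comm]
    exact fun h => hi (by simp [acts, h])
  | measure k a σ τ =>
    rw [apply_measure, apply_measure, act_comm]
    exact fun h => hi (by simp [acts, h])

/-! ## The final state -/

theorem finalState_nil (θ : ℕ → ZMod d → ℝ) (out : Fin n ↪ Fin N) (s : Fin N → ZMod d)
    (Φ : Basis d N → ℂ) : finalState θ out [] s Φ = reducedState out Φ := rfl

theorem finalState_measure (θ : ℕ → ZMod d → ℝ) (out : Fin n ↪ Fin N) (i : Fin N) (a : ℕ)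
    (σ τ : Signal d N) (qs : List (Op d N)) (s : Fin N → ZMod d) (Φ : Basis d N → ℂ) :
    finalState θ out (.measure i a σ τ :: qs) s Φ = ∑ j, finalState θ out qs (update s i j)
      (act i (measProj (angles θ a) (σ.value s) (τ.value s) j) Φ) := by
  simp only [← apply_measure]
  rfl

/-- An operation which is not a measurement. -/
def Op.IsUnitary (q : Op d N) : Prop := q.measured = ∅

theorem finalState_cons (θ : ℕ → ZMod d → ℝ) (out : Fin n ↪ Fin N) {q : Op d N}
    (hq : q.IsUnitary) (qs : List (Op d N)) (s : Fin N → ZMod d) (Φ : Basis d N → ℂ) :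
    finalState θ out (q :: qs) s Φ = finalState θ out qs s (q.apply θ s 0 Φ) := by
  cases q with
  | measure i a σ τ => simp [Op.IsUnitary, Op.measured] at hq
  | _ => rfl

/-- The basis label `w` with the output qudits relabelled by `y`. -/
def relabel (out : Fin n ↪ Fin N) (w : Basis d N) (y : Basis d n) : Basis d N :=
  fun k => if h : ∃ a, out a = k then y h.choose else w k

theorem relabel_out (out : Fin n ↪ Fin N) (w : Basis d N) (y : Basis d n) (a : Fin n) :
    relabel out w y (out a) = y a := by
  have h : ∃ b, out b = out a := ⟨a, rfl⟩
  rw [relabel, dif_pos h]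
  exact congrArg y (out.injective h.choose_spec)

theorem relabel_of_ne (out : Fin n ↪ Fin N) (w : Basis d N) (y : Basis d n) {k : Fin N}
    (hk : ∀ a, out a ≠ k) : relabel out w y k = w k := by
  rw [relabel, dif_neg]
  rintro ⟨a, ha⟩
  exact hk a ha

theorem relabel_update (out : Fin n ↪ Fin N) (w : Basis d N) (y : Basis d n) {i : Fin N}
    (hi : ∀ a, out a ≠ i) (b : ZMod d) :
    relabel out (update w i b) y = update (relabel out w y) i b := by
  funext k
  by_cases hk : k = i
  · subst hk; rw [relabel_of_ne out _ _ hi, update_self, update_self]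
  · rw [update_of_ne hk]
    by_cases h : ∃ a, out a = k
    · obtain ⟨a, rfl⟩ := h
      rw [relabel_out, relabel_out]
    · push Not at h
      rw [relabel_of_ne _ _ _ h, relabel_of_ne _ _ _ h, update_of_ne hk]

/-- The second label in the double sum agrees with `w` off the outputs and with `y` on them, so it
is determined by `w`. -/
theorem reducedState_apply (out : Fin n ↪ Fin N) (Φ : Basis d N → ℂ) (x y : Basis d n) :
    reducedState out Φ x y =
      ∑ w, if ∀ a, w (out a) = x a then Φ w * star (Φ (relabel out w y)) else 0 := by
  simp only [reducedState, Matrix.of_apply]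
  refine Finset.sum_congr rfl fun w _ => ?_
  rw [Finset.sum_eq_single (relabel out w y)]
  · refine if_congr ?_ rfl rfl
    exact ⟨fun h => h.1, fun h => ⟨h, relabel_out out w y, fun i hi =>
      (relabel_of_ne out w y hi).symm⟩⟩
  · intro w' _ hne
    rw [if_neg]
    rintro ⟨-, h₂, h₃⟩
    refine hne (funext fun k => ?_)
    by_cases h : ∃ a, out a = k
    · obtain ⟨a, rfl⟩ := h
      rw [relabel_out, h₂]
    · push Not at h
      rw [relabel_of_ne _ _ _ h, h₃ k h]
  · simp

theorem onQudit_mul (i : Fin N) (A B : Matrix (ZMod d) (ZMod d) ℂ) :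
    Op.onQudit i A * Op.onQudit i B = Op.onQudit i (A * B) := by
  refine Matrix.ext_of_mulVec_single fun y => ?_
  rw [← Matrix.mulVec_mulVec, onQudit_mulVec, onQudit_mulVec, onQudit_mulVec, act_act]

theorem onQudit_one (i : Fin N) : Op.onQudit i (1 : Matrix (ZMod d) (ZMod d) ℂ) = 1 := by
  refine Matrix.ext_of_mulVec_single fun y => ?_
  rw [onQudit_mulVec, act_one, Matrix.one_mulVec]

theorem onQudit_conjTranspose (i : Fin N) (A : Matrix (ZMod d) (ZMod d) ℂ) :
    (Op.onQudit i A)ᴴ = Op.onQudit i Aᴴ := by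
  ext x y
  simp only [Matrix.conjTranspose_apply, Op.onQudit, Matrix.of_apply]
  have : (∀ k, k ≠ i → y k = x k) ↔ ∀ k, k ≠ i → x k = y k :=
    forall₂_congr fun k _ => eq_comm
  simp only [this]
  split_ifs <;> simp

theorem sum_act_mul_star_act (i : Fin N) {V : Matrix (ZMod d) (ZMod d) ℂ} (hV : Vᴴ * V = 1)
    (A B : Basis d N → ℂ) :
    ∑ w, act i V A w * star (act i V B w) = ∑ w, A w * star (B w) := by
  have : ∀ C D : Basis d N → ℂ, ∑ w, C w * star (D w) = C ⬝ᵥ star D := fun C D => rfl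
  rw [this, this, ← onQudit_mulVec, ← onQudit_mulVec, Matrix.star_mulVec,
    dotProduct_comm, ← Matrix.dotProduct_mulVec, Matrix.mulVec_mulVec, onQudit_conjTranspose,
    onQudit_mul, hV, onQudit_one, Matrix.one_mulVec, dotProduct_comm]

/-- The partial trace is an inner product over the traced-out labels, and an isometry on a
traced-out qudit preserves it. -/
theorem reducedState_act {out : Fin n ↪ Fin N} {i : Fin N} (hi : ∀ a, out a ≠ i)
    {V : Matrix (ZMod d) (ZMod d) ℂ} (hV : Vᴴ * V = 1) (Φ : Basis d N → ℂ) :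
    reducedState out (act i V Φ) = reducedState out Φ := by
  ext x y
  rw [reducedState_apply, reducedState_apply]
  -- For fixed `x` and `y` the matrix entry is the inner product of `Φ` restricted to outputs `x`
  -- with `Φ` relabelled by `y`; both manipulations commute with an operator on a qudit that is not
  -- an output.
  have key := sum_act_mul_star_act i hV (fun w => if ∀ a, w (out a) = x a then Φ w else 0)
    (fun w => Φ (relabel out w y))
  have e₁ : ∀ w, act i V (fun w => if ∀ a, w (out a) = x a then Φ w else 0) w =
      if ∀ a, w (out a) = x a then act i V Φ w else 0 := by
    intro w
    simp only [act, update_of_ne (hi _)]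
    split_ifs <;> simp
  have e₂ : ∀ w, act i V (fun w => Φ (relabel out w y)) w = act i V Φ (relabel out w y) := by
    intro w
    simp only [act, relabel_update out w y hi, relabel_of_ne out w y hi]
  simp only [e₁, e₂, ite_mul, zero_mul] at key
  exact key

/-- Nothing acts on a measured qudit any more, so an isometry on it commutes with everything that
follows and disappears in the final trace. -/
theorem finalState_act (θ : ℕ → ZMod d → ℝ) {out : Fin n ↪ Fin N} {i : Fin N}
    {V : Matrix (ZMod d) (ZMod d) ℂ} (hV : Vᴴ * V = 1) : ∀ {qs : List (Op d N)}
    {M : Finset (Fin N)}, Executable out M qs → i ∈ M → ∀ (s : Fin N → ZMod d) (Φ : Basis d N → ℂ),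
      finalState θ out qs s (act i V Φ) = finalState θ out qs s Φ
  | [], M, h, hi, s, Φ => reducedState_act (fun a ha => h a (ha ▸ hi)) hV Φ
  | q :: qs, M, h, hi, s, Φ => by
    have hq : i ∉ q.acts := fun hq => Finset.disjoint_left.1 h.1 hq hi
    have hi' : i ∈ M ∪ q.measured := Finset.mem_union_left _ hi
    by_cases hu : q.IsUnitary
    · rw [finalState_cons θ out hu, finalState_cons θ out hu, Op.apply_act θ s 0 q hq,
        finalState_act θ hV h.2.2 hi']
    · cases q with
      | measure k a σ τ =>
        rw [finalState_measure, finalState_measure]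
        refine Finset.sum_congr rfl fun j _ => ?_
        rw [act_comm (fun e => hq (by simp [Op.acts, e])), finalState_act θ hV h.2.2 hi']
      | _ => exact absurd rfl hu

theorem reducedState_smul (out : Fin n ↪ Fin N) (c : ℂ) (Φ : Basis d N → ℂ) :
    reducedState out (c • Φ) = (c * star c) • reducedState out Φ := by
  ext x y
  rw [Matrix.smul_apply, reducedState_apply, reducedState_apply, Finset.smul_sum]
  refine Finset.sum_congr rfl fun w _ => ?_
  split_ifs
  · simp only [Pi.smul_apply, smul_eq_mul, star_mul']
    ring
  · simp

/-- Phases drop out of the density matrix, and normalisation factors enter with their squared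
modulus; both facts are used for by-products of measurements. -/
theorem finalState_smul (θ : ℕ → ZMod d → ℝ) (out : Fin n ↪ Fin N) (c : ℂ) :
    ∀ (qs : List (Op d N)) (s : Fin N → ZMod d) (Φ : Basis d N → ℂ),
      finalState θ out qs s (c • Φ) = (c * star c) • finalState θ out qs s Φ
  | [], s, Φ => reducedState_smul out c Φ
  | q :: qs, s, Φ => by
    by_cases hu : q.IsUnitary
    · rw [finalState_cons θ out hu, finalState_cons θ out hu, Op.apply_smul,
        finalState_smul θ out c qs]
    · cases q with
      | measure k a σ τ =>
        rw [finalState_measure, finalState_measure, Finset.smul_sum]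
        refine Finset.sum_congr rfl fun j _ => ?_
        rw [act_smul, finalState_smul θ out c qs]
      | _ => exact absurd rfl hu

end Semantics

end QuditComp

end


set_option linter.unusedSectionVars false

noncomputable section

/-! ### Identities between the gates -/

namespace QuditComp

open Function ZMod

section Gates

variable {d : ℕ} [NeZero d] {n N : ℕ}

theorem sqrt_mul_sqrt : ((Real.sqrt d : ℝ) : ℂ) * ((Real.sqrt d : ℝ) : ℂ) = (d : ℂ) := by
  rw [← Complex.ofReal_mul, Real.mul_self_sqrt (Nat.cast_nonneg d), Complex.ofReal_natCast]

theorem star_stdAddChar (a : ZMod d) : star (stdAddChar a) = stdAddChar (-a) :=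
  (AddChar.map_neg_eq_conj _ _).symm

theorem stdAddChar_mul_star (a : ZMod d) : stdAddChar a * star (stdAddChar a) = 1 := by
  rw [star_stdAddChar, ← AddChar.map_add_eq_mul, add_neg_cancel, AddChar.map_zero_eq_one]

theorem sum_stdAddChar (b : ZMod d) :
    ∑ a : ZMod d, stdAddChar (a * b) = if b = 0 then (d : ℂ) else 0 := by
  rw [AddChar.sum_mulShift b (isPrimitive_stdAddChar d), ZMod.card]
  push_cast
  rfl

theorem fourier_apply (m k : ZMod d) :
    fourier m k = stdAddChar (m * k) / (Real.sqrt d : ℂ) := rfl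

theorem conjTranspose_fourier_mul : (fourier : Matrix (ZMod d) (ZMod d) ℂ)ᴴ * fourier = 1 := by
  ext m k
  rw [Matrix.mul_apply, Matrix.one_apply]
  have : ∀ a : ZMod d, (fourier : Matrix (ZMod d) (ZMod d) ℂ)ᴴ m a * fourier a k =
      stdAddChar (a * (k - m)) / d := fun a => by
    rw [Matrix.conjTranspose_apply, fourier_apply, fourier_apply, star_div₀, star_stdAddChar]
    have h : star ((Real.sqrt d : ℝ) : ℂ) = ((Real.sqrt d : ℝ) : ℂ) := Complex.conj_ofReal _
    rw [h, div_mul_div_comm, sqrt_mul_sqrt, ← AddChar.map_add_eq_mul]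
    congr 2
    ring
  simp only [this]
  rw [← Finset.sum_div, sum_stdAddChar]
  have hd : (d : ℂ) ≠ 0 := Nat.cast_ne_zero.2 (NeZero.ne d)
  by_cases h : m = k
  · subst h; simp [hd]
  · rw [if_neg (sub_ne_zero.2 (Ne.symm h)), if_neg h, zero_div]

theorem conjTranspose_rotation_mul (θ : ZMod d → ℝ) : (rotation θ)ᴴ * rotation θ = 1 := by
  rw [rotation, Matrix.diagonal_conjTranspose, Matrix.diagonal_mul_diagonal, ← Matrix.diagonal_one]
  congr 1
  funext k
  simp only [Pi.star_apply]
  have h : star (Complex.exp (Complex.I * (θ k : ℂ))) = Complex.exp (-(Complex.I * (θ k : ℂ))) := by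
    change (starRingEnd ℂ) _ = _
    rw [← Complex.exp_conj]
    simp
  rw [h, ← Complex.exp_add, neg_add_cancel, Complex.exp_zero]

theorem conjTranspose_vGate_mul (θ : ZMod d → ℝ) : (vGate θ)ᴴ * vGate θ = 1 := by
  rw [vGate, Matrix.conjTranspose_mul, Matrix.mul_assoc, ← Matrix.mul_assoc fourierᴴ,
    conjTranspose_fourier_mul, Matrix.one_mul, conjTranspose_rotation_mul]

theorem vGate_apply (θ : ZMod d → ℝ) (m k : ZMod d) :
    vGate θ m k = stdAddChar (m * k) / (Real.sqrt d : ℂ) * Complex.exp (Complex.I * (θ k : ℂ)) := by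
  rw [vGate, rotation, Matrix.mul_diagonal, fourier_apply]

theorem vGate_zero : vGate (0 : ZMod d → ℝ) = fourier := by
  ext m k
  rw [vGate_apply, fourier_apply]
  simp

/-- The matrix of `n ↦ -n`, the square of the Fourier gate. -/
def parity : Matrix (ZMod d) (ZMod d) ℂ := Matrix.of fun m k => if m = -k then 1 else 0

/-- The entries are full character sums, so only one term in each column is nonzero. With `s = 0`
this gives `F²`, the parity operator. -/
theorem fourier_mul_pauliZ_mul_fourier (s : ZMod d) :
    (fourier * pauliZ s * fourier : Matrix (ZMod d) (ZMod d) ℂ) =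
      Matrix.of fun m k => if m = -(k + s) then 1 else 0 := by
  ext m k
  rw [Matrix.mul_apply, Matrix.of_apply]
  have : ∀ a : ZMod d, (fourier * pauliZ s : Matrix (ZMod d) (ZMod d) ℂ) m a * fourier a k =
      stdAddChar (a * (m + (k + s))) / d := fun a => by
    rw [pauliZ, Matrix.mul_diagonal, fourier_apply, fourier_apply, div_mul_eq_mul_div,
      div_mul_div_comm, sqrt_mul_sqrt, ← AddChar.map_add_eq_mul, ← AddChar.map_add_eq_mul]
    congr 2
    ring
  simp only [this]
  rw [← Finset.sum_div, sum_stdAddChar]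
  have hd : (d : ℂ) ≠ 0 := Nat.cast_ne_zero.2 (NeZero.ne d)
  by_cases h : m = -(k + s)
  · simp [h, hd]
  · rw [if_neg h, if_neg, zero_div]
    exact fun e => h (eq_neg_of_add_eq_zero_left e)

theorem pauliZ_zero : (pauliZ 0 : Matrix (ZMod d) (ZMod d) ℂ) = 1 := by
  rw [pauliZ, ← Matrix.diagonal_one]
  congr 1
  funext k
  simp

theorem fourier_mul_fourier : (fourier * fourier : Matrix (ZMod d) (ZMod d) ℂ) = parity := by
  have := fourier_mul_pauliZ_mul_fourier (0 : ZMod d)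
  rw [pauliZ_zero, Matrix.mul_one] at this
  rw [this]
  simp [parity]

theorem parity_mul_apply (A : Matrix (ZMod d) (ZMod d) ℂ) (m k : ZMod d) :
    ((parity : Matrix (ZMod d) (ZMod d) ℂ) * A) m k = A (-m) k := by
  simp only [Matrix.mul_apply, parity, Matrix.of_apply, ite_mul, one_mul, zero_mul]
  have : ∀ a : ZMod d, (m = -a) ↔ (a = -m) := fun a =>
    ⟨fun h => by rw [h, neg_neg], fun h => by rw [h, neg_neg]⟩
  simp [this]

/-- Conjugation by the Fourier gate, with inverse `F³`, turns `Z^s` into `X^s`. -/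
theorem fourier_conj_pauliZ (s : ZMod d) :
    (fourier * (fourier * (fourier * (pauliZ s * fourier))) : Matrix (ZMod d) (ZMod d) ℂ) =
      pauliX s := by
  rw [← Matrix.mul_assoc, fourier_mul_fourier, ← Matrix.mul_assoc fourier,
    fourier_mul_pauliZ_mul_fourier]
  ext m k
  rw [parity_mul_apply, Matrix.of_apply, pauliX, Matrix.of_apply]
  simp only [neg_inj]

theorem ketPlus_apply (a : ZMod d) : ketPlus a = 1 / (Real.sqrt d : ℂ) := by
  simp [ketPlus, ketZero, fourier_apply]

theorem fourier_mulVec_ketZero :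
    (fourier : Matrix (ZMod d) (ZMod d) ℂ) *ᵥ ketZero = ketPlus := rfl

theorem fourier_mulVec_ketPlus :
    (fourier : Matrix (ZMod d) (ZMod d) ℂ) *ᵥ ketPlus = ketZero := by
  rw [ketPlus, Matrix.mulVec_mulVec, fourier_mul_fourier]
  funext a
  simp [ketZero, parity, Pi.single_apply]

/-- The shift of `θ` by `s` is conjugation of the rotation by `X^s`, and the linear phase in `Λ` is
`Z^t`. Moving `X^s` past the Fourier gate replaces `ω^{mk}` by `ω^{m(k+s)}`, and `Z^{-s}`
compensates for this. Standing last, before the projection to a basis state, that factor only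
contributes a phase. -/
theorem vGate_measAngle (θ : ZMod d → ℝ) (s t : ZMod d) :
    vGate (measAngle θ s t) = pauliZ (-s) * (vGate θ * (pauliX s * pauliZ t)) := by
  ext m k
  have h : (vGate θ * (pauliX s * pauliZ t)) m k = vGate θ m (k + s) * stdAddChar (t * k) := by
    rw [← Matrix.mul_assoc, pauliZ, Matrix.mul_diagonal]
    congr 1
    simp [Matrix.mul_apply, pauliX]
  have h' : Complex.exp (Complex.I * ((t.val : ℂ) * (k.val : ℂ) * (2 * Real.pi / (d : ℂ)))) =
      stdAddChar (t * k) := by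
    have e : ((t.val * k.val : ℕ) : ZMod d) = t * k := by simp
    have e' : ((((t.val * k.val : ℕ) : ℤ)) : ZMod d) = t * k := by rw [Int.cast_natCast, e]
    rw [← e', ZMod.stdAddChar_coe]
    congr 1
    push_cast
    ring
  rw [pauliZ, Matrix.diagonal_mul, h, vGate_apply, vGate_apply, ← h']
  have e : stdAddChar (m * k) = stdAddChar (-s * m) * stdAddChar (m * (k + s)) := by
    rw [← AddChar.map_add_eq_mul]
    congr 1
    ring
  rw [e, measAngle]
  push_cast
  rw [mul_add Complex.I, Complex.exp_add]
  ring

theorem pauliX_mul_apply (s : ZMod d) (A : Matrix (ZMod d) (ZMod d) ℂ) (m k : ZMod d) :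
    (pauliX s * A) m k = A (m - s) k := by
  have : ∀ a : ZMod d, (m = a + s) ↔ (a = m - s) := fun a =>
    ⟨fun h => by rw [h]; ring, fun h => by rw [h]; ring⟩
  simp [Matrix.mul_apply, pauliX, this]

theorem conjTranspose_pauliX_mul (s : ZMod d) :
    (pauliX s)ᴴ * pauliX s = (1 : Matrix (ZMod d) (ZMod d) ℂ) := by
  have : (pauliX s)ᴴ = (pauliX (-s) : Matrix (ZMod d) (ZMod d) ℂ) := by
    ext m k
    have : (k = m + s) ↔ (m = k + -s) := ⟨fun h => by rw [h]; ring, fun h => by rw [h]; ring⟩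
    simp only [Matrix.conjTranspose_apply, pauliX, Matrix.of_apply, this]
    split_ifs <;> simp
  rw [this]
  ext m k
  rw [pauliX_mul_apply]
  simp [pauliX, Matrix.one_apply]

/-- After a measurement, the state of the measured qudit is immaterial: one may take it to be the
basis state `k` whatever the outcome `j`. -/
theorem finalState_act_measProj (φ : ℕ → ZMod d → ℝ) {out : Fin n ↪ Fin N} {i : Fin N}
    {qs : List (Op d N)} {M : Finset (Fin N)} (h : Executable out M qs) (hi : i ∈ M)
    (θ : ZMod d → ℝ) (s t j k : ZMod d) (r : Fin N → ZMod d) (Φ : Basis d N → ℂ) :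
    finalState φ out qs r (act i (measProj θ s t j) Φ) =
      finalState φ out qs r (act i (Matrix.single k j 1 * vGate (measAngle θ s t)) Φ) := by
  set V := vGate (measAngle θ s t) with hV
  have hVV : Vᴴ * V = 1 := conjTranspose_vGate_mul _
  have hVV' : V * Vᴴ = 1 := mul_eq_one_comm.1 hVV
  -- The projector is `|k⟩⟨j| V` followed by the isometry `V† X^{j-k}`, which acts on a qudit that
  -- is already measured and so can be dropped.
  have e : measProj θ s t j = (Vᴴ * pauliX (j - k)) * (Matrix.single k j 1 * V) := by
    rw [measProj, ← hV]
    have : (pauliX (j - k) * Matrix.single k j 1 : Matrix (ZMod d) (ZMod d) ℂ) =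
        Matrix.single j j 1 := by
      ext a b
      rw [pauliX_mul_apply, Matrix.single_apply, Matrix.single_apply]
      refine if_congr ?_ rfl rfl
      refine and_congr ⟨fun h => ?_, fun h => ?_⟩ Iff.rfl
      · linear_combination h
      · linear_combination h
    rw [Matrix.mul_assoc Vᴴ (pauliX _), ← Matrix.mul_assoc (pauliX _), this, Matrix.mul_assoc]
  rw [e, ← act_act, finalState_act φ _ h hi]
  rw [Matrix.conjTranspose_mul, Matrix.conjTranspose_conjTranspose, Matrix.mul_assoc,
    ← Matrix.mul_assoc V, hVV', Matrix.one_mul, conjTranspose_pauliX_mul]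

end Gates

end QuditComp

end


set_option linter.unusedSectionVars false

noncomputable section

namespace QuditComp

open Function ZMod

/-! ## Depth -/

section Depth

variable {d N : ℕ}

/-- Every path of dependent operations in `l` has length at most `C`. -/
def ChainLE (l : List (Op d N)) (C : ℕ) : Prop :=
  ∀ l' : List (Op d N), l'.Sublist l → l'.IsChain Op.Follows → l'.length ≤ C

theorem depth_le {n : ℕ} {Q : Computation d n} {C : ℕ} (h : ChainLE Q.ops C) : Q.depth ≤ C :=
  csSup_le ⟨0, [], List.nil_sublist _, List.isChain_nil, rfl⟩ (by
    rintro _ ⟨l, h₁, h₂, rfl⟩; exact h l h₁ h₂)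

theorem chainLE_depth {n : ℕ} (Q : Computation d n) : ChainLE Q.ops Q.depth := fun l h₁ h₂ =>
  le_csSup ⟨Q.ops.length, by rintro _ ⟨l, h₁, -, rfl⟩; exact h₁.length_le⟩ ⟨l, h₁, h₂, rfl⟩

theorem ChainLE.mono {l : List (Op d N)} {C C' : ℕ} (h : ChainLE l C) (hC : C ≤ C') :
    ChainLE l C' := fun l' h₁ h₂ => (h l' h₁ h₂).trans hC

theorem chainLE_nil : ChainLE ([] : List (Op d N)) 0 := fun l' h _ => by
  rw [List.sublist_nil.1 h]; rfl

theorem chainLE_length (l : List (Op d N)) : ChainLE l l.length := fun _ h _ => h.length_le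

theorem ChainLE.append {l₁ l₂ : List (Op d N)} {C₁ C₂ : ℕ} (h₁ : ChainLE l₁ C₁)
    (h₂ : ChainLE l₂ C₂) : ChainLE (l₁ ++ l₂) (C₁ + C₂) := by
  intro l' hl hc
  obtain ⟨a, b, rfl, ha, hb⟩ := List.sublist_append_iff.1 hl
  rw [List.isChain_append] at hc
  rw [List.length_append]
  exact add_le_add (h₁ a ha hc.1) (h₂ b hb hc.2.1)

/-- If dependencies between blocks reflect dependencies between the members of a list, and paths
in a block have length at most `C`, then each path in the blocks gives rise to a path in the
list. -/
theorem exists_chain_of_blocks {β : Type*} {R : β → β → Prop} {blk : β → List (Op d N)} {C : ℕ} :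
    ∀ {bs : List β}, (∀ b ∈ bs, ChainLE (blk b) C) →
      bs.Pairwise (fun a b => ∀ x ∈ blk a, ∀ y ∈ blk b, x.Follows y → R a b) →
      ∀ l' : List (Op d N), l'.Sublist (bs.flatMap blk) → l'.IsChain Op.Follows →
        ∃ l : List β, l.Sublist bs ∧ l.IsChain R ∧ l'.length ≤ C * l.length ∧
          ∀ x ∈ l'.head?, ∃ b ∈ l.head?, x ∈ blk b
  | [], _, _, l', hl, _ => ⟨[], List.nil_sublist _, List.isChain_nil, by
      rw [List.sublist_nil.1 hl]; simp, by rw [List.sublist_nil.1 hl]; simp⟩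
  | b :: bs, hC, hR, l', hl, hc => by
    rw [List.flatMap_cons] at hl
    obtain ⟨l₁, l₂, rfl, h₁, h₂⟩ := List.sublist_append_iff.1 hl
    rw [List.isChain_append] at hc
    rw [List.pairwise_cons] at hR
    obtain ⟨l, hls, hlc, hlen, hhead⟩ := exists_chain_of_blocks
      (fun b hb => hC b (List.mem_cons_of_mem _ hb)) hR.2 l₂ h₂ hc.2.1
    have hb := hC b List.mem_cons_self _ h₁ hc.1
    cases l₁ with
    | nil => exact ⟨l, hls.cons b, hlc, by simpa using hlen, by simpa using hhead⟩
    | cons x l₁ =>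
      have hmem : ∀ y ∈ x :: l₁, y ∈ blk b := fun y hy => h₁.subset hy
      cases l₂ with
      | nil =>
        refine ⟨[b], by simp, by simp, by simpa using hb, ?_⟩
        intro y hy
        exact ⟨b, rfl, hmem y (by simp only [List.append_nil] at hy; exact List.mem_of_mem_head? hy)⟩
      | cons y l₂ =>
        refine ⟨b :: l, hls.cons_cons b, ?_, ?_, ?_⟩
        -- The last element taken from the block of `b` is followed by the head of the rest, which
        -- lies in the block of the head of `l`; the clause on heads in the conclusion is carried
        -- along for this purpose.
        · rw [List.isChain_cons]
          refine ⟨fun b' hb' => ?_, hlc⟩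
          obtain ⟨b'', hb'', hy⟩ := hhead y rfl
          rw [hb'] at hb''
          cases hb''
          have hlast := List.getLast?_eq_some_getLast (List.cons_ne_nil x l₁)
          exact hR.1 b' (hls.subset (List.mem_of_mem_head? hb')) _
            (hmem _ (List.getLast_mem (List.cons_ne_nil x l₁))) y hy
            (hc.2.2 _ hlast y rfl)
        · rw [List.length_append, List.length_cons]
          have : C * ((b :: l).length) = C * l.length + C := by simp; ring
          simp only [List.length_cons] at *
          omega
        · intro z hz
          refine ⟨b, rfl, hmem z ?_⟩
          simp at hz
          simp [hz]

/-- Paths in a sequence of mutually independent blocks stay in one block. -/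
theorem chainLE_flatMap {β : Type*} {blk : β → List (Op d N)} {C : ℕ} {bs : List β}
    (hC : ∀ b ∈ bs, ChainLE (blk b) C)
    (hR : bs.Pairwise fun a b => ∀ x ∈ blk a, ∀ y ∈ blk b, ¬ x.Follows y) :
    ChainLE (bs.flatMap blk) C := by
  intro l' hl hc
  obtain ⟨l, -, hlc, hlen, -⟩ := exists_chain_of_blocks (R := fun _ _ => False) hC
    (hR.imp fun h x hx y hy hxy => h x hx y hy hxy) l' hl hc
  match l, hlc with
  | [], _ => exact hlen.trans (by simp)
  | [b], _ => simpa using hlen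
  | b :: b' :: l, h => simp at h

/-- The depth of a computation which is made of blocks of bounded depth, one for each operation of
a second computation, if dependencies between blocks reflect dependencies between operations. -/
theorem chainLE_blocks {N' n : ℕ} {Q : Computation d n}
    {blk : Op d Q.N × ℕ → List (Op d N')} {C : ℕ}
    (hC : ∀ b ∈ Q.ops.zipIdx, ChainLE (blk b) C)
    (hR : Q.ops.zipIdx.Pairwise fun a b =>
      ∀ x ∈ blk a, ∀ y ∈ blk b, x.Follows y → a.1.Follows b.1) :
    ChainLE (Q.ops.zipIdx.flatMap blk) (C * Q.depth) := by
  intro l' hl hc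
  obtain ⟨l, hls, hlc, hlen, -⟩ := exists_chain_of_blocks
    (R := fun a b : Op d Q.N × ℕ => a.1.Follows b.1) hC hR l' hl hc
  refine hlen.trans (Nat.mul_le_mul_left _ ?_)
  have h := chainLE_depth Q (l.map Prod.fst) (by
    have := hls.map Prod.fst
    rwa [List.zipIdx_map_fst] at this) (by rwa [List.isChain_map])
  simpa using h

end Depth

/-! ## Size and complexity -/

section Size

variable {d n : ℕ} [NeZero d]

theorem Op.length_code_pos {N : ℕ} (q : Op d N) : 0 < q.code.length := by
  cases q <;> simp [Op.code]

/-- Every operation contributes at least one number to the description, and `Q.N`, which bounds the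
number of qudits it acts on, is itself written in unary there. -/
theorem size_le (Q : Computation d n) :
    Q.size ≤ (encodeList Q.code).length * (encodeList Q.code).length := by
  have h₁ : Q.ops.length ≤ (encodeList Q.code).length := by
    refine le_trans ?_ (StackProg.length_le_encodeList _)
    simp only [Computation.code, List.length_append, List.length_flatMap]
    have : ∀ l : List (Op d Q.N), l.length ≤ (l.map fun q => q.code.length).sum := by
      intro l
      induction l with
      | nil => simp
      | cons q l ih => have := q.length_code_pos; simp; omega
    have := this Q.ops
    omega
  have h₂ : Q.N ≤ (encodeList Q.code).length := by
    have := StackProg.getD_le_encodeList Q.code 0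
    simpa [Computation.code] using this
  refine le_trans ?_ (Nat.mul_le_mul h₁ h₂)
  rw [Computation.size]
  refine (List.sum_le_card_nsmul _ Q.N ?_).trans (by simp)
  intro x hx
  obtain ⟨q, -, rfl⟩ := List.mem_map.1 hx
  exact (Finset.card_le_univ _).trans (by simp)

/-- Polynomial size is a consequence of uniformity, so translations need not be checked for it. -/
theorem exists_size_le {Q : (n : ℕ) → Computation d n} (h : Uniform Q) :
    ∃ p : Polynomial ℕ, ∀ n, (Q n).size ≤ p.eval n := by
  obtain ⟨B, hB⟩ := StackProg.exists_length_le h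
  refine ⟨B * B, fun n => (size_le _).trans ?_⟩
  have : (Computability.unaryEncodeNat n).length = n := by
    induction n with
    | zero => rfl
    | succ n ih => rw [Computability.unaryEncodeNat, List.length_cons, ih]
  have h := hB n
  rw [this] at h
  rw [Polynomial.eval_mul]
  exact Nat.mul_le_mul h h

/-- The additive constant is absorbed because `log n` is eventually at least `1`; for `k = 0` as
well the bound is at least a positive constant. -/
theorem depth_isBigO {k C : ℕ} {D D' : ℕ → ℕ} (h : ∀ n, D' n ≤ C * D n + C)
    (hD : (fun n : ℕ => (D n : ℝ)) =O[Filter.atTop] fun n : ℕ => Real.log n ^ k) :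
    (fun n : ℕ => (D' n : ℝ)) =O[Filter.atTop] fun n : ℕ => Real.log n ^ k := by
  have h₁ : (fun _ : ℕ => (1 : ℝ)) =O[Filter.atTop] fun n : ℕ => Real.log n ^ k := by
    refine Asymptotics.IsBigO.of_bound 1 ?_
    have : Filter.Tendsto (fun n : ℕ => Real.log n) Filter.atTop Filter.atTop :=
      Real.tendsto_log_atTop.comp tendsto_natCast_atTop_atTop
    filter_upwards [this.eventually_ge_atTop 1] with n hn
    rw [norm_one, one_mul, norm_pow, Real.norm_of_nonneg (zero_le_one.trans hn)]
    exact one_le_pow₀ hn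
  have h₂ : (fun n : ℕ => (C : ℝ) * D n + C * 1) =O[Filter.atTop] fun n : ℕ => Real.log n ^ k :=
    (hD.const_mul_left _).add (h₁.const_mul_left _)
  refine Asymptotics.IsBigO.trans (Asymptotics.IsBigO.of_bound 1 ?_) h₂
  filter_upwards with n
  rw [one_mul, mul_one, Real.norm_of_nonneg (by positivity), Real.norm_of_nonneg (by positivity)]
  exact_mod_cast h n

/-- A translation of computations shows an inclusion between complexity classes, if it can be
performed in polynomial time and multiplies the depth by a constant at most. -/
theorem complexityClass_subset {k : ℕ} {A A' : ∀ {N : ℕ}, Op d N → Prop} {φ φ' : ZMod d → ℂ}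
    (f : ∀ {n : ℕ}, Computation d n → Computation d n) (g : List ℕ → List ℕ) (C : ℕ)
    (hg : StackProg.PolyList g)
    (hcode : ∀ {n : ℕ} (Q : Computation d n), (∀ q ∈ Q.ops, A q) → (f Q).code = g Q.code)
    (hA : ∀ {n : ℕ} (Q : Computation d n), (∀ q ∈ Q.ops, A q) → ∀ q ∈ (f Q).ops, A' q)
    (hdepth : ∀ {n : ℕ} (Q : Computation d n), (∀ q ∈ Q.ops, A q) → Executable Q.out ∅ Q.ops →
      (f Q).depth ≤ C * Q.depth + C)
    (himp : ∀ {n : ℕ} (Q : Computation d n) (θ : ℕ → ZMod d → ℝ)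
      (U : Matrix (Basis d n) (Basis d n) ℂ), (∀ q ∈ Q.ops, A q) → Q.Implements θ φ U →
      (f Q).Implements θ φ' U) :
    complexityClass d A φ k ⊆ complexityClass d A' φ' k := by
  rintro U ⟨θ, Q, hθ, hQ, hAQ, hU, -, hO⟩
  have hu : Uniform fun n => f (Q n) := by
    have := StackProg.PolyList.nonempty_comp hg hQ
    have heq : (fun n => (f (Q n)).code) = fun n => g (Q n).code :=
      funext fun n => hcode (Q n) (hAQ n)
    rw [Uniform, heq]
    exact this
  exact ⟨θ, fun n => f (Q n), hθ, hu, fun n => hA (Q n) (hAQ n),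
    fun n => himp (Q n) θ _ (hAQ n) (hU n), exists_size_le hu,
    depth_isBigO (fun n => hdepth (Q n) (hAQ n) (hU n).1) hO⟩

end Size

end QuditComp

end


/-! ### More closure properties; parsing descriptions -/

namespace StackProg

open Function QuditComp

set_option linter.unusedSectionVars false

section

variable {Γ : Type} [LawfulCtx Γ]

namespace PolyFun

theorem congr {f g : Γ → ℕ} (hf : PolyFun f) (h : ∀ c, g c = f c) : PolyFun g :=
  (funext h : g = f) ▸ hf

/-- Two numbers are equal exactly if both truncated differences vanish, that is, if the sum of these
does. -/
theorem ite_eq {f g h k : Γ → ℕ} (hf : PolyFun f) (hg : PolyFun g) (hh : PolyFun h)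
    (hk : PolyFun k) : PolyFun fun c => if f c = g c then h c else k c :=
  (((hf.sub hg).add (hg.sub hf)).ite hh hk).congr fun c =>
    if_congr (by omega) rfl rfl

theorem ite_lt {f g h k : Γ → ℕ} (hf : PolyFun f) (hg : PolyFun g) (hh : PolyFun h)
    (hk : PolyFun k) : PolyFun fun c => if f c < g c then h c else k c :=
  ((hg.sub hf).ite hk hh).congr fun c => by
    split_ifs <;> first | rfl | omega

/-- Sums of polynomially many values. -/
theorem sum {cnt : Γ → ℕ} {f : Γ × ℕ → ℕ} (hc : PolyFun cnt) (hf : PolyFun f) :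
    PolyFun fun c => ∑ i ∈ Finset.range (cnt c), f (c, i) := by
  obtain ⟨B, hB⟩ := hf.bounded.subst hc.bounded
  refine iter (step := fun x => x.2 + f x.1) (F := fun c k => ∑ i ∈ Finset.range k, f (c, i))
    (bd := fun c => cnt c * B.eval (Ctx.size c)) hc (const 0) (snd.add hf.fst) (fun _ => rfl)
    (fun c i => Finset.sum_range_succ _ _) (hc.bounded.mul ⟨B, fun _ => le_rfl⟩) fun c i hi => ?_
  rcases Nat.eq_zero_or_pos i with rfl | hi'
  · simp
  refine (Finset.sum_le_card_nsmul _ _ (B.eval (Ctx.size c)) fun k hk => ?_).trans ?_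
  · exact hB c k ((Finset.mem_range.1 hk).le.trans hi)
  · rw [Finset.card_range, smul_eq_mul]
    exact Nat.mul_le_mul_right _ hi

end PolyFun

namespace PolyList

theorem congr {f g : Γ → List ℕ} (hf : PolyList f) (h : ∀ c, g c = f c) : PolyList g :=
  (funext h : g = f) ▸ hf

theorem ite_eq {f g : Γ → ℕ} {h k : Γ → List ℕ} (hf : PolyFun f) (hg : PolyFun g)
    (hh : PolyList h) (hk : PolyList k) : PolyList fun c => if f c = g c then h c else k c :=
  (PolyList.ite ((hf.sub hg).add (hg.sub hf)) hh hk).congr fun c =>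
    if_congr (by omega) rfl rfl

theorem ite_lt {f g : Γ → ℕ} {h k : Γ → List ℕ} (hf : PolyFun f) (hg : PolyFun g)
    (hh : PolyList h) (hk : PolyList k) : PolyList fun c => if f c < g c then h c else k c :=
  (PolyList.ite (hg.sub hf) hk hh).congr fun c => by
    split_ifs <;> first | rfl | omega

end PolyList

end

/-! ## Reading the description of a computation -/

/-- The length of the description of the operation at position `p`. -/
def opLen (A : List ℕ) (p : ℕ) : ℕ :=
  if A.getD p 0 < 2 then 3
  else if A.getD p 0 = 5 then 3 + 2 * A.getD 0 0 else 2 + A.getD 0 0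

/-- The position of the description of operation number `j`. -/
def opPos (A : List ℕ) : ℕ → ℕ
  | 0 => 2 + 2 * A.getD 1 0
  | j + 1 => opPos A j + opLen A (opPos A j)

/-- Entry number `r` of the description of operation number `j`. -/
def field (A : List ℕ) (j r : ℕ) : ℕ := A.getD (opPos A j + r) 0

theorem opLen_le (A : List ℕ) (p : ℕ) : opLen A p ≤ 3 + 2 * A.getD 0 0 := by
  unfold opLen; split_ifs <;> omega

theorem opPos_le (A : List ℕ) (j : ℕ) :
    opPos A j ≤ 2 + 2 * A.getD 1 0 + j * (3 + 2 * A.getD 0 0) := by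
  induction j with
  | zero => simp [opPos]
  | succ j ih =>
    have := opLen_le A (opPos A j)
    rw [opPos, add_one_mul]
    omega

theorem opPos_strictMono (A : List ℕ) : StrictMono (opPos A) :=
  strictMono_nat_of_lt_succ fun j => by
    rw [opPos, opLen]; split_ifs <;> omega

section

variable {Γ : Type} [LawfulCtx Γ]

theorem PolyFun.entry (r : ℕ) : PolyFun fun c : Γ => (Ctx.arr c).getD r 0 := PolyFun.get (.const r)

theorem PolyFun.opLen {f : Γ → ℕ} (hf : PolyFun f) :
    PolyFun fun c => StackProg.opLen (Ctx.arr c) (f c) :=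
  .ite_lt (.get hf) (.const 2) (.const 3) (.ite_eq (.get hf) (.const 5)
    ((PolyFun.const 3).add ((PolyFun.const 2).mul (.entry 0))) ((PolyFun.const 2).add (.entry 0)))

/-- Positions are found one after another by bounded iteration; the linear bound `opPos_le` keeps
the values polynomial. -/
theorem PolyFun.opPos {f : Γ → ℕ} (hf : PolyFun f) :
    PolyFun fun c => StackProg.opPos (Ctx.arr c) (f c) :=
  PolyFun.iter (F := fun c j => StackProg.opPos (Ctx.arr c) j)
    (step := fun x => x.2 + StackProg.opLen (Ctx.arr x) x.2) hf
    ((PolyFun.const 2).add ((PolyFun.const 2).mul (.entry 1)))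
    (PolyFun.snd.add (PolyFun.opLen PolyFun.snd)) (fun _ => rfl) (fun _ _ => rfl)
    (bd := fun c => 2 + 2 * (Ctx.arr c).getD 1 0 + f c * (3 + 2 * (Ctx.arr c).getD 0 0))
    (((PolyFun.const 2).add ((PolyFun.const 2).mul (.entry 1))).add (hf.mul
      ((PolyFun.const 3).add ((PolyFun.const 2).mul (.entry 0))))).bounded
    fun c i hi => (opPos_le _ i).trans (by gcongr)

theorem PolyFun.field {f : Γ → ℕ} (hf : PolyFun f) {r : Γ → ℕ} (hr : PolyFun r) :
    PolyFun fun c => StackProg.field (Ctx.arr c) (f c) (r c) :=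
  .get ((PolyFun.opPos hf).add hr)

end

section

variable {d n : ℕ} [NeZero d] (Q : Computation d n)

theorem getD_zero_code : Q.code.getD 0 0 = Q.N := rfl

theorem getD_one_code : Q.code.getD 1 0 = n := rfl

theorem opLen_of_drop {A : List ℕ} {p : ℕ} {N : ℕ} (hN : A.getD 0 0 = N) {q : Op d N} {l : List ℕ}
    (h : A.drop p = q.code ++ l) : opLen A p = q.code.length := by
  have h₀ : A.getD p 0 = (q.code ++ l).getD 0 0 := by
    rw [← h]; simp [List.getD_eq_getElem?_getD]
  rw [opLen, h₀, hN]
  cases q <;> simp [Op.code] <;> omega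

theorem drop_opPos : ∀ j ≤ Q.ops.length,
    Q.code.drop (opPos Q.code j) = (Q.ops.drop j).flatMap Op.code
  | 0, _ => by
    rw [opPos, getD_one_code, Computation.code, List.drop_zero,
      List.drop_append_of_le_length (by simp; omega), List.drop_of_length_le (by simp; omega),
      List.nil_append]
  | j + 1, h => by
    have ih := drop_opPos j (by omega)
    rw [List.drop_eq_getElem_cons (by omega : j < Q.ops.length), List.flatMap_cons] at ih
    rw [opPos, opLen_of_drop (getD_zero_code Q) ih, ← List.drop_drop, ih, List.drop_left]

theorem field_eq {j r : ℕ} {q : Op d Q.N} (h : Q.ops[j]? = some q) (hr : r < q.code.length) :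
    field Q.code j r = q.code.getD r 0 := by
  obtain ⟨hj, rfl⟩ := List.getElem?_eq_some_iff.1 h
  have := drop_opPos Q j hj.le
  rw [List.drop_eq_getElem_cons hj, List.flatMap_cons] at this
  have h₀ : field Q.code j r = (Q.code.drop (opPos Q.code j)).getD r 0 := by
    simp [field, List.getD_eq_getElem?_getD]
  rw [h₀, this, List.getD_append _ _ _ _ hr]

/-- No operation has an empty description. Hence the number of operations, which the description
does not record, can be read off from where the description ends. -/
theorem opPos_lt_iff {j : ℕ} : opPos Q.code j < Q.code.length ↔ j < Q.ops.length := by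
  have key : ∀ j ≤ Q.ops.length, opPos Q.code j < Q.code.length ↔ j < Q.ops.length := by
    intro j hj
    rw [← not_le, ← List.drop_eq_nil_iff, drop_opPos Q j hj]
    rcases hj.lt_or_eq with hj | rfl
    · have := (Q.ops[j]).length_code_pos
      rw [List.drop_eq_getElem_cons hj, List.flatMap_cons]
      simp only [hj, iff_true]
      intro h
      rw [List.append_eq_nil_iff] at h
      simp [h.1] at this
    · simp
  rcases le_or_gt j Q.ops.length with hj | hj
  · exact key j hj
  · have h₁ := (key _ le_rfl).not.2 (lt_irrefl _)
    have h₂ := opPos_strictMono Q.code hj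
    omega

/-- The length of the description is easy to compute and bounds the number of operations; the
translations use it as the number of groups of auxiliary rows. -/
theorem length_ops_le : Q.ops.length ≤ Q.code.length := by
  have h := (opPos_strictMono Q.code).le_apply (x := Q.code.length)
  by_contra hlt
  exact absurd ((opPos_lt_iff Q).2 (not_le.1 hlt)) (not_lt.2 h)

/-- A loop over all `j` below the length of the description is a loop over the operations, since the
surplus values of `j` contribute nothing. -/
theorem flatMap_range_ops {β : Type*} {G : ℕ → List β} {H : Op d Q.N × ℕ → List β}
    (h : ∀ j q, Q.ops[j]? = some q → G j = H (q, j)) :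
    ((List.range Q.code.length).flatMap fun j =>
      if opPos Q.code j < Q.code.length then G j else []) = Q.ops.zipIdx.flatMap H := by
  obtain ⟨m, hm⟩ := Nat.exists_eq_add_of_le (length_ops_le Q)
  rw [hm, List.range_add, List.flatMap_append, ← hm]
  have h₁ : ((List.range Q.ops.length).flatMap fun j =>
      if opPos Q.code j < Q.code.length then G j else []) = Q.ops.zipIdx.flatMap H := by
    have : Q.ops.zipIdx.flatMap H = (List.range Q.ops.length).flatMap fun j =>
        (Q.ops[j]?).elim [] fun q => H (q, j) := by
      have : Q.ops.zipIdx.map H = (List.range Q.ops.length).map fun j =>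
          (Q.ops[j]?).elim [] fun q => H (q, j) := by
        apply List.ext_getElem
        · simp
        · intro i h₁ h₂
          simp at h₁ h₂
          simp [h₁]
      rw [List.flatMap_def, this, ← List.flatMap_def]
    rw [this]
    refine List.flatMap_congr fun j hj => ?_
    rw [List.mem_range] at hj
    rw [if_pos ((opPos_lt_iff Q).2 hj), h j _ (List.getElem?_eq_getElem hj),
      List.getElem?_eq_getElem hj]
    rfl
  rw [h₁]
  convert List.append_nil _
  rw [List.flatMap_eq_nil_iff]
  intro j hj
  rw [List.mem_map] at hj
  obtain ⟨j, -, rfl⟩ := hj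
  rw [if_neg]
  rw [opPos_lt_iff]
  omega

theorem ofFn_eq_flatMap {N : ℕ} {f : Fin N → ℕ} {g : ℕ → ℕ} (h : ∀ i : Fin N, f i = g i) :
    List.ofFn f = (List.range N).flatMap fun i => [g i] := by
  have : f = fun i : Fin N => g i := funext h
  rw [this, ← List.map_eq_flatMap, List.ofFn_eq_map, ← List.map_coe_finRange_eq_range,
    List.map_map]
  rfl

theorem flatMap_finRange {β : Type*} {N : ℕ} {f : Fin N → List β} {g : ℕ → List β}
    (h : ∀ i : Fin N, f i = g i) : (List.finRange N).flatMap f = (List.range N).flatMap g := by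
  rw [← List.map_coe_finRange_eq_range, List.flatMap_map]
  exact List.flatMap_congr fun i _ => h i

end

end StackProg

/-! ### Qudits arranged in a rectangular array -/

namespace QuditComp

/-- The qudit in row `r` and column `k` of an array of `R * N` qudits. -/
def cell {R N : ℕ} (r : Fin R) (k : Fin N) : Fin (R * N) := finProdFinEquiv (r, k)

theorem val_cell {R N : ℕ} (r : Fin R) (k : Fin N) : (cell r k : ℕ) = k + N * r := rfl

@[simp] theorem cell_inj {R N : ℕ} {r r' : Fin R} {k k' : Fin N} :
    cell r k = cell r' k' ↔ r = r' ∧ k = k' := by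
  rw [cell, cell, finProdFinEquiv.injective.eq_iff, Prod.mk.injEq]

theorem exists_eq_cell {R N : ℕ} (x : Fin (R * N)) : ∃ r k, x = cell r k :=
  ⟨_, _, (finProdFinEquiv.apply_symm_apply x).symm⟩

theorem ofFn_cell {R N : ℕ} {f : Fin (R * N) → ℕ} {g : ℕ → ℕ → ℕ}
    (h : ∀ (r : Fin R) (k : Fin N), f (cell r k) = g r k) :
    List.ofFn f = (List.range R).flatMap fun r => (List.range N).flatMap fun k => [g r k] := by
  rw [List.ofFn_mul, ← StackProg.flatMap_finRange (fun r => rfl), List.flatMap_def, List.ofFn_eq_map]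
  congr 1
  refine List.map_congr_left fun r _ => StackProg.ofFn_eq_flatMap fun k => ?_
  rw [← h]
  congr 1
  ext
  rw [val_cell]
  simp only []
  ring

end QuditComp


set_option linter.unusedSectionVars false

noncomputable section

namespace QuditComp

open Function ZMod StackProg

/-! ## Sequences of operations -/

section Sequences

variable {d n N : ℕ}

/-- The sequence of operations can be performed on a register whose qudits in `M` have been
measured. -/
def Runnable : Finset (Fin N) → List (Op d N) → Prop
  | _, [] => True
  | M, q :: qs => Disjoint q.acts M ∧ q.deps ⊆ M ∧ Runnable (M ∪ q.measured) qs

/-- The qudits which are measured in a sequence of operations. -/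
def measuredIn (l : List (Op d N)) : Finset (Fin N) := l.foldr (fun q M => q.measured ∪ M) ∅

@[simp] theorem measuredIn_nil : measuredIn ([] : List (Op d N)) = ∅ := rfl

@[simp] theorem measuredIn_cons (q : Op d N) (l : List (Op d N)) :
    measuredIn (q :: l) = q.measured ∪ measuredIn l := rfl

@[simp] theorem measuredIn_append (l l' : List (Op d N)) :
    measuredIn (l ++ l') = measuredIn l ∪ measuredIn l' := by
  induction l with
  | nil => simp
  | cons q l ih => simp [ih, Finset.union_assoc]

theorem mem_measuredIn {l : List (Op d N)} {i : Fin N} :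
    i ∈ measuredIn l ↔ ∃ q ∈ l, i ∈ q.measured := by
  induction l with
  | nil => simp
  | cons q l ih => simp [ih]

theorem Runnable.append {M : Finset (Fin N)} {l l' : List (Op d N)} (h : Runnable M l)
    (h' : Runnable (M ∪ measuredIn l) l') : Runnable M (l ++ l') := by
  induction l generalizing M with
  | nil => simpa using h'
  | cons q l ih =>
    refine ⟨h.1, h.2.1, ih h.2.2 ?_⟩
    rwa [Finset.union_assoc]

theorem executable_iff {out : Fin n ↪ Fin N} {M : Finset (Fin N)} {l : List (Op d N)} :
    Executable out M l ↔ Runnable M l ∧ ∀ i, out i ∉ M ∪ measuredIn l := by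
  induction l generalizing M with
  | nil => simp [Executable, Runnable]
  | cons q l ih => simp only [Executable, Runnable, ih, measuredIn_cons, Finset.union_assoc]; tauto

theorem executable_append {out : Fin n ↪ Fin N} {M : Finset (Fin N)} {l l' : List (Op d N)}
    (h : Runnable M l) (h' : Executable out (M ∪ measuredIn l) l') :
    Executable out M (l ++ l') := by
  rw [executable_iff] at h' ⊢
  refine ⟨h.append h'.1, ?_⟩
  rw [measuredIn_append, ← Finset.union_assoc]
  exact h'.2

/-- Operations without measurements and dependencies. -/
theorem Runnable.of_forall {M : Finset (Fin N)} {l : List (Op d N)}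
    (h : ∀ q ∈ l, Disjoint q.acts M ∧ q.deps ⊆ M ∧ q.measured = ∅) : Runnable M l := by
  induction l with
  | nil => trivial
  | cons q l ih =>
    obtain ⟨h₁, h₂, h₃⟩ := h q List.mem_cons_self
    refine ⟨h₁, h₂, ?_⟩
    rw [h₃, Finset.union_empty]
    exact ih fun q hq => h q (List.mem_cons_of_mem _ hq)

theorem measuredIn_eq_empty {l : List (Op d N)} (h : ∀ q ∈ l, q.measured = ∅) :
    measuredIn l = ∅ := by
  rw [Finset.eq_empty_iff_forall_notMem]
  intro i hi
  obtain ⟨q, hq, hi⟩ := mem_measuredIn.1 hi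
  rw [h q hq] at hi
  exact absurd hi (Finset.notMem_empty i)

variable [NeZero d]

/-- The state after a sequence of unitary operations. -/
def run (θ : ℕ → ZMod d → ℝ) (s : Fin N → ZMod d) (l : List (Op d N)) (Φ : Basis d N → ℂ) :
    Basis d N → ℂ := l.foldl (fun Φ q => q.apply θ s 0 Φ) Φ

@[simp] theorem run_nil (θ : ℕ → ZMod d → ℝ) (s : Fin N → ZMod d) (Φ : Basis d N → ℂ) :
    run θ s [] Φ = Φ := rfl

@[simp] theorem run_cons (θ : ℕ → ZMod d → ℝ) (s : Fin N → ZMod d) (q : Op d N)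
    (l : List (Op d N)) (Φ : Basis d N → ℂ) :
    run θ s (q :: l) Φ = run θ s l (q.apply θ s 0 Φ) := rfl

theorem run_append (θ : ℕ → ZMod d → ℝ) (s : Fin N → ZMod d) (l l' : List (Op d N))
    (Φ : Basis d N → ℂ) : run θ s (l ++ l') Φ = run θ s l' (run θ s l Φ) := List.foldl_append

theorem finalState_append (θ : ℕ → ZMod d → ℝ) (out : Fin n ↪ Fin N) {l : List (Op d N)}
    (hl : ∀ q ∈ l, q.IsUnitary) (l' : List (Op d N)) (s : Fin N → ZMod d) (Φ : Basis d N → ℂ) :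
    finalState θ out (l ++ l') s Φ = finalState θ out l' s (run θ s l Φ) := by
  induction l generalizing Φ with
  | nil => rfl
  | cons q l ih =>
    rw [List.cons_append, finalState_cons _ _ (hl q List.mem_cons_self), run_cons,
      ih fun q hq => hl q (List.mem_cons_of_mem _ hq)]

end Sequences

/-! ## Preparing the non-input qudits by Fourier gates -/

section Prepare

variable {d n : ℕ}

open Classical in
/-- Fourier gates on the non-input qudits. -/
def fourierLayer {N : ℕ} (inp : Fin n ↪ Fin N) : List (Op d N) :=
  (List.finRange N).flatMap fun i => if ∃ a, inp a = i then [] else [Op.rot 0 i]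

/-- The computation `Q`, preceded by Fourier gates on the non-input qudits. -/
def Computation.prepare (Q : Computation d n) : Computation d n :=
  { Q with ops := fourierLayer Q.inp ++ Q.ops }

theorem mem_fourierLayer {N : ℕ} {inp : Fin n ↪ Fin N} {q : Op d N}
    (h : q ∈ fourierLayer inp) : ∃ i, q = Op.rot 0 i := by
  obtain ⟨i, -, hi⟩ := List.mem_flatMap.1 h
  split_ifs at hi
  · simp at hi
  · exact ⟨i, List.mem_singleton.1 hi⟩

theorem chainLE_fourierLayer {N : ℕ} (inp : Fin n ↪ Fin N) :
    ChainLE (fourierLayer inp : List (Op d N)) 1 := by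
  refine chainLE_flatMap (fun i _ => ?_) ?_
  · split_ifs
    exacts [chainLE_nil.mono zero_le_one, chainLE_length _]
  · refine (List.nodup_finRange N).imp fun {i k} hik x hx y hy h => ?_
    split_ifs at hx hy <;> simp at hx hy
    subst hx hy
    simp [Op.Follows, Op.acts, Op.measured] at h
    exact hik h

variable [NeZero d]

theorem act_prod {N : ℕ} {inp : Fin n ↪ Fin N} (ψ : Basis d n → ℂ) {J : Finset (Fin N)}
    {f : Fin N → ZMod d → ℂ} {i : Fin N} (hi : i ∈ J) (hinp : ∀ a, inp a ≠ i)
    (g : Matrix (ZMod d) (ZMod d) ℂ) :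
    act i g (fun x => ψ (fun a => x (inp a)) * ∏ k ∈ J, f k (x k)) =
      fun x => ψ (fun a => x (inp a)) * ∏ k ∈ J, update f i (g *ᵥ f i) k (x k) := by
  funext x
  rw [← Finset.mul_prod_erase J _ hi]
  have h₁ : ∀ a : ZMod d, (∏ k ∈ J, f k (update x i a k)) = f i a * ∏ k ∈ J.erase i, f k (x k) := by
    intro a
    rw [← Finset.mul_prod_erase J _ hi, update_self]
    congr 1
    exact Finset.prod_congr rfl fun k hk => by rw [update_of_ne (Finset.ne_of_mem_erase hk)]
  have h₂ : (∏ k ∈ J.erase i, update f i (g *ᵥ f i) k (x k)) =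
      ∏ k ∈ J.erase i, f k (x k) :=
    Finset.prod_congr rfl fun k hk => by rw [update_of_ne (Finset.ne_of_mem_erase hk)]
  have h₃ : ∀ a : ZMod d, (fun b => update x i a (inp b)) = fun b => x (inp b) := fun a =>
    funext fun b => update_of_ne (hinp b) _ _
  simp only [act, h₁, h₂, h₃, update_self, Matrix.mulVec, dotProduct, Finset.sum_mul,
    Finset.mul_sum]
  exact Finset.sum_congr rfl fun a _ => by ring

theorem run_fourierLayer {N : ℕ} (θ : ℕ → ZMod d → ℝ) (s : Fin N → ZMod d) (inp : Fin n ↪ Fin N)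
    {φ φ' : ZMod d → ℂ} (hφ : fourier *ᵥ φ' = φ) (ψ : Basis d n → ℂ) :
    run θ s (fourierLayer inp) (initialState inp φ' ψ) = initialState inp φ ψ := by
  -- Generalised to a product state with its own factor `f i` for each qudit: `φ'` where the gate is
  -- still to come, `φ` elsewhere.
  have key : ∀ (l : List (Fin N)) (f : Fin N → ZMod d → ℂ), l.Nodup →
      (∀ i ∈ l, f i = φ') → (∀ i ∉ l, f i = φ) →
      run θ s (l.flatMap fun i => if ∃ a, inp a = i then [] else [Op.rot 0 i])
        (fun x => ψ (fun a => x (inp a)) *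
          ∏ i ∈ Finset.univ.filter (fun i => ∀ a, inp a ≠ i), f i (x i)) =
        initialState inp φ ψ := by
    intro l
    induction l with
    | nil =>
      intro f _ _ h
      simp only [List.flatMap_nil, run_nil]
      rw [show f = fun _ => φ from funext fun i => h i (by simp)]
      rfl
    | cons i l ih =>
      intro f hl h₁ h₂
      rw [List.nodup_cons] at hl
      rw [List.flatMap_cons, run_append]
      by_cases hi : ∃ a, inp a = i
      · rw [if_pos hi, run_nil]
        -- An input qudit does not occur in the product, so its factor may be changed at will to
        -- maintain the invariant.
        rw [← ih (update f i φ) hl.2 (fun k hk => ?_) (fun k hk => ?_)]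
        · congr 1
          funext x
          congr 1
          refine Finset.prod_congr rfl fun k hk => ?_
          rw [update_of_ne]
          rintro rfl
          obtain ⟨a, ha⟩ := hi
          exact (Finset.mem_filter.1 hk).2 a ha
        · rw [update_of_ne (ne_of_mem_of_not_mem hk hl.1), h₁ k (List.mem_cons_of_mem _ hk)]
        · by_cases hki : k = i
          · rw [hki, update_self]
          · rw [update_of_ne hki, h₂ k (by simp [hki, hk])]
      · rw [if_neg hi, run_cons, run_nil, apply_rot, angles, vGate_zero]
        have hi' : ∀ a, inp a ≠ i := not_exists.1 hi
        rw [act_prod ψ (Finset.mem_filter.2 ⟨Finset.mem_univ _, hi'⟩) hi',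
          h₁ i List.mem_cons_self, hφ]
        refine ih _ hl.2 (fun k hk => ?_) (fun k hk => ?_)
        · rw [update_of_ne (ne_of_mem_of_not_mem hk hl.1), h₁ k (List.mem_cons_of_mem _ hk)]
        · by_cases hki : k = i
          · rw [hki, update_self]
          · rw [update_of_ne hki, h₂ k (by simp [hki, hk])]
  rw [fourierLayer]
  convert key (List.finRange N) (fun _ => φ') (List.nodup_finRange N) (fun _ _ => rfl)
    (fun i hi => absurd (List.mem_finRange i) hi) using 2
  rfl

theorem Computation.Implements.prepare {Q : Computation d n} {θ : ℕ → ZMod d → ℝ}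
    {φ φ' : ZMod d → ℂ} {U : Matrix (Basis d n) (Basis d n) ℂ} (h : Q.Implements θ φ U)
    (hφ : fourier *ᵥ φ' = φ) : Q.prepare.Implements θ φ' U := by
  have hm : ∀ q ∈ (fourierLayer Q.inp : List (Op d Q.N)), q.measured = ∅ := fun q hq => by
    obtain ⟨i, rfl⟩ := mem_fourierLayer hq; rfl
  refine ⟨executable_append (.of_forall fun q hq => ?_) ?_, fun ψ => ?_⟩
  · refine ⟨Finset.disjoint_empty_right _, ?_, hm q hq⟩
    obtain ⟨i, rfl⟩ := mem_fourierLayer hq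
    exact Finset.Subset.refl _
  · have := h.1
    exact ((congrArg (∅ ∪ ·) (measuredIn_eq_empty hm)).trans (Finset.empty_union _)).symm ▸ this
  · rw [← h.2 ψ]
    change finalState θ Q.out (fourierLayer Q.inp ++ Q.ops) 0 (initialState Q.inp φ' ψ) = _
    rw [finalState_append _ _ hm, run_fourierLayer _ _ _ hφ]

theorem flatMap_copy (A : List ℕ) (p m : ℕ) (h : p + m ≤ A.length) :
    ((List.range m).flatMap fun i => [A.getD (p + i) 0]) = (A.drop p).take m := by
  rw [← List.map_eq_flatMap]
  refine List.ext_getElem (by simp; omega) fun i h₁ h₂ => ?_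
  simp at h₁
  rw [List.getElem_map, List.getElem_range, List.getElem_take, List.getElem_drop,
    List.getD_eq_getElem]

/-- The translation of descriptions which belongs to `Computation.prepare`. -/
def prepareCode (A : List ℕ) : List ℕ :=
  ((List.range (2 + 2 * A.getD 1 0)).flatMap fun i => [A.getD (0 + i) 0]) ++
    (((List.range (A.getD 0 0)).flatMap fun i =>
      if (∑ a ∈ Finset.range (A.getD 1 0), if A.getD (2 + a) 0 = i then 1 else 0) = 0
        then [1, 0, i] else []) ++
    ((List.range (A.length - (2 + 2 * A.getD 1 0))).flatMap fun i =>
      [A.getD (2 + 2 * A.getD 1 0 + i) 0]))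

theorem polyList_prepareCode : PolyList prepareCode := by
  have h₁ : PolyFun fun A : List ℕ => 2 + 2 * A.getD 1 0 :=
    (PolyFun.const 2).add ((PolyFun.const 2).mul (PolyFun.entry 1))
  have h₂ : PolyFun fun c : List ℕ × ℕ => c.1.getD (0 + c.2) 0 :=
    PolyFun.get ((PolyFun.const 0).add PolyFun.snd)
  have h₃ : PolyFun fun c : List ℕ × ℕ => c.1.getD (2 + 2 * c.1.getD 1 0 + c.2) 0 :=
    PolyFun.get (h₁.fst.add PolyFun.snd)
  have h₄ : PolyFun fun c : (List ℕ × ℕ) × ℕ => if c.1.1.getD (2 + c.2) 0 = c.1.2 then 1 else 0 :=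
    .ite_eq (PolyFun.get ((PolyFun.const 2).add .snd)) PolyFun.snd.fst (.const 1) (.const 0)
  have h₅ : PolyFun fun c : List ℕ × ℕ =>
      ∑ a ∈ Finset.range (c.1.getD 1 0), if c.1.getD (2 + a) 0 = c.2 then 1 else 0 :=
    PolyFun.sum (PolyFun.entry 1) h₄
  have h₆ : PolyList fun c : List ℕ × ℕ => [1, 0, c.2] :=
    .cons (.const 1) (.cons (.const 0) (.single .snd))
  exact .append (.flatMap h₁ (.single h₂)) (.append (.flatMap (PolyFun.entry 0) (.ite h₅ h₆ .nil))
    (.flatMap (PolyFun.len.sub h₁) (.single h₃)))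

theorem getD_inp (Q : Computation d n) (a : Fin n) : Q.code.getD (2 + a) 0 = Q.inp a := by
  simp [Computation.code, List.getD_eq_getElem?_getD, List.getElem?_append, add_comm 2]

theorem getD_out (Q : Computation d n) (a : Fin n) : Q.code.getD (2 + n + a) 0 = Q.out a := by
  have : 2 + n + (a : ℕ) = (n + a) + 2 := by ring
  rw [this]
  simp [Computation.code, List.getD_eq_getElem?_getD, List.getElem?_append]

theorem code_prepare (Q : Computation d n) : Q.prepare.code = prepareCode Q.code := by
  have hlen : 2 + 2 * n ≤ Q.code.length := by simp [Computation.code]; omega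
  rw [prepareCode, getD_zero_code, getD_one_code, flatMap_copy _ _ _ (by omega),
    flatMap_copy _ _ _ (by omega)]
  have h₁ : List.take (2 + 2 * n) (List.drop 0 Q.code) = [Q.N, n] ++
      (List.ofFn fun a => (Q.inp a : ℕ)) ++ (List.ofFn fun a => (Q.out a : ℕ)) := by
    rw [Computation.code, List.drop_zero, List.take_left']
    simp; omega
  have h₂ : List.drop (2 + 2 * n) Q.code = Q.ops.flatMap Op.code := by
    rw [Computation.code, List.drop_left']
    simp; omega
  rw [h₁, h₂, List.take_of_length_le (by rw [← h₂]; simp)]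
  have h₃ : (fourierLayer Q.inp : List (Op d Q.N)).flatMap Op.code =
      (List.range Q.N).flatMap fun i =>
        if (∑ a ∈ Finset.range n, if Q.code.getD (2 + a) 0 = i then 1 else 0) = 0
          then [1, 0, i] else [] := by
    rw [fourierLayer, List.flatMap_assoc]
    refine flatMap_finRange fun i => ?_
    have : (∑ a ∈ Finset.range n, if Q.code.getD (2 + a) 0 = i then 1 else 0) = 0 ↔
        ¬ ∃ a, Q.inp a = i := by
      rw [← Fin.sum_univ_eq_sum_range (fun a => if Q.code.getD (2 + a) 0 = i then 1 else 0),
        Finset.sum_eq_zero_iff]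
      simp [-List.getD_eq_getElem?_getD, getD_inp, Fin.val_inj]
    rw [if_congr this rfl rfl]
    split_ifs <;> simp_all [Op.code]
  rw [← h₃]
  simp [Computation.code, Computation.prepare]
  rfl

/-- This serves both directions, since `F|0⟩ = |+_0⟩` and `F|+_0⟩ = |0⟩`. The class `A'` only needs
to allow the Fourier gate and may be intermediate between the two models. -/
theorem complexityClass_prepare {k : ℕ} {A A' : ∀ {N : ℕ}, Op d N → Prop} {φ φ' : ZMod d → ℂ}
    (hφ : fourier *ᵥ φ' = φ) (hA : ∀ {N : ℕ} {q : Op d N}, A q → A' q)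
    (hA' : ∀ {N : ℕ} (i : Fin N), A' (Op.rot 0 i)) :
    complexityClass d A φ k ⊆ complexityClass d A' φ' k := by
  refine complexityClass_subset (fun {n} Q => Q.prepare) prepareCode 1 polyList_prepareCode
    (fun Q _ => code_prepare Q) (fun Q hQ q hq => ?_) (fun Q _ _ => ?_)
    (fun Q θ U _ h => h.prepare hφ)
  · rcases List.mem_append.1 hq with hq | hq
    · obtain ⟨i, rfl⟩ := mem_fourierLayer hq
      exact hA' i
    · exact hA (hQ q hq)
  · rw [one_mul, add_comm]
    exact depth_le ((chainLE_fourierLayer Q.inp).append (chainLE_depth Q))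

end Prepare

end QuditComp

end


set_option linter.unusedSectionVars false

noncomputable section

namespace QuditComp

open Function ZMod StackProg

section Phase

variable {d n N : ℕ} [NeZero d]

/-! ## Diagonal sequences of operations -/

/-- The operations multiply the basis state `x` by `ω ^ f x`. -/
def IsPhase (s : Fin N → ZMod d) (l : List (Op d N)) (f : Basis d N → ZMod d) : Prop :=
  ∀ (θ : ℕ → ZMod d → ℝ) (Φ : Basis d N → ℂ),
    run θ s l Φ = fun x => stdAddChar (f x) * Φ x

theorem IsPhase.congr {s : Fin N → ZMod d} {l : List (Op d N)} {f g : Basis d N → ZMod d}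
    (h : IsPhase s l f) (hfg : ∀ x, g x = f x) : IsPhase s l g := (funext hfg : g = f) ▸ h

theorem IsPhase.nil (s : Fin N → ZMod d) : IsPhase s [] fun _ => 0 := fun θ Φ => by
  simp

theorem IsPhase.append {s : Fin N → ZMod d} {l l' : List (Op d N)} {f g : Basis d N → ZMod d}
    (h : IsPhase s l f) (h' : IsPhase s l' g) : IsPhase s (l ++ l') fun x => f x + g x :=
  fun θ Φ => by
    rw [run_append, h, h']
    funext x
    rw [AddChar.map_add_eq_mul]
    ring

theorem IsPhase.flatMap {β : Type*} {s : Fin N → ZMod d} {blk : β → List (Op d N)}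
    {f : β → Basis d N → ZMod d} {bs : List β} (h : ∀ b ∈ bs, IsPhase s (blk b) (f b)) :
    IsPhase s (bs.flatMap blk) fun x => (bs.map fun b => f b x).sum := by
  induction bs with
  | nil => exact .nil s
  | cons b bs ih =>
    simp only [List.flatMap_cons, List.map_cons, List.sum_cons]
    exact (h b List.mem_cons_self).append (ih fun b hb => h b (List.mem_cons_of_mem _ hb))

theorem IsPhase.flatMap_finRange {s : Fin N → ZMod d} {m : ℕ} {blk : Fin m → List (Op d N)}
    {f : Fin m → Basis d N → ZMod d} (h : ∀ b, IsPhase s (blk b) (f b)) :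
    IsPhase s ((List.finRange m).flatMap blk) fun x => ∑ b, f b x :=
  (IsPhase.flatMap fun b _ => h b).congr fun x => by
    rw [← List.ofFn_eq_map, List.sum_ofFn]

theorem IsPhase.flatMap_range {s : Fin N → ZMod d} {m : ℕ} {blk : ℕ → List (Op d N)}
    {f : ℕ → Basis d N → ZMod d} (h : ∀ b, IsPhase s (blk b) (f b)) :
    IsPhase s ((List.range m).flatMap blk) fun x => ∑ b ∈ Finset.range m, f b x :=
  (IsPhase.flatMap fun b _ => h b).congr fun _ => rfl

theorem IsPhase.ite {s : Fin N → ZMod d} {p : Prop} [Decidable p] {l l' : List (Op d N)}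
    {f g : Basis d N → ZMod d} (h : p → IsPhase s l f) (h' : ¬ p → IsPhase s l' g) :
    IsPhase s (if p then l else l') fun x => if p then f x else g x := by
  split_ifs with hp
  exacts [h hp, h' hp]

theorem isPhase_cz (s : Fin N → ZMod d) {i k : Fin N} (h : i ≠ k) :
    IsPhase s [Op.cz i k h] fun x => x i * x k := fun θ Φ => by
  rw [run_cons, run_nil, apply_cz]

theorem isPhase_corrZ (s : Fin N → ZMod d) (i : Fin N) (σ : Signal d N) :
    IsPhase s [Op.corrZ i σ] fun x => σ.value s * x i := fun θ Φ => by
  rw [run_cons, run_nil, apply_corrZ, act_pauliZ]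

/-! ## Sums over the outcomes of a measurement -/

theorem act_single (i : Fin N) (j : ZMod d) (Φ : Basis d N → ℂ) :
    act i (Matrix.single j j 1) Φ = fun x => if x i = j then Φ x else 0 := by
  have : (Matrix.single j j 1 : Matrix (ZMod d) (ZMod d) ℂ) =
      Matrix.diagonal fun a => if a = j then 1 else 0 := by
    ext a b
    rw [Matrix.single_apply, Matrix.diagonal_apply]
    grind
  rw [this, act_diagonal]
  funext x
  simp

/-- A complete measurement in the computational basis of a qudit which is traced out. -/
theorem sum_reducedState_act_single {out : Fin n ↪ Fin N} {i : Fin N} (hi : ∀ a, out a ≠ i)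
    (Φ : Basis d N → ℂ) :
    ∑ j, reducedState out (act i (Matrix.single j j 1) Φ) = reducedState out Φ := by
  ext x y
  simp only [Matrix.sum_apply, reducedState_apply, act_single]
  rw [Finset.sum_comm]
  refine Finset.sum_congr rfl fun w _ => ?_
  simp only [relabel_of_ne out w y hi]
  split_ifs
  · simp only [apply_ite star, star_zero, ite_mul, mul_ite, zero_mul, mul_zero,
      Finset.sum_ite_eq, Finset.mem_univ, if_true]
  · simp

/-- Sequences of operations commute with single-qudit operators on qudits on which they do not
act. -/
theorem run_act (θ : ℕ → ZMod d → ℝ) (s : Fin N → ZMod d) {l : List (Op d N)} {i : Fin N}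
    (hi : ∀ q ∈ l, i ∉ q.acts) (V : Matrix (ZMod d) (ZMod d) ℂ) (Φ : Basis d N → ℂ) :
    run θ s l (act i V Φ) = act i V (run θ s l Φ) := by
  induction l generalizing Φ with
  | nil => rfl
  | cons q l ih =>
    rw [run_cons, run_cons, Op.apply_act _ _ _ _ (hi q List.mem_cons_self),
      ih fun q hq => hi q (List.mem_cons_of_mem _ hq)]

/-! ## Powers of fan-out gates -/

theorem run_replicate_fanout (θ : ℕ → ZMod d → ℝ) (s : Fin N → ZMod d) {c : Fin N}
    {T : Finset (Fin N)} (h : c ∉ T) (m : ℕ) (Φ : Basis d N → ℂ) :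
    run θ s (List.replicate m (Op.fanout c T h)) Φ =
      fun x => Φ fun k => if k ∈ T then x k - m * x c else x k := by
  induction m generalizing Φ with
  | zero => simp
  | succ m ih =>
    rw [List.replicate_succ, run_cons, ih, apply_fanout]
    funext x
    refine congrArg Φ (funext fun k => ?_)
    simp only [h, if_false]
    split_ifs
    · push_cast; ring
    · rfl

/-- In front of the projection to `|j⟩`, the operator `Z^t` is the scalar `ω^{tj}`, which cancels
against its conjugate. This disposes of the factor `Z^{-s}` from `vGate_measAngle`. -/
theorem finalState_act_single_smul (θ : ℕ → ZMod d → ℝ) (out : Fin n ↪ Fin N)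
    (qs : List (Op d N)) (s : Fin N → ZMod d) (i : Fin N) (j t : ZMod d)
    (V : Matrix (ZMod d) (ZMod d) ℂ) (Φ : Basis d N → ℂ) :
    finalState θ out qs s (act i (Matrix.single j j 1 * (pauliZ t * V)) Φ) =
      finalState θ out qs s (act i (Matrix.single j j 1) (act i V Φ)) := by
  have : act i (Matrix.single j j 1 * (pauliZ t * V)) Φ =
      stdAddChar (t * j) • act i (Matrix.single j j 1) (act i V Φ) := by
    rw [← act_act, ← act_act, act_single, act_single, act_pauliZ]
    funext x
    simp only [Pi.smul_apply, smul_eq_mul]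
    split_ifs with h
    · rw [h]
    · simp
  rw [this, finalState_smul, stdAddChar_mul_star, one_smul]

end Phase

section Lists

variable {d n N : ℕ}

theorem Runnable.disjoint_acts {M : Finset (Fin N)} {l : List (Op d N)} (h : Runnable M l) :
    ∀ q ∈ l, Disjoint M q.acts := by
  induction l generalizing M with
  | nil => simp
  | cons q l ih =>
    intro q' hq'
    rcases List.mem_cons.1 hq' with rfl | hq'
    · exact h.1.symm
    · exact (ih h.2.2 q' hq').mono_left Finset.subset_union_left

/-- What an operation depends on has been measured by then, and nothing acts on a measured qudit. -/
theorem Runnable.pairwise {M : Finset (Fin N)} {l : List (Op d N)} (h : Runnable M l) :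
    l.Pairwise fun a b => Disjoint a.deps b.acts := by
  induction l generalizing M with
  | nil => exact .nil
  | cons q l ih =>
    refine List.pairwise_cons.2 ⟨fun b hb => ?_, ih h.2.2⟩
    exact (h.2.2.disjoint_acts b hb).mono_left (h.2.1.trans Finset.subset_union_left)

theorem pairwise_zipIdx {β : Type*} {R : β → β → Prop} {l : List β} (h : l.Pairwise R) :
    l.zipIdx.Pairwise fun a b => R a.1 b.1 ∧ a.2 < b.2 ∧ b.2 < l.length := by
  rw [List.pairwise_iff_getElem] at h ⊢
  intro i j hi hj hij
  simp only [List.length_zipIdx] at hi hj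
  simp only [List.getElem_zipIdx, zero_add]
  exact ⟨h i j hi hj hij, hij, hj⟩

end Lists

end QuditComp

end


set_option linter.unusedSectionVars false

noncomputable section

namespace QuditComp

open Function ZMod StackProg

namespace Coherent

/-! ## Measurement patterns as circuits -/

section Defs

variable {d N : ℕ} (B : ℕ)

/-- The row of copies of outcomes which operation number `j` uses. -/
def copyRow (j : ℕ) : Fin (2 * B + 1) := Fin.ofNat (2 * B + 1) (1 + j)

/-- The row of auxiliary qudits of operation number `j`. -/
def auxRow (j : ℕ) : Fin (2 * B + 1) := Fin.ofNat (2 * B + 1) (B + 1 + j)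

theorem val_copyRow {j : ℕ} (hj : j < B) : (copyRow B j : ℕ) = 1 + j :=
  Nat.mod_eq_of_lt (by omega)

theorem val_auxRow {j : ℕ} (hj : j < B) : (auxRow B j : ℕ) = B + 1 + j :=
  Nat.mod_eq_of_lt (by omega)

/-- Qudit `i` of the pattern, in the circuit. -/
def main (i : Fin N) : Fin ((2 * B + 1) * N) := cell 0 i

theorem main_injective : Injective (main (N := N) B) := fun i k h => by simpa [main] using h

/-- The auxiliary qudits of operation number `j`. -/
def auxSet (j : ℕ) : Finset (Fin ((2 * B + 1) * N)) :=
  Finset.univ.filter fun x => 0 < B ∧ ∃ k : Fin N, x = cell (auxRow B (j % B)) k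

/-- The copies of the outcome `i`. -/
def copySet (i : Fin N) : Finset (Fin ((2 * B + 1) * N)) :=
  Finset.univ.filter fun x => ∃ r : Fin (2 * B + 1), (0 < (r : ℕ) ∧ (r : ℕ) ≤ B) ∧ x = cell r i

/-- The reduction modulo `B` and the case `B = 0` in `auxSet` make this true without any hypothesis
on `j`, so that `fan` is defined for all `j`. -/
theorem main_notMem_auxSet (i : Fin N) (j : ℕ) : main B i ∉ auxSet (N := N) B j := by
  simp only [auxSet, Finset.mem_filter, main, cell_inj, not_and, not_exists]
  intro _ hB k h
  have := congrArg Fin.val h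
  rw [val_auxRow B (Nat.mod_lt j hB), Fin.val_zero] at this
  omega

theorem main_notMem_copySet (i i' : Fin N) : main B i ∉ copySet B i' := by
  simp only [copySet, Finset.mem_filter, main, cell_inj, not_and, not_exists]
  rintro _ r hr rfl
  simp at hr

/-- Subtract the value of qudit `i` from the auxiliary qudits of operation `j`. -/
def fan (j : ℕ) (i : Fin N) : Op d ((2 * B + 1) * N) :=
  .fanout (main B i) (auxSet B j) (main_notMem_auxSet B i j)

/-- The Pauli correction `Z^σ` on qudit `i`, controlled by copies of the outcomes. -/
def corrZ (j : ℕ) (i : Fin N) (σ : Signal d N) : List (Op d ((2 * B + 1) * N)) :=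
  fan B j i :: (((List.range (d - 1)).flatMap fun r => (List.finRange N).flatMap fun k =>
    if h : r < (σ k).val ∧ auxRow B j ≠ copyRow B j
      then [.cz (cell (auxRow B j) k) (cell (copyRow B j) k) (fun e => h.2 (cell_inj.1 e).1)]
      else []) ++
  List.replicate (d - 1) (fan B j i))

/-- The Fourier gate on qudit `i`. -/
def F (i : Fin N) : Op d ((2 * B + 1) * N) := .rot 0 (main B i)

/-- The translation of operation number `j`. -/
def block : Op d N × ℕ → List (Op d ((2 * B + 1) * N))
  | (.cz i k h, _) => [.cz (main B i) (main B k) ((main_injective B).ne h)]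
  | (.rot a i, _) => [.rot a (main B i)]
  | (.fanout _ _ _, _) => []
  | (.corrX i σ, j) => F B i :: (corrZ B j i σ ++ [F B i, F B i, F B i])
  | (.corrZ i σ, j) => corrZ B j i σ
  | (.measure i a σ τ, j) => corrZ B j i τ ++ (F B i :: (corrZ B j i σ ++ [F B i, F B i, F B i,
      .rot a (main B i), .fanout (main B i) (copySet B i) (main_notMem_copySet B i i)]))

end Defs

section Semantics

variable {d n N : ℕ} [NeZero d] (B : ℕ)

/-- The label of the register in which the pattern's qudits have labels `w`, the copies of the
outcomes of the qudits in `M` have been made, and all other qudits are in state `0`. -/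
def lift (M : Finset (Fin N)) (w : Basis d N) : Basis d ((2 * B + 1) * N) := fun x =>
  let p := finProdFinEquiv.symm x
  if (p.1 : ℕ) = 0 then w p.2 else if (p.1 : ℕ) ≤ B ∧ p.2 ∈ M then w p.2 else 0

theorem lift_cell (M : Finset (Fin N)) (w : Basis d N) (r : Fin (2 * B + 1)) (k : Fin N) :
    lift B M w (cell r k) =
      if (r : ℕ) = 0 then w k else if (r : ℕ) ≤ B ∧ k ∈ M then w k else 0 := by
  simp [lift, cell]

theorem lift_main (M : Finset (Fin N)) (w : Basis d N) (k : Fin N) :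
    lift B M w (main B k) = w k := by
  simp [main, lift_cell]

/-- The state of the register of the circuit which belongs to the state `Ψ` of the pattern. -/
def emb (M : Finset (Fin N)) (Ψ : Basis d N → ℂ) : Basis d ((2 * B + 1) * N) → ℂ := fun z =>
  if z = lift B M (fun k => z (main B k)) then Ψ fun k => z (main B k) else 0

theorem emb_lift (M : Finset (Fin N)) (Ψ : Basis d N → ℂ) (w : Basis d N) :
    emb B M Ψ (lift B M w) = Ψ w := by
  simp [emb, lift_main]

theorem lift_update {M : Finset (Fin N)} {i : Fin N} (hi : i ∉ M) (w : Basis d N) (a : ZMod d) :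
    lift B M (update w i a) = update (lift B M w) (main B i) a := by
  funext x
  obtain ⟨r, k, rfl⟩ := exists_eq_cell x
  by_cases h : cell r k = main B i
  · rw [h, update_self, lift_main, update_self]
  · rw [update_of_ne h, lift_cell, lift_cell]
    by_cases hk : k = i
    · subst hk
      have hr : (r : ℕ) ≠ 0 := fun hr => h (by rw [main, cell_inj]; exact ⟨Fin.ext hr, rfl⟩)
      simp [hr, hi]
    · rw [update_of_ne hk]

/-- A qudit which is not in `M` has no copies, so changing its label leads from labels of the form
`lift` to such labels and from others to others. -/
theorem act_emb {M : Finset (Fin N)} {i : Fin N} (hi : i ∉ M) (g : Matrix (ZMod d) (ZMod d) ℂ)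
    (Ψ : Basis d N → ℂ) : act (main B i) g (emb B M Ψ) = emb B M (act i g Ψ) := by
  have key : ∀ (z : Basis d ((2 * B + 1) * N)) (a : ZMod d),
      (fun k => update z (main B i) a (main B k)) = update (fun k => z (main B k)) i a := by
    intro z a
    funext k
    by_cases hk : k = i
    · subst hk; simp
    · rw [update_of_ne hk, update_of_ne ((main_injective B).ne hk)]
  have key' : ∀ (z : Basis d ((2 * B + 1) * N)) (a : ZMod d),
      update z (main B i) a = update (lift B M fun k => z (main B k)) (main B i) a ↔
        z = lift B M fun k => z (main B k) := by
    intro z a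
    constructor
    · intro h
      funext x
      by_cases hx : x = main B i
      · subst hx; rw [lift_main]
      · simpa [update_of_ne hx] using congrFun h x
    · intro h; rw [← h]
  funext z
  simp only [act, emb, key, lift_update B hi, key']
  split_ifs <;> simp

theorem emb_mul (M : Finset (Fin N)) (Ψ : Basis d N → ℂ) (f : Basis d N → ℂ) :
    (fun z => f (fun k => z (main B k)) * emb B M Ψ z) = emb B M fun w => f w * Ψ w := by
  funext z
  simp only [emb, mul_ite, mul_zero]

/-- The state `Ψ` after the measurement of the qudits in `M`, with outcomes `s`. -/
def Supported (M : Finset (Fin N)) (s : Fin N → ZMod d) (Ψ : Basis d N → ℂ) : Prop :=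
  ∀ w, Ψ w ≠ 0 → ∀ k ∈ M, w k = s k

theorem Supported.act {M : Finset (Fin N)} {s : Fin N → ZMod d} {Ψ : Basis d N → ℂ}
    (h : Supported M s Ψ) {i : Fin N} (hi : i ∉ M) (g : Matrix (ZMod d) (ZMod d) ℂ) :
    Supported M s (act i g Ψ) := by
  intro w hw k hk
  obtain ⟨a, -, ha⟩ := Finset.exists_ne_zero_of_sum_ne_zero hw
  have := h _ (right_ne_zero_of_mul ha) k hk
  rwa [update_of_ne (ne_of_mem_of_not_mem hk hi)] at this

theorem Supported.mul {M : Finset (Fin N)} {s : Fin N → ZMod d} {Ψ : Basis d N → ℂ}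
    (h : Supported M s Ψ) (f : Basis d N → ℂ) : Supported M s fun w => f w * Ψ w :=
  fun w hw => h w (right_ne_zero_of_mul hw)

theorem mem_auxSet {j : ℕ} (hj : j < B) {x : Fin ((2 * B + 1) * N)} :
    x ∈ auxSet (N := N) B j ↔ ∃ k : Fin N, x = cell (auxRow B j) k := by
  simp [auxSet, Nat.mod_eq_of_lt hj, Nat.zero_lt_of_lt hj]

/-- After the first fan-out every auxiliary qudit of operation `j` holds the value of qudit `i`.
Applying `CZ` with the copies of the outcomes, `σ k` times in column `k`, produces the phase
`ω^{σ(s) w_i}`, and the fan-out is then undone. The columns use disjoint pairs of qudits, so the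
depth does not depend on how many outcomes enter. -/
theorem run_corrZ (θ : ℕ → ZMod d → ℝ) {M : Finset (Fin N)} {s : Fin N → ZMod d}
    {Ψ : Basis d N → ℂ} (hΨ : Supported M s Ψ) {i : Fin N} {σ : Signal d N}
    (hσ : ∀ k, σ k ≠ 0 → k ∈ M) {j : ℕ} (hj : j < B) :
    run θ 0 (corrZ B j i σ) (emb B M Ψ) = emb B M (act i (pauliZ (σ.value s)) Ψ) := by
  have hne : auxRow B j ≠ copyRow B j := fun h => by
    have := congrArg Fin.val h
    rw [val_auxRow B hj, val_copyRow B hj] at this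
    omega
  have hphase : IsPhase (0 : Fin ((2 * B + 1) * N) → ZMod d)
      ((List.range (d - 1)).flatMap fun r => (List.finRange N).flatMap fun k =>
        if h : r < (σ k).val ∧ auxRow B j ≠ copyRow B j
          then [.cz (cell (auxRow B j) k) (cell (copyRow B j) k) (fun e => h.2 (cell_inj.1 e).1)]
          else [])
      fun z => ∑ k, σ k * (z (cell (auxRow B j) k) * z (cell (copyRow B j) k)) := by
    -- In round `r` column `k` takes part if `r < (σ k).val`. As `(σ k).val ≤ d - 1`, this happens
    -- exactly `(σ k).val` times.
    refine (IsPhase.flatMap_range (f := fun r z => ∑ k, if r < (σ k).val then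
      z (cell (auxRow B j) k) * z (cell (copyRow B j) k) else 0) fun r =>
      IsPhase.flatMap_finRange fun k => ?_).congr fun z => ?_
    · by_cases h : r < (σ k).val
      · rw [dif_pos ⟨h, hne⟩]
        simp only [h, if_true]
        exact isPhase_cz _ _
      · rw [dif_neg fun h' => h h'.1]
        simp only [h, if_false]
        exact .nil _
    · rw [Finset.sum_comm]
      refine Finset.sum_congr rfl fun k _ => ?_
      rw [← Finset.sum_filter, Finset.sum_const]
      have : (Finset.range (d - 1)).filter (fun r => r < (σ k).val) = Finset.range (σ k).val := by
        ext r
        have := ZMod.val_lt (σ k)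
        simp only [Finset.mem_filter, Finset.mem_range]
        omega
      rw [this, Finset.card_range, nsmul_eq_mul, ZMod.natCast_zmod_val]
  rw [corrZ, run_cons, run_append, hphase, fan, run_replicate_fanout, apply_fanout, act_pauliZ]
  funext z
  have hmain : ∀ k, main B k ∉ auxSet (N := N) B j := fun k => main_notMem_auxSet B k j
  have haux : ∀ k, cell (auxRow B j) k ∈ auxSet (N := N) B j := fun k =>
    (mem_auxSet B hj).2 ⟨k, rfl⟩
  have hcopy : ∀ k, cell (copyRow B j) k ∉ auxSet (N := N) B j := fun k h => by
    obtain ⟨k', h⟩ := (mem_auxSet B hj).1 h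
    exact hne (cell_inj.1 h).1.symm
  -- The fan-out gate has order dividing `d`, so `d - 1` repetitions are its inverse.
  have hd : ((d - 1 : ℕ) : ZMod d) = -1 := by
    rw [Nat.cast_sub (NeZero.one_le), ZMod.natCast_self, Nat.cast_one, zero_sub]
  simp only [hmain, haux, hcopy, if_true, if_false, hd]
  have hz : (fun k => if k ∈ auxSet (N := N) B j then
      (if k ∈ auxSet (N := N) B j then z k - -1 * z (main B i) else z k) - z (main B i)
      else if k ∈ auxSet (N := N) B j then z k - -1 * z (main B i) else z k) = z := by
    funext k
    split_ifs <;> ring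
  rw [hz]
  by_cases hw : emb B M Ψ z = 0
  · rw [hw, mul_zero]
    rw [← congrFun (emb_mul B M Ψ fun w => stdAddChar (σ.value s * w i)) z, hw, mul_zero]
  · rw [← congrFun (emb_mul B M Ψ fun w => stdAddChar (σ.value s * w i)) z]
    congr 2
    have hl : z = lift B M fun k => z (main B k) := by
      by_contra h
      exact hw (if_neg h)
    have hΨz : Ψ (fun k => z (main B k)) ≠ 0 := by
      rwa [emb, if_pos hl] at hw
    rw [Signal.value, Finset.sum_mul]
    refine Finset.sum_congr rfl fun k _ => ?_
    by_cases hk : σ k = 0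
    · simp [hk]
    -- On the support of the state the auxiliary qudits are `0` before the fan-out, and the copies
    -- carry the recorded outcomes by `Supported`.
    · have h₁ : z (cell (auxRow B j) k) = 0 := by
        rw [hl, lift_cell, val_auxRow B hj, if_neg (by omega), if_neg (by omega)]
      have h₂ : z (cell (copyRow B j) k) = s k := by
        rw [hl, lift_cell, val_copyRow B hj, if_neg (by omega), if_pos ⟨by omega, hσ k hk⟩]
        exact hΨ _ hΨz k (hσ k hk)
      rw [h₁, h₂]
      ring

theorem run_F (θ : ℕ → ZMod d → ℝ) {M : Finset (Fin N)} {i : Fin N} (hi : i ∉ M)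
    (Ψ : Basis d N → ℂ) (l : List (Op d ((2 * B + 1) * N))) :
    run θ 0 (F B i :: l) (emb B M Ψ) = run θ 0 l (emb B M (act i fourier Ψ)) := by
  rw [run_cons, F, apply_rot, angles, vGate_zero, act_emb B hi]

/-- The targets are `0` as long as `i` is unmeasured, so the fan-out makes them equal to the label
of `i`; this is the condition defining `lift` for `insert i M`. -/
theorem run_copy (θ : ℕ → ZMod d → ℝ) {M : Finset (Fin N)} {i : Fin N} (hi : i ∉ M)
    (Ψ : Basis d N → ℂ) :
    run θ 0 [.fanout (main B i) (copySet B i) (main_notMem_copySet B i i)] (emb B M Ψ) =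
      emb B (insert i M) Ψ := by
  rw [run_cons, run_nil, apply_fanout]
  funext z
  have hmain : ∀ k, main B k ∉ copySet B i := fun k => main_notMem_copySet B k i
  simp only [emb, hmain, if_false]
  refine if_congr ?_ rfl rfl
  rw [funext_iff, funext_iff]
  refine forall_congr' fun x => ?_
  obtain ⟨r, k, rfl⟩ := exists_eq_cell x
  have hmem : cell r k ∈ copySet B i ↔ (0 < (r : ℕ) ∧ (r : ℕ) ≤ B) ∧ k = i := by
    simp only [copySet, Finset.mem_filter, Finset.mem_univ, true_and, cell_inj]
    constructor
    · rintro ⟨r', h, rfl, rfl⟩; exact ⟨h, rfl⟩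
    · rintro ⟨h, rfl⟩; exact ⟨r, h, rfl, rfl⟩
  rw [lift_cell, lift_cell]
  by_cases h : cell r k ∈ copySet B i
  · obtain ⟨⟨h₁, h₂⟩, rfl⟩ := hmem.1 h
    have h₀ : (r : ℕ) ≠ 0 := by omega
    simp [h, h₀, h₂, hi, sub_eq_zero]
  · rw [if_neg h]
    by_cases hr : (r : ℕ) = 0
    · simp [hr]
    · by_cases hrB : (r : ℕ) ≤ B
      · have hki : k ≠ i := fun hki => h (hmem.2 ⟨⟨by omega, hrB⟩, hki⟩)
        simp [hr, hki]
      · simp [hr, hrB]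

/-- The unitary operations of the pattern. -/
theorem run_block (θ : ℕ → ZMod d → ℝ) {M : Finset (Fin N)} {s : Fin N → ZMod d}
    {Ψ : Basis d N → ℂ} (hΨ : Supported M s Ψ) {q : Op d N} (hu : q.IsUnitary)
    (hq : ∀ c T h, q ≠ .fanout c T h)
    (hacts : Disjoint q.acts M) (hdeps : q.deps ⊆ M) {j : ℕ} (hj : j < B) :
    run θ 0 (block B (q, j)) (emb B M Ψ) = emb B M (q.apply θ s 0 Ψ) ∧
      Supported M s (q.apply θ s 0 Ψ) := by
  cases q with
  | cz i k h =>
    rw [block, run_cons, run_nil, apply_cz, apply_cz]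
    exact ⟨emb_mul B M Ψ fun w => stdAddChar (w i * w k), hΨ.mul _⟩
  | rot a i =>
    have hi : i ∉ M := Finset.disjoint_left.1 hacts (by simp [Op.acts])
    rw [block, run_cons, run_nil, apply_rot, apply_rot, act_emb B hi]
    exact ⟨rfl, hΨ.act hi _⟩
  | fanout c T h => exact absurd rfl (hq c T h)
  | corrX i σ =>
    have hi : i ∉ M := Finset.disjoint_left.1 hacts (by simp [Op.acts])
    have hσ : ∀ k, σ k ≠ 0 → k ∈ M := fun k hk => hdeps (by simp [Op.deps, hk])
    rw [block, run_F B _ hi, run_append, run_corrZ B θ (hΨ.act hi _) hσ hj, run_F B _ hi,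
      run_F B _ hi, run_F B _ hi, run_nil, apply_corrX, act_act, act_act, act_act, act_act,
      ← fourier_conj_pauliZ]
    simp only [Matrix.mul_assoc]
    exact ⟨trivial, hΨ.act hi _⟩
  | corrZ i σ =>
    have hi : i ∉ M := Finset.disjoint_left.1 hacts (by simp [Op.acts])
    have hσ : ∀ k, σ k ≠ 0 → k ∈ M := fun k hk => hdeps (by simp [Op.deps, hk])
    rw [block, run_corrZ B θ hΨ hσ hj, apply_corrZ]
    exact ⟨rfl, hΨ.act hi _⟩
  | measure i a σ τ => simp [Op.IsUnitary, Op.measured] at hu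

/-- The blocks in order are `Z^τ`, then `F³ Z^σ F = X^σ`, then `v(θ)`, then the copying: by
`vGate_measAngle` everything but the measurement itself and an invisible phase. -/
theorem run_block_measure (θ : ℕ → ZMod d → ℝ) {M : Finset (Fin N)} {s : Fin N → ZMod d}
    {Ψ : Basis d N → ℂ} (hΨ : Supported M s Ψ) {i : Fin N} (hi : i ∉ M) (a : ℕ)
    {σ τ : Signal d N} (hσ : ∀ k, σ k ≠ 0 ∨ τ k ≠ 0 → k ∈ M) {j : ℕ} (hj : j < B) :
    run θ 0 (block B (.measure i a σ τ, j)) (emb B M Ψ) =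
      emb B (insert i M) (act i (vGate (angles θ a) * (pauliX (σ.value s) *
        pauliZ (τ.value s))) Ψ) := by
  rw [block, run_append, run_corrZ B θ hΨ (fun k hk => hσ k (.inr hk)) hj, run_F B _ hi,
    run_append, run_corrZ B θ ((hΨ.act hi _).act hi _) (fun k hk => hσ k (.inl hk)) hj,
    run_F B _ hi, run_F B _ hi, run_F B _ hi, run_cons, apply_rot, act_emb B hi, run_copy B _ hi,
    act_act, act_act, act_act, act_act, act_act, act_act, ← fourier_conj_pauliZ]
  simp only [Matrix.mul_assoc]

end Semantics

end Coherent

end QuditComp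

end


set_option linter.unusedSectionVars false

noncomputable section

/-! ### Deferred measurement: supports of the blocks and correctness -/

namespace QuditComp

open Function ZMod StackProg

namespace Coherent

section Semantics

variable {d n N : ℕ} [NeZero d] (B : ℕ)

/-- The rows and columns of the qudits on which the translation of operation `q`, with number `j`,
acts. -/
def Touches (q : Op d N) (j : ℕ) (r : Fin (2 * B + 1)) (k : Fin N) : Prop :=
  (r = 0 ∧ k ∈ q.acts) ∨ r = auxRow B j ∨ (r = copyRow B j ∧ k ∈ q.deps) ∨
    ((0 < (r : ℕ) ∧ (r : ℕ) ≤ B) ∧ k ∈ q.measured)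

theorem mem_acts_corrZ {j : ℕ} (hj : j < B) {i : Fin N} {σ : Signal d N}
    {x : Op d ((2 * B + 1) * N)} (hx : x ∈ corrZ B j i σ) {r : Fin (2 * B + 1)} {k : Fin N}
    (hk : cell r k ∈ x.acts) :
    (r = 0 ∧ k = i) ∨ r = auxRow B j ∨ (r = copyRow B j ∧ σ k ≠ 0) := by
  have hfan : cell r k ∈ (fan B j i : Op d _).acts → (r = 0 ∧ k = i) ∨ r = auxRow B j := by
    intro h
    rcases Finset.mem_insert.1 h with h | h
    · exact .inl (cell_inj.1 h)
    · obtain ⟨k', h⟩ := (mem_auxSet B hj).1 h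
      exact .inr (cell_inj.1 h).1
  rw [corrZ, List.mem_cons, List.mem_append] at hx
  rcases hx with rfl | hx | hx
  · exact (hfan hk).imp_right .inl
  · obtain ⟨m, -, hx⟩ := List.mem_flatMap.1 hx
    obtain ⟨k', -, hx⟩ := List.mem_flatMap.1 hx
    split_ifs at hx with h
    · rw [List.mem_singleton.1 hx] at hk
      simp only [Op.acts, Finset.mem_insert, Finset.mem_singleton, cell_inj] at hk
      rcases hk with ⟨rfl, rfl⟩ | ⟨rfl, rfl⟩
      · exact .inr (.inl rfl)
      · refine .inr (.inr ⟨rfl, fun h0 => ?_⟩)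
        rw [h0, ZMod.val_zero] at h
        exact absurd h.1 (Nat.not_lt_zero _)
    · simp at hx
  · rw [List.eq_of_mem_replicate hx] at hk
    exact (hfan hk).imp_right .inl

theorem touches_of_mem_block {q : Op d N} {j : ℕ} (hj : j < B) {x : Op d ((2 * B + 1) * N)}
    (hx : x ∈ block B (q, j)) {r : Fin (2 * B + 1)} {k : Fin N} (hk : cell r k ∈ x.acts) :
    Touches B q j r k := by
  have hF : ∀ i, cell r k ∈ (F B i : Op d _).acts → r = 0 ∧ k = i := fun i h =>
    cell_inj.1 (Finset.mem_singleton.1 h)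
  cases q with
  | cz i l h =>
    rw [block, List.mem_singleton] at hx
    subst hx
    simp only [Op.acts, main, Finset.mem_insert, Finset.mem_singleton, cell_inj] at hk
    exact .inl ⟨by tauto, by simp [Op.acts]; tauto⟩
  | rot a i =>
    rw [block, List.mem_singleton] at hx
    subst hx
    simp only [Op.acts, main, Finset.mem_singleton, cell_inj] at hk
    exact .inl ⟨hk.1, by simp [Op.acts, hk.2]⟩
  | fanout c T h => simp [block] at hx
  | corrX i σ =>
    simp only [block, List.mem_cons, List.mem_append, List.not_mem_nil, or_false, or_self] at hx
    rcases hx with rfl | hx | rfl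
    · exact .inl ⟨(hF i hk).1, by simp [Op.acts, (hF i hk).2]⟩
    · rcases mem_acts_corrZ B hj hx hk with h | h | h
      · exact .inl ⟨h.1, by simp [Op.acts, h.2]⟩
      · exact .inr (.inl h)
      · exact .inr (.inr (.inl ⟨h.1, by simp [Op.deps, h.2]⟩))
    · exact .inl ⟨(hF i hk).1, by simp [Op.acts, (hF i hk).2]⟩
  | corrZ i σ =>
    rcases mem_acts_corrZ B hj hx hk with h | h | h
    · exact .inl ⟨h.1, by simp [Op.acts, h.2]⟩
    · exact .inr (.inl h)
    · exact .inr (.inr (.inl ⟨h.1, by simp [Op.deps, h.2]⟩))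
  | measure i a σ τ =>
    simp only [block, List.mem_cons, List.mem_append, List.not_mem_nil, or_false] at hx
    have h₁ : r = 0 ∧ k = i → Touches B (.measure i a σ τ : Op d N) j r k := fun h =>
      .inl ⟨h.1, by simp [Op.acts, h.2]⟩
    rcases hx with hx | rfl | hx | rfl | rfl | rfl | rfl | rfl
    · rcases mem_acts_corrZ B hj hx hk with h | h | h
      · exact h₁ h
      · exact .inr (.inl h)
      · exact .inr (.inr (.inl ⟨h.1, by simp [Op.deps, h.2]⟩))
    · exact h₁ (hF i hk)
    · rcases mem_acts_corrZ B hj hx hk with h | h | h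
      · exact h₁ h
      · exact .inr (.inl h)
      · exact .inr (.inr (.inl ⟨h.1, by simp [Op.deps, h.2]⟩))
    · exact h₁ (hF i hk)
    · exact h₁ (hF i hk)
    · exact h₁ (hF i hk)
    · exact h₁ (cell_inj.1 (Finset.mem_singleton.1 hk))
    · rcases Finset.mem_insert.1 hk with h | h
      · exact h₁ (cell_inj.1 h)
      · simp only [copySet, Finset.mem_filter, Finset.mem_univ, true_and, cell_inj] at h
        obtain ⟨r', h, rfl, rfl⟩ := h
        exact .inr (.inr (.inr ⟨h, by simp [Op.measured]⟩))

theorem isFanoutGate_block {q : Op d N} {j : ℕ} {x : Op d ((2 * B + 1) * N)}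
    (hx : x ∈ block B (q, j)) : x.IsFanoutGate := by
  have hZ : ∀ i σ, x ∈ corrZ B j i σ → x.IsFanoutGate := by
    intro i σ hx
    rw [corrZ, List.mem_cons, List.mem_append] at hx
    rcases hx with rfl | hx | hx
    · trivial
    · obtain ⟨m, -, hx⟩ := List.mem_flatMap.1 hx
      obtain ⟨k', -, hx⟩ := List.mem_flatMap.1 hx
      split_ifs at hx
      · rw [List.mem_singleton.1 hx]; trivial
      · simp at hx
    · rw [List.eq_of_mem_replicate hx]; trivial
  cases q <;> simp only [block, List.mem_cons, List.mem_append, List.not_mem_nil, or_false,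
    or_self] at hx
  · rw [hx]; trivial
  · rw [hx]; trivial
  · rcases hx with rfl | hx | rfl
    exacts [trivial, hZ _ _ hx, trivial]
  · exact hZ _ _ hx
  · rcases hx with hx | rfl | hx | rfl | rfl | rfl | rfl | rfl
    exacts [hZ _ _ hx, trivial, hZ _ _ hx, trivial, trivial, trivial, trivial, trivial]

theorem measured_of_isFanoutGate {q : Op d N} (h : q.IsFanoutGate) : q.measured = ∅ := by
  cases q <;> first | rfl | exact absurd h id

theorem deps_of_isFanoutGate {q : Op d N} (h : q.IsFanoutGate) : q.deps = ∅ := by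
  cases q <;> first | rfl | exact absurd h id

/-- The output qudits in the circuit. -/
def mainEmb (out : Fin n ↪ Fin N) : Fin n ↪ Fin ((2 * B + 1) * N) :=
  out.trans ⟨main B, main_injective B⟩

theorem lift_injective (M : Finset (Fin N)) : Injective (lift B M : Basis d N → _) := fun w w' h =>
  funext fun k => by rw [← lift_main B M w, h, lift_main]

theorem relabel_lift {M : Finset (Fin N)} {out : Fin n ↪ Fin N} (hout : ∀ a, out a ∉ M)
    (w : Basis d N) (y : Basis d n) :
    relabel (mainEmb B out) (lift B M w) y = lift B M (relabel out w y) := by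
  funext x
  by_cases hx : ∃ a, mainEmb B out a = x
  · obtain ⟨a, rfl⟩ := hx
    rw [relabel_out]
    change _ = lift B M _ (main B (out a))
    rw [lift_main, relabel_out]
  · rw [not_exists] at hx
    rw [relabel_of_ne _ _ _ hx]
    obtain ⟨r, k, rfl⟩ := exists_eq_cell x
    rw [lift_cell, lift_cell]
    have hk : (r : ℕ) = 0 ∨ k ∈ M → relabel out w y k = w k := by
      intro h
      refine relabel_of_ne _ _ _ fun a ha => ?_
      subst ha
      rcases h with h | h
      · exact hx a (by change cell 0 _ = _; rw [cell_inj]; exact ⟨Fin.ext h.symm, rfl⟩)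
      · exact hout a h
    split_ifs with h₁ h₂
    · rw [hk (.inl h₁)]
    · rw [hk (.inr h₂.2)]
    · rfl

/-- Labels not of the form `lift` have amplitude `0`. Outputs are not measured and so have no
copies, hence relabelling the outputs commutes with `lift`, and the other added qudits are simply
traced out. -/
theorem reducedState_emb {M : Finset (Fin N)} {out : Fin n ↪ Fin N} (hout : ∀ a, out a ∉ M)
    (Ψ : Basis d N → ℂ) :
    reducedState (mainEmb B out) (emb B M Ψ) = reducedState out Ψ := by
  ext x y
  rw [reducedState_apply, reducedState_apply]
  rw [← Finset.sum_subset (Finset.subset_univ (Finset.univ.image (lift B M : Basis d N → _)))]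
  · rw [Finset.sum_image fun w _ w' _ h => lift_injective B M h]
    refine Finset.sum_congr rfl fun w _ => ?_
    rw [relabel_lift B hout, emb_lift, emb_lift]
    exact if_congr (forall_congr' fun a => by
      change lift B M w (main B (out a)) = _ ↔ _
      rw [lift_main]) rfl rfl
  · intro z _ hz
    have : emb B M Ψ z = 0 := if_neg fun h => hz (Finset.mem_image.2 ⟨_, Finset.mem_univ _, h.symm⟩)
    rw [this, zero_mul, ite_self]

theorem initialState_emb (inp : Fin n ↪ Fin N) (ψ : Basis d n → ℂ) :
    initialState (mainEmb B inp) ketZero ψ = emb B ∅ (initialState inp ketZero ψ) := by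
  have hprod : ∀ {m : ℕ} (J : Finset (Fin m)) (x : Fin m → ZMod d),
      ∏ i ∈ J, (ketZero : ZMod d → ℂ) (x i) = if ∀ i ∈ J, x i = 0 then 1 else 0 := by
    intro m J x
    simp only [ketZero, Pi.single_apply]
    split_ifs with h
    · exact Finset.prod_eq_one fun i hi => if_pos (h i hi)
    · push Not at h
      obtain ⟨i, hi, hne⟩ := h
      exact Finset.prod_eq_zero hi (if_neg hne)
  funext z
  simp only [initialState, emb, hprod, mul_ite, mul_one, mul_zero, ← ite_and]
  refine if_congr ?_ rfl rfl
  simp only [Finset.mem_filter, Finset.mem_univ, true_and]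
  constructor
  · intro h
    refine ⟨funext fun x => ?_, fun i hi => h _ fun a ha => hi a (main_injective B ha)⟩
    obtain ⟨r, k, rfl⟩ := exists_eq_cell x
    rw [lift_cell]
    split_ifs with hr hM
    · rw [main, show r = 0 from Fin.ext hr]
    · simp at hM
    · refine h _ fun a ha => hr ?_
      change cell 0 _ = _ at ha
      rw [← (cell_inj.1 ha).1]
      rfl
  · rintro ⟨h₁, h₂⟩ x hx
    obtain ⟨r, k, rfl⟩ := exists_eq_cell x
    by_cases hr : (r : ℕ) = 0
    · obtain rfl : r = 0 := Fin.ext hr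
      exact h₂ k fun a ha => hx a (by change cell 0 _ = _; rw [ha])
    · rw [h₁, lift_cell, if_neg hr, if_neg (by simp)]

/-- The circuit computes the final state of the pattern. -/
theorem finalState_eq (θ : ℕ → ZMod d → ℝ) (out : Fin n ↪ Fin N) :
    ∀ (qs : List (Op d N)) (j : ℕ) (M : Finset (Fin N)) (s : Fin N → ZMod d) (Ψ : Basis d N → ℂ),
      (∀ q ∈ qs, ∀ c T h, q ≠ Op.fanout c T h) → j + qs.length ≤ B → Executable out M qs →
      Supported M s Ψ →
      finalState θ out qs s Ψ =
        reducedState (mainEmb B out) (run θ 0 ((qs.zipIdx j).flatMap (block B)) (emb B M Ψ))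
  | [], j, M, s, Ψ, _, _, hM, _ => by
    rw [finalState_nil, List.zipIdx_nil, List.flatMap_nil, run_nil, reducedState_emb B hM]
  | q :: qs, j, M, s, Ψ, hq, hj, hex, hΨ => by
    rw [List.length_cons] at hj
    obtain ⟨hacts, hdeps, hex'⟩ := hex
    have ih := finalState_eq θ out qs (j + 1)
    have hqs : ∀ q ∈ qs, ∀ c T h, q ≠ Op.fanout c T h := fun q h => hq q (List.mem_cons_of_mem _ h)
    rw [List.zipIdx_cons, List.flatMap_cons, run_append]
    by_cases hu : q.IsUnitary
    · obtain ⟨h₁, h₂⟩ := run_block B θ hΨ hu (hq q List.mem_cons_self) hacts hdeps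
        (by omega : j < B)
      rw [finalState_cons _ _ hu, h₁]
      rw [show q.measured = ∅ from hu, Finset.union_empty] at hex'
      exact ih M s _ hqs (by omega) hex' h₂
    · cases q with
      | measure i a σ τ =>
        have hi : i ∉ M := Finset.disjoint_left.1 hacts (by simp [Op.acts])
        have hM : M ∪ (Op.measure i a σ τ).measured = insert i M := by
          rw [Op.measured, Finset.union_comm]; rfl
        rw [hM] at hex'
        rw [run_block_measure B θ hΨ hi a (fun k hk => hdeps (by simpa [Op.deps] using hk))
          (by omega : j < B), finalState_measure]
        have hout : ∀ b, mainEmb B out b ≠ main B i := fun b hb => by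
          have := (executable_iff.1 hex').2 b
          rw [main_injective B hb] at this
          simp at this
        -- The circuit does not measure, but a complete measurement of a traced-out qudit may be
        -- inserted after its last gate.
        rw [← sum_reducedState_act_single hout]
        refine Finset.sum_congr rfl fun k _ => ?_
        -- The state left behind is chosen to be `|k⟩` for outcome `k`, so that label, copies and
        -- recorded outcome coincide.
        rw [finalState_act_measProj θ hex' (Finset.mem_insert_self _ _) _ _ _ _ k,
          vGate_measAngle, finalState_act_single_smul]
        have hS : Supported (insert i M) (update s i k) (act i (Matrix.single k k 1)
            (act i (vGate (angles θ a) * (pauliX (σ.value s) * pauliZ (τ.value s))) Ψ)) := by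
          intro w hw l hl
          rcases Finset.mem_insert.1 hl with rfl | hl
          · rw [act_single] at hw
            rw [update_self]
            by_contra h
            exact hw (if_neg h)
          · rw [update_of_ne (ne_of_mem_of_not_mem hl hi)]
            exact ((hΨ.act hi _).act hi _) w hw l hl
        -- The inserted projection is moved back in front of the remaining gates, where it turns the
        -- state into the one belonging to outcome `k`.
        rw [ih _ _ _ hqs (by omega) hex' hS, ← run_act]
        · congr 2
          rw [act_single, act_single]
          funext z
          simp only [emb]
          split_ifs <;> rfl
        -- No later block reaches qudit `i` in row `0`: its own copies and auxiliary qudits lie in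
        -- other rows, and its operation does not act on a measured qudit.
        · intro x hx hmem
          obtain ⟨⟨q, j'⟩, hq', hx⟩ := List.mem_flatMap.1 hx
          have hj' := List.mem_zipIdx hq'
          have hqm : q ∈ qs := by
            have := List.mem_map_of_mem (f := Prod.fst) hq'
            rwa [List.zipIdx_map_fst] at this
          have hb := Finset.disjoint_left.1 ((executable_iff.1 hex').1.disjoint_acts q hqm)
            (Finset.mem_insert_self i M)
          rcases touches_of_mem_block B (by omega) hx hmem with h | h | h | h
          · exact hb h.2
          · have := congrArg Fin.val h
            rw [val_auxRow B (by omega), Fin.val_zero] at this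
            omega
          · have := congrArg Fin.val h.1
            rw [val_copyRow B (by omega), Fin.val_zero] at this
            omega
          · simp at h
      | _ => exact absurd rfl hu

end Semantics

end Coherent

end QuditComp

end


set_option linter.unusedSectionVars false

noncomputable section

/-! ### Deferred measurement: depth and description of the circuit -/

namespace QuditComp

open Function ZMod StackProg

theorem ChainLE.flatMap {d N : ℕ} {β : Type*} {blk : β → List (Op d N)} {C : ℕ} {bs : List β}
    (h : ∀ b ∈ bs, ChainLE (blk b) C) : ChainLE (bs.flatMap blk) (bs.length * C) := by
  induction bs with
  | nil => rw [List.length_nil, zero_mul]; exact chainLE_nil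
  | cons b bs ih =>
    rw [List.flatMap_cons, List.length_cons, add_one_mul, add_comm]
    exact (h b List.mem_cons_self).append (ih fun b hb => h b (List.mem_cons_of_mem _ hb))

namespace Coherent

variable {d n : ℕ} [NeZero d]

/-- The translation of a measurement pattern to a circuit. -/
def translate (Q : Computation d n) : Computation d n where
  N := (2 * Q.code.length + 1) * Q.N
  inp := mainEmb Q.code.length Q.inp
  out := mainEmb Q.code.length Q.out
  ops := Q.ops.zipIdx.flatMap (block Q.code.length)

theorem isFanoutGate_translate (Q : Computation d n) :
    ∀ q ∈ (translate Q).ops, q.IsFanoutGate := fun q hq => by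
  obtain ⟨⟨q', j⟩, -, hq⟩ := List.mem_flatMap.1 hq
  exact isFanoutGate_block _ hq

theorem implements_translate {Q : Computation d n} {θ : ℕ → ZMod d → ℝ}
    {U : Matrix (Basis d n) (Basis d n) ℂ} (hQ : ∀ q ∈ Q.ops, ∀ c T h, q ≠ Op.fanout c T h)
    (h : Q.Implements θ ketZero U) : (translate Q).Implements θ ketZero U := by
  have hm : ∀ q ∈ (translate Q).ops, q.IsUnitary := fun q hq =>
    measured_of_isFanoutGate (isFanoutGate_translate Q q hq)
  refine ⟨executable_iff.2 ⟨.of_forall fun q hq => ⟨Finset.disjoint_empty_right _, ?_, hm q hq⟩,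
    fun i => ?_⟩, fun ψ => ?_⟩
  · rw [deps_of_isFanoutGate (isFanoutGate_translate Q q hq)]
  · rw [measuredIn_eq_empty hm]
    simp
  · rw [← h.2 ψ, finalState_eq Q.code.length θ Q.out Q.ops 0 ∅ 0 _ hQ
      (by simpa using length_ops_le Q) h.1 (fun w _ k hk => by simp at hk), ← initialState_emb]
    have := finalState_append θ (translate Q).out hm [] 0
      (initialState (translate Q).inp ketZero ψ)
    rw [List.append_nil, finalState_nil] at this
    exact this

/-- One fan-out, at most `d - 1` rounds of `CZ` gates on disjoint pairs, and `d - 1` fan-outs to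
undo the first. -/
theorem chainLE_corrZ {N : ℕ} (B j : ℕ) (i : Fin N) (σ : Signal d N) :
    ChainLE (corrZ B j i σ) (1 + ((d - 1) + (d - 1))) := by
  refine (chainLE_length [fan B j i]).append (.append ?_ ?_)
  · have := ChainLE.flatMap (C := 1) (bs := List.range (d - 1)) (blk := fun r =>
      (List.finRange N).flatMap fun k => if h : r < (σ k).val ∧ auxRow B j ≠ copyRow B j
        then [(.cz (cell (auxRow B j) k) (cell (copyRow B j) k) (fun e => h.2 (cell_inj.1 e).1) :
          Op d ((2 * B + 1) * N))]
        else []) fun r _ => ?_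
    · rwa [List.length_range, mul_one] at this
    · refine chainLE_flatMap (fun k _ => ?_) ((List.nodup_finRange N).imp fun {k k'} hk x hx y hy => ?_)
      · split_ifs
        exacts [chainLE_length _, chainLE_nil.mono zero_le_one]
      · split_ifs at hx hy with h₁ h₂
        all_goals first | simp at hx; done | skip
        all_goals first | simp at hy; done | skip
        rw [List.mem_singleton] at hx hy
        subst hx hy
        rintro (⟨z, hz, hz'⟩ | ⟨z, hz, -⟩)
        · simp only [Op.acts, Finset.mem_insert, Finset.mem_singleton] at hz hz'
          rcases hz with rfl | rfl <;> simp only [cell_inj] at hz' <;> tauto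
        · simp [Op.measured] at hz
  · have := chainLE_length (List.replicate (d - 1) (fan B j i : Op d ((2 * B + 1) * N)))
    rwa [List.length_replicate] at this

/-- The longest case is a measurement: two corrections of depth `2d - 1`, one Fourier gate between
them and five gates after them, `4d + 4` in all. -/
theorem chainLE_block {N : ℕ} (B : ℕ) (b : Op d N × ℕ) :
    ChainLE (block B b) (4 * d + 8) := by
  have hd := NeZero.one_le (n := d)
  obtain ⟨q, j⟩ := b
  have h₁ : ∀ {l l' : List (Op d ((2 * B + 1) * N))} {C C' : ℕ}, ChainLE l C → ChainLE l' C' →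
      C + C' ≤ 4 * d + 8 → ChainLE (l ++ l') (4 * d + 8) := fun h h' hC => (h.append h').mono hC
  cases q with
  | cz i k h => exact (chainLE_length _).mono (by simp [block])
  | rot a i => exact (chainLE_length _).mono (by simp [block])
  | fanout c T h => exact chainLE_nil.mono (Nat.zero_le _)
  | corrX i σ =>
    refine ((chainLE_length [F B i]).append ((chainLE_corrZ B j i σ).append
      (chainLE_length _))).mono ?_
    simp only [List.length_cons, List.length_nil]
    omega
  | corrZ i σ => exact (chainLE_corrZ B j i σ).mono (by omega)
  | measure i a σ τ =>
    refine ((chainLE_corrZ B j i τ).append ((chainLE_length [F B i]).append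
      ((chainLE_corrZ B j i σ).append (chainLE_length _)))).mono ?_
    simp only [List.length_cons, List.length_nil]
    omega

/-- Two blocks can meet in row `0`, where both operations act on the same qudit, or in the rows of
copies. There the earlier operation measures the qudit and the later one depends on it or measures
it too. The auxiliary rows belong to one operation each. -/
theorem depth_translate {Q : Computation d n} (h : Executable Q.out ∅ Q.ops) :
    (translate Q).depth ≤ (4 * d + 8) * Q.depth + (4 * d + 8) := by
  refine (depth_le (chainLE_blocks (fun b _ => chainLE_block _ b) ?_)).trans (Nat.le_add_right _ _)
  refine (pairwise_zipIdx (executable_iff.1 h).1.pairwise).imp ?_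
  rintro ⟨a, j⟩ ⟨b, j'⟩ ⟨hab, hj, hj'⟩ x hx y hy hxy
  have hB := length_ops_le Q
  simp only at hab hj hj'
  have hma : ∀ {q : Op d Q.N} {k}, k ∈ q.measured → k ∈ q.acts := by
    intro q k hk
    cases q <;> simp_all [Op.measured, Op.acts]
  rcases hxy with ⟨z, hz, hz'⟩ | ⟨z, hz, -⟩
  · obtain ⟨r, k, rfl⟩ := exists_eq_cell z
    have h₁ := touches_of_mem_block _ (by omega : j < Q.code.length) hx hz
    have h₂ := touches_of_mem_block _ (by omega : j' < Q.code.length) hy hz'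
    simp only [Touches, Fin.ext_iff, val_auxRow Q.code.length (by omega : j < Q.code.length),
      val_auxRow Q.code.length (by omega : j' < Q.code.length),
      val_copyRow Q.code.length (by omega : j < Q.code.length),
      val_copyRow Q.code.length (by omega : j' < Q.code.length), Fin.val_zero] at h₁ h₂
    rcases h₁ with ⟨hr, h₁⟩ | hr | ⟨hr, h₁⟩ | ⟨hr, h₁⟩ <;>
    rcases h₂ with ⟨hr', h₂⟩ | hr' | ⟨hr', h₂⟩ | ⟨hr', h₂⟩ <;>
    -- The first alternative excludes rows that cannot coincide. The last one is an earlier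
    -- operation using a copy of an outcome still to be measured, which executability forbids.
    first
    | omega
    | exact .inl ⟨k, h₁, h₂⟩
    | exact .inr ⟨k, h₁, h₂⟩
    | exact .inl ⟨k, hma h₁, hma h₂⟩
    | exact absurd (hma h₂) (Finset.disjoint_left.1 hab h₁)
  · rw [measured_of_isFanoutGate (isFanoutGate_block _ hx)] at hz
    simp at hz

/-! ## The translation of descriptions -/

/-- The description of `fan`. -/
def fanCode (A : List ℕ) (j i : ℕ) : List ℕ :=
  [2, i] ++ (List.range (2 * A.length + 1)).flatMap fun r => (List.range (A.getD 0 0)).flatMap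
    fun _ => [if r = A.length + 1 + j then 1 else 0]

/-- The description of `corrZ`, where the coefficients are found from entry `o` on. -/
def corrZCode (d : ℕ) (A : List ℕ) (j i o : ℕ) : List ℕ :=
  fanCode A j i ++ (((List.range (d - 1)).flatMap fun r => (List.range (A.getD 0 0)).flatMap fun k =>
    if r < field A j (o + k) then
      [0, k + A.getD 0 0 * (A.length + 1 + j), k + A.getD 0 0 * (1 + j)] else []) ++
    (List.range (d - 1)).flatMap fun _ => fanCode A j i)

/-- The description of the Fourier gate. -/
def FCode (i : ℕ) : List ℕ := [1, 0, i]

/-- The description of the fan-out gate which copies an outcome. -/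
def copyCode (A : List ℕ) (i : ℕ) : List ℕ :=
  [2, i] ++ (List.range (2 * A.length + 1)).flatMap fun r => (List.range (A.getD 0 0)).flatMap
    fun k => [if 0 < r then if r < A.length + 1 then if k = i then 1 else 0 else 0 else 0]

/-- The description of `block`. -/
def blockCode (d : ℕ) (A : List ℕ) (j : ℕ) : List ℕ :=
  if field A j 0 = 0 then [0, field A j 1, field A j 2] else
  if field A j 0 = 1 then [1, field A j 1, field A j 2] else
  if field A j 0 = 2 then [] else
  if field A j 0 = 3 then
    FCode (field A j 1) ++ (corrZCode d A j (field A j 1) 2 ++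
      (FCode (field A j 1) ++ (FCode (field A j 1) ++ FCode (field A j 1)))) else
  if field A j 0 = 4 then corrZCode d A j (field A j 1) 2 else
    corrZCode d A j (field A j 1) (3 + A.getD 0 0) ++ (FCode (field A j 1) ++
      (corrZCode d A j (field A j 1) 3 ++
      (FCode (field A j 1) ++ (FCode (field A j 1) ++ (FCode (field A j 1) ++
        ([1, field A j 2, field A j 1] ++ copyCode A (field A j 1)))))))

/-- The description of `translate`. -/
def translateCode (d : ℕ) (A : List ℕ) : List ℕ :=
  [(2 * A.length + 1) * A.getD 0 0, A.getD 1 0] ++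
    (((List.range (2 * A.getD 1 0)).flatMap fun i => [A.getD (2 + i) 0]) ++
    (List.range A.length).flatMap fun j =>
      if opPos A j < A.length then blockCode d A j else [])

theorem polyList_fanCode {Γ : Type} [LawfulCtx Γ] {j i : Γ → ℕ} (hj : PolyFun j) (hi : PolyFun i) :
    PolyList fun c => fanCode (Ctx.arr c) (j c) (i c) := by
  have h₁ : PolyFun fun c : Γ => 2 * (Ctx.arr c).length + 1 :=
    ((PolyFun.const 2).mul .len).add (.const 1)
  have h₂ : PolyFun fun c : (Γ × ℕ) × ℕ =>
      if c.1.2 = (Ctx.arr c.1.1).length + 1 + j c.1.1 then 1 else 0 :=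
    .ite_eq (PolyFun.snd.fst) ((PolyFun.len.add (.const 1)).add hj.fst.fst) (.const 1) (.const 0)
  have h₃ : PolyList fun c : Γ × ℕ => (List.range ((Ctx.arr c.1).getD 0 0)).flatMap
      fun _ => [if c.2 = (Ctx.arr c.1).length + 1 + j c.1 then 1 else 0] :=
    .flatMap (PolyFun.entry 0) (.single h₂)
  exact .append (.cons (.const 2) (.single hi)) (.flatMap h₁ h₃)

theorem polyList_corrZCode (d : ℕ) {Γ : Type} [LawfulCtx Γ] {j i o : Γ → ℕ} (hj : PolyFun j)
    (hi : PolyFun i) (ho : PolyFun o) :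
    PolyList fun c => corrZCode d (Ctx.arr c) (j c) (i c) (o c) := by
  have hN : ∀ {Γ : Type} [LawfulCtx Γ], PolyFun fun c : Γ => (Ctx.arr c).getD 0 0 := .entry 0
  have h₁ : PolyFun fun c : (Γ × ℕ) × ℕ => field (Ctx.arr c.1.1) (j c.1.1) (o c.1.1 + c.2) :=
    PolyFun.field hj.fst.fst (ho.fst.fst.add .snd)
  have h₂ : PolyFun fun c : (Γ × ℕ) × ℕ => c.2 + (Ctx.arr c.1.1).getD 0 0 *
      ((Ctx.arr c.1.1).length + 1 + j c.1.1) :=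
    PolyFun.snd.add (.mul hN ((PolyFun.len.add (.const 1)).add hj.fst.fst))
  have h₃ : PolyFun fun c : (Γ × ℕ) × ℕ => c.2 + (Ctx.arr c.1.1).getD 0 0 * (1 + j c.1.1) :=
    PolyFun.snd.add (.mul hN ((PolyFun.const 1).add hj.fst.fst))
  have h₄ : PolyList fun c : Γ × ℕ => (List.range ((Ctx.arr c.1).getD 0 0)).flatMap fun k =>
      if c.2 < field (Ctx.arr c.1) (j c.1) (o c.1 + k) then
        [0, k + (Ctx.arr c.1).getD 0 0 * ((Ctx.arr c.1).length + 1 + j c.1),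
          k + (Ctx.arr c.1).getD 0 0 * (1 + j c.1)] else [] :=
    .flatMap (PolyFun.entry 0) (.ite_lt PolyFun.snd.fst h₁
      (.cons (.const 0) (.cons h₂ (.single h₃))) .nil)
  exact (polyList_fanCode hj hi).append ((PolyList.flatMap (.const (d - 1)) h₄).append
    (PolyList.flatMap (.const (d - 1)) (polyList_fanCode hj.fst hi.fst)))

theorem polyList_copyCode {Γ : Type} [LawfulCtx Γ] {i : Γ → ℕ} (hi : PolyFun i) :
    PolyList fun c => copyCode (Ctx.arr c) (i c) := by
  have h₁ : PolyFun fun c : Γ => 2 * (Ctx.arr c).length + 1 :=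
    ((PolyFun.const 2).mul .len).add (.const 1)
  have h₂ : PolyFun fun c : (Γ × ℕ) × ℕ => if c.2 = i c.1.1 then 1 else 0 :=
    .ite_eq .snd hi.fst.fst (.const 1) (.const 0)
  have h₃ : PolyFun fun c : (Γ × ℕ) × ℕ => if 0 < c.1.2 then
      if c.1.2 < (Ctx.arr c.1.1).length + 1 then if c.2 = i c.1.1 then 1 else 0 else 0 else 0 :=
    .ite_lt (.const 0) PolyFun.snd.fst (.ite_lt PolyFun.snd.fst (PolyFun.len.add (.const 1)) h₂
      (.const 0)) (.const 0)
  have h₄ : PolyList fun c : Γ × ℕ => (List.range ((Ctx.arr c.1).getD 0 0)).flatMap fun k =>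
      [if 0 < c.2 then if c.2 < (Ctx.arr c.1).length + 1 then if k = i c.1 then 1 else 0 else 0
        else 0] := .flatMap (PolyFun.entry 0) (.single h₃)
  exact .append (.cons (.const 2) (.single hi)) (.flatMap h₁ h₄)

theorem polyList_FCode {Γ : Type} [LawfulCtx Γ] {i : Γ → ℕ} (hi : PolyFun i) :
    PolyList fun c => FCode (i c) := .cons (.const 1) (.cons (.const 0) (.single hi))

theorem polyList_blockCode (d : ℕ) {Γ : Type} [LawfulCtx Γ] {j : Γ → ℕ} (hj : PolyFun j) :
    PolyList fun c => blockCode d (Ctx.arr c) (j c) := by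
  have h₀ := PolyFun.field hj (.const 0)
  have h₁ := PolyFun.field hj (.const 1)
  have h₂ := PolyFun.field hj (.const 2)
  have hF := polyList_FCode h₁
  have hZ : ∀ {o : Γ → ℕ}, PolyFun o → _ := fun {o} => polyList_corrZCode d (o := o) hj h₁
  exact .ite_eq h₀ (.const 0) (.cons (.const 0) (.cons h₁ (.single h₂))) <|
    .ite_eq h₀ (.const 1) (.cons (.const 1) (.cons h₁ (.single h₂))) <|
    .ite_eq h₀ (.const 2) .nil <|
    .ite_eq h₀ (.const 3) (hF.append ((hZ (.const 2)).append (hF.append (hF.append hF)))) <|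
    .ite_eq h₀ (.const 4) (hZ (.const 2)) <|
    (hZ ((PolyFun.const 3).add (.entry 0))).append <| hF.append <| (hZ (.const 3)).append <|
    hF.append <| hF.append <| hF.append <|
    .append (.cons (.const 1) (.cons h₂ (.single h₁))) (polyList_copyCode h₁)

theorem polyList_translateCode (d : ℕ) : PolyList (translateCode d) := by
  have h₁ : PolyFun fun A : List ℕ => (2 * A.length + 1) * A.getD 0 0 :=
    (((PolyFun.const 2).mul PolyFun.len).add (.const 1)).mul (PolyFun.entry 0)
  have h₂ : PolyFun fun A : List ℕ => A.getD 1 0 := PolyFun.entry 1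
  have h₃ : PolyFun fun c : List ℕ × ℕ => c.1.getD (2 + c.2) 0 :=
    PolyFun.get ((PolyFun.const 2).add PolyFun.snd)
  have h₄ : PolyList fun c : List ℕ × ℕ =>
      if opPos c.1 c.2 < c.1.length then blockCode d c.1 c.2 else [] :=
    .ite_lt (PolyFun.opPos PolyFun.snd) PolyFun.len (polyList_blockCode d PolyFun.snd) .nil
  exact .append (.cons h₁ (.single h₂)) (.append (.flatMap ((PolyFun.const 2).mul h₂) (.single h₃))
    (.flatMap PolyFun.len h₄))

theorem code_fan (Q : Computation d n) {j : ℕ} (hj : j < Q.code.length) (i : Fin Q.N) :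
    (fan Q.code.length j i : Op d _).code = fanCode Q.code j i := by
  rw [fan, Op.code, fanCode, getD_zero_code]
  congr 1
  refine ofFn_cell (g := fun r _ => if r = Q.code.length + 1 + j then 1 else 0) fun r k => ?_
  refine if_congr ?_ rfl rfl
  rw [mem_auxSet _ hj, ← val_auxRow _ hj, ← Fin.ext_iff]
  simp

theorem code_corrZ (Q : Computation d n) {j : ℕ} (hj : j < Q.code.length) (i : Fin Q.N)
    (σ : Signal d Q.N) {o : ℕ} (ho : ∀ k : Fin Q.N, field Q.code j (o + k) = (σ k).val) :
    (corrZ Q.code.length j i σ).flatMap Op.code = corrZCode d Q.code j i o := by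
  rw [corrZ, List.flatMap_cons, List.flatMap_append, code_fan Q hj, corrZCode, getD_zero_code,
    List.flatMap_assoc]
  congr 2
  · refine List.flatMap_congr fun r _ => ?_
    rw [List.flatMap_assoc]
    refine flatMap_finRange fun k => ?_
    have hne : auxRow Q.code.length j ≠ copyRow Q.code.length j := fun h => by
      have := congrArg Fin.val h
      rw [val_auxRow _ hj, val_copyRow _ hj] at this
      omega
    rw [ho]
    by_cases h : r < (σ k).val
    · rw [dif_pos ⟨h, hne⟩, if_pos h]
      simp [Op.code, val_cell, val_auxRow _ hj, val_copyRow _ hj]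
    · rw [dif_neg fun h' => h h'.1, if_neg h]
      rfl
  · rw [← code_fan Q hj]
    generalize fan Q.code.length j i = q
    induction d - 1 with
    | zero => rfl
    | succ m ih =>
      rw [List.replicate_succ, List.flatMap_cons, ih, List.range_succ_eq_map, List.flatMap_cons,
        List.flatMap_map]

theorem code_block (Q : Computation d n) {j : ℕ} {q : Op d Q.N} (h : Q.ops[j]? = some q) :
    (block Q.code.length (q, j)).flatMap Op.code = blockCode d Q.code j := by
  have hj : j < Q.code.length := by
    obtain ⟨hj, -⟩ := List.getElem?_eq_some_iff.1 h
    exact hj.trans_le (length_ops_le Q)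
  have hfield : ∀ r < q.code.length, field Q.code j r = q.code.getD r 0 := fun r => field_eq Q h
  have h₀ := hfield 0 q.length_code_pos
  rw [blockCode, h₀]
  have hF : ∀ i : Fin Q.N, (F Q.code.length i : Op d _).code = FCode i := fun i => by
    simp [F, Op.code, FCode, main, val_cell]
  cases q with
  | cz i k e =>
    have h₁ := hfield 1 (by simp [Op.code])
    have h₂ := hfield 2 (by simp [Op.code])
    rw [h₁, h₂]
    simp [block, Op.code, main, val_cell]
  | rot a i =>
    have h₁ := hfield 1 (by simp [Op.code])
    have h₂ := hfield 2 (by simp [Op.code])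
    rw [h₁, h₂]
    simp [block, Op.code, main, val_cell]
  | fanout c T e => simp [block, Op.code]
  | corrX i σ =>
    have h₁ := hfield 1 (by simp [Op.code])
    have h₂ : ∀ k : Fin Q.N, field Q.code j (2 + k) = (σ k).val := fun k => by
      rw [hfield _ (by simp [Op.code]; omega), add_comm 2]
      simp [Op.code]
    rw [h₁]
    simp only [block, List.flatMap_cons, List.flatMap_append, List.flatMap_nil, List.append_nil, hF,
      code_corrZ Q hj i σ h₂]
    simp [Op.code]
  | corrZ i σ =>
    have h₁ := hfield 1 (by simp [Op.code])
    have h₂ : ∀ k : Fin Q.N, field Q.code j (2 + k) = (σ k).val := fun k => by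
      rw [hfield _ (by simp [Op.code]; omega), add_comm 2]
      simp [Op.code]
    rw [h₁]
    simp only [block, code_corrZ Q hj i σ h₂]
    simp [Op.code]
  | measure i a σ τ =>
    have h₁ := hfield 1 (by simp [Op.code])
    have h₂ := hfield 2 (by simp [Op.code])
    have h₃ : ∀ k : Fin Q.N, field Q.code j (3 + k) = (σ k).val := fun k => by
      rw [hfield _ (by simp [Op.code]; omega), add_comm 3]
      simp only [Op.code, List.getD_eq_getElem?_getD, List.cons_append, List.nil_append,
        List.getElem?_cons_succ]
      rw [List.getElem?_append_left (by simp)]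
      simp
    have h₄ : ∀ k : Fin Q.N, field Q.code j (3 + Q.N + k) = (τ k).val := fun k => by
      rw [hfield _ (by simp [Op.code]; omega), show 3 + Q.N + (k : ℕ) = Q.N + k + 3 by ring]
      simp [Op.code, List.getD_eq_getElem?_getD]
    have h₅ : (Op.fanout (main Q.code.length i) (copySet Q.code.length i)
        (main_notMem_copySet _ i i) : Op d _).code = copyCode Q.code i := by
      rw [Op.code, copyCode, getD_zero_code]
      congr 1
      refine ofFn_cell (g := fun r k => if 0 < r then if r < Q.code.length + 1 then
        if k = (i : ℕ) then 1 else 0 else 0 else 0) fun r k => ?_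
      simp only [copySet, Finset.mem_filter, Finset.mem_univ, true_and, cell_inj, ← ite_and]
      refine if_congr ?_ rfl rfl
      constructor
      · rintro ⟨r', hr, e, e'⟩
        rw [e, e']
        exact ⟨hr.1, Nat.lt_succ_iff.2 hr.2, rfl⟩
      · rintro ⟨h, h', h''⟩; exact ⟨r, ⟨h, Nat.lt_succ_iff.1 h'⟩, rfl, Fin.ext h''⟩
    rw [h₁, h₂]
    simp only [block, List.flatMap_cons, List.flatMap_append, List.flatMap_nil, List.append_nil, hF,
      code_corrZ Q hj i σ h₃, code_corrZ Q hj i τ h₄, h₅, getD_zero_code]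
    simp [Op.code, main, val_cell]

/-- Qudits in row `0` keep their numbers, so the lists of inputs and outputs are copied verbatim. -/
theorem code_translate (Q : Computation d n) : (translate Q).code = translateCode d Q.code := by
  rw [translateCode, flatMap_range_ops Q (H := fun b => (block Q.code.length b).flatMap Op.code)
    (fun j q h => (code_block Q h).symm), getD_zero_code, getD_one_code,
    flatMap_copy _ _ _ (by simp [Computation.code]; omega)]
  have : List.take (2 * n) (List.drop 2 Q.code) =
      (List.ofFn fun a => (Q.inp a : ℕ)) ++ (List.ofFn fun a => (Q.out a : ℕ)) := by
    rw [Computation.code]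
    simp only [List.append_assoc]
    change List.take _ ((List.ofFn fun a => (Q.inp a : ℕ)) ++
      ((List.ofFn fun a => (Q.out a : ℕ)) ++ Q.ops.flatMap Op.code)) = _
    rw [← List.append_assoc, List.take_left' (by simp; ring)]
  rw [this, ← List.flatMap_assoc]
  have hval : ∀ (B : ℕ) (f : Fin n ↪ Fin Q.N),
      (List.ofFn fun a => (mainEmb B f a : ℕ)) = List.ofFn fun a => (f a : ℕ) :=
    fun B f => congrArg List.ofFn (funext fun a => by simp [mainEmb, main, val_cell])
  rw [← hval Q.code.length Q.inp, ← hval Q.code.length Q.out]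
  simp only [List.append_assoc]
  rw [Computation.code]
  simp only [List.append_assoc]
  rfl

end Coherent

/-- Measurement patterns, with non-input qudits prepared in `|0⟩`, can be simulated by circuits. -/
theorem complexityClass_subset_QNCf {d : ℕ} [NeZero d] (k : ℕ) :
    complexityClass d (fun {_} q => ∀ c T h, q ≠ Op.fanout c T h) ketZero k ⊆ QNCf d k :=
  complexityClass_subset Coherent.translate (Coherent.translateCode d) (4 * d + 8)
    (Coherent.polyList_translateCode d) (fun Q _ => Coherent.code_translate Q)
    (fun Q _ => Coherent.isFanoutGate_translate Q) (fun _ _ h => Coherent.depth_translate h)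
    (fun _ _ _ hQ h => Coherent.implements_translate hQ h)

/-- The intermediate class allows everything except fan-out gates, in particular the Fourier gates
prepended to a pattern. -/
theorem QMNC_subset_QNCf {d : ℕ} [NeZero d] (k : ℕ) : QMNC d k ⊆ QNCf d k :=
  (complexityClass_prepare fourier_mulVec_ketZero (fun hq c T h e => by
    subst e; exact hq) fun i c T h e => by cases e).trans (complexityClass_subset_QNCf k)

end QuditComp

end


set_option linter.unusedSectionVars false

noncomputable section

namespace QuditComp

open Function ZMod StackProg

/-! ## Circuits as measurement patterns -/

namespace OneWay

section Semantics

variable {d n N N' : ℕ} [NeZero d]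

/-- The qudits which carry nothing: neither a qudit of the circuit nor a fresh `|+_0⟩`. -/
def dead (ℓ : Fin N → Fin N') (Fr : Finset (Fin N')) : Finset (Fin N') :=
  Finset.univ.filter fun x => x ∉ Fr ∧ ∀ i, ℓ i ≠ x

theorem mem_dead {ℓ : Fin N → Fin N'} {Fr : Finset (Fin N')} {x : Fin N'} :
    x ∈ dead ℓ Fr ↔ x ∉ Fr ∧ ∀ i, ℓ i ≠ x := by simp [dead]

/-- The state in which qudit `i` of `Ψ` is at `ℓ i`, the qudits in `Fr` are in the state `|+_0⟩`
and all others in the state `|0⟩`. -/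
def emb (ℓ : Fin N → Fin N') (Fr : Finset (Fin N')) (Ψ : Basis d N → ℂ) : Basis d N' → ℂ := fun z =>
  if ∀ x ∈ dead ℓ Fr, z x = 0 then ((Real.sqrt d : ℂ)⁻¹) ^ Fr.card * Ψ fun i => z (ℓ i) else 0

theorem act_single_mul (i : Fin N) (j : ZMod d) (V : Matrix (ZMod d) (ZMod d) ℂ)
    (Φ : Basis d N → ℂ) : act i (Matrix.single 0 j 1 * V) Φ =
      fun z => if z i = 0 then ∑ a, V j a * Φ (update z i a) else 0 := by
  funext z
  simp only [act]
  by_cases h : z i = 0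
  · rw [if_pos h]
    refine Finset.sum_congr rfl fun a _ => ?_
    rw [h, Matrix.single_mul_apply_same, one_mul]
  · rw [if_neg h]
    refine Finset.sum_eq_zero fun a _ => ?_
    rw [Matrix.single_mul_apply_of_ne _ _ _ _ _ h, zero_mul]

theorem measAngle_zero (θ : ZMod d → ℝ) : measAngle θ 0 0 = θ := by
  funext j
  simp [measAngle]

theorem value_zero (s : Fin N → ZMod d) : Signal.value (0 : Signal d N) s = 0 := by
  simp [Signal.value]

/-- A measurement all of whose outcomes lead to the same final state. -/
theorem finalState_measure_eq {θ : ℕ → ZMod d → ℝ} {out : Fin n ↪ Fin N'} {M : Finset (Fin N')}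
    {l : List (Op d N')} {i : Fin N'} (hex : Executable out M l) (hi : i ∈ M) {a : ℕ}
    {s : Fin N' → ZMod d} {Φ : Basis d N' → ℂ} (Φ' : ZMod d → Basis d N' → ℂ)
    {R : Matrix (Basis d n) (Basis d n) ℂ}
    (h : ∀ j, act i (Matrix.single 0 j 1 * vGate (angles θ a)) Φ = (Real.sqrt d : ℂ)⁻¹ • Φ' j)
    (hR : ∀ j, finalState θ out l (update s i j) (Φ' j) = R) :
    finalState θ out (.measure i a 0 0 :: l) s Φ = R := by
  rw [finalState_measure]
  have key : ∀ j, finalState θ out l (update s i j)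
      (act i (measProj (angles θ a) (Signal.value 0 s) (Signal.value 0 s) j) Φ) =
        (d : ℂ)⁻¹ • R := by
    intro j
    -- The measured qudit may be taken to be in state `|0⟩`, which is the state `emb` assigns to
    -- dead qudits.
    rw [finalState_act_measProj θ hex hi _ _ _ _ 0, value_zero, measAngle_zero, h, finalState_smul,
      hR]
    congr 1
    rw [star_inv₀, ← mul_inv]
    congr 1
    rw [show star (Real.sqrt d : ℂ) = Real.sqrt d from Complex.conj_ofReal _, sqrt_mul_sqrt]
  -- There are `d` outcomes, and each contributes `R / d`.
  simp only [key, Finset.sum_const, Finset.card_univ, ZMod.card]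
  rw [← Nat.cast_smul_eq_nsmul ℂ, smul_smul, mul_inv_cancel₀ (NeZero.ne _), one_smul]

/-- Whatever fresh qudits there are besides those in `K`, and whatever outcomes have been recorded,
the operations `l` can be performed and turn the state `Ψ` located at `ℓ` into `ρ Ψ`. -/
def Spec (θ : ℕ → ZMod d → ℝ) (out : Fin n ↪ Fin N') (ℓ : Fin N → Fin N') (K : Finset (Fin N'))
    (l : List (Op d N')) (ρ : (Basis d N → ℂ) → Matrix (Basis d n) (Basis d n) ℂ) : Prop :=
  ∀ Fr, K ⊆ Fr → (∀ i, ℓ i ∉ Fr) → Executable out (dead ℓ Fr) l ∧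
    ∀ s Ψ, finalState θ out l s (emb ℓ Fr Ψ) = ρ Ψ

theorem Spec.mono {θ : ℕ → ZMod d → ℝ} {out : Fin n ↪ Fin N'} {ℓ : Fin N → Fin N'}
    {K K' : Finset (Fin N')} {l : List (Op d N')}
    {ρ : (Basis d N → ℂ) → Matrix (Basis d n) (Basis d n) ℂ} (h : Spec θ out ℓ K l ρ)
    (hK : K ⊆ K') : Spec θ out ℓ K' l ρ := fun Fr hFr => h Fr (hK.trans hFr)

/-- The gate `CZ`, if the qudits are distinct. -/
def mkcz (x y : Fin N') : List (Op d N') := if h : x ≠ y then [.cz x y h] else []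

/-- Apply `v(θ)`, where `θ` is the angle vector number `a`, while moving a qudit from `x`
to `y`. -/
def mv (a : ℕ) (x y : Fin N') : List (Op d N') :=
  mkcz x y ++ [.measure x a 0 0, .corrX y (Pi.single x 1)]

theorem comp_update_eq {ℓ : Fin N → Fin N'} (hℓ : Injective ℓ) (z : Basis d N') (i : Fin N)
    (a : ZMod d) : (fun k => update z (ℓ i) a (ℓ k)) = update (fun k => z (ℓ k)) i a := by
  funext k
  by_cases hk : k = i
  · subst hk; simp
  · rw [update_of_ne hk, update_of_ne (hℓ.ne hk)]

theorem comp_update_of_forall_ne {ℓ : Fin N → Fin N'} {x : Fin N'} (hx : ∀ i, ℓ i ≠ x)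
    (z : Basis d N') (a : ZMod d) : (fun k => update z x a (ℓ k)) = fun k => z (ℓ k) :=
  funext fun k => update_of_ne (hx k) _ _

theorem forall_mem_update {M : Finset (Fin N')} {x : Fin N'} (hx : x ∉ M) (z : Basis d N')
    (a : ZMod d) : (∀ w ∈ M, update z x a w = 0) ↔ ∀ w ∈ M, z w = 0 :=
  forall₂_congr fun w hw => by rw [update_of_ne (ne_of_mem_of_not_mem hw hx)]

theorem dead_update {ℓ : Fin N → Fin N'} (hℓ : Injective ℓ) {Fr : Finset (Fin N')} {i : Fin N}
    {y : Fin N'} (hy : y ∈ Fr) (hd : ∀ i, ℓ i ∉ Fr) :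
    dead (update ℓ i y) (Fr.erase y) = insert (ℓ i) (dead ℓ Fr) := by
  ext x
  rw [Finset.mem_insert, mem_dead, mem_dead, Finset.mem_erase]
  constructor
  · rintro ⟨h₁, h₂⟩
    have hxy : y ≠ x := by simpa using h₂ i
    by_cases hx : x = ℓ i
    · exact .inl hx
    · refine .inr ⟨fun h => h₁ ⟨hxy.symm, h⟩, fun k hk => ?_⟩
      by_cases hki : k = i
      · subst hki; exact hx hk.symm
      · exact h₂ k (by rw [update_of_ne hki]; exact hk)
  · rintro (rfl | ⟨h₁, h₂⟩)
    · refine ⟨fun h => hd i h.2, fun k => ?_⟩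
      by_cases hki : k = i
      · subst hki
        rw [update_self]
        rintro rfl
        exact hd _ hy
      · rw [update_of_ne hki]
        exact hℓ.ne hki
    · refine ⟨fun h => h₁ h.2, fun k => ?_⟩
      by_cases hki : k = i
      · subst hki
        rw [update_self]
        rintro rfl
        exact h₁ hy
      · rw [update_of_ne hki]
        exact h₂ k

/-- Teleportation of one qudit: after the `CZ`, outcome `j` leaves at `y` the amplitude `∑ b, v_{jb}
ω^{b y} Ψ(b)`, and `v_{jb} ω^{b y} = v_{y+j, b}`. So `v Ψ` has arrived at `y` up to a shift by `j`,
which the correction `X^j` removes. -/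
theorem Spec.mv {θ : ℕ → ZMod d → ℝ} {out : Fin n ↪ Fin N'} {ℓ : Fin N → Fin N'}
    (hℓ : Injective ℓ) {K K' : Finset (Fin N')} {l : List (Op d N')}
    {ρ : (Basis d N → ℂ) → Matrix (Basis d n) (Basis d n) ℂ} {i : Fin N} {y : Fin N'}
    (h : Spec θ out (update ℓ i y) K l ρ) (hK : K ⊆ K') (hy : y ∉ K) (hy' : y ∈ K') (a : ℕ) :
    Spec θ out ℓ K' (mv a (ℓ i) y ++ l) fun Ψ => ρ (act i (vGate (angles θ a)) Ψ) := by
  intro Fr hFr hd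
  have hyF := hFr hy'
  have hxy : ℓ i ≠ y := fun h => hd i (h ▸ hyF)
  have hx : ℓ i ∉ dead ℓ Fr := fun h => (mem_dead.1 h).2 i rfl
  have hyd : y ∉ dead ℓ Fr := fun h => (mem_dead.1 h).1 hyF
  obtain ⟨h₁, h₂⟩ := h (Fr.erase y) (fun x hx => Finset.mem_erase.2
    ⟨ne_of_mem_of_not_mem hx hy, hFr (hK hx)⟩) (fun k hk => by
      by_cases hki : k = i
      · subst hki; simp at hk
      · rw [update_of_ne hki] at hk
        exact hd k (Finset.mem_of_mem_erase hk))
  rw [dead_update hℓ hyF hd] at h₁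
  have hex : Executable out (insert (ℓ i) (dead ℓ Fr)) (.corrX y (Pi.single (ℓ i) 1) :: l) := by
    refine ⟨?_, ?_, ?_⟩
    · simp only [Op.acts, Finset.disjoint_singleton_left, Finset.mem_insert, not_or]
      exact ⟨hxy.symm, hyd⟩
    · intro k hk
      simp only [Op.deps, Finset.mem_filter, Finset.mem_univ, true_and, Pi.single_apply] at hk
      rw [Finset.mem_insert]
      by_contra hne
      simp only [not_or] at hne
      exact hk (if_neg hne.1)
    · simpa [Op.measured] using h₁
  rw [OneWay.mv, mkcz, dif_pos hxy, List.cons_append, List.nil_append]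
  refine ⟨⟨?_, ?_, ?_, ?_, ?_⟩, fun s Ψ => ?_⟩
  · simp only [Op.acts, Finset.disjoint_insert_left, Finset.disjoint_singleton_left]
    exact ⟨hx, hyd⟩
  · simp [Op.deps]
  · simpa [Op.acts, Op.measured] using hx
  · simp [Op.deps]
  · have : dead ℓ Fr ∪ (Op.cz (ℓ i) y hxy : Op d N').measured ∪
        (Op.measure (ℓ i) a 0 0 : Op d N').measured = insert (ℓ i) (dead ℓ Fr) := by
      ext x
      simp [Op.measured]
    rw [this]
    exact hex
  · set V := vGate (angles θ a) with hV
    rw [List.cons_append, finalState_cons θ out (by rfl), apply_cz, List.cons_append,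
      List.cons_append, List.nil_append]
    refine finalState_measure_eq hex (Finset.mem_insert_self _ _)
      -- The state after outcome `j`: the wanted state with the label of `y` shifted by `j`.
      (fun j z => emb (update ℓ i y) (Fr.erase y) (act i V Ψ) (update z y (z y + j)))
      (fun j => ?_) (fun j => ?_)
    · rw [act_single_mul]
      funext z
      simp only [Pi.smul_apply, smul_eq_mul, emb, dead_update hℓ hyF hd, comp_update_eq hℓ,
        forall_mem_update hx, update_self, update_of_ne hxy.symm]
      simp only [Finset.forall_mem_insert, forall_mem_update hyd, update_of_ne hxy, mul_ite,
        mul_zero]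
      by_cases hc : ∀ w ∈ dead ℓ Fr, z w = 0
      swap
      · simp [hc]
      by_cases hz : z (ℓ i) = 0
      swap
      · rw [if_neg hz, if_neg (fun h => hz h.1)]
      rw [if_pos hz, if_pos ⟨hz, hc⟩]
      simp only [if_pos hc, act, Finset.mul_sum]
      refine Finset.sum_congr rfl fun b _ => ?_
      have e₁ : update (fun k => update z y (z y + j) (update ℓ i y k)) i b =
          update (fun k => z (ℓ k)) i b := by
        funext k
        by_cases hki : k = i
        · subst hki; simp
        · rw [update_of_ne hki, update_of_ne hki, update_of_ne hki, update_of_ne]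
          intro h
          exact hd k (h ▸ hyF)
      have e₂ : V (z y + j) b = V j b * stdAddChar (b * z y) := by
        rw [hV, vGate_apply, vGate_apply, add_mul, AddChar.map_add_eq_mul, mul_comm b]
        ring
      rw [e₁, update_self, update_self, e₂, ← Finset.card_erase_add_one hyF, pow_succ]
      ring
    · rw [finalState_cons θ out (by rfl), apply_corrX, act_pauliX]
      have : Signal.value (Pi.single (ℓ i) 1) (update s (ℓ i) j) = j := by
        simp only [Signal.value, Pi.single_apply, ite_mul, one_mul, zero_mul, Finset.sum_ite_eq',
          Finset.mem_univ, if_true, update_self]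
      rw [this]
      simp only [update_self, update_idem, sub_add_cancel, update_eq_self]
      exact h₂ _ _

/-- A phase depending on the basis labels. -/
theorem Spec.phase {θ : ℕ → ZMod d → ℝ} {out : Fin n ↪ Fin N'} {ℓ : Fin N → Fin N'}
    {K : Finset (Fin N')} {l : List (Op d N')}
    {ρ : (Basis d N → ℂ) → Matrix (Basis d n) (Basis d n) ℂ} (h : Spec θ out ℓ K l ρ)
    {i k : Fin N} (hik : ℓ i ≠ ℓ k) :
    Spec θ out ℓ K (mkcz (ℓ i) (ℓ k) ++ l) fun Ψ => ρ fun w => stdAddChar (w i * w k) * Ψ w := by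
  intro Fr hFr hd
  obtain ⟨h₁, h₂⟩ := h Fr hFr hd
  rw [mkcz, dif_pos hik]
  refine ⟨⟨?_, ?_, ?_⟩, fun s Ψ => ?_⟩
  · simp only [Op.acts, Finset.disjoint_insert_left, Finset.disjoint_singleton_left]
    exact ⟨fun h => (mem_dead.1 h).2 i rfl, fun h => (mem_dead.1 h).2 k rfl⟩
  · simp [Op.deps]
  · simpa [Op.measured] using h₁
  · rw [List.cons_append, finalState_cons θ out (by rfl), apply_cz, List.nil_append]
    refine Eq.trans (congrArg _ ?_) (h₂ s _)
    funext z
    simp only [emb]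
    split_ifs
    · ring
    · simp

/-! ## The initial and the final state -/

/-- A fresh `|+_0⟩` is `F` applied to a dead `|0⟩`. So fresh qudits can be removed one at a time by
isometries. -/
theorem emb_eq_act {ℓ : Fin N → Fin N'} {Fr : Finset (Fin N')} {y : Fin N'} (hy : y ∈ Fr)
    (hd : ∀ i, ℓ i ∉ Fr) (Ψ : Basis d N → ℂ) :
    emb ℓ Fr Ψ = act y fourier (emb ℓ (Fr.erase y) Ψ) := by
  have hℓy : ∀ i, ℓ i ≠ y := fun i h => hd i (h ▸ hy)
  have hdead : dead ℓ (Fr.erase y) = insert y (dead ℓ Fr) := by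
    ext x
    rw [Finset.mem_insert, mem_dead, mem_dead, Finset.mem_erase]
    by_cases hx : x = y
    · subst hx; simp [hℓy]
    · simp [hx]
  have hyd : y ∉ dead ℓ Fr := fun h => (mem_dead.1 h).1 hy
  funext z
  simp only [act, emb, hdead, Finset.forall_mem_insert, forall_mem_update hyd, update_self,
    comp_update_of_forall_ne hℓy]
  rw [Finset.sum_eq_single 0]
  · simp only [true_and, fourier_apply, mul_zero, AddChar.map_zero_eq_one]
    rw [← Finset.card_erase_add_one hy, pow_succ]
    split_ifs
    · ring
    · ring
  · intro a _ ha
    rw [if_neg (fun h => ha h.1), mul_zero]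
  · simp

theorem relabel_comp {ℓ : Fin N → Fin N'} (hℓ : Injective ℓ) {out : Fin n ↪ Fin N}
    {out' : Fin n ↪ Fin N'} (hout : ∀ a, out' a = ℓ (out a)) (z : Basis d N') (y : Basis d n) :
    (fun i => relabel out' z y (ℓ i)) = relabel out (fun i => z (ℓ i)) y := by
  funext i
  by_cases hi : ∃ a, out a = i
  · obtain ⟨a, rfl⟩ := hi
    rw [relabel_out, ← hout, relabel_out]
  · rw [not_exists] at hi
    rw [relabel_of_ne _ _ _ hi, relabel_of_ne]
    intro a ha
    rw [hout] at ha
    exact hi a (hℓ ha)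

/-- Unused fresh qudits are turned into `|0⟩` by isometries on traced-out qudits. In the remaining
state all qudits outside the range of `ℓ` are `0`, and its labels correspond to those of `Ψ`. -/
theorem reducedState_emb {ℓ : Fin N → Fin N'} (hℓ : Injective ℓ) {out : Fin n ↪ Fin N}
    {out' : Fin n ↪ Fin N'} (hout : ∀ a, out' a = ℓ (out a)) (Ψ : Basis d N → ℂ)
    (Fr : Finset (Fin N')) (hd : ∀ i, ℓ i ∉ Fr) :
    reducedState out' (emb ℓ Fr Ψ) = reducedState out Ψ := by
  induction Fr using Finset.induction_on with
  | insert y Fr hy ih =>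
    rw [emb_eq_act (Finset.mem_insert_self y Fr) hd, Finset.erase_insert hy,
      reducedState_act (fun a ha => hd (out a) (by rw [← hout, ha]; exact Finset.mem_insert_self _ _))
        (conjTranspose_fourier_mul)]
    exact ih fun i hi => hd i (Finset.mem_insert_of_mem hi)
  | empty =>
    ext x y
    rw [reducedState_apply, reducedState_apply]
    have hdead : ∀ (z : Basis d N'), (∀ x ∈ dead ℓ ∅, relabel out' z y x = 0) ↔
        ∀ x ∈ dead ℓ ∅, z x = 0 := fun z => forall₂_congr fun x hx => by
      rw [relabel_of_ne]
      intro a ha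
      exact (mem_dead.1 hx).2 (out a) (by rw [← hout, ha])
    let lift : Basis d N → Basis d N' := fun w x => if h : ∃ i, ℓ i = x then w h.choose else 0
    have hlift : ∀ w i, lift w (ℓ i) = w i := fun w i => by
      have h : ∃ k, ℓ k = ℓ i := ⟨i, rfl⟩
      simp only [lift, dif_pos h]
      rw [hℓ h.choose_spec]
    have hzero : ∀ w, ∀ x ∈ dead ℓ ∅, lift w x = 0 := fun w x hx => by
      simp only [lift]
      rw [dif_neg]
      rintro ⟨i, hi⟩
      exact (mem_dead.1 hx).2 i hi
    rw [← Finset.sum_subset (Finset.subset_univ (Finset.univ.image lift))]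
    · rw [Finset.sum_image fun w _ w' _ h => funext fun i => by rw [← hlift w, h, hlift]]
      refine Finset.sum_congr rfl fun w _ => ?_
      simp only [emb, hdead, if_pos (hzero w), relabel_comp hℓ hout, Finset.card_empty, pow_zero,
        one_mul, hout, hlift]
    · intro z _ hz
      suffices emb ℓ ∅ Ψ z = 0 by rw [this, zero_mul, ite_self]
      refine if_neg fun h => ?_
      refine hz (Finset.mem_image.2 ⟨fun i => z (ℓ i), Finset.mem_univ _, funext fun x => ?_⟩)
      by_cases hx : ∃ i, ℓ i = x
      · obtain ⟨i, rfl⟩ := hx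
        exact hlift (fun i => z (ℓ i)) i
      · rw [not_exists] at hx
        rw [h x (mem_dead.2 ⟨Finset.notMem_empty _, hx⟩)]
        simp only [lift]
        rw [dif_neg (not_exists.2 hx)]

theorem spec_nil (θ : ℕ → ZMod d → ℝ) {ℓ : Fin N → Fin N'} (hℓ : Injective ℓ) {out : Fin n ↪ Fin N}
    {out' : Fin n ↪ Fin N'} (hout : ∀ a, out' a = ℓ (out a)) (K : Finset (Fin N')) :
    Spec θ out' ℓ K [] (reducedState out) := fun Fr _ hd =>
  ⟨fun a h => (mem_dead.1 h).2 (out a) (hout a).symm, fun _ Ψ => reducedState_emb hℓ hout Ψ Fr hd⟩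

/-- All places without a qudit of the circuit are fresh; the non-input qudits of the circuit are
themselves in the state `|+_0⟩` on both sides. -/
theorem initialState_emb {ℓ : Fin N → Fin N'} (hℓ : Injective ℓ) {inp : Fin n ↪ Fin N}
    {inp' : Fin n ↪ Fin N'} (hinp : ∀ a, inp' a = ℓ (inp a)) (ψ : Basis d n → ℂ) :
    initialState inp' ketPlus ψ =
      emb ℓ (Finset.univ.filter fun x => ∀ i, ℓ i ≠ x) (initialState inp ketPlus ψ) := by
  funext z
  rw [emb, if_pos]
  · simp only [initialState, ketPlus_apply, Finset.prod_const, hinp, one_div]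
    have : (Finset.univ.filter fun x => ∀ a, inp' a ≠ x) =
        (Finset.univ.filter fun x => ∀ i, ℓ i ≠ x) ∪
          (Finset.univ.filter fun i => ∀ a, inp a ≠ i).image ℓ := by
      ext x
      simp only [Finset.mem_union, Finset.mem_filter, Finset.mem_univ, true_and, Finset.mem_image]
      constructor
      · intro h
        by_cases hx : ∃ i, ℓ i = x
        · obtain ⟨i, rfl⟩ := hx
          exact .inr ⟨i, fun a ha => h a (by rw [hinp, ha]), rfl⟩
        · exact .inl (not_exists.1 hx)
      · rintro (h | ⟨i, h, rfl⟩) a ha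
        · exact h (inp a) (by rw [← hinp, ha])
        · rw [hinp] at ha
          exact h a (hℓ ha)
    simp only [← hinp]
    rw [this, Finset.card_union_of_disjoint, Finset.card_image_of_injective _ hℓ, pow_add]
    · ring
    · rw [Finset.disjoint_left]
      intro x hx hx'
      obtain ⟨i, -, rfl⟩ := Finset.mem_image.1 hx'
      exact (Finset.mem_filter.1 hx).2 i rfl
  · intro x hx
    rw [mem_dead] at hx
    exact absurd (Finset.mem_filter.2 ⟨Finset.mem_univ _, hx.2⟩) hx.1

end Semantics

end OneWay

end QuditComp

end


set_option linter.unusedSectionVars false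

noncomputable section

/-! ### `CZ` gates with a common qudit, by measuring a chain -/

namespace QuditComp

open Function ZMod StackProg

namespace OneWay

section Blocks

variable {d n N N' : ℕ} [NeZero d]

/-- Blocks of unitary operations, each followed by a measurement. -/
def measureBlocks (L : Fin N → List (Op d N')) (m : Fin N → Fin N') (ks : List (Fin N)) :
    List (Op d N') := ks.flatMap fun k => L k ++ [.measure (m k) 0 0 0]

theorem measuredIn_measureBlocks {L : Fin N → List (Op d N')} {m : Fin N → Fin N'}
    (hL : ∀ k, ∀ q ∈ L k, q.measured = ∅) (ks : List (Fin N)) (x : Fin N') :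
    x ∈ measuredIn (measureBlocks L m ks) ↔ ∃ k ∈ ks, m k = x := by
  induction ks with
  | nil => simp [measureBlocks]
  | cons k ks ih =>
    rw [measureBlocks, List.flatMap_cons, measuredIn_append, measuredIn_append,
      measuredIn_eq_empty (hL k), Finset.mem_union]
    rw [measureBlocks] at ih
    rw [ih]
    simp [Op.measured, eq_comm]

theorem runnable_measureBlocks {L : Fin N → List (Op d N')} {m : Fin N → Fin N'}
    (hm : Injective m) (hL : ∀ k, ∀ q ∈ L k, q.measured = ∅ ∧ ∀ k' ≠ k, m k' ∉ q.acts) :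
    ∀ {ks : List (Fin N)} {M : Finset (Fin N')}, ks.Nodup → (∀ k ∈ ks, m k ∉ M) →
      (∀ k ∈ ks, ∀ q ∈ L k, Disjoint q.acts M ∧ q.deps ⊆ M) → Runnable M (measureBlocks L m ks)
  | [], _, _, _, _ => trivial
  | k :: ks, M, hks, h₁, h₂ => by
    rw [List.nodup_cons] at hks
    have hmeas : measuredIn (L k ++ [.measure (m k) 0 0 0]) = {m k} := by
      rw [measuredIn_append, measuredIn_eq_empty fun q hq => (hL k q hq).1]
      simp [Op.measured]
    rw [measureBlocks, List.flatMap_cons]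
    refine Runnable.append (Runnable.append (.of_forall fun q hq => ?_) ?_)
      (runnable_measureBlocks hm hL hks.2 (fun k' hk' => ?_) fun k' hk' q hq => ?_)
    · exact ⟨(h₂ k List.mem_cons_self q hq).1, (h₂ k List.mem_cons_self q hq).2, (hL k q hq).1⟩
    · rw [measuredIn_eq_empty fun q hq => (hL k q hq).1, Finset.union_empty]
      exact ⟨by simpa [Op.acts] using h₁ k List.mem_cons_self, by simp [Op.deps], trivial⟩
    · rw [hmeas, Finset.mem_union, not_or, Finset.mem_singleton]
      exact ⟨h₁ k' (List.mem_cons_of_mem _ hk'), fun h => hks.1 (hm h ▸ hk')⟩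
    · rw [hmeas, Finset.disjoint_union_right, Finset.disjoint_singleton_right]
      obtain ⟨h₃, h₄⟩ := h₂ k' (List.mem_cons_of_mem _ hk') q hq
      exact ⟨⟨h₃, (hL k' q hq).2 k fun h => hks.1 (h ▸ hk')⟩,
        h₄.trans Finset.subset_union_left⟩

/-- `Φ ks s` is the state when the blocks for `ks` are still to come. Each outcome leads, with
amplitude `1/√d`, to the next such state, so `finalState_measure_eq` applies repeatedly. -/
theorem finalState_measureBlocks {θ : ℕ → ZMod d → ℝ} {out : Fin n ↪ Fin N'}
    {L : Fin N → List (Op d N')} {m : Fin N → Fin N'} {l : List (Op d N')}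
    (hL : ∀ k, ∀ q ∈ L k, q.measured = ∅) {R : Matrix (Basis d n) (Basis d n) ℂ}
    (Φ : List (Fin N) → (Fin N' → ZMod d) → Basis d N' → ℂ)
    (hl : ∀ s, finalState θ out l s (Φ [] s) = R)
    (hstep : ∀ k ks, k ∉ ks → ∀ s j,
      act (m k) (Matrix.single 0 j 1 * vGate (angles θ 0)) (run θ s (L k) (Φ (k :: ks) s)) =
        (Real.sqrt d : ℂ)⁻¹ • Φ ks (update s (m k) j)) :
    ∀ (ks : List (Fin N)) (M : Finset (Fin N')), ks.Nodup →
      Executable out M (measureBlocks L m ks ++ l) → ∀ s,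
        finalState θ out (measureBlocks L m ks ++ l) s (Φ ks s) = R
  | [], _, _, _, s => hl s
  | k :: ks, M, hks, hex, s => by
    rw [List.nodup_cons] at hks
    rw [measureBlocks, List.flatMap_cons, List.append_assoc, List.append_assoc,
      List.singleton_append] at hex ⊢
    have hex' : ∀ {M : Finset (Fin N')} {l₁ l₂ : List (Op d N')}, Executable out M (l₁ ++ l₂) →
        Executable out (M ∪ measuredIn l₁) l₂ := by
      intro M l₁ l₂ h
      induction l₁ generalizing M with
      | nil => simpa using h
      | cons q l₁ ih =>
        rw [measuredIn_cons, ← Finset.union_assoc]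
        exact ih h.2.2
    have hex₂ := (hex' hex).2.2
    rw [finalState_append θ out (hL k)]
    exact finalState_measure_eq hex₂ (Finset.mem_union_right _ (by simp [Op.measured])) _
      (hstep k ks hks.1 s) fun j =>
        finalState_measureBlocks hL Φ hl hstep ks _ hks.2 hex₂ _

end Blocks

section Star

variable {d n N N' : ℕ} [NeZero d]

/-- The predecessor of `p k` in the sequence `x, p 0, p 1, …`. -/
def prev (x : Fin N') (p : Fin N → Fin N') (k : Fin N) : Fin N' :=
  if (k : ℕ) = 0 then x else p ⟨k - 1, by omega⟩

/-- Minus the sum of the outcomes of `q l` for `l ≤ t`. -/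
def prefixSignal (d : ℕ) (q : Fin N → Fin N') (t : Fin N) : Signal d N' := fun x =>
  if ∃ l ≤ t, q l = x then -1 else 0

/-- Minus the sum of the outcomes of `p l`. -/
def totalSignal (d : ℕ) (p : Fin N → Fin N') : Signal d N' := fun x =>
  if ∃ l, p l = x then -1 else 0

/-- The operations which copy a value to `p k`. -/
def copyOps (d : ℕ) (p q : Fin N → Fin N') (k : Fin N) : List (Op d N') :=
  (List.range (d - 1)).flatMap fun _ => mkcz (p k) (q k)

/-- The operations which use the copy at `p t`. -/
def useOps (d : ℕ) (ℓ p q : Fin N → Fin N') (T : Finset (Fin N)) (t : Fin N) : List (Op d N') :=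
  if t ∈ T then mkcz (p t) (ℓ t) ++ [.corrZ (ℓ t) (prefixSignal d q t)] else []

/-- Controlled-`Z` gates between the qudit `c` and the qudits in `T`, in bounded depth. -/
def star (d : ℕ) (ℓ p q : Fin N → Fin N') (c : Fin N) (T : Finset (Fin N)) : List (Op d N') :=
  ((List.finRange N).flatMap fun k => mkcz (prev (ℓ c) p k) (q k)) ++
    (measureBlocks (copyOps d p q) q (List.finRange N) ++
      (measureBlocks (useOps d ℓ p q T) p (List.finRange N) ++
        [.corrZ (ℓ c) (totalSignal d p)]))

theorem isPhase_mkcz (s : Fin N' → ZMod d) {x y : Fin N'} (h : x ≠ y) :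
    IsPhase s (mkcz x y) fun z => z x * z y := by
  rw [mkcz, dif_pos h]
  exact isPhase_cz s h

theorem mem_mkcz {x y : Fin N'} {q : Op d N'} (h : q ∈ mkcz x y) :
    q.acts = {x, y} ∧ q.deps = ∅ ∧ q.measured = ∅ ∧ q.IsPatternCommand := by
  rw [mkcz] at h
  split_ifs at h
  · rw [List.mem_singleton] at h
    subst h
    exact ⟨rfl, rfl, rfl, trivial⟩
  · simp at h

theorem mem_copyOps {p q : Fin N → Fin N'} {k : Fin N} {x : Op d N'} (h : x ∈ copyOps d p q k) :
    x.acts = {p k, q k} ∧ x.deps = ∅ ∧ x.measured = ∅ ∧ x.IsPatternCommand := by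
  obtain ⟨-, -, h⟩ := List.mem_flatMap.1 h
  exact mem_mkcz h

theorem mem_useOps {ℓ p q : Fin N → Fin N'} {T : Finset (Fin N)} {t : Fin N} {x : Op d N'}
    (h : x ∈ useOps d ℓ p q T t) : x.acts ⊆ {p t, ℓ t} ∧ (∀ y ∈ x.deps, ∃ l, q l = y) ∧
      x.measured = ∅ ∧ x.IsPatternCommand := by
  rw [useOps] at h
  split_ifs at h
  · rcases List.mem_append.1 h with h | h
    · obtain ⟨h₁, h₂, h₃, h₄⟩ := mem_mkcz h
      exact ⟨h₁.subset, by simp [h₂], h₃, h₄⟩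
    · rw [List.mem_singleton] at h
      subst h
      refine ⟨by simp [Op.acts], fun y hy => ?_, rfl, trivial⟩
      rw [Op.deps, Finset.mem_filter] at hy
      by_contra hne
      refine hy.2 (if_neg ?_)
      rintro ⟨l, -, hl⟩
      exact hne ⟨l, hl⟩
  · simp at h

theorem value_signal {q : Fin N → Fin N'} (hq : Injective q) (P : Fin N → Prop) [DecidablePred P]
    (s : Fin N' → ZMod d) (σ : Signal d N') (hσ : ∀ l, σ (q l) = if P l then -1 else 0)
    (hσ' : ∀ x, (∀ l, q l ≠ x) → σ x = 0) :
    σ.value s = -∑ l, if P l then s (q l) else 0 := by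
  rw [Signal.value, ← Finset.sum_subset (Finset.subset_univ (Finset.univ.image q))]
  · rw [Finset.sum_image fun a _ b _ h => hq h, ← Finset.sum_neg_distrib]
    refine Finset.sum_congr rfl fun l _ => ?_
    rw [hσ]
    split_ifs <;> ring
  · intro x _ hx
    rw [hσ', zero_mul]
    rintro l rfl
    exact hx (Finset.mem_image_of_mem q (Finset.mem_univ l))

theorem value_prefixSignal {q : Fin N → Fin N'} (hq : Injective q) (t : Fin N)
    (s : Fin N' → ZMod d) :
    (prefixSignal d q t).value s = -∑ l, if l ≤ t then s (q l) else 0 := by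
  refine value_signal hq _ s _ (fun l => ?_) fun x hx => if_neg fun ⟨l, _, h⟩ => hx l h
  refine if_congr ⟨?_, fun h => ⟨l, h, rfl⟩⟩ rfl rfl
  rintro ⟨l', h, e⟩
  rwa [← hq e]

theorem value_totalSignal {p : Fin N → Fin N'} (hp : Injective p) (s : Fin N' → ZMod d) :
    (totalSignal d p).value s = -∑ l, s (p l) := by
  rw [value_signal hp (fun _ => True) s (totalSignal d p) (fun l => ?_) fun x hx => if_neg fun ⟨l, h⟩ => hx l h]
  · simp
  · rw [totalSignal, if_pos ⟨l, rfl⟩, if_pos trivial]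

/-- The situation in which `star` is applied. -/
structure StarData (ℓ p q : Fin N → Fin N') (Fr : Finset (Fin N')) : Prop where
  p_inj : Injective p
  q_inj : Injective q
  p_ne_q : ∀ k l, p k ≠ q l
  ℓ_notMem : ∀ i, ℓ i ∉ Fr
  p_mem : ∀ k, p k ∈ Fr
  q_mem : ∀ k, q k ∈ Fr

variable {ℓ p q : Fin N → Fin N'} {Fr : Finset (Fin N')}

namespace StarData

theorem ℓ_ne_p (h : StarData ℓ p q Fr) (i k : Fin N) : ℓ i ≠ p k :=
  fun e => h.ℓ_notMem i (e ▸ h.p_mem k)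

theorem ℓ_ne_q (h : StarData ℓ p q Fr) (i k : Fin N) : ℓ i ≠ q k :=
  fun e => h.ℓ_notMem i (e ▸ h.q_mem k)

theorem p_notMem_dead (h : StarData ℓ p q Fr) (k : Fin N) : p k ∉ dead ℓ Fr :=
  fun e => (mem_dead.1 e).1 (h.p_mem k)

theorem q_notMem_dead (h : StarData ℓ p q Fr) (k : Fin N) : q k ∉ dead ℓ Fr :=
  fun e => (mem_dead.1 e).1 (h.q_mem k)

theorem ℓ_notMem_dead (_ : StarData ℓ p q Fr) (i : Fin N) : ℓ i ∉ dead ℓ Fr :=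
  fun e => (mem_dead.1 e).2 i rfl

theorem prev_ne_q (h : StarData ℓ p q Fr) (c k l : Fin N) : prev (ℓ c) p k ≠ q l := by
  rw [prev]
  split_ifs
  exacts [h.ℓ_ne_q c l, h.p_ne_q _ l]

theorem prev_notMem_dead (h : StarData ℓ p q Fr) (c k : Fin N) :
    prev (ℓ c) p k ∉ dead ℓ Fr := by
  rw [prev]
  split_ifs
  exacts [h.ℓ_notMem_dead c, h.p_notMem_dead _]

end StarData

/-- The state while the copies are being made, those for `ks` having still to be made. -/
def copyState (ℓ p q : Fin N → Fin N') (Fr : Finset (Fin N')) (c : Fin N) (Ψ : Basis d N → ℂ)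
    (ks : List (Fin N)) (s : Fin N' → ZMod d) : Basis d N' → ℂ := fun z =>
  ((d : ℂ)⁻¹) ^ ks.length *
    if (∀ x ∈ dead ℓ Fr, z x = 0) ∧
        ∀ l, l ∉ ks → z (q l) = 0 ∧ z (p l) = z (prev (ℓ c) p l) + s (q l)
      then stdAddChar (∑ l, if l ∈ ks then z (q l) * z (prev (ℓ c) p l) else 0) *
        Ψ fun i => z (ℓ i)
      else 0

/-- The state while the copies are being used, those for `ts` having still to be used. -/
def useState (ℓ p q : Fin N → Fin N') (Fr : Finset (Fin N')) (c : Fin N) (T : Finset (Fin N))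
    (Ψ : Basis d N → ℂ) (ts : List (Fin N)) (s : Fin N' → ZMod d) : Basis d N' → ℂ := fun z =>
  if (∀ x ∈ dead ℓ Fr, z x = 0) ∧ (∀ l, z (q l) = 0) ∧ (∀ l, l ∉ ts → z (p l) = 0) ∧
      ∀ l, l ∈ ts → z (p l) = z (ℓ c) + ∑ m, if m ≤ l then s (q m) else 0
    then stdAddChar (∑ l, if l ∈ ts then 0 else (if l ∈ T then z (ℓ c) * z (ℓ l) else 0) +
        s (p l) * (z (ℓ c) + ∑ m, if m ≤ l then s (q m) else 0)) * Ψ fun i => z (ℓ i)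
    else 0

/-- `CZ` has order dividing `d`, so `d - 1` copies of it are its inverse. -/
theorem isPhase_copyOps (h : StarData ℓ p q Fr) (s : Fin N' → ZMod d) (k : Fin N) :
    IsPhase s (copyOps d p q k) fun z => -(z (q k) * z (p k)) := by
  refine (IsPhase.flatMap_range fun _ => isPhase_mkcz s (h.p_ne_q k k)).congr fun z => ?_
  rw [Finset.sum_const, Finset.card_range, nsmul_eq_mul, Nat.cast_sub NeZero.one_le,
    ZMod.natCast_self]
  push_cast
  ring

/-- The qudit `q k` carries the phase `ω^{a (prev - p_k)}` in its label `a`. A Fourier measurement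
with outcome `j` sums `ω^{a (j + prev - p_k)}` over `a`, which forces `p_k = prev + j`. This
condition only relates `p_k` to its predecessor, so all links can be processed independently. -/
theorem copyState_step (h : StarData ℓ p q Fr) (θ : ℕ → ZMod d → ℝ) (c : Fin N)
    (Ψ : Basis d N → ℂ) {k : Fin N} {ks : List (Fin N)} (hk : k ∉ ks) (s : Fin N' → ZMod d)
    (j : ZMod d) :
    act (q k) (Matrix.single 0 j 1 * vGate (angles θ 0))
      (run θ s (copyOps d p q k) (copyState ℓ p q Fr c Ψ (k :: ks) s)) =
        (Real.sqrt d : ℂ)⁻¹ • copyState ℓ p q Fr c Ψ ks (update s (q k) j) := by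
  rw [isPhase_copyOps h s k, act_single_mul]
  funext z
  have hiff : (∀ l, l ∉ ks → z (q l) = 0 ∧ z (p l) = z (prev (ℓ c) p l) + update s (q k) j (q l)) ↔
      (z (q k) = 0 ∧ z (p k) = z (prev (ℓ c) p k) + j) ∧
        ∀ l, l ∉ k :: ks → z (q l) = 0 ∧ z (p l) = z (prev (ℓ c) p l) + s (q l) := by
    constructor
    · intro H
      refine ⟨by simpa using H k hk, fun l hl => ?_⟩
      rw [List.mem_cons, not_or] at hl
      simpa [update_of_ne (h.q_inj.ne hl.1)] using H l hl.2
    · rintro ⟨H₁, H₂⟩ l hl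
      by_cases hlk : l = k
      · subst hlk; simpa using H₁
      · simpa [update_of_ne (h.q_inj.ne hlk)] using H₂ l (by simp [hlk, hl])
  have hcond : ∀ a, (∀ l, l ∉ k :: ks → update z (q k) a (q l) = 0 ∧
      update z (q k) a (p l) = update z (q k) a (prev (ℓ c) p l) + s (q l)) ↔
      ∀ l, l ∉ k :: ks → z (q l) = 0 ∧ z (p l) = z (prev (ℓ c) p l) + s (q l) := fun a => by
    refine forall₂_congr fun l hl => ?_
    rw [List.mem_cons, not_or] at hl
    rw [update_of_ne (h.q_inj.ne hl.1), update_of_ne (h.p_ne_q l k),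
      update_of_ne (h.prev_ne_q c l k)]
  have hsum : ∀ a, (∑ l, if l ∈ k :: ks then
      update z (q k) a (q l) * update z (q k) a (prev (ℓ c) p l) else 0) =
      a * z (prev (ℓ c) p k) + ∑ l, if l ∈ ks then z (q l) * z (prev (ℓ c) p l) else 0 := fun a => by
    rw [← Finset.add_sum_erase _ _ (Finset.mem_univ k), if_pos List.mem_cons_self, update_self,
      update_of_ne (h.prev_ne_q c k k), ← Finset.add_sum_erase Finset.univ
        (fun l => if l ∈ ks then z (q l) * z (prev (ℓ c) p l) else 0) (Finset.mem_univ k),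
      if_neg hk, zero_add]
    congr 1
    refine Finset.sum_congr rfl fun l hl => ?_
    have hlk := Finset.ne_of_mem_erase hl
    rw [update_of_ne (h.q_inj.ne hlk), update_of_ne (h.prev_ne_q c l k)]
    simp [hlk]
  simp only [copyState, Pi.smul_apply, smul_eq_mul, update_self, update_of_ne (h.p_ne_q k k),
    forall_mem_update (h.q_notMem_dead k), hcond, hsum, hiff,
    comp_update_of_forall_ne fun i => h.ℓ_ne_q i k, List.length_cons]
  by_cases hz : z (q k) = 0
  swap
  · simp [hz]
  rw [if_pos hz]
  by_cases hA : (∀ x ∈ dead ℓ Fr, z x = 0) ∧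
      ∀ l, l ∉ k :: ks → z (q l) = 0 ∧ z (p l) = z (prev (ℓ c) p l) + s (q l)
  swap
  · rw [if_neg (fun H => hA ⟨H.1, H.2.2⟩)]
    simp only [if_neg hA, mul_zero, Finset.sum_const_zero]
  simp only [if_pos hA]
  set G := ∑ l, if l ∈ ks then z (q l) * z (prev (ℓ c) p l) else 0
  -- All dependence on the summation label `a` is collected in one character.
  have hterm : ∀ a, vGate (angles θ 0) j a * (stdAddChar (-(a * z (p k))) *
      ((d : ℂ)⁻¹ ^ (ks.length + 1) *
        (stdAddChar (a * z (prev (ℓ c) p k) + G) * Ψ fun i => z (ℓ i)))) =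
      (Real.sqrt d : ℂ)⁻¹ * ((d : ℂ)⁻¹ ^ (ks.length + 1) * (stdAddChar G * Ψ fun i => z (ℓ i))) *
        stdAddChar (a * (j + z (prev (ℓ c) p k) - z (p k))) := fun a => by
    rw [angles, vGate_zero, fourier_apply]
    have : a * (j + z (prev (ℓ c) p k) - z (p k)) =
        j * a + -(a * z (p k)) + a * z (prev (ℓ c) p k) := by ring
    rw [this, AddChar.map_add_eq_mul, AddChar.map_add_eq_mul, AddChar.map_add_eq_mul]
    ring
  simp only [hterm, ← Finset.mul_sum]
  rw [sum_stdAddChar]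
  have hz' : j + z (prev (ℓ c) p k) - z (p k) = 0 ↔ z (p k) = z (prev (ℓ c) p k) + j := by
    rw [sub_eq_zero, eq_comm, add_comm]
  by_cases hj : z (p k) = z (prev (ℓ c) p k) + j
  · rw [if_pos (hz'.2 hj), if_pos ⟨hA.1, ⟨hz, hj⟩, hA.2⟩, pow_succ]
    have hd : (d : ℂ) ≠ 0 := NeZero.ne _
    field_simp
  · rw [if_neg (fun H => hj (hz'.1 H)), if_neg (fun H => hj H.2.1.2)]
    simp

theorem isPhase_useOps (h : StarData ℓ p q Fr) (s : Fin N' → ZMod d) (T : Finset (Fin N))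
    (t : Fin N) : IsPhase s (useOps d ℓ p q T t) fun z => if t ∈ T then
      (z (p t) - ∑ m, if m ≤ t then s (q m) else 0) * z (ℓ t) else 0 := by
  refine .ite (fun _ => ?_) fun _ => .nil s
  refine ((isPhase_mkcz s (h.ℓ_ne_p t t).symm).append (isPhase_corrZ s _ _)).congr fun z => ?_
  rw [value_prefixSignal h.q_inj]
  ring

/-- The copy equals `z_c + S_k` with a known shift `S_k`. The `CZ` with the target gives the phase
`(z_c + S_k) z_k`, of which the `Z` correction leaves `z_c z_k`. The label of the copy is determined
by `z_c`, so the Fourier measurement erases it at the price of the phase `j (z_c + S_k)`. -/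
theorem useState_step (h : StarData ℓ p q Fr) (θ : ℕ → ZMod d → ℝ) (c : Fin N)
    (T : Finset (Fin N)) (Ψ : Basis d N → ℂ) {k : Fin N} {ks : List (Fin N)} (hk : k ∉ ks)
    (s : Fin N' → ZMod d) (j : ZMod d) :
    act (p k) (Matrix.single 0 j 1 * vGate (angles θ 0))
      (run θ s (useOps d ℓ p q T k) (useState ℓ p q Fr c T Ψ (k :: ks) s)) =
        (Real.sqrt d : ℂ)⁻¹ • useState ℓ p q Fr c T Ψ ks (update s (p k) j) := by
  rw [isPhase_useOps h s T k, act_single_mul]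
  funext z
  set S : Fin N → ZMod d := fun l => ∑ m, if m ≤ l then s (q m) else 0 with hS
  have hSl : ∀ l, (∑ m, if m ≤ l then s (q m) else 0) = S l := fun _ => rfl
  have hS' : ∀ l, (∑ m, if m ≤ l then update s (p k) j (q m) else 0) = S l := fun l =>
    Finset.sum_congr rfl fun m _ => by rw [update_of_ne (h.p_ne_q k m).symm]
  have hq : ∀ a l, update z (p k) a (q l) = z (q l) := fun a l =>
    update_of_ne (h.p_ne_q k l).symm _ _
  have hℓ : ∀ a i, update z (p k) a (ℓ i) = z (ℓ i) := fun a i =>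
    update_of_ne (h.ℓ_ne_p i k) _ _
  have hc₁ : ∀ a, (∀ l, l ∉ k :: ks → update z (p k) a (p l) = 0) ↔
      ∀ l, l ∉ k :: ks → z (p l) = 0 := fun a => forall₂_congr fun l hl => by
    rw [List.mem_cons, not_or] at hl
    rw [update_of_ne (h.p_inj.ne hl.1)]
  have hc₂ : ∀ a, (∀ l, l ∈ k :: ks → update z (p k) a (p l) = z (ℓ c) + S l) ↔
      a = z (ℓ c) + S k ∧ ∀ l, l ∈ ks → z (p l) = z (ℓ c) + S l := fun a => by
    rw [List.forall_mem_cons, update_self]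
    refine and_congr_right' (forall₂_congr fun l hl => ?_)
    rw [update_of_ne (h.p_inj.ne (ne_of_mem_of_not_mem hl hk))]
  have hc₃ : (∀ l, l ∉ ks → z (p l) = 0) ↔ z (p k) = 0 ∧ ∀ l, l ∉ k :: ks → z (p l) = 0 := by
    constructor
    · intro H
      exact ⟨H k hk, fun l hl => H l fun h => hl (List.mem_cons_of_mem _ h)⟩
    · rintro ⟨H₁, H₂⟩ l hl
      by_cases hlk : l = k
      · subst hlk; exact H₁
      · exact H₂ l (by simp [hlk, hl])
  have hsum : (∑ l, if l ∈ ks then 0 else (if l ∈ T then z (ℓ c) * z (ℓ l) else 0) +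
      update s (p k) j (p l) * (z (ℓ c) + S l)) =
      ((if k ∈ T then z (ℓ c) * z (ℓ k) else 0) + j * (z (ℓ c) + S k)) +
      ∑ l, if l ∈ k :: ks then 0 else (if l ∈ T then z (ℓ c) * z (ℓ l) else 0) +
        s (p l) * (z (ℓ c) + S l) := by
    rw [← Finset.add_sum_erase _ _ (Finset.mem_univ k), if_neg hk, update_self,
      ← Finset.add_sum_erase Finset.univ (fun l => if l ∈ k :: ks then 0 else
        (if l ∈ T then z (ℓ c) * z (ℓ l) else 0) + s (p l) * (z (ℓ c) + S l)) (Finset.mem_univ k),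
      if_pos List.mem_cons_self, zero_add]
    congr 1
    refine Finset.sum_congr rfl fun l hl => ?_
    have hlk := Finset.ne_of_mem_erase hl
    rw [update_of_ne (h.p_inj.ne hlk)]
    simp [hlk]
  simp only [useState, Pi.smul_apply, smul_eq_mul, update_self, hq, hℓ, hSl, hS', hc₁, hc₂, hc₃,
    forall_mem_update (h.p_notMem_dead k), hsum]
  by_cases hz : z (p k) = 0
  swap
  · simp [hz]
  rw [if_pos hz]
  by_cases hA : (∀ x ∈ dead ℓ Fr, z x = 0) ∧ (∀ l, z (q l) = 0) ∧
      (∀ l, l ∉ k :: ks → z (p l) = 0) ∧ ∀ l, l ∈ ks → z (p l) = z (ℓ c) + S l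
  swap
  · rw [if_neg (c := _ ∧ _) (fun H => hA ⟨H.1, H.2.1, H.2.2.1.2, H.2.2.2⟩), mul_zero]
    refine Finset.sum_eq_zero fun a _ => ?_
    rw [if_neg (c := _ ∧ _) (fun H => hA ⟨H.1, H.2.1, H.2.2.1, H.2.2.2.2⟩), mul_zero, mul_zero]
  obtain ⟨hA₁, hA₂, hA₃, hA₄⟩ := hA
  -- Only the label prescribed for the copy contributes to the sum.
  rw [if_pos (c := _ ∧ _) ⟨hA₁, hA₂, ⟨hz, hA₃⟩, hA₄⟩, Finset.sum_eq_single (z (ℓ c) + S k)]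
  · rw [if_pos (c := _ ∧ _) ⟨hA₁, hA₂, hA₃, rfl, hA₄⟩, angles, vGate_zero, fourier_apply,
      AddChar.map_add_eq_mul, AddChar.map_add_eq_mul]
    simp only [add_sub_cancel_right]
    ring
  · intro a _ ha
    rw [if_neg (c := _ ∧ _) (fun H => ha H.2.2.2.1), mul_zero, mul_zero]
  · simp

/-- Once all copies are made, the relations between neighbours telescope to `p_l = z_c` plus the sum
of the outcomes up to `l`. -/
theorem copyState_nil (c : Fin N) (T : Finset (Fin N))
    (Ψ : Basis d N → ℂ) (s : Fin N' → ZMod d) :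
    copyState ℓ p q Fr c Ψ [] s = useState ℓ p q Fr c T Ψ (List.finRange N) s := by
  funext z
  have key : (∀ l, z (p l) = z (prev (ℓ c) p l) + s (q l)) ↔
      ∀ l, z (p l) = z (ℓ c) + ∑ m, if m ≤ l then s (q m) else 0 := by
    -- Recursion for the partial sums of outcomes, with the first position separate, in the same
    -- form as `prev`.
    have hrec : ∀ l : Fin N, (∑ m, if m ≤ l then s (q m) else 0) =
        (if h : (l : ℕ) = 0 then 0 else ∑ m, if m ≤ (⟨l - 1, by omega⟩ : Fin N) then s (q m) else 0)
          + s (q l) := by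
      intro l
      have h₁ : s (q l) = ∑ m, if m = l then s (q m) else 0 := by simp
      split_ifs with hl
      · rw [zero_add, h₁]
        refine Finset.sum_congr rfl fun m _ => if_congr ?_ rfl rfl
        rw [Fin.ext_iff, Fin.le_def]
        omega
      · rw [h₁, ← Finset.sum_add_distrib]
        refine Finset.sum_congr rfl fun m _ => ?_
        simp only [Fin.ext_iff, Fin.le_def]
        split_ifs <;> first | omega | simp
    constructor
    · intro H
      have : ∀ (m : ℕ) (hm : m < N), z (p ⟨m, hm⟩) =
          z (ℓ c) + ∑ i, if i ≤ (⟨m, hm⟩ : Fin N) then s (q i) else 0 := by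
        intro m
        induction m with
        | zero =>
          intro hm
          rw [H, hrec, prev]
          simp
        | succ m ih =>
          intro hm
          rw [H, hrec, prev]
          simp only [Nat.succ_ne_zero, Nat.add_sub_cancel, if_false, dif_neg, not_false_eq_true]
          rw [ih (by omega), add_assoc]
      exact fun l => this l l.2
    · intro H l
      rw [H l, hrec, prev]
      split_ifs with hl
      · rw [zero_add]
      · rw [H, add_assoc]
  simp only [copyState, useState, List.length_nil, pow_zero, one_mul, List.not_mem_nil,
    not_false_eq_true, forall_const, if_false, Finset.sum_const_zero, AddChar.map_zero_eq_one,
    List.mem_finRange, if_true, not_true, IsEmpty.forall_iff, forall_and, key, true_and,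
    implies_true]

end Star

end OneWay

end QuditComp

end


set_option linter.unusedSectionVars false

noncomputable section

/-! ### Correctness of the star; fan-out gates from `F` and `CZ` -/

namespace QuditComp

open Function ZMod StackProg

namespace OneWay

section Star

variable {d n N N' : ℕ} [NeZero d]

/-- Copies of the label of `c` are made along the chain, used for the targets and erased. The
erasures leave the phase `∑ s(p_l) (z_c + S_l)`; its part linear in `z_c` is cancelled by the last
correction, and the rest depends only on the outcomes. A copy is made for every qudit, not only for
those in `T`, so that the chain has the same shape for all gates. -/
theorem Spec.star {θ : ℕ → ZMod d → ℝ} {out : Fin n ↪ Fin N'} {ℓ p q : Fin N → Fin N'}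
    (hp : Injective p) (hq : Injective q) (hpq : ∀ k l, p k ≠ q l)
    {K K' : Finset (Fin N')} {l : List (Op d N')}
    {ρ : (Basis d N → ℂ) → Matrix (Basis d n) (Basis d n) ℂ} (h : Spec θ out ℓ K l ρ)
    (hK : K ⊆ K') (hpK : ∀ k, p k ∈ K' ∧ p k ∉ K) (hqK : ∀ k, q k ∈ K' ∧ q k ∉ K)
    (c : Fin N) (T : Finset (Fin N)) :
    Spec θ out ℓ K' (OneWay.star d ℓ p q c T ++ l) fun Ψ =>
      ρ fun w => stdAddChar (∑ t ∈ T, w c * w t) * Ψ w := by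
  intro Fr hFr hd
  have sd : StarData ℓ p q Fr := ⟨hp, hq, hpq, hd, fun k => hFr (hpK k).1,
    fun k => hFr (hqK k).1⟩
  set P : Finset (Fin N') := Finset.univ.image p with hP
  set Q : Finset (Fin N') := Finset.univ.image q with hQ
  have hPQ : Disjoint P Q := by
    rw [Finset.disjoint_left]
    intro x hx hx'
    obtain ⟨k, -, rfl⟩ := Finset.mem_image.1 hx
    obtain ⟨k', -, e⟩ := Finset.mem_image.1 hx'
    exact hpq k k' e.symm
  have hsub : P ∪ Q ⊆ Fr := by
    intro x hx
    rcases Finset.mem_union.1 hx with hx | hx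
    · obtain ⟨k, -, rfl⟩ := Finset.mem_image.1 hx
      exact sd.p_mem k
    · obtain ⟨k, -, rfl⟩ := Finset.mem_image.1 hx
      exact sd.q_mem k
  -- Afterwards the chain is used up: its qudits have been measured and count as dead.
  have hdead : dead ℓ (Fr \ (P ∪ Q)) = dead ℓ Fr ∪ Q ∪ P := by
    ext x
    simp only [Finset.mem_union, mem_dead, Finset.mem_sdiff]
    constructor
    · rintro ⟨h₁, h₂⟩
      tauto
    · rintro ((⟨h₁, h₂⟩ | hx) | hx)
      · tauto
      · refine ⟨by tauto, fun i e => ?_⟩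
        obtain ⟨k, -, rfl⟩ := Finset.mem_image.1 hx
        exact sd.ℓ_ne_q i k e
      · refine ⟨by tauto, fun i e => ?_⟩
        obtain ⟨k, -, rfl⟩ := Finset.mem_image.1 hx
        exact sd.ℓ_ne_p i k e
  obtain ⟨h₁, h₂⟩ := h (Fr \ (P ∪ Q)) (fun x hx => Finset.mem_sdiff.2 ⟨hFr (hK hx), fun hx' => by
    rcases Finset.mem_union.1 hx' with hx' | hx'
    · obtain ⟨k, -, rfl⟩ := Finset.mem_image.1 hx'
      exact (hpK k).2 hx
    · obtain ⟨k, -, rfl⟩ := Finset.mem_image.1 hx'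
      exact (hqK k).2 hx⟩) fun i hi => hd i (Finset.mem_sdiff.1 hi).1
  have hcopy : ∀ k, ∀ x ∈ copyOps d p q k, x.measured = ∅ := fun k x hx => (mem_copyOps hx).2.2.1
  have huse : ∀ k, ∀ x ∈ useOps d ℓ p q T k, x.measured = ∅ := fun k x hx => (mem_useOps hx).2.2.1
  have hmeas : ∀ {L : Fin N → List (Op d N')} {m : Fin N → Fin N'},
      (∀ k, ∀ q ∈ L k, q.measured = ∅) →
        measuredIn (measureBlocks L m (List.finRange N)) = Finset.univ.image m := by
    intro L m hL
    ext x
    rw [measuredIn_measureBlocks hL]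
    simp
  have hex₄ : Executable out (dead ℓ Fr ∪ Q ∪ P)
      ([.corrZ (ℓ c) (totalSignal d p)] ++ l) := by
    refine ⟨?_, ?_, ?_⟩
    · rw [← hdead]
      simpa [Op.acts] using fun e => (mem_dead.1 e).2 c rfl
    · intro x hx
      rw [Op.deps, Finset.mem_filter] at hx
      refine Finset.mem_union_right _ ?_
      by_contra hne
      refine hx.2 (if_neg ?_)
      rintro ⟨k, rfl⟩
      exact hne (Finset.mem_image_of_mem p (Finset.mem_univ k))
    · rw [← hdead]
      simpa [Op.measured] using h₁
  have hex₃ : Executable out (dead ℓ Fr ∪ Q) (measureBlocks (useOps d ℓ p q T) p (List.finRange N) ++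
      ([.corrZ (ℓ c) (totalSignal d p)] ++ l)) := by
    refine executable_append (runnable_measureBlocks hp (fun k x hx => ⟨huse k x hx, ?_⟩)
      (List.nodup_finRange N) (fun k _ => ?_) fun k _ x hx => ⟨?_, ?_⟩) ?_
    · intro k' hk' hmem
      have := (mem_useOps hx).1 hmem
      rw [Finset.mem_insert, Finset.mem_singleton] at this
      rcases this with e | e
      · exact hk' (hp e)
      · exact sd.ℓ_ne_p _ _ e.symm
    · rw [Finset.mem_union, not_or]
      exact ⟨sd.p_notMem_dead k, fun e => Finset.disjoint_left.1 hPQ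
        (Finset.mem_image_of_mem p (Finset.mem_univ k)) e⟩
    · refine Finset.disjoint_of_subset_left (mem_useOps hx).1 ?_
      rw [Finset.disjoint_insert_left, Finset.disjoint_singleton_left, Finset.mem_union,
        Finset.mem_union]
      refine ⟨?_, ?_⟩
      · rintro (e | e)
        · exact sd.p_notMem_dead k e
        · obtain ⟨k', -, e⟩ := Finset.mem_image.1 e
          exact hpq _ _ e.symm
      · rintro (e | e)
        · exact sd.ℓ_notMem_dead k e
        · obtain ⟨k', -, e⟩ := Finset.mem_image.1 e
          exact sd.ℓ_ne_q _ _ e.symm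
    · intro y hy
      obtain ⟨k', rfl⟩ := (mem_useOps hx).2.1 y hy
      exact Finset.mem_union_right _ (Finset.mem_image_of_mem q (Finset.mem_univ k'))
    · rw [hmeas huse]
      exact hex₄
  have hex₂ : Executable out (dead ℓ Fr) (measureBlocks (copyOps d p q) q (List.finRange N) ++
      (measureBlocks (useOps d ℓ p q T) p (List.finRange N) ++
        ([.corrZ (ℓ c) (totalSignal d p)] ++ l))) := by
    refine executable_append (runnable_measureBlocks hq (fun k x hx => ⟨hcopy k x hx, ?_⟩)
      (List.nodup_finRange N) (fun k _ => sd.q_notMem_dead k) fun k _ x hx => ⟨?_, ?_⟩) ?_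
    · intro k' hk'
      rw [(mem_copyOps hx).1, Finset.mem_insert, Finset.mem_singleton, not_or]
      exact ⟨(hpq _ _).symm, hq.ne hk'⟩
    · rw [(mem_copyOps hx).1, Finset.disjoint_insert_left, Finset.disjoint_singleton_left]
      exact ⟨sd.p_notMem_dead k, sd.q_notMem_dead k⟩
    · rw [(mem_copyOps hx).2.1]
      exact Finset.empty_subset _
    · rw [hmeas hcopy]
      exact hex₃
  have hlink : ∀ x ∈ (List.finRange N).flatMap fun k => (mkcz (prev (ℓ c) p k) (q k) : List (Op d N')),
      ∃ k, x ∈ (mkcz (prev (ℓ c) p k) (q k) : List (Op d N')) := fun x hx => by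
    obtain ⟨k, -, hx⟩ := List.mem_flatMap.1 hx
    exact ⟨k, hx⟩
  have hlink' : ∀ x ∈ (List.finRange N).flatMap fun k => (mkcz (prev (ℓ c) p k) (q k) : List (Op d N')),
      x.measured = ∅ := fun x hx => by
    obtain ⟨k, hx⟩ := hlink x hx
    exact (mem_mkcz hx).2.2.1
  rw [OneWay.star, List.append_assoc, List.append_assoc, List.append_assoc]
  refine ⟨executable_append (.of_forall fun x hx => ?_) ?_, fun s Ψ => ?_⟩
  · obtain ⟨k, hk⟩ := hlink x hx
    obtain ⟨e₁, e₂, e₃, -⟩ := mem_mkcz hk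
    rw [e₁, e₂, Finset.disjoint_insert_left, Finset.disjoint_singleton_left]
    exact ⟨⟨sd.prev_notMem_dead c k, sd.q_notMem_dead k⟩, Finset.empty_subset _, e₃⟩
  · rw [measuredIn_eq_empty hlink', Finset.union_empty]
    exact hex₂
  · rw [finalState_append θ out hlink']
    -- The normalisation of the fresh qudits outside the chain is absorbed in the state.
    set Ψ' : Basis d N → ℂ := fun w => (Real.sqrt d : ℂ)⁻¹ ^ (Fr \ (P ∪ Q)).card * Ψ w with hΨ'
    have hstart : run θ s ((List.finRange N).flatMap fun k => mkcz (prev (ℓ c) p k) (q k))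
        (emb ℓ Fr Ψ) = copyState ℓ p q Fr c Ψ' (List.finRange N) s := by
      rw [IsPhase.flatMap_finRange fun k => isPhase_mkcz s (sd.prev_ne_q c k k)]
      funext z
      have hcard : Fr.card = (Fr \ (P ∪ Q)).card + (N + N) := by
        have h₁ := Finset.card_sdiff_add_card_eq_card hsub
        rw [Finset.card_union_of_disjoint hPQ, hP, hQ, Finset.card_image_of_injective _ hp,
          Finset.card_image_of_injective _ hq, Finset.card_univ, Fintype.card_fin] at h₁
        rw [h₁]
      -- The `2N` qudits of the chain contribute `(1/√d)^{2N} = d^{-N}`, the factor in `copyState`.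
      have hpow : (Real.sqrt d : ℂ)⁻¹ ^ Fr.card =
          (d : ℂ)⁻¹ ^ N * (Real.sqrt d : ℂ)⁻¹ ^ (Fr \ (P ∪ Q)).card := by
        rw [hcard, pow_add, ← two_mul, pow_mul, pow_two, ← mul_inv, sqrt_mul_sqrt, mul_comm]
      simp only [emb, copyState, List.mem_finRange, not_true, IsEmpty.forall_iff, implies_true,
        and_true, if_true, List.length_finRange, hΨ', hpow, mul_comm (z (prev (ℓ c) p _))]
      split_ifs
      · ring
      · simp
    rw [hstart]
    refine finalState_measureBlocks hcopy (copyState ℓ p q Fr c Ψ') (fun s => ?_)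
      (fun k ks hk s j => copyState_step sd θ c Ψ' hk s j) _ _ (List.nodup_finRange N) hex₂ s
    rw [copyState_nil c T]
    refine finalState_measureBlocks huse (useState ℓ p q Fr c T Ψ') (fun s => ?_)
      (fun k ks hk s j => useState_step sd θ c T Ψ' hk s j) _ _ (List.nodup_finRange N) hex₃ s
    rw [List.singleton_append, finalState_cons θ out (by rfl), apply_corrZ, act_pauliZ,
      value_totalSignal hp]
    -- The phase which remains is the same for all labels, so it is a global phase for each record
    -- of outcomes.
    set u : ℂ := stdAddChar (∑ l, s (p l) * ∑ m, if m ≤ l then s (q m) else 0) with hu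
    have hend : (fun z : Basis d N' => stdAddChar (-(∑ l, s (p l)) * z (ℓ c)) *
        useState ℓ p q Fr c T Ψ' [] s z) =
        u • emb ℓ (Fr \ (P ∪ Q)) fun w => stdAddChar (∑ t ∈ T, w c * w t) * Ψ w := by
      funext z
      have hc : (∀ x ∈ dead ℓ (Fr \ (P ∪ Q)), z x = 0) ↔
          (∀ x ∈ dead ℓ Fr, z x = 0) ∧ (∀ l, z (q l) = 0) ∧ ∀ l, z (p l) = 0 := by
        rw [hdead, Finset.forall_mem_union, Finset.forall_mem_union, and_assoc, hP, hQ]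
        simp
      simp only [useState, emb, hc, Pi.smul_apply, smul_eq_mul, List.not_mem_nil, if_false,
        not_false_eq_true, forall_const, IsEmpty.forall_iff, implies_true, and_true, hΨ']
      split_ifs
      · have : -(∑ l, s (p l)) * z (ℓ c) + ∑ l, ((if l ∈ T then z (ℓ c) * z (ℓ l) else 0) +
            s (p l) * (z (ℓ c) + ∑ m, if m ≤ l then s (q m) else 0)) =
            (∑ l, s (p l) * ∑ m, if m ≤ l then s (q m) else 0) +
              ∑ t ∈ T, z (ℓ c) * z (ℓ t) := by
          rw [Finset.sum_add_distrib, ← Finset.sum_filter, Finset.filter_mem_eq_inter,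
            Finset.univ_inter]
          simp only [mul_add, Finset.sum_add_distrib, ← Finset.sum_mul]
          ring
        rw [← mul_assoc, ← AddChar.map_add_eq_mul, this, AddChar.map_add_eq_mul, hu]
        ring
      · simp
    rw [hend, finalState_smul, hu, stdAddChar_mul_star, one_smul, h₂]

end Star

/-! ## Layers of single-qudit operators -/

section Layers

variable {d n N N' : ℕ} [NeZero d]

/-- The operator `g` applied to each of the qudits in a list. -/
def actAll (g : Matrix (ZMod d) (ZMod d) ℂ) (ts : List (Fin N)) (Φ : Basis d N → ℂ) :
    Basis d N → ℂ := ts.foldl (fun Φ t => act t g Φ) Φ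

theorem actAll_act {g h : Matrix (ZMod d) (ZMod d) ℂ} {t : Fin N} :
    ∀ {ts : List (Fin N)}, t ∉ ts → ∀ Φ : Basis d N → ℂ,
      actAll g ts (act t h Φ) = act t h (actAll g ts Φ)
  | [], _, _ => rfl
  | t' :: ts, ht, Φ => by
    rw [List.mem_cons, not_or] at ht
    change actAll g ts (act t' g (act t h Φ)) = act t h (actAll g ts (act t' g Φ))
    rw [act_comm (Ne.symm ht.1), actAll_act ht.2]

theorem actAll_actAll (g h : Matrix (ZMod d) (ZMod d) ℂ) :
    ∀ {ts : List (Fin N)}, ts.Nodup → ∀ Φ : Basis d N → ℂ,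
      actAll g ts (actAll h ts Φ) = actAll (g * h) ts Φ
  | [], _, _ => rfl
  | t :: ts, ht, Φ => by
    rw [List.nodup_cons] at ht
    change actAll g ts (act t g (actAll h ts (act t h Φ))) = actAll (g * h) ts (act t (g * h) Φ)
    rw [← actAll_act ht.1, act_act, actAll_actAll g h ht.2]

theorem actAll_pauliZ (s : ZMod d) : ∀ (ts : List (Fin N)) (Φ : Basis d N → ℂ),
    actAll (pauliZ s) ts Φ = fun w => stdAddChar (ts.map fun t => s * w t).sum * Φ w
  | [], Φ => by
    funext w
    simp [actAll]
  | t :: ts, Φ => by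
    change actAll _ ts (act t _ Φ) = _
    rw [actAll_pauliZ s ts, act_pauliZ]
    funext w
    rw [List.map_cons, List.sum_cons, AddChar.map_add_eq_mul]
    ring

theorem actAll_pauliX (s : ZMod d) : ∀ {ts : List (Fin N)}, ts.Nodup → ∀ Φ : Basis d N → ℂ,
    actAll (pauliX s) ts Φ = fun w => Φ fun k => if k ∈ ts then w k - s else w k
  | [], _, Φ => by simp [actAll]
  | t :: ts, ht, Φ => by
    rw [List.nodup_cons] at ht
    change actAll _ ts (act t _ Φ) = _
    rw [actAll_pauliX s ht.2, act_pauliX]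
    funext w
    refine congrArg Φ (funext fun k => ?_)
    by_cases hk : k = t
    · subst hk; simp [ht.1]
    · simp [hk]

/-- Operators on other qudits can be applied for each value of a qudit separately. -/
theorem actAll_congr {g : Matrix (ZMod d) (ZMod d) ℂ} {c : Fin N} (v : ZMod d) :
    ∀ {ts : List (Fin N)}, c ∉ ts → ∀ {Φ Φ' : Basis d N → ℂ}, (∀ w, w c = v → Φ w = Φ' w) →
      ∀ w, w c = v → actAll g ts Φ w = actAll g ts Φ' w
  | [], _, _, _, h, w, hw => h w hw
  | t :: ts, hc, Φ, Φ', h, w, hw => by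
    rw [List.mem_cons, not_or] at hc
    refine actAll_congr v hc.2 (Φ := act t g Φ) (Φ' := act t g Φ') (fun w hw => ?_) w hw
    refine Finset.sum_congr rfl fun a _ => ?_
    rw [h _ (by rwa [update_of_ne hc.1])]

/-- A fan-out gate by Fourier gates and controlled-`Z` gates. -/
theorem actAll_fourier_eq_fanout {c : Fin N} {ts : List (Fin N)} (hts : ts.Nodup) (hc : c ∉ ts)
    (Φ : Basis d N → ℂ) :
    actAll fourier ts (actAll fourier ts (actAll fourier ts fun w =>
      stdAddChar (ts.map fun t => w c * w t).sum * actAll fourier ts Φ w)) =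
        fun w => Φ fun k => if k ∈ ts then w k - w c else w k := by
  rw [actAll_actAll _ _ hts, actAll_actAll _ _ hts]
  funext w
  -- With the label of `c` held fixed, the phase is `Z^{w c}` on each target, and conjugation by `F`
  -- turns it into the shift `X^{w c}`.
  rw [actAll_congr (w c) hc (Φ' := actAll (pauliZ (w c)) ts (actAll fourier ts Φ))
    (fun w' hw' => by rw [actAll_pauliZ, hw']) w rfl, actAll_actAll _ _ hts, actAll_actAll _ _ hts]
  have : (fourier : Matrix (ZMod d) (ZMod d) ℂ) * (fourier * fourier) * (pauliZ (w c) * fourier) =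
      pauliX (w c) := by
    rw [← fourier_conj_pauliZ]
    simp only [Matrix.mul_assoc]
  rw [← Matrix.mul_assoc] at this
  simp only [← Matrix.mul_assoc] at this ⊢
  rw [this, actAll_pauliX _ hts]

/-- Apply Fourier gates to the qudits in `T`, while moving them from `x` to `y`. -/
def layer (x y : Fin N → Fin N') (T : Finset (Fin N)) : List (Op d N') :=
  (List.finRange N).flatMap fun t => if t ∈ T then mv 0 (x t) (y t) else []

theorem layer_eq (x y : Fin N → Fin N') (T : Finset (Fin N)) : (layer x y T : List (Op d N')) =
    ((List.finRange N).filter fun t => t ∈ T).flatMap fun t => mv 0 (x t) (y t) := by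
  rw [layer]
  induction List.finRange N with
  | nil => rfl
  | cons t ts ih =>
    rw [List.flatMap_cons, ih]
    by_cases ht : t ∈ T <;> simp [ht]

theorem Spec.layer {θ : ℕ → ZMod d → ℝ} {out : Fin n ↪ Fin N'} {x y : Fin N → Fin N'}
    (hy : Injective y) {K : Finset (Fin N')} {l : List (Op d N')}
    {ρ : (Basis d N → ℂ) → Matrix (Basis d n) (Basis d n) ℂ} :
    ∀ {ts : List (Fin N)} {ℓ : Fin N → Fin N'} {K' : Finset (Fin N')}, ts.Nodup →
      (∀ t ∈ ts, ℓ t = x t) → Injective ℓ → (∀ i, ∀ t ∈ ts, ℓ i ≠ y t) →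
      Spec θ out (fun i => if i ∈ ts then y i else ℓ i) K l ρ → K ⊆ K' →
      (∀ t ∈ ts, y t ∈ K' ∧ y t ∉ K) →
      Spec θ out ℓ K' (ts.flatMap (fun t => OneWay.mv 0 (x t) (y t)) ++ l) fun Ψ =>
        ρ (actAll fourier ts Ψ)
  | [], ℓ, K', _, _, _, _, h, hK, _ => by simpa [actAll] using h.mono hK
  | t :: ts, ℓ, K', hts, hx, hℓ, hne, h, hK, hyK => by
    rw [List.nodup_cons] at hts
    rw [List.flatMap_cons, List.append_assoc, ← hx t List.mem_cons_self]
    have hyt : ∀ t' ∈ ts, y t' ≠ y t := fun t' ht' => hy.ne (ne_of_mem_of_not_mem ht' hts.1)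
    have key := Spec.layer (θ := θ) (out := out) (ρ := ρ) (l := l) (K := K) hy
      (K' := K'.erase (y t)) (ℓ := update ℓ t (y t)) (x := x) hts.2
      (fun t' ht' => by
        rw [update_of_ne (ne_of_mem_of_not_mem ht' hts.1), hx t' (List.mem_cons_of_mem _ ht')])
      (by
        intro i k hik
        by_cases hi : i = t <;> by_cases hk : k = t
        · rw [hi, hk]
        · rw [hi, update_self, update_of_ne hk] at hik
          exact absurd hik.symm (hne k t List.mem_cons_self)
        · rw [hk, update_self, update_of_ne hi] at hik
          exact absurd hik (hne i t List.mem_cons_self)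
        · rw [update_of_ne hi, update_of_ne hk] at hik
          exact hℓ hik)
      (fun i t' ht' => by
        by_cases hi : i = t
        · rw [hi, update_self]
          exact (hyt t' ht').symm
        · rw [update_of_ne hi]
          exact hne i t' (List.mem_cons_of_mem _ ht'))
      (by
        convert h using 2 with i
        by_cases hi : i = t
        · subst hi; simp [hts.1]
        · simp [hi])
      (fun k hk => Finset.mem_erase.2 ⟨fun e => (hyK t List.mem_cons_self).2 (e ▸ hk), hK hk⟩)
      (fun t' ht' => ⟨Finset.mem_erase.2 ⟨hyt t' ht', (hyK t' (List.mem_cons_of_mem _ ht')).1⟩,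
        (hyK t' (List.mem_cons_of_mem _ ht')).2⟩)
    have := Spec.mv hℓ key (Finset.erase_subset _ _) (Finset.notMem_erase _ _)
      (hyK t List.mem_cons_self).1 0
    rw [angles, vGate_zero] at this
    exact this

end Layers

end OneWay

end QuditComp

end


set_option linter.unusedSectionVars false

noncomputable section

/-! ### Rows of qudits and correctness of the pattern -/

namespace QuditComp

open Function ZMod StackProg

namespace OneWay

section Defs

variable {d n N : ℕ} [NeZero d] (B : ℕ)

/-- The qudits of the translated computation are arranged in rows; qudit `k` of row `r`. -/
def qd (r : ℕ) (k : Fin N) : Fin ((6 * B + 1) * N) := cell (Fin.ofNat (6 * B + 1) r) k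

theorem val_qd {r : ℕ} (hr : r ≤ 6 * B) (k : Fin N) : (qd B r k : ℕ) = k + N * r := by
  rw [qd, val_cell, Fin.val_ofNat, Nat.mod_eq_of_lt (by omega)]

theorem qd_inj {r r' : ℕ} (hr : r ≤ 6 * B) (hr' : r' ≤ 6 * B) {k k' : Fin N} :
    qd B r k = qd B r' k' ↔ r = r' ∧ k = k' := by
  rw [qd, qd, cell_inj, Fin.ext_iff, Fin.val_ofNat, Fin.val_ofNat, Nat.mod_eq_of_lt (by omega),
    Nat.mod_eq_of_lt (by omega)]

theorem eq_of_qd_eq {r r' : ℕ} {k k' : Fin N} (h : qd B r k = qd B r' k') : k = k' :=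
  (cell_inj.1 h).2

theorem qd_injective (μ : Fin N → ℕ) : Injective fun i => qd B (μ i) i := fun _ _ h =>
  eq_of_qd_eq B h

/-- The qudits in the rows after row `r`. -/
def fresh (N r : ℕ) : Finset (Fin ((6 * B + 1) * N)) :=
  Finset.univ.filter fun x => N * (r + 1) ≤ x

theorem qd_mem_fresh {r r' : ℕ} (hr' : r' ≤ 6 * B) {k : Fin N} : qd B r' k ∈ fresh B N r ↔ r < r' := by
  rw [fresh, Finset.mem_filter, val_qd B hr']
  constructor
  · rintro ⟨-, h⟩
    by_contra hlt
    have := Nat.mul_le_mul_left N (not_lt.1 hlt)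
    rw [mul_add] at h
    omega
  · intro h
    have := Nat.mul_le_mul_left N (Nat.succ_le_of_lt h)
    exact ⟨Finset.mem_univ _, by rw [Nat.succ_eq_add_one] at this; omega⟩

theorem fresh_anti {r r' : ℕ} (h : r ≤ r') : fresh B N r' ⊆ fresh B N r := fun x hx => by
  rw [fresh, Finset.mem_filter] at hx ⊢
  exact ⟨hx.1, (Nat.mul_le_mul_left N (by omega)).trans hx.2⟩

/-- The gate `q` is translated to operations which move qudit `i` to a new place. -/
def Moves : Op d N → Fin N → Prop
  | .rot _ k, i => k = i
  | .fanout _ T _, i => i ∈ T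
  | _, _ => False

open Classical in
/-- The row of qudit `i` after the translation of the first `j` gates in a list. -/
def loc (ops : List (Op d N)) : ℕ → Fin N → ℕ
  | 0, _ => 0
  | j + 1, i => if ∃ q ∈ ops[j]?, Moves q i then 6 * j + 6 else loc ops j i

theorem loc_le (ops : List (Op d N)) (j : ℕ) (i : Fin N) : loc ops j i ≤ 6 * j := by
  induction j with
  | zero => rfl
  | succ j ih => rw [loc]; split_ifs <;> omega

/-- The translation of a fan-out gate, where `μ i` is the row of qudit `i`. -/
def translatedFanout (μ : Fin N → ℕ) (j : ℕ) (c : Fin N) (T : Finset (Fin N)) :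
    List (Op d ((6 * B + 1) * N)) :=
  layer (fun i => qd B (μ i) i) (qd B (6 * j + 1)) T ++
    (star d (fun i => qd B (if i ∈ T then 6 * j + 1 else μ i) i) (qd B (6 * j + 2))
      (qd B (6 * j + 3)) c T ++
    (layer (qd B (6 * j + 1)) (qd B (6 * j + 4)) T ++
    (layer (qd B (6 * j + 4)) (qd B (6 * j + 5)) T ++
    layer (qd B (6 * j + 5)) (qd B (6 * j + 6)) T)))

/-- The translation of gate number `j`, where `μ i` is the row of qudit `i`. -/
def block (μ : Fin N → ℕ) : Op d N × ℕ → List (Op d ((6 * B + 1) * N))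
  | (.cz i k _, _) => mkcz (qd B (μ i) i) (qd B (μ k) k)
  | (.rot a i, j) => mv a (qd B (μ i) i) (qd B (6 * j + 6) i)
  | (.fanout c T _, j) => translatedFanout B μ j c T
  | _ => []

variable {B}

theorem Spec.congr {N' : ℕ} {θ : ℕ → ZMod d → ℝ} {out : Fin n ↪ Fin N'} {ℓ ℓ' : Fin N → Fin N'}
    {K : Finset (Fin N')} {l : List (Op d N')}
    {ρ ρ' : (Basis d N → ℂ) → Matrix (Basis d n) (Basis d n) ℂ} (h : Spec θ out ℓ K l ρ)
    (hℓ : ∀ i, ℓ' i = ℓ i) (hρ : ∀ Ψ, ρ' Ψ = ρ Ψ) : Spec θ out ℓ' K l ρ' := by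
  obtain rfl := funext hℓ
  obtain rfl := funext hρ
  exact h

theorem Spec.layer_qd {θ : ℕ → ZMod d → ℝ} {out : Fin n ↪ Fin ((6 * B + 1) * N)} {x μ : Fin N → ℕ}
    {T : Finset (Fin N)} {r r' : ℕ} {l : List (Op d ((6 * B + 1) * N))}
    {ρ : (Basis d N → ℂ) → Matrix (Basis d n) (Basis d n) ℂ} (hr : r < r') (hr' : r' ≤ 6 * B)
    (hμ : ∀ i, μ i ≤ r) (hx : ∀ t ∈ T, μ t = x t)
    (h : Spec θ out (fun i => qd B (if i ∈ T then r' else μ i) i) (fresh B N r') l ρ) :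
    Spec θ out (fun i => qd B (μ i) i) (fresh B N r)
      (OneWay.layer (fun i => qd B (x i) i) (qd B r') T ++ l) fun Ψ =>
        ρ (actAll fourier ((List.finRange N).filter fun t => t ∈ T) Ψ) := by
  rw [layer_eq]
  have hmem : ∀ t, t ∈ (List.finRange N).filter (fun t => t ∈ T) ↔ t ∈ T := by simp
  refine Spec.layer (y := qd B r') (qd_injective B fun _ => r') (K := fresh B N r')
    ((List.nodup_finRange N).filter _) (fun t ht => ?_) (qd_injective B μ) (fun i t _ e => ?_) ?_
    (fresh_anti B hr.le) fun t _ => ⟨(qd_mem_fresh B hr').2 hr, fun h => ?_⟩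
  · rw [hx t ((hmem t).1 ht)]
  · have := hμ i
    rw [qd_inj B (by omega) hr'] at e
    omega
  · convert h using 2 with i
    simp only [hmem]
    split_ifs <;> rfl
  · exact lt_irrefl _ ((qd_mem_fresh B hr').1 h)

/-- The targets pass through the rows `6j+1`, `6j+4`, `6j+5`, `6j+6`, with one Fourier gate in each
move; the rows `6j+2` and `6j+3` hold the chain for the star, which is applied after the first move.
-/
theorem spec_translatedFanout {θ : ℕ → ZMod d → ℝ} {out : Fin n ↪ Fin ((6 * B + 1) * N)}
    {μ : Fin N → ℕ} {T : Finset (Fin N)} {c : Fin N} (hc : c ∉ T) {j : ℕ}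
    {l : List (Op d ((6 * B + 1) * N))} {ρ : (Basis d N → ℂ) → Matrix (Basis d n) (Basis d n) ℂ}
    (hj : j < B) (hμ : ∀ i, μ i ≤ 6 * j)
    (h : Spec θ out (fun i => qd B (if i ∈ T then 6 * j + 6 else μ i) i) (fresh B N (6 * j + 6)) l
      ρ) :
    Spec θ out (fun i => qd B (μ i) i) (fresh B N (6 * j)) (translatedFanout B μ j c T ++ l)
      fun Ψ => ρ fun w => Ψ fun k => if k ∈ T then w k - w c else w k := by
  have hle : ∀ r i, 6 * j ≤ r → (if i ∈ T then r else μ i) ≤ r := fun r i hr => by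
    have := hμ i
    split_ifs <;> omega
  have hite : ∀ r r' i, (if i ∈ T then r' else if i ∈ T then r else μ i) =
      if i ∈ T then r' else μ i := fun r r' i => by split_ifs <;> rfl
  have hx : ∀ r, ∀ t ∈ T, (if t ∈ T then r else μ t) = (fun _ => r) t := fun r t ht => if_pos ht
  -- `Spec` describes what the remaining operations do, so the layers are added from the last one
  -- backwards.
  have h₁ := Spec.layer_qd (B := B) (μ := fun i => if i ∈ T then 6 * j + 5 else μ i) (r := 6 * j + 5)
    (r' := 6 * j + 6) (x := fun _ => 6 * j + 5)
    (by omega) (by omega) (fun i => hle (6 * j + 5) i (by omega)) (hx (6 * j + 5))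
    (by simpa only [hite] using h)
  have h₂ := Spec.layer_qd (B := B) (μ := fun i => if i ∈ T then 6 * j + 4 else μ i) (r := 6 * j + 4)
    (r' := 6 * j + 5) (x := fun _ => 6 * j + 4)
    (by omega) (by omega) (fun i => hle (6 * j + 4) i (by omega)) (hx (6 * j + 4))
    (by simpa only [hite] using h₁)
  have h₃ := Spec.layer_qd (B := B) (μ := fun i => if i ∈ T then 6 * j + 1 else μ i) (r := 6 * j + 3)
    (r' := 6 * j + 4) (x := fun _ => 6 * j + 1)
    (by omega) (by omega) (fun i => (hle (6 * j + 1) i (by omega)).trans (by omega)) (hx (6 * j + 1))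
    (by simpa only [hite] using h₂)
  have hm : ∀ r r', r' ≤ 6 * B → ∀ k : Fin N, r < r' → qd B r' k ∈ fresh B N r :=
    fun r r' hr' k h => (qd_mem_fresh B hr').2 h
  have hm' : ∀ r r', r' ≤ 6 * B → ∀ k : Fin N, r' ≤ r → qd B r' k ∉ fresh B N r :=
    fun r r' hr' k h h' => absurd ((qd_mem_fresh B hr').1 h') (by omega)
  have h₄ := Spec.star (p := qd B (6 * j + 2)) (q := qd B (6 * j + 3))
    (qd_injective B fun _ => 6 * j + 2) (qd_injective B fun _ => 6 * j + 3)
    (fun k l e => by rw [qd_inj B (by omega) (by omega)] at e; omega) h₃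
    (fresh_anti B (by omega : 6 * j + 1 ≤ 6 * j + 3))
    (fun k => ⟨hm _ _ (by omega) k (by omega), hm' _ _ (by omega) k (by omega)⟩)
    (fun k => ⟨hm _ _ (by omega) k (by omega), hm' _ _ (by omega) k (by omega)⟩) c T
  have h₅ := Spec.layer_qd (μ := μ) (r' := 6 * j + 1) (by omega) (by omega) hμ (fun _ _ => rfl) h₄
  simp only [translatedFanout, List.append_assoc]
  refine h₅.congr (fun _ => rfl) fun Ψ => congrArg ρ ?_
  have hmem : ∀ t, t ∈ (List.finRange N).filter (fun t => t ∈ T) ↔ t ∈ T := by simp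
  have hsum : ∀ w : Basis d N, ∑ t ∈ T, w c * w t =
      (((List.finRange N).filter fun t => t ∈ T).map fun t => w c * w t).sum := fun w => by
    rw [← List.sum_toFinset _ ((List.nodup_finRange N).filter _)]
    refine Finset.sum_congr ?_ fun _ _ => rfl
    ext t
    simp
  simp only [hsum]
  rw [actAll_fourier_eq_fanout ((List.nodup_finRange N).filter _) ((hmem c).not.2 hc)]
  simp only [hmem]

theorem loc_succ {ops : List (Op d N)} {j : ℕ} {q : Op d N} (h : ops[j]? = some q) (i : Fin N)
    [Decidable (Moves q i)] :
    loc ops (j + 1) i = if Moves q i then 6 * j + 6 else loc ops j i := by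
  rw [loc, h]
  simp only [Option.mem_def, Option.some.injEq, exists_eq_left']

/-- Before gate `j` every qudit is in one of the rows up to `6j`, and all later rows are still
fresh. -/
theorem spec_ops {θ : ℕ → ZMod d → ℝ} {out : Fin n ↪ Fin N} {out' : Fin n ↪ Fin ((6 * B + 1) * N)}
    {ops : List (Op d N)} (hops : ∀ q ∈ ops, q.IsFanoutGate) (hB : ops.length ≤ B)
    (hout : ∀ a, out' a = qd B (loc ops ops.length (out a)) (out a)) :
    ∀ (l : List (Op d N)) (j : ℕ), j ≤ ops.length → ops.drop j = l →
      Spec θ out' (fun i => qd B (loc ops j i) i) (fresh B N (6 * j))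
        ((l.zipIdx j).flatMap fun b => block B (loc ops b.2) b) fun Ψ => finalState θ out l 0 Ψ
  | [], j, hj, h => by
    rw [List.drop_eq_nil_iff] at h
    obtain rfl : j = ops.length := le_antisymm hj h
    exact spec_nil θ (qd_injective B _) hout _
  | q :: l, j, hj, h => by
    have hj' : j < ops.length := by
      by_contra hlt
      rw [List.drop_eq_nil_of_le (not_lt.1 hlt)] at h
      simp at h
    have hq : ops[j]? = some q := by
      rw [List.drop_eq_getElem_cons hj', List.cons.injEq] at h
      rw [List.getElem?_eq_getElem hj', h.1]
    have hl : ops.drop (j + 1) = l := by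
      rw [← List.drop_drop, h]; rfl
    have ih := spec_ops (θ := θ) hops hB hout l (j + 1) hj' hl
    have hμ := loc_le ops j
    have hgate := hops q (List.mem_of_getElem? hq)
    rw [List.zipIdx_cons, List.flatMap_cons]
    rw [mul_add, mul_one] at ih
    cases q with
    | cz i k hik =>
      have h₁ : ∀ i, loc ops (j + 1) i = loc ops j i := fun i => by
        classical
        rw [loc_succ hq]
        exact if_neg fun h => h
      simp only [h₁] at ih
      refine (Spec.phase (ih.mono (fresh_anti B (by omega : 6 * j ≤ 6 * j + 6)))
        (i := i) (k := k) fun e => hik (eq_of_qd_eq B e)).congr (fun _ => rfl) fun Ψ => ?_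
      rw [finalState_cons _ _ (q := .cz i k hik) rfl, apply_cz]
    | rot a i =>
      have h₁ : ∀ k, update (fun k => qd B (loc ops j k) k) i (qd B (6 * j + 6) i) k =
          qd B (loc ops (j + 1) k) k := fun k => by
        classical
        rw [loc_succ hq]
        by_cases hk : k = i
        · subst hk; simp [Moves]
        · rw [update_of_ne hk, if_neg (show ¬ Moves (Op.rot a i) k from Ne.symm hk)]
      refine (Spec.mv (qd_injective B _) (ih.congr h₁ fun _ => rfl)
        (fresh_anti B (by omega : 6 * j ≤ 6 * j + 6))
        (fun h => lt_irrefl _ ((qd_mem_fresh B (by omega)).1 h))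
        ((qd_mem_fresh B (by omega)).2 (by omega)) a).congr (fun _ => rfl) fun Ψ => ?_
      rw [finalState_cons _ _ (q := .rot a i) rfl, apply_rot]
    | fanout c T hc =>
      have h₁ : ∀ k, loc ops (j + 1) k = if k ∈ T then 6 * j + 6 else loc ops j k := fun k => by
        classical
        rw [loc_succ hq]
        exact if_congr Iff.rfl rfl rfl
      simp only [h₁] at ih
      refine (spec_translatedFanout hc (by omega) hμ ih).congr (fun _ => rfl) fun Ψ => ?_
      rw [finalState_cons _ _ (q := .fanout c T hc) rfl, apply_fanout]
    | corrX i σ => exact hgate.elim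
    | corrZ i σ => exact hgate.elim
    | measure i a σ τ => exact hgate.elim

end Defs

section Translate

variable {d n : ℕ} [NeZero d]

/-- Place the qudits of `f` in the rows `μ`. -/
def place {N : ℕ} (B : ℕ) (μ : Fin N → ℕ) (f : Fin n ↪ Fin N) : Fin n ↪ Fin ((6 * B + 1) * N) :=
  f.trans ⟨fun i => qd B (μ i) i, qd_injective B μ⟩

/-- The translation of a circuit to a measurement pattern. -/
def translate (Q : Computation d n) : Computation d n where
  N := (6 * Q.code.length + 1) * Q.N
  inp := place Q.code.length (loc Q.ops 0) Q.inp
  out := place Q.code.length (loc Q.ops Q.ops.length) Q.out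
  ops := Q.ops.zipIdx.flatMap fun b => block Q.code.length (loc Q.ops b.2) b

theorem implements_translate {Q : Computation d n} {θ : ℕ → ZMod d → ℝ}
    {U : Matrix (Basis d n) (Basis d n) ℂ} (hQ : ∀ q ∈ Q.ops, q.IsFanoutGate)
    (h : Q.Implements θ ketPlus U) : (translate Q).Implements θ ketPlus U := by
  have hspec := spec_ops (θ := θ) hQ (length_ops_le Q) (out := Q.out) (out' := (translate Q).out)
    (fun _ => rfl) Q.ops 0 (Nat.zero_le _) rfl
  set ℓ : Fin Q.N → Fin ((6 * Q.code.length + 1) * Q.N) :=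
    fun i => qd Q.code.length (loc Q.ops 0 i) i with hℓ
  set Fr : Finset (Fin ((6 * Q.code.length + 1) * Q.N)) :=
    Finset.univ.filter fun x => ∀ i, ℓ i ≠ x with hFr
  -- At the beginning every place is either occupied or fresh.
  have hdead : dead ℓ Fr = ∅ := by
    ext x
    simp [mem_dead, hFr]
  have hsub : fresh Q.code.length Q.N (6 * 0) ⊆ Fr := fun x hx => by
    rw [hFr, Finset.mem_filter]
    refine ⟨Finset.mem_univ _, ?_⟩
    rintro i rfl
    exact lt_irrefl _ ((qd_mem_fresh _ (Nat.zero_le _)).1 hx)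
  obtain ⟨hex, hfin⟩ := hspec Fr hsub (fun i => by simp [hFr])
  rw [hdead] at hex
  refine ⟨hex, fun ψ => ?_⟩
  rw [← h.2 ψ]
  refine Eq.trans ?_ (hfin 0 (initialState Q.inp ketPlus ψ))
  have := initialState_emb (qd_injective Q.code.length (loc Q.ops 0)) (inp := Q.inp)
    (inp' := (translate Q).inp) (fun _ => rfl) ψ
  exact congrArg (finalState θ (translate Q).out (translate Q).ops 0) this

end Translate

end OneWay

end QuditComp

end


set_option linter.unusedSectionVars false

noncomputable section

/-! ### Depth of the pattern -/

namespace QuditComp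

open Function ZMod StackProg

namespace OneWay

section Members

variable {d N N' : ℕ} [NeZero d]

theorem mem_mv {a : ℕ} {u v : Fin N'} {x : Op d N'} (h : x ∈ mv a u v) :
    x.IsPatternCommand ∧ x.acts ⊆ {u, v} ∧ x.deps ⊆ {u} ∧ x.measured ⊆ {u} := by
  rcases List.mem_append.1 h with h | h
  · obtain ⟨h₁, h₂, h₃, h₄⟩ := mem_mkcz h
    exact ⟨h₄, h₁.subset, by simp [h₂], by simp [h₃]⟩
  · simp only [List.mem_cons, List.not_mem_nil, or_false] at h
    rcases h with rfl | rfl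
    · exact ⟨trivial, by simp [Op.acts], by simp [Op.deps], by simp [Op.measured]⟩
    · refine ⟨trivial, by simp [Op.acts], fun y hy => ?_, by simp [Op.measured]⟩
      rw [Op.deps, Finset.mem_filter] at hy
      by_contra hne
      exact hy.2 (Pi.single_eq_of_ne (by simpa using hne) _)

theorem length_mkcz (u v : Fin N') : (mkcz u v : List (Op d N')).length ≤ 1 := by
  rw [mkcz]; split_ifs <;> simp

theorem length_mv (a : ℕ) (u v : Fin N') : (mv a u v : List (Op d N')).length ≤ 3 := by
  have := length_mkcz (d := d) u v
  simp only [mv, List.length_append, List.length_cons, List.length_nil]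
  omega

theorem mem_layer {x y : Fin N → Fin N'} {T : Finset (Fin N)} {q : Op d N'}
    (h : q ∈ layer x y T) : ∃ t ∈ T, q ∈ mv 0 (x t) (y t) := by
  obtain ⟨t, -, h⟩ := List.mem_flatMap.1 h
  split_ifs at h with ht
  exacts [⟨t, ht, h⟩, by simp at h]

theorem mem_star {ℓ p q : Fin N → Fin N'} {c : Fin N} {T : Finset (Fin N)} {x : Op d N'}
    (h : x ∈ star d ℓ p q c T) : x.IsPatternCommand ∧ ∀ z, z ∈ x.acts ∨ z ∈ x.deps →
      (∃ k, z = p k) ∨ (∃ k, z = q k) ∨ ∃ t, (t = c ∨ t ∈ T) ∧ z = ℓ t := by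
  rw [star, List.mem_append, List.mem_append, List.mem_append] at h
  rcases h with h | h | h | h
  · obtain ⟨k, -, h⟩ := List.mem_flatMap.1 h
    obtain ⟨h₁, h₂, -, h₄⟩ := mem_mkcz h
    refine ⟨h₄, fun z hz => ?_⟩
    rw [h₁, h₂, Finset.mem_insert, Finset.mem_singleton] at hz
    simp only [Finset.notMem_empty, or_false] at hz
    rcases hz with rfl | rfl
    · rw [prev]
      split_ifs
      · exact .inr (.inr ⟨c, .inl rfl, rfl⟩)
      · exact .inl ⟨_, rfl⟩
    · exact .inr (.inl ⟨k, rfl⟩)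
  · obtain ⟨k, -, h⟩ := List.mem_flatMap.1 h
    rcases List.mem_append.1 h with h | h
    · obtain ⟨h₁, h₂, -, h₄⟩ := mem_copyOps h
      refine ⟨h₄, fun z hz => ?_⟩
      rw [h₁, h₂, Finset.mem_insert, Finset.mem_singleton] at hz
      simp only [Finset.notMem_empty, or_false] at hz
      rcases hz with rfl | rfl
      exacts [.inl ⟨k, rfl⟩, .inr (.inl ⟨k, rfl⟩)]
    · rw [List.mem_singleton] at h
      subst h
      refine ⟨trivial, fun z hz => .inr (.inl ⟨k, ?_⟩)⟩
      simpa [Op.acts, Op.deps] using hz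
  · obtain ⟨k, -, h⟩ := List.mem_flatMap.1 h
    rcases List.mem_append.1 h with h | h
    · obtain ⟨h₁, h₂, -, h₄⟩ := mem_useOps h
      refine ⟨h₄, fun z hz => ?_⟩
      have hk : k ∈ T := by
        by_contra hk
        simp [useOps, hk] at h
      rcases hz with hz | hz
      · have := h₁ hz
        rw [Finset.mem_insert, Finset.mem_singleton] at this
        rcases this with rfl | rfl
        exacts [.inl ⟨k, rfl⟩, .inr (.inr ⟨k, .inr hk, rfl⟩)]
      · obtain ⟨l, rfl⟩ := h₂ z hz
        exact .inr (.inl ⟨l, rfl⟩)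
    · rw [List.mem_singleton] at h
      subst h
      refine ⟨trivial, fun z hz => .inl ⟨k, ?_⟩⟩
      simpa [Op.acts, Op.deps] using hz
  · rw [List.mem_singleton] at h
    subst h
    refine ⟨trivial, fun z hz => ?_⟩
    rcases hz with hz | hz
    · exact .inr (.inr ⟨c, .inl rfl, by simpa [Op.acts] using hz⟩)
    · rw [Op.deps, Finset.mem_filter] at hz
      by_contra hne
      refine hz.2 (if_neg ?_)
      rintro ⟨l, rfl⟩
      exact hne (.inl ⟨l, rfl⟩)

/-- Depth of a layer of short sequences of operations on disjoint sets of qudits. -/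
theorem chainLE_finRange {m C : ℕ} {blk : Fin m → List (Op d N')} (S : Fin m → Finset (Fin N'))
    (hC : ∀ k, (blk k).length ≤ C) (hS : ∀ k k', k ≠ k' → Disjoint (S k) (S k'))
    (hacts : ∀ k, ∀ x ∈ blk k, x.acts ⊆ S k)
    (hdeps : ∀ k k', k ≠ k' → ∀ x ∈ blk k, ∀ y ∈ blk k', Disjoint x.measured y.deps) :
    ChainLE ((List.finRange m).flatMap blk) C := by
  refine chainLE_flatMap (fun k _ => (chainLE_length _).mono (hC k))
    ((List.nodup_finRange m).imp fun {k k'} hk x hx y hy => ?_)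
  rintro (⟨z, hz, hz'⟩ | ⟨z, hz, hz'⟩)
  · exact Finset.disjoint_left.1 (hS k k' hk) (hacts k x hx hz) (hacts k' y hy hz')
  · exact Finset.disjoint_left.1 (hdeps k k' hk x hx y hy) hz hz'

theorem disjoint_pair {x y x' y' : Fin N'} (h₁ : x ≠ x') (h₂ : x ≠ y') (h₃ : y ≠ x')
    (h₄ : y ≠ y') : Disjoint ({x, y} : Finset (Fin N')) {x', y'} := by
  rw [Finset.disjoint_left]
  intro z hz hz'
  simp only [Finset.mem_insert, Finset.mem_singleton] at hz hz'
  rcases hz with rfl | rfl <;> rcases hz' with h | h <;> contradiction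

theorem chainLE_layer {x y : Fin N → Fin N'} {T : Finset (Fin N)} (hx : Injective x)
    (hy : Injective y) (hxy : ∀ t t', t ≠ t' → x t ≠ y t') :
    ChainLE (layer x y T : List (Op d N')) 3 := by
  have hmem : ∀ t, ∀ q ∈ (if t ∈ T then mv 0 (x t) (y t) else [] : List (Op d N')),
      q ∈ mv 0 (x t) (y t) := fun t q hq => by
    split_ifs at hq
    exacts [hq, by simp at hq]
  refine chainLE_finRange (fun t => {x t, y t}) (fun t => ?_) (fun t t' ht => ?_)
    (fun t q hq => (mem_mv (hmem t q hq)).2.1) (fun t t' ht q hq q' hq' => ?_)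
  · split_ifs
    exacts [length_mv _ _ _, by simp]
  · exact disjoint_pair (hx.ne ht) (hxy t t' ht) (hxy t' t ht.symm).symm (hy.ne ht)
  · exact Finset.disjoint_of_subset_left (mem_mv (hmem t q hq)).2.2.2
      (Finset.disjoint_of_subset_right (mem_mv (hmem t' q' hq')).2.2.1 (by simpa using hx.ne ht))

/-- The four stages contribute `1`, `d`, `3` and `1`. Corrections depend on outcomes of an earlier
stage only, and within a stage different indices use disjoint sets of qudits. -/
theorem chainLE_star {ℓ p q : Fin N → Fin N'} (hℓ : Injective ℓ) (hp : Injective p)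
    (hq : Injective q) (hpq : ∀ k l, p k ≠ q l) (hℓp : ∀ k l, ℓ k ≠ p l) (hℓq : ∀ k l, ℓ k ≠ q l)
    (c : Fin N) (T : Finset (Fin N)) : ChainLE (star d ℓ p q c T) (d + 5) := by
  have hd := NeZero.one_le (n := d)
  have hprev : ∀ k l, prev (ℓ c) p k ≠ q l := fun k l => by
    rw [prev]
    split_ifs
    exacts [hℓq c l, hpq _ l]
  have hprev' : ∀ k l, k ≠ l → prev (ℓ c) p k ≠ prev (ℓ c) p l := fun k l hkl => by
    rw [prev, prev]
    split_ifs with h₁ h₂ h₂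
    · exact absurd (Fin.ext (h₁.trans h₂.symm)) hkl
    · exact hℓp c _
    · exact (hℓp c _).symm
    · refine hp.ne fun h => hkl (Fin.ext ?_)
      rw [Fin.ext_iff] at h
      simp only at h
      omega
  have h₁ : ChainLE ((List.finRange N).flatMap fun k =>
      (mkcz (prev (ℓ c) p k) (q k) : List (Op d N'))) 1 := by
    refine chainLE_finRange (fun k => {prev (ℓ c) p k, q k}) (fun k => length_mkcz _ _)
      (fun k k' hk => ?_) (fun k x hx => (mem_mkcz hx).1.subset) fun k k' _ x hx y hy => ?_
    · exact disjoint_pair (hprev' k k' hk) (hprev k k') (hprev k' k).symm (hq.ne hk)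
    · rw [(mem_mkcz hx).2.2.1]
      exact Finset.disjoint_empty_left _
  have h₂ : ChainLE (measureBlocks (copyOps d p q) q (List.finRange N)) d := by
    refine chainLE_finRange (fun k => {p k, q k}) (fun k => ?_)
      (fun k k' hk => disjoint_pair (hp.ne hk) (hpq k k') (hpq k' k).symm (hq.ne hk))
      (fun k x hx => ?_) fun k k' _ x hx y hy => ?_
    · have h : (copyOps d p q k).length ≤ (d - 1) * 1 := by
        rw [copyOps, List.length_flatMap]
        refine (List.sum_le_card_nsmul _ 1 fun x hx => ?_).trans (by simp)
        obtain ⟨r, -, rfl⟩ := List.mem_map.1 hx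
        exact length_mkcz _ _
      rw [List.length_append, List.length_singleton]
      omega
    · rcases List.mem_append.1 hx with hx | hx
      · exact (mem_copyOps hx).1.subset
      · rw [List.mem_singleton.1 hx]
        simp [Op.acts]
    · have : y.deps = ∅ := by
        rcases List.mem_append.1 hy with hy | hy
        · exact (mem_copyOps hy).2.1
        · rw [List.mem_singleton.1 hy]
          simp [Op.deps]
      rw [this]
      exact Finset.disjoint_empty_right _
  have h₃ : ChainLE (measureBlocks (useOps d ℓ p q T) p (List.finRange N)) 3 := by
    refine chainLE_finRange (fun k => {p k, ℓ k}) (fun k => ?_)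
      (fun k k' hk => disjoint_pair (hp.ne hk) (hℓp k' k).symm (hℓp k k') (hℓ.ne hk))
      (fun k x hx => ?_) fun k k' _ x hx y hy => ?_
    · have := length_mkcz (d := d) (p k) (ℓ k)
      rw [useOps]
      split_ifs <;>
      simp only [List.length_append, List.length_cons, List.length_nil] <;> omega
    · rcases List.mem_append.1 hx with hx | hx
      · exact (mem_useOps hx).1
      · rw [List.mem_singleton.1 hx]
        simp [Op.acts]
    · rcases List.mem_append.1 hx with hx | hx
      · rw [(mem_useOps hx).2.2.1]
        exact Finset.disjoint_empty_left _
      · rw [List.mem_singleton.1 hx, Finset.disjoint_left]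
        intro z hz hz'
        rw [Op.measured, Finset.mem_singleton] at hz
        subst hz
        rcases List.mem_append.1 hy with hy | hy
        · obtain ⟨l, hl⟩ := (mem_useOps hy).2.1 _ hz'
          exact hpq k l hl.symm
        · rw [List.mem_singleton.1 hy] at hz'
          simp [Op.deps] at hz'
  exact (h₁.append (h₂.append (h₃.append (chainLE_length _)))).mono (by
    rw [List.length_singleton]; omega)

end Members

section Depth

variable {d n N B : ℕ} [NeZero d]

/-- A fan-out gate costs four layers of depth `3` and one star of depth `d + 5`. -/
theorem chainLE_block {μ : Fin N → ℕ} {q : Op d N} {j : ℕ} (hj : j < B) (hμ : ∀ i, μ i ≤ 6 * j) :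
    ChainLE (block B μ (q, j)) (d + 17) := by
  have hrow : ∀ (r r' : Fin N → ℕ) (t t' : Fin N), t ≠ t' → qd B (r t) t ≠ qd B (r' t') t' :=
    fun r r' t t' ht e => ht (eq_of_qd_eq B e)
  have hL : ∀ r : Fin N → ℕ, ∀ (r' : ℕ) (T : Finset (Fin N)),
      ChainLE (layer (fun i => qd B (r i) i) (qd B r') T : List (Op d _)) 3 := fun r r' T =>
    chainLE_layer (qd_injective B r) (qd_injective B fun _ => r') (hrow r fun _ => r')
  cases q with
  | cz i k h => exact (chainLE_length _).mono ((length_mkcz _ _).trans (by omega))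
  | rot a i => exact (chainLE_length _).mono ((length_mv _ _ _).trans (by omega))
  | fanout c T h =>
    have hle : ∀ i, (if i ∈ T then 6 * j + 1 else μ i) ≤ 6 * j + 1 := fun i => by
      have := hμ i
      split_ifs <;> omega
    have hs := chainLE_star (d := d) (ℓ := fun i => qd B (if i ∈ T then 6 * j + 1 else μ i) i)
      (p := qd B (6 * j + 2)) (q := qd B (6 * j + 3)) (qd_injective B _)
      (qd_injective B fun _ => 6 * j + 2) (qd_injective B fun _ => 6 * j + 3)
      (fun k l e => by rw [qd_inj B (by omega) (by omega)] at e; omega)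
      (fun k l e => by
        have := hle k
        rw [qd_inj B (by omega) (by omega)] at e; omega)
      (fun k l e => by
        have := hle k
        rw [qd_inj B (by omega) (by omega)] at e; omega) c T
    exact ((hL μ (6 * j + 1) T).append (hs.append ((hL (fun _ => 6 * j + 1) (6 * j + 4) T).append
      ((hL (fun _ => 6 * j + 4) (6 * j + 5) T).append
        (hL (fun _ => 6 * j + 5) (6 * j + 6) T))))).mono (by omega)
  | corrX i σ => exact chainLE_nil.mono (Nat.zero_le _)
  | corrZ i σ => exact chainLE_nil.mono (Nat.zero_le _)
  | measure i a σ τ => exact chainLE_nil.mono (Nat.zero_le _)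

/-- A place to which the translation of gate number `j` refers. -/
def Touches (B : ℕ) (μ : Fin N → ℕ) (q : Op d N) (j : ℕ) (z : Fin ((6 * B + 1) * N)) : Prop :=
  ∃ r k, z = qd B r k ∧ ((r = μ k ∧ k ∈ q.acts) ∨ (6 * j < r ∧ r < 6 * j + 6) ∨
    (r = 6 * j + 6 ∧ k ∈ q.acts))

theorem mem_block {μ : Fin N → ℕ} {q : Op d N} {j : ℕ} {x : Op d ((6 * B + 1) * N)}
    (h : x ∈ block B μ (q, j)) :
    x.IsPatternCommand ∧ ∀ z, z ∈ x.acts ∨ z ∈ x.deps → Touches B μ q j z := by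
  have hmv : ∀ {a u v}, x ∈ mv a u v → Touches B μ q j u → Touches B μ q j v →
      x.IsPatternCommand ∧ ∀ z, z ∈ x.acts ∨ z ∈ x.deps → Touches B μ q j z := by
    intro a u v hx hu hv
    obtain ⟨h₁, h₂, h₃, -⟩ := mem_mv hx
    refine ⟨h₁, ?_⟩
    rintro z (hz | hz)
    · have := h₂ hz
      rw [Finset.mem_insert, Finset.mem_singleton] at this
      rcases this with rfl | rfl <;> assumption
    · rw [Finset.mem_singleton.1 (h₃ hz)]
      exact hu
  cases q with
  | cz i k h' =>
    obtain ⟨h₁, h₂, -, h₄⟩ := mem_mkcz h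
    refine ⟨h₄, fun z hz => ?_⟩
    rw [h₁, h₂, Finset.mem_insert, Finset.mem_singleton] at hz
    simp only [Finset.notMem_empty, or_false] at hz
    rcases hz with rfl | rfl
    exacts [⟨_, _, rfl, .inl ⟨rfl, by simp [Op.acts]⟩⟩, ⟨_, _, rfl, .inl ⟨rfl, by simp [Op.acts]⟩⟩]
  | rot a i =>
    exact hmv h ⟨_, _, rfl, .inl ⟨rfl, by simp [Op.acts]⟩⟩
      ⟨_, _, rfl, .inr (.inr ⟨rfl, by simp [Op.acts]⟩)⟩
  | fanout c T h' =>
    have hin : ∀ {r k}, 6 * j < r ∧ r < 6 * j + 6 → Touches B μ (.fanout c T h' : Op d N) j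
      (qd B r k) := fun {r k} h => ⟨r, k, rfl, .inr (.inl h)⟩
    have hacts : ∀ t, t = c ∨ t ∈ T → t ∈ (Op.fanout c T h' : Op d N).acts := fun t ht => by
      simpa [Op.acts] using ht
    change x ∈ translatedFanout B μ j c T at h
    rw [translatedFanout, List.mem_append, List.mem_append, List.mem_append, List.mem_append] at h
    rcases h with h | h | h | h | h
    · obtain ⟨t, ht, h⟩ := mem_layer h
      exact hmv h ⟨_, _, rfl, .inl ⟨rfl, hacts t (.inr ht)⟩⟩ (hin (by omega))
    · obtain ⟨h₁, h₂⟩ := mem_star h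
      refine ⟨h₁, fun z hz => ?_⟩
      rcases h₂ z hz with ⟨k, rfl⟩ | ⟨k, rfl⟩ | ⟨t, ht, rfl⟩
      · exact hin (by omega)
      · exact hin (by omega)
      · by_cases htT : t ∈ T
        · rw [if_pos htT]
          exact hin (by omega)
        · rw [if_neg htT]
          exact ⟨_, _, rfl, .inl ⟨rfl, hacts t ht⟩⟩
    · obtain ⟨t, ht, h⟩ := mem_layer h
      exact hmv h (hin (by omega)) (hin (by omega))
    · obtain ⟨t, ht, h⟩ := mem_layer h
      exact hmv h (hin (by omega)) (hin (by omega))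
    · obtain ⟨t, ht, h⟩ := mem_layer h
      exact hmv h (hin (by omega)) ⟨_, _, rfl, .inr (.inr ⟨rfl, hacts t (.inr ht)⟩)⟩
  | corrX i σ => simp [block] at h
  | corrZ i σ => simp [block] at h
  | measure i a σ τ => simp [block] at h

/-- Between gates qudits rest in rows divisible by `6`, hence never in the interior rows of another
gate. -/
theorem six_dvd_loc (ops : List (Op d N)) (j : ℕ) (i : Fin N) : 6 ∣ loc ops j i := by
  induction j with
  | zero => exact dvd_zero 6
  | succ j ih => rw [loc]; split_ifs <;> omega

theorem isPatternCommand_translate (Q : Computation d n) :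
    ∀ q ∈ (translate Q).ops, q.IsPatternCommand := fun q hq => by
  obtain ⟨⟨q', j⟩, -, hq⟩ := List.mem_flatMap.1 hq
  exact (mem_block hq).1

theorem measured_subset_acts (q : Op d N) : q.measured ⊆ q.acts := by
  cases q <;> simp [Op.measured, Op.acts]

/-- The rows strictly between `6j` and `6j + 6` belong to gate `j` alone. Blocks of different gates
can therefore only share a resting place of a qudit on which both gates act; outcomes on which a
block depends are also covered, since they come from places that the block touches. -/
theorem depth_translate (Q : Computation d n) :
    (translate Q).depth ≤ (d + 17) * Q.depth + (d + 17) := by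
  have hB := length_ops_le Q
  have hp := pairwise_zipIdx (R := fun _ _ => True) (l := Q.ops) (List.pairwise_of_forall fun _ _ => trivial)
  refine (depth_le (chainLE_blocks (Q := Q) (fun b hb => ?_) (hp.imp ?_))).trans
    (Nat.le_add_right _ _)
  · obtain ⟨q, j⟩ := b
    have hj := List.snd_lt_of_mem_zipIdx hb
    exact chainLE_block (by simpa using hj.trans_le (by simpa using hB)) (loc_le Q.ops j)
  · rintro ⟨q, j⟩ ⟨q', j'⟩ ⟨-, hj, hj'⟩ x hx y hy hxy
    simp only at hj hj'
    obtain ⟨z, hz, hz'⟩ : ∃ z, z ∈ x.acts ∧ (z ∈ y.acts ∨ z ∈ y.deps) := by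
      rcases hxy with ⟨z, h₁, h₂⟩ | ⟨z, h₁, h₂⟩
      exacts [⟨z, h₁, .inl h₂⟩, ⟨z, measured_subset_acts x h₁, .inr h₂⟩]
    obtain ⟨r, k, rfl, h₁⟩ := (mem_block hx).2 z (.inl hz)
    obtain ⟨r', k', e, h₂⟩ := (mem_block hy).2 _ hz'
    have hl := loc_le Q.ops j k
    have hl' := loc_le Q.ops j' k'
    have hd := six_dvd_loc Q.ops j' k'
    simp only at h₁ h₂
    rw [qd_inj _ (by omega) (by omega)] at e
    obtain ⟨rfl, rfl⟩ := e
    rcases h₁ with ⟨h, h₁⟩ | h | ⟨h, h₁⟩ <;> rcases h₂ with ⟨h', h₂⟩ | h' | ⟨h', h₂⟩ <;>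
    first
    | omega
    | exact .inl ⟨k, h₁, h₂⟩

end Depth

end OneWay

end QuditComp

end


set_option linter.unusedSectionVars false

noncomputable section

namespace QuditComp

open Function ZMod StackProg

namespace OneWay

/-! ## The translation of descriptions -/

/-- The description of a signal with coefficient `g r k` at qudit `k` of row `r`. -/
def signalCode (A : List ℕ) (g : ℕ → ℕ → ℕ) : List ℕ :=
  (List.range (6 * A.length + 1)).flatMap fun r => (List.range (A.getD 0 0)).flatMap fun k =>
    [g r k]

/-- The number of the qudit `k` of row `r`. -/
def qdCode (A : List ℕ) (r k : ℕ) : ℕ := k + A.getD 0 0 * r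

/-- The description of an independent measurement. -/
def measureCode (A : List ℕ) (u a : ℕ) : List ℕ :=
  [5, u, a] ++ (signalCode A (fun _ _ => 0) ++ signalCode A fun _ _ => 0)

/-- The description of `mv`. -/
def mvCode (d : ℕ) [NeZero d] (A : List ℕ) (a u v : ℕ) : List ℕ :=
  [0, u, v] ++ (measureCode A u a ++ ([3, v] ++ signalCode A fun r k =>
    if qdCode A r k = u then (1 : ZMod d).val else 0))

/-- Whether gate number `j` moves qudit `i`. -/
def movesCode (A : List ℕ) (j i : ℕ) : ℕ :=
  if opPos A j < A.length then
    if field A j 0 = 1 then if field A j 2 = i then 1 else 0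
    else if field A j 0 = 2 then if field A j (2 + i) = 1 then 1 else 0 else 0
  else 0

/-- The row of qudit `i` before gate number `j`. -/
def locCode (A : List ℕ) : ℕ → ℕ → ℕ
  | 0, _ => 0
  | j + 1, i => if movesCode A j i = 1 then 6 * j + 6 else locCode A j i

/-- The description of `layer`. -/
def layerCode (d : ℕ) [NeZero d] (A : List ℕ) (j : ℕ) (x : ℕ → ℕ) (y : ℕ) : List ℕ :=
  (List.range (A.getD 0 0)).flatMap fun t =>
    if field A j (2 + t) = 1 then mvCode d A 0 (qdCode A (x t) t) (qdCode A y t) else []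

/-- The number of the qudit at which qudit `i` is when `star` is applied for gate number `j`. -/
def starLoc (A : List ℕ) (j i : ℕ) : ℕ :=
  qdCode A (if field A j (2 + i) = 1 then 6 * j + 1 else locCode A j i) i

/-- The description of `star`. -/
def starCode (d : ℕ) [NeZero d] (A : List ℕ) (j : ℕ) : List ℕ :=
  ((List.range (A.getD 0 0)).flatMap fun k =>
    [0, if k = 0 then starLoc A j (field A j 1) else qdCode A (6 * j + 2) (k - 1),
      qdCode A (6 * j + 3) k]) ++
  (((List.range (A.getD 0 0)).flatMap fun k =>
    ((List.range (d - 1)).flatMap fun _ => [0, qdCode A (6 * j + 2) k, qdCode A (6 * j + 3) k]) ++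
      measureCode A (qdCode A (6 * j + 3) k) 0) ++
  (((List.range (A.getD 0 0)).flatMap fun t =>
    (if field A j (2 + t) = 1 then
      [0, qdCode A (6 * j + 2) t, starLoc A j t] ++ ([4, starLoc A j t] ++ signalCode A fun r k =>
        if r = 6 * j + 3 then if k < t + 1 then (-1 : ZMod d).val else 0 else 0) else []) ++
      measureCode A (qdCode A (6 * j + 2) t) 0) ++
  ([4, starLoc A j (field A j 1)] ++ signalCode A fun r _ =>
    if r = 6 * j + 2 then (-1 : ZMod d).val else 0)))

/-- The description of `block`. -/
def blockCode (d : ℕ) [NeZero d] (A : List ℕ) (j : ℕ) : List ℕ :=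
  if field A j 0 = 0 then [0, qdCode A (locCode A j (field A j 1)) (field A j 1),
    qdCode A (locCode A j (field A j 2)) (field A j 2)] else
  if field A j 0 = 1 then mvCode d A (field A j 1)
    (qdCode A (locCode A j (field A j 2)) (field A j 2)) (qdCode A (6 * j + 6) (field A j 2)) else
  layerCode d A j (locCode A j) (6 * j + 1) ++ (starCode d A j ++
    (layerCode d A j (fun _ => 6 * j + 1) (6 * j + 4) ++
    (layerCode d A j (fun _ => 6 * j + 4) (6 * j + 5) ++
      layerCode d A j (fun _ => 6 * j + 5) (6 * j + 6))))

/-- The description of `translate`. -/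
def translateCode (d : ℕ) [NeZero d] (A : List ℕ) : List ℕ :=
  [(6 * A.length + 1) * A.getD 0 0, A.getD 1 0] ++
    (((List.range (A.getD 1 0)).flatMap fun i => [A.getD (2 + i) 0]) ++
    (((List.range (A.getD 1 0)).flatMap fun i =>
      [qdCode A (locCode A A.length (A.getD (2 + A.getD 1 0 + i) 0))
        (A.getD (2 + A.getD 1 0 + i) 0)]) ++
    (List.range A.length).flatMap fun j =>
      if opPos A j < A.length then blockCode d A j else []))

/-! ### The translation of circuits is computable in polynomial time -/

section Poly

variable {Γ : Type} [LawfulCtx Γ]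

theorem polyList_signalCode {g : (Γ × ℕ) × ℕ → ℕ} (hg : PolyFun g) :
    PolyList fun c : Γ => signalCode (Ctx.arr c) fun r k => g ((c, r), k) := by
  have h₁ : PolyFun fun c : Γ => 6 * (Ctx.arr c).length + 1 :=
    ((PolyFun.const 6).mul .len).add (.const 1)
  have h₂ : PolyList fun c : Γ × ℕ =>
      (List.range ((Ctx.arr c.1).getD 0 0)).flatMap fun k => [g (c, k)] :=
    .flatMap (PolyFun.entry 0) (.single hg)
  exact .flatMap h₁ h₂

theorem polyFun_qdCode {r k : Γ → ℕ} (hr : PolyFun r) (hk : PolyFun k) :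
    PolyFun fun c => qdCode (Ctx.arr c) (r c) (k c) := hk.add ((PolyFun.entry 0).mul hr)

theorem polyList_measureCode {u a : Γ → ℕ} (hu : PolyFun u) (ha : PolyFun a) :
    PolyList fun c => measureCode (Ctx.arr c) (u c) (a c) :=
  .append (.cons (.const 5) (.cons hu (.single ha)))
    ((polyList_signalCode (.const 0)).append (polyList_signalCode (.const 0)))

theorem polyList_mvCode (d : ℕ) [NeZero d] {a u v : Γ → ℕ} (ha : PolyFun a) (hu : PolyFun u)
    (hv : PolyFun v) : PolyList fun c => mvCode d (Ctx.arr c) (a c) (u c) (v c) := by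
  have h₁ : PolyFun fun c : (Γ × ℕ) × ℕ =>
      if qdCode (Ctx.arr c.1.1) c.1.2 c.2 = u c.1.1 then (1 : ZMod d).val else 0 :=
    .ite_eq (polyFun_qdCode PolyFun.snd.fst .snd) hu.fst.fst (.const _) (.const 0)
  exact .append (.cons (.const 0) (.cons hu (.single hv))) ((polyList_measureCode hu ha).append
    (.append (.cons (.const 3) (.single hv)) (polyList_signalCode h₁)))

theorem polyFun_movesCode {j i : Γ → ℕ} (hj : PolyFun j) (hi : PolyFun i) :
    PolyFun fun c => movesCode (Ctx.arr c) (j c) (i c) :=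
  .ite_lt (PolyFun.opPos hj) .len
    (.ite_eq (PolyFun.field hj (.const 0)) (.const 1)
      (.ite_eq (PolyFun.field hj (.const 2)) hi (.const 1) (.const 0))
      (.ite_eq (PolyFun.field hj (.const 0)) (.const 2)
        (.ite_eq (PolyFun.field hj ((PolyFun.const 2).add hi)) (.const 1) (.const 1) (.const 0))
        (.const 0)))
    (.const 0)

theorem locCode_le (A : List ℕ) (j i : ℕ) : locCode A j i ≤ 6 * j := by
  induction j with
  | zero => rfl
  | succ j ih => rw [locCode]; split_ifs <;> omega

/-- The location is computed by iterating over the gates with the qudit fixed; rows never exceed `6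
* j`, as iteration requires. -/
theorem polyFun_locCode {j i : Γ → ℕ} (hj : PolyFun j) (hi : PolyFun i) :
    PolyFun fun c => locCode (Ctx.arr c) (j c) (i c) :=
  PolyFun.iter (F := fun c j => locCode (Ctx.arr c) j (i c))
    (step := fun x => if movesCode (Ctx.arr x.1.1) x.1.2 (i x.1.1) = 1 then 6 * x.1.2 + 6 else x.2)
    (bd := fun c => 6 * j c) hj (.const 0)
    (.ite_eq (polyFun_movesCode PolyFun.snd.fst hi.fst.fst) (.const 1)
      (((PolyFun.const 6).mul PolyFun.snd.fst).add (.const 6)) .snd)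
    (fun _ => rfl) (fun _ _ => rfl) ((PolyFun.const 6).mul hj).bounded
    fun c k hk => (locCode_le _ _ _).trans (by gcongr)

theorem polyList_layerCode (d : ℕ) [NeZero d] {j y : Γ → ℕ} {x : Γ × ℕ → ℕ} (hj : PolyFun j)
    (hx : PolyFun x) (hy : PolyFun y) :
    PolyList fun c : Γ => layerCode d (Ctx.arr c) (j c) (fun t => x (c, t)) (y c) := by
  have h₁ : PolyFun fun c : Γ × ℕ => field (Ctx.arr c.1) (j c.1) (2 + c.2) :=
    PolyFun.field hj.fst ((PolyFun.const 2).add .snd)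
  have h₂ : PolyList fun c : Γ × ℕ => mvCode d (Ctx.arr c.1) 0 (qdCode (Ctx.arr c.1) (x c) c.2)
      (qdCode (Ctx.arr c.1) (y c.1) c.2) :=
    polyList_mvCode d (.const 0) (polyFun_qdCode hx .snd) (polyFun_qdCode hy.fst .snd)
  have h₃ : PolyList fun c : Γ × ℕ => if field (Ctx.arr c.1) (j c.1) (2 + c.2) = 1 then
      mvCode d (Ctx.arr c.1) 0 (qdCode (Ctx.arr c.1) (x c) c.2)
        (qdCode (Ctx.arr c.1) (y c.1) c.2) else [] := .ite_eq h₁ (.const 1) h₂ .nil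
  exact .flatMap (PolyFun.entry 0) h₃

theorem polyFun_row {j : Γ → ℕ} (hj : PolyFun j) (m : ℕ) : PolyFun fun c => 6 * j c + m :=
  ((PolyFun.const 6).mul hj).add (.const m)

theorem polyFun_starLoc {j i : Γ → ℕ} (hj : PolyFun j) (hi : PolyFun i) :
    PolyFun fun c => starLoc (Ctx.arr c) (j c) (i c) :=
  polyFun_qdCode (.ite_eq (PolyFun.field hj ((PolyFun.const 2).add hi)) (.const 1)
    (polyFun_row hj 1) (polyFun_locCode hj hi)) hi

theorem polyList_starCode (d : ℕ) [NeZero d] {j : Γ → ℕ} (hj : PolyFun j) :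
    PolyList fun c : Γ => starCode d (Ctx.arr c) (j c) := by
  have hc : PolyFun fun c : Γ => field (Ctx.arr c) (j c) 1 := PolyFun.field hj (.const 1)
  have hℓc : PolyFun fun c : Γ => starLoc (Ctx.arr c) (j c) (field (Ctx.arr c) (j c) 1) :=
    polyFun_starLoc hj hc
  have hp : PolyFun fun c : Γ × ℕ => qdCode (Ctx.arr c.1) (6 * j c.1 + 2) c.2 :=
    polyFun_qdCode (polyFun_row hj.fst 2) .snd
  have hq : PolyFun fun c : Γ × ℕ => qdCode (Ctx.arr c.1) (6 * j c.1 + 3) c.2 :=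
    polyFun_qdCode (polyFun_row hj.fst 3) .snd
  have hprev : PolyFun fun c : Γ × ℕ => if c.2 = 0 then
      starLoc (Ctx.arr c.1) (j c.1) (field (Ctx.arr c.1) (j c.1) 1) else
        qdCode (Ctx.arr c.1) (6 * j c.1 + 2) (c.2 - 1) :=
    .ite_eq .snd (.const 0) hℓc.fst (polyFun_qdCode (polyFun_row hj.fst 2) (PolyFun.snd.sub (.const 1)))
  have hℓ : PolyFun fun c : Γ × ℕ => starLoc (Ctx.arr c.1) (j c.1) c.2 := polyFun_starLoc hj.fst .snd
  have h₁ : PolyList fun c : Γ × ℕ => [0, if c.2 = 0 then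
      starLoc (Ctx.arr c.1) (j c.1) (field (Ctx.arr c.1) (j c.1) 1) else
        qdCode (Ctx.arr c.1) (6 * j c.1 + 2) (c.2 - 1),
        qdCode (Ctx.arr c.1) (6 * j c.1 + 3) c.2] := .cons (.const 0) (.cons hprev (.single hq))
  have h₂ : PolyList fun c : Γ × ℕ => ((List.range (d - 1)).flatMap fun _ =>
      [0, qdCode (Ctx.arr c.1) (6 * j c.1 + 2) c.2, qdCode (Ctx.arr c.1) (6 * j c.1 + 3) c.2]) ++
        measureCode (Ctx.arr c.1) (qdCode (Ctx.arr c.1) (6 * j c.1 + 3) c.2) 0 :=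
    .append (PolyList.flatMap (.const (d - 1)) (.cons (.const 0) (.cons hp.fst (.single hq.fst))))
      (polyList_measureCode hq (.const 0))
  have hT : PolyFun fun c : Γ × ℕ => field (Ctx.arr c.1) (j c.1) (2 + c.2) :=
    PolyFun.field hj.fst ((PolyFun.const 2).add .snd)
  have hσ : PolyFun fun c : ((Γ × ℕ) × ℕ) × ℕ => if c.1.2 = 6 * j c.1.1.1 + 3 then
      if c.2 < c.1.1.2 + 1 then (-1 : ZMod d).val else 0 else 0 :=
    .ite_eq PolyFun.snd.fst (polyFun_row hj.fst.fst.fst 3)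
      (.ite_lt .snd (PolyFun.snd.fst.fst.add (.const 1)) (.const _) (.const 0)) (.const 0)
  have h₃ : PolyList fun c : Γ × ℕ => (if field (Ctx.arr c.1) (j c.1) (2 + c.2) = 1 then
      [0, qdCode (Ctx.arr c.1) (6 * j c.1 + 2) c.2, starLoc (Ctx.arr c.1) (j c.1) c.2] ++
        ([4, starLoc (Ctx.arr c.1) (j c.1) c.2] ++ signalCode (Ctx.arr c.1) fun r k =>
          if r = 6 * j c.1 + 3 then if k < c.2 + 1 then (-1 : ZMod d).val else 0 else 0) else []) ++
        measureCode (Ctx.arr c.1) (qdCode (Ctx.arr c.1) (6 * j c.1 + 2) c.2) 0 :=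
    .append (.ite_eq hT (.const 1) (.append (.cons (.const 0) (.cons hp (.single hℓ)))
      (.append (.cons (.const 4) (.single hℓ)) (polyList_signalCode hσ))) .nil)
      (polyList_measureCode hp (.const 0))
  have hσ' : PolyFun fun c : (Γ × ℕ) × ℕ =>
      if c.1.2 = 6 * j c.1.1 + 2 then (-1 : ZMod d).val else 0 :=
    .ite_eq PolyFun.snd.fst (polyFun_row hj.fst.fst 2) (.const _) (.const 0)
  exact .append (.flatMap (PolyFun.entry 0) h₁) (.append (.flatMap (PolyFun.entry 0) h₂)
    (.append (.flatMap (PolyFun.entry 0) h₃)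
      (.append (.cons (.const 4) (.single hℓc)) (polyList_signalCode hσ'))))

theorem polyList_blockCode (d : ℕ) [NeZero d] {j : Γ → ℕ} (hj : PolyFun j) :
    PolyList fun c : Γ => blockCode d (Ctx.arr c) (j c) := by
  have h₀ := PolyFun.field hj (.const 0)
  have h₁ := PolyFun.field hj (.const 1)
  have h₂ := PolyFun.field hj (.const 2)
  have hx : PolyFun fun c : Γ × ℕ => locCode (Ctx.arr c.1) (j c.1) c.2 :=
    polyFun_locCode hj.fst .snd
  have hL : ∀ m m', PolyList fun c : Γ =>
      layerCode d (Ctx.arr c) (j c) (fun _ => 6 * j c + m) (6 * j c + m') := fun m m' =>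
    polyList_layerCode d (x := fun c => 6 * j c.1 + m) hj (polyFun_row hj.fst m) (polyFun_row hj m')
  exact .ite_eq h₀ (.const 0) (.cons (.const 0) (.cons (polyFun_qdCode (polyFun_locCode hj h₁) h₁)
      (.single (polyFun_qdCode (polyFun_locCode hj h₂) h₂)))) <|
    .ite_eq h₀ (.const 1) (polyList_mvCode d h₁ (polyFun_qdCode (polyFun_locCode hj h₂) h₂)
      (polyFun_qdCode (polyFun_row hj 6) h₂)) <|
    .append (polyList_layerCode d hj hx (polyFun_row hj 1)) <| .append (polyList_starCode d hj) <|
    .append (hL 1 4) <| .append (hL 4 5) (hL 5 6)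

theorem polyList_translateCode (d : ℕ) [NeZero d] : PolyList (translateCode d) := by
  have h₁ : PolyFun fun A : List ℕ => (6 * A.length + 1) * A.getD 0 0 :=
    (((PolyFun.const 6).mul PolyFun.len).add (.const 1)).mul (PolyFun.entry 0)
  have h₂ : PolyFun fun A : List ℕ => A.getD 1 0 := PolyFun.entry 1
  have h₃ : PolyFun fun c : List ℕ × ℕ => c.1.getD (2 + c.2) 0 :=
    PolyFun.get ((PolyFun.const 2).add PolyFun.snd)
  have h₄ : PolyFun fun c : List ℕ × ℕ => c.1.getD (2 + c.1.getD 1 0 + c.2) 0 :=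
    PolyFun.get (((PolyFun.const 2).add (PolyFun.entry 1)).add PolyFun.snd)
  have h₅ : PolyFun fun c : List ℕ × ℕ =>
      qdCode c.1 (locCode c.1 c.1.length (c.1.getD (2 + c.1.getD 1 0 + c.2) 0))
        (c.1.getD (2 + c.1.getD 1 0 + c.2) 0) := polyFun_qdCode (polyFun_locCode .len h₄) h₄
  have h₆ : PolyList fun c : List ℕ × ℕ =>
      if opPos c.1 c.2 < c.1.length then blockCode d c.1 c.2 else [] :=
    .ite_lt (PolyFun.opPos PolyFun.snd) PolyFun.len (polyList_blockCode d PolyFun.snd) .nil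
  exact .append (.cons h₁ (.single h₂)) (.append (.flatMap h₂ (.single h₃))
    (.append (.flatMap h₂ (.single h₅)) (.flatMap PolyFun.len h₆)))

end Poly

end OneWay

end QuditComp

end


set_option linter.unusedSectionVars false

noncomputable section

/-! ### The computed description is that of the pattern -/

namespace QuditComp

open Function ZMod StackProg

namespace OneWay

section Code

variable {d n : ℕ} [NeZero d] (Q : Computation d n)

theorem ofFn_signalCode {f : Fin ((6 * Q.code.length + 1) * Q.N) → ℕ} {g : ℕ → ℕ → ℕ}
    (h : ∀ r ≤ 6 * Q.code.length, ∀ k, f (qd Q.code.length r k) = g r k) :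
    List.ofFn f = signalCode Q.code g := by
  rw [signalCode, getD_zero_code]
  refine ofFn_cell fun r k => ?_
  have := h r (by omega) k
  rwa [qd, Fin.ofNat_eq_cast, Fin.cast_val_eq_self] at this

theorem val_qd_eq {r : ℕ} (hr : r ≤ 6 * Q.code.length) (k : Fin Q.N) :
    (qd Q.code.length r k : ℕ) = qdCode Q.code r k := by
  rw [val_qd _ hr, qdCode, getD_zero_code]

theorem code_mkcz {N' : ℕ} {u v : Fin N'} (h : u ≠ v) :
    (mkcz u v : List (Op d N')).flatMap Op.code = [0, (u : ℕ), (v : ℕ)] := by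
  rw [mkcz, dif_pos h]; rfl

theorem code_measure (u : Fin ((6 * Q.code.length + 1) * Q.N)) (a : ℕ) :
    (Op.measure u a 0 0 : Op d _).code = measureCode Q.code u a := by
  rw [Op.code, ofFn_signalCode Q (g := fun _ _ => 0) fun r _ k => by simp, measureCode,
    List.append_assoc]

theorem code_mv (a : ℕ) {r r' : ℕ} (hr : r ≤ 6 * Q.code.length) (hr' : r' ≤ 6 * Q.code.length)
    (hne : r ≠ r') (k : Fin Q.N) :
    (mv a (qd Q.code.length r k) (qd Q.code.length r' k) : List (Op d _)).flatMap Op.code =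
      mvCode d Q.code a (qdCode Q.code r k) (qdCode Q.code r' k) := by
  have hne' : qd Q.code.length r k ≠ qd Q.code.length r' k := fun e => hne ((qd_inj _ hr hr').1 e).1
  rw [mv, List.flatMap_append, code_mkcz hne', List.flatMap_cons, code_measure, List.flatMap_cons,
    List.flatMap_nil, List.append_nil, mvCode, val_qd_eq Q hr, val_qd_eq Q hr']
  congr 2
  rw [Op.code, ← val_qd_eq Q hr', ← val_qd_eq Q hr]
  congr 1
  refine ofFn_signalCode Q fun r'' hr'' k' => ?_
  rw [← val_qd_eq Q hr'', Pi.single_apply]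
  split_ifs with h₁ h₂ h₂
  · rfl
  · exact absurd (congrArg Fin.val h₁) h₂
  · exact absurd (Fin.ext h₂) h₁
  · exact ZMod.val_zero

variable {Q}

theorem moves_iff {j : ℕ} {q : Op d Q.N} (h : Q.ops[j]? = some q) (i : Fin Q.N) :
    movesCode Q.code j i = 1 ↔ Moves q i := by
  have hj : j < Q.ops.length := (List.getElem?_eq_some_iff.1 h).1
  have hfield : ∀ r < q.code.length, field Q.code j r = q.code.getD r 0 := fun r => field_eq Q h
  have h₀ := hfield 0 q.length_code_pos
  rw [movesCode, if_pos ((opPos_lt_iff Q).2 hj), h₀]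
  cases q with
  | rot a k =>
    rw [hfield 2 (by simp [Op.code])]
    simp [Op.code, Moves, Fin.ext_iff]
  | fanout c T hc =>
    rw [hfield (2 + i) (by simp [Op.code]; omega), add_comm 2]
    simp [Op.code, Moves]
  | _ => simp [Op.code, Moves]

theorem locCode_eq (j : ℕ) (i : Fin Q.N) : locCode Q.code j i = loc Q.ops j i := by
  induction j with
  | zero => rfl
  | succ j ih =>
    classical
    rw [locCode, loc, ih]
    refine if_congr ?_ rfl rfl
    cases h : Q.ops[j]? with
    | none =>
      rw [List.getElem?_eq_none_iff] at h
      rw [movesCode, if_neg]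
      · simp
      · rw [opPos_lt_iff]
        omega
    | some q =>
      rw [moves_iff h]
      simp

/-- Nothing moves after the last gate. So the final rows may be computed with the length of the
description in place of the number of gates, which is not recorded. -/
theorem loc_eq_of_le {N : ℕ} {ops : List (Op d N)} {j : ℕ} (hj : ops.length ≤ j) (i : Fin N) :
    loc ops j i = loc ops ops.length i := by
  obtain ⟨m, rfl⟩ := Nat.exists_eq_add_of_le hj
  induction m with
  | zero => rfl
  | succ m ih =>
    rw [← add_assoc, loc, if_neg, ih (by omega)]
    rw [List.getElem?_eq_none (by omega)]
    simp

variable (Q)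

theorem code_layer {j : ℕ} {T : Finset (Fin Q.N)}
    (hT : ∀ i : Fin Q.N, field Q.code j (2 + i) = 1 ↔ i ∈ T) {x : Fin Q.N → ℕ} {x' : ℕ → ℕ} {y : ℕ}
    (hx : ∀ i, x i < y) (hx' : ∀ i : Fin Q.N, x' i = x i) (hy : y ≤ 6 * Q.code.length) :
    (layer (fun i => qd Q.code.length (x i) i) (qd Q.code.length y) T : List (Op d _)).flatMap
      Op.code = layerCode d Q.code j x' y := by
  rw [layer, List.flatMap_assoc, layerCode, getD_zero_code]
  refine flatMap_finRange fun t => ?_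
  by_cases ht : t ∈ T
  · rw [if_pos ht, if_pos ((hT t).2 ht), hx']
    exact code_mv Q 0 ((hx t).le.trans hy) hy (hx t).ne t
  · rw [if_neg ht, if_neg fun h => ht ((hT t).1 h), List.flatMap_nil]

theorem code_star {j : ℕ} (hj : j < Q.code.length) {c : Fin Q.N} {T : Finset (Fin Q.N)}
    (hT : ∀ i : Fin Q.N, field Q.code j (2 + i) = 1 ↔ i ∈ T) (hc : field Q.code j 1 = c) :
    (star d (fun i => qd Q.code.length (if i ∈ T then 6 * j + 1 else loc Q.ops j i) i)
      (qd Q.code.length (6 * j + 2)) (qd Q.code.length (6 * j + 3)) c T).flatMap Op.code =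
        starCode d Q.code j := by
  set ℓ := fun i : Fin Q.N => qd Q.code.length (if i ∈ T then 6 * j + 1 else loc Q.ops j i) i with hℓ
  have hle : ∀ i, (if i ∈ T then 6 * j + 1 else loc Q.ops j i) ≤ 6 * j + 1 := fun i => by
    have := loc_le Q.ops j i
    split_ifs <;> omega
  have hval : ∀ i, (ℓ i : ℕ) = starLoc Q.code j i := fun i => by
    rw [hℓ, val_qd_eq Q ((hle i).trans (by omega)), starLoc, locCode_eq]
    simp only [hT]
  have hp : ∀ k, (qd Q.code.length (6 * j + 2) k : ℕ) = qdCode Q.code (6 * j + 2) k :=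
    val_qd_eq Q (by omega)
  have hq : ∀ k, (qd Q.code.length (6 * j + 3) k : ℕ) = qdCode Q.code (6 * j + 3) k :=
    val_qd_eq Q (by omega)
  have hne : ∀ {r r'}, r ≤ 6 * Q.code.length → r' ≤ 6 * Q.code.length → r ≠ r' →
      ∀ k l : Fin Q.N, qd Q.code.length r k ≠ qd Q.code.length r' l := fun hr hr' h k l e =>
    h ((qd_inj _ hr hr').1 e).1
  have hℓp : ∀ k l, qd Q.code.length (6 * j + 2) k ≠ ℓ l := fun k l =>
    hne (by omega) ((hle l).trans (by omega)) (by have := hle l; omega) k l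
  have hℓq : ∀ k l, ℓ k ≠ qd Q.code.length (6 * j + 3) l := fun k l =>
    hne ((hle k).trans (by omega)) (by omega) (by have := hle k; omega) k l
  have hpq : ∀ k l : Fin Q.N, qd Q.code.length (6 * j + 2) k ≠ qd Q.code.length (6 * j + 3) l :=
    hne (by omega) (by omega) (by omega)
  rw [star, List.flatMap_append, List.flatMap_append, List.flatMap_append, measureBlocks,
    measureBlocks, List.flatMap_assoc, List.flatMap_assoc, List.flatMap_assoc, starCode,
    getD_zero_code, hc]
  congr 1
  · refine flatMap_finRange fun k => ?_
    rw [code_mkcz, ← hq, prev]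
    · split_ifs with hk
      · rw [hval]
      · rw [hp]
    · rw [prev]
      split_ifs
      exacts [hℓq _ _, hpq _ _]
  congr 1
  · refine flatMap_finRange fun k => ?_
    rw [List.flatMap_append, copyOps, List.flatMap_assoc, List.flatMap_singleton, code_measure,
      hq, code_mkcz (hpq k k), hp, hq]
  congr 1
  · refine flatMap_finRange fun t => ?_
    rw [List.flatMap_append, List.flatMap_singleton, code_measure, hp, useOps]
    congr 1
    by_cases ht : t ∈ T
    · rw [if_pos ht, if_pos ((hT t).2 ht), List.flatMap_append, code_mkcz (hℓp t t),
        List.flatMap_singleton, Op.code, hp, hval]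
      congr 2
      refine ofFn_signalCode Q fun r hr k => ?_
      rw [prefixSignal]
      by_cases h : r = 6 * j + 3 ∧ k ≤ t
      · rw [if_pos h.1, if_pos (Nat.lt_succ_of_le h.2), if_pos]
        exact ⟨k, h.2, by rw [h.1]⟩
      · rw [if_neg, ZMod.val_zero]
        · have hkt : (k : ℕ) < t + 1 ↔ k ≤ t := Nat.lt_succ_iff
          simp only [hkt]
          split_ifs <;> first | rfl | tauto
        · rintro ⟨l, hl, e⟩
          rw [qd_inj _ (by omega) hr] at e
          obtain ⟨rfl, rfl⟩ := e
          exact h ⟨rfl, hl⟩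
    · rw [if_neg ht, if_neg fun h => ht ((hT t).1 h), List.flatMap_nil]
  · rw [List.flatMap_singleton, Op.code, hval]
    congr 1
    refine ofFn_signalCode Q fun r hr k => ?_
    rw [totalSignal]
    by_cases h : r = 6 * j + 2
    · rw [if_pos h, if_pos ⟨k, by rw [h]⟩]
    · rw [if_neg h, if_neg, ZMod.val_zero]
      rintro ⟨l, e⟩
      rw [qd_inj _ (by omega) hr] at e
      exact h e.1.symm

theorem code_block {j : ℕ} {q : Op d Q.N} (hq : q.IsFanoutGate) (h : Q.ops[j]? = some q) :
    (block Q.code.length (loc Q.ops j) (q, j)).flatMap Op.code = blockCode d Q.code j := by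
  have hj : j < Q.code.length := by
    obtain ⟨hj, -⟩ := List.getElem?_eq_some_iff.1 h
    exact hj.trans_le (length_ops_le Q)
  have hfield : ∀ r < q.code.length, field Q.code j r = q.code.getD r 0 := fun r => field_eq Q h
  have h₀ := hfield 0 q.length_code_pos
  have hloc : ∀ i, loc Q.ops j i ≤ 6 * Q.code.length := fun i => (loc_le _ _ _).trans (by omega)
  rw [blockCode, h₀]
  cases q with
  | cz i k e =>
    have h₁ : field Q.code j 1 = i := hfield 1 (by simp [Op.code])
    have h₂ : field Q.code j 2 = k := hfield 2 (by simp [Op.code])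
    rw [h₁, h₂, block, code_mkcz fun e' => e (eq_of_qd_eq _ e'), val_qd_eq Q (hloc i),
      val_qd_eq Q (hloc k), locCode_eq, locCode_eq]
    rfl
  | rot a i =>
    have h₁ : field Q.code j 1 = a := hfield 1 (by simp [Op.code])
    have h₂ : field Q.code j 2 = i := hfield 2 (by simp [Op.code])
    rw [h₁, h₂, block, code_mv Q a (hloc i) (by omega) (by have := loc_le Q.ops j i; omega),
      locCode_eq]
    rfl
  | fanout c T hc =>
    have h₁ : field Q.code j 1 = c := hfield 1 (by simp [Op.code])
    have hT : ∀ i : Fin Q.N, field Q.code j (2 + i) = 1 ↔ i ∈ T := fun i => by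
      rw [hfield (2 + i) (by simp [Op.code]; omega), add_comm 2]
      simp [Op.code]
    have hlt : ∀ i, loc Q.ops j i < 6 * j + 1 := fun i => Nat.lt_succ_of_le (loc_le _ _ _)
    have hL : ∀ r r', r < r' → r' ≤ 6 * Q.code.length →
        (layer (qd Q.code.length r) (qd Q.code.length r') T : List (Op d _)).flatMap Op.code =
          layerCode d Q.code j (fun _ => r) r' := fun r r' hr hr' =>
      code_layer Q hT (x := fun _ => r) (fun _ => hr) (fun _ => rfl) hr'
    rw [block, translatedFanout, List.flatMap_append, List.flatMap_append, List.flatMap_append,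
      List.flatMap_append, code_layer Q hT hlt (locCode_eq j) (by omega), code_star Q hj hT h₁,
      hL _ _ (by omega) (by omega), hL _ _ (by omega) (by omega), hL _ _ (by omega) (by omega)]
    rfl
  | corrX i σ => exact hq.elim
  | corrZ i σ => exact hq.elim
  | measure i a σ τ => exact hq.elim

/-- Inputs are in row `0` and keep their numbers, whereas outputs have to be looked up at the places
where the last gates have left them. -/
theorem code_translate (hQ : ∀ q ∈ Q.ops, q.IsFanoutGate) :
    (translate Q).code = translateCode d Q.code := by
  rw [translateCode, flatMap_range_ops Q
    (H := fun b => (block Q.code.length (loc Q.ops b.2) b).flatMap Op.code)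
    (fun j q h => (code_block Q (hQ q (List.mem_of_getElem? h)) h).symm), getD_zero_code,
    getD_one_code, ← List.flatMap_assoc, ← ofFn_eq_flatMap (f := fun a => ((translate Q).inp a : ℕ)),
    ← ofFn_eq_flatMap (f := fun a => ((translate Q).out a : ℕ)), Computation.code]
  · simp only [List.append_assoc]
    rfl
  · intro a
    rw [getD_out, locCode_eq, loc_eq_of_le (length_ops_le Q), ← val_qd_eq Q]
    · rfl
    · have := loc_le Q.ops Q.ops.length (Q.out a)
      have := length_ops_le Q
      omega
  · intro a
    rw [getD_inp]
    change (qd Q.code.length 0 (Q.inp a) : ℕ) = _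
    rw [val_qd _ (Nat.zero_le _), mul_zero, add_zero]

end Code

end OneWay

/-- Circuits can be simulated by measurement patterns. -/
theorem QNCf_subset_QMNC {d : ℕ} [NeZero d] (k : ℕ) : QNCf d k ⊆ QMNC d k :=
  (complexityClass_prepare fourier_mulVec_ketPlus (A' := Op.IsFanoutGate) (fun h => h)
    fun _ => trivial).trans
  (complexityClass_subset OneWay.translate (OneWay.translateCode d) (d + 17)
    (OneWay.polyList_translateCode d) OneWay.code_translate
    (fun Q _ => OneWay.isPatternCommand_translate Q) (fun Q _ _ => OneWay.depth_translate Q)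
    (fun _ _ _ hQ h => OneWay.implements_translate hQ h))

end QuditComp

end

theorem mainTheorem1 (d : ℕ) [NeZero d] (hd : 2 ≤ d) (k : ℕ) :
    QuditComp.QNCf d k = QuditComp.QMNC d k :=
  Set.Subset.antisymm (QuditComp.QNCf_subset_QMNC k) (QuditComp.QMNC_subset_QNCf k)
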